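/- **Conventions.** For $(m,n)\in\{(3,6),(3,7),(6,6),(6,7)\}$ let $m\cdot A_n$ denote the (unique up to isomorphism) perfect group $G$ whose centre $Z(G)$ has order $m$ and with $G/Z(G)\cong A_n$; let $\tilde A_5$ be the Schur double cover $2\cdot A_5$ of $A_5$, i.e. the perfect group with centre of order $2$ and central quotient $A_5$. Characters are complex characters of finite groups; a linear character is one of degree one, and its order is its order in the group of linear characters. An irreducible character $\chi$ of $G$ is *imprimitive* if $\chi=\varphi{\uparrow}^G$ for an irreducible character $\varphi$ of a proper subgroup $H<G$; such an $H$ is called a *block stabilizer* of $\chi$. A *minimal triple* for $G$ is a triple $(H,\varphi,\chi)$ where $\chi$ is an imprimitive faithful irreducible character of $G$, $H\le G$ contains $Z(G)$, $\varphi$ is an irreducible character of $H$ that is faithful on $Z(G)$, $\chi=\varphi{\uparrow}^G$, and $H$ does not properly contain a block stabilizer of $\chi$. The following characters (named as in the ATLAS, up to simultaneous complex conjugation, and up to interchanging $\chi_{14},\chi_{15}$, resp. $\chi_{21},\chi_{22}$ of $6\cdot A_6$) are used. - For $3\cdot A_6$: the faithful irreducible characters of degree $3$ are the four distinct characters $\chi_{14},\chi_{15},\bar\chi_{14},\bar\chi_{15}$,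 where $\chi_{14}$ and $\chi_{15}$ agree on the centre; those of degree $6$ are the two distinct characters $\chi_{16},\bar\chi_{16}$; those of degree $15$ are the two distinct characters $\chi_{18},\bar\chi_{18}$. - For $3\cdot A_7$: the faithful irreducible characters of degree $15$ with value $3$ on involutions are the two distinct characters $\chi_{19},\bar\chi_{19}$; those of degree $21$ with value $1$ on involutions are the two distinct characters $\chi_{20},\bar\chi_{20}$; those of degree $21$ with value $-3$ on involutions are the two distinct characters $\chi_{21},\bar\chi_{21}$. - For $6\cdot A_6$: the faithful irreducible characters of degree $12$ are the four distinct characters $\chi_{21},\chi_{22},\bar\chi_{21},\bar\chi_{22}$, where $\chi_{21}$ and $\chi_{22}$ agree on the centre. **Theorem 5.7.** For $G=3\cdot A_6$ the minimal triples are exactly the triples $(H,\varphi,\varphi{\uparrow}^G)$ with $H\le G$ and $\varphi$ as follows: 1. $H\cong 3\times A_5$ and $\varphi$ is a non-trivial linear character of $H$; the characters $\varphi{\uparrow}^G$ arising in this way are exactly $\chi_{16}$ and $\bar\chi_{16}$. 2. $H\cong 3\times S_4$ and $\varphi$ is a linear character of $H$ of order six; the characters arising are exactly $\chi_{18}$ and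 $\bar\chi_{18}$. For $G=3\cdot A_7$ the minimal triples are exactly the triples $(H,\varphi,\varphi{\uparrow}^G)$ with $H\le G$ and $\varphi$ as follows: 1. $H\cong 3\cdot A_6$ and $\varphi$ is a faithful irreducible character of $H$ of degree three; the characters arising are exactly $\chi_{21}$ and $\bar\chi_{21}$. More precisely, for each such $H$, with suitable naming, $\chi_{14}{\uparrow}^G=\chi_{15}{\uparrow}^G=\chi_{21}$ and $\bar\chi_{14}{\uparrow}^G=\bar\chi_{15}{\uparrow}^G=\bar\chi_{21}$. 2. $H\cong 3\times S_5$ and $\varphi$ is a linear character of $H$ of order six; the characters arising are exactly $\chi_{20}$ and $\bar\chi_{20}$. 3. $H\cong 3\times L_2(7)$ and $\varphi$ is a non-trivial linear character of $H$; the characters arising are exactly $\chi_{19}$ and $\bar\chi_{19}$. For $G=6\cdot A_6$ the minimal triples are exactly the triples $(H,\varphi,\varphi{\uparrow}^G)$ with $H\cong 3\times\tilde A_5$ a subgroup of $G$ and $\varphi$ a faithful irreducible character of $H$ of degree two; the characters arising are exactly $\chi_{21},\chi_{22},\bar\chi_{21},\bar\chi_{22}$. No faithful irreducible character of $6\cdot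 A_7$ is imprimitive. -/

import Mathlib

universe u

namespace ImprimitiveCovers

/-- `G` is a covering group `m·Aₙ`: a perfect group whose centre has order `m` and whose central
quotient is the alternating group `Aₙ`.  (For `n ≥ 5` these are exactly the perfect central
extensions of `Aₙ` by a group of order `m`, because `Aₙ` is centreless.  For the pairs
`(m, n) = (3, 6), (3, 7), (6, 6), (6, 7)` and `(2, 5)` such a group is unique up to isomorphism.) -/
def IsCover (m n : ℕ) (G : Type u) [Group G] : Prop :=
  Group.IsPerfect G ∧ Nat.card (Subgroup.center G) = m ∧
    Nonempty (G ⧸ Subgroup.center G ≃* alternatingGroup (Fin n))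

/-- `χ` is the character of an irreducible complex representation (of finite degree) of `G`. -/
def IsIrr {G : Type u} [Group G] (χ : G → ℂ) : Prop :=
  ∃ (d : ℕ) (ρ : Representation ℂ G (Fin d → ℂ)), ρ.IsIrreducible ∧ χ = ρ.character

/-- `χ` is a faithful irreducible character: an irreducible character with trivial kernel. -/
def IsFaithfulIrr {G : Type u} [Group G] (χ : G → ℂ) : Prop :=
  IsIrr χ ∧ ∀ g : G, χ g = χ 1 → g = 1

open Classical in
/-- The induced class function `φ↑G`,
`g ↦ |H|⁻¹ ∑ φ(x⁻¹ g x)`, the sum over the `x ∈ G` with `x⁻¹ g x ∈ H`. -/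
noncomputable def ind {G : Type u} [Group G] [Fintype G] (H : Subgroup G) (φ : H → ℂ) : G → ℂ :=
  fun g => (Nat.card H : ℂ)⁻¹ *
    ∑ x : G, if h : x⁻¹ * g * x ∈ H then φ ⟨x⁻¹ * g * x, h⟩ else 0

/-- `H` is a block stabilizer of `χ`: a proper subgroup from which `χ` is induced. -/
def IsBlockStabilizer {G : Type u} [Group G] [Fintype G] (H : Subgroup G) (χ : G → ℂ) : Prop :=
  H ≠ ⊤ ∧ ∃ φ : H → ℂ, IsIrr φ ∧ χ = ind H φ

/-- `χ` is imprimitive: it is an irreducible character induced from a proper subgroup. -/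
def IsImprimitive {G : Type u} [Group G] [Fintype G] (χ : G → ℂ) : Prop :=
  IsIrr χ ∧ ∃ H : Subgroup G, IsBlockStabilizer H χ

/-- `φ` belongs to `Irr₋(H)`: `H` contains the centre `Z` of `G`, and `φ` is an irreducible
character of `H` which is faithful on `Z`. -/
def IsIrrMinus {G : Type u} [Group G] (H : Subgroup G) (φ : H → ℂ) : Prop :=
  Subgroup.center G ≤ H ∧ IsIrr φ ∧
    ∀ h : H, (h : G) ∈ Subgroup.center G → φ h = φ 1 → h = 1

/-- `(H, φ, χ)` is a minimal triple for `G`: `χ` is an imprimitive faithful irreducible character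
of `G`, induced from `φ ∈ Irr₋(H)`, and `H` does not properly contain a block stabilizer of `χ`. -/
def IsMinimalTriple {G : Type u} [Group G] [Fintype G] (H : Subgroup G) (φ : H → ℂ)
    (χ : G → ℂ) : Prop :=
  IsFaithfulIrr χ ∧ IsImprimitive χ ∧ IsIrrMinus H φ ∧ χ = ind H φ ∧
    ∀ K : Subgroup G, K < H → ¬ IsBlockStabilizer K χ

/-- `φ` is a linear character, i.e. an irreducible character of degree one. -/
def IsLinearChar {G : Type u} [Group G] (φ : G → ℂ) : Prop :=
  IsIrr φ ∧ φ 1 = 1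

/-- `H` is isomorphic to `3 × K`, the direct product of a cyclic group of order three and `K`. -/
def IsThreeTimes (H : Type u) [Group H] (K : Type) [Group K] : Prop :=
  Nonempty (H ≃* Multiplicative (ZMod 3) × K)

/-- `H` is isomorphic to `3 × Ã₅`, where `Ã₅ = 2·A₅` is the Schur double cover of `A₅`. -/
def IsThreeTimesDoubleA5 (H : Type u) [Group H] : Prop :=
  ∃ (K : Type) (_ : Group K), IsCover 2 5 K ∧ IsThreeTimes H K

/-- The pairs `H ≅ 3 × A₅`, `φ` a non-trivial linear character of `H`. -/
def PairA5 {G : Type u} [Group G] (H : Subgroup G) (φ : H → ℂ) : Prop :=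
  IsThreeTimes H (alternatingGroup (Fin 5)) ∧ IsLinearChar φ ∧ φ ≠ 1

/-- The pairs `H ≅ 3 × S₄`, `φ` a linear character of `H` of order six. -/
def PairS4 {G : Type u} [Group G] (H : Subgroup G) (φ : H → ℂ) : Prop :=
  IsThreeTimes H (Equiv.Perm (Fin 4)) ∧ IsLinearChar φ ∧ orderOf φ = 6

/-- The pairs `H ≅ 3·A₆`, `φ` a faithful irreducible character of `H` of degree three. -/
def PairA6 {G : Type u} [Group G] (H : Subgroup G) (φ : H → ℂ) : Prop :=
  IsCover 3 6 H ∧ IsFaithfulIrr φ ∧ φ 1 = 3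

/-- The pairs `H ≅ 3 × S₅`, `φ` a linear character of `H` of order six. -/
def PairS5 {G : Type u} [Group G] (H : Subgroup G) (φ : H → ℂ) : Prop :=
  IsThreeTimes H (Equiv.Perm (Fin 5)) ∧ IsLinearChar φ ∧ orderOf φ = 6

/-- The pairs `H ≅ 3 × L₂(7)`, `φ` a non-trivial linear character of `H`. -/
def PairL27 {G : Type u} [Group G] (H : Subgroup G) (φ : H → ℂ) : Prop :=
  IsThreeTimes H (Matrix.ProjectiveSpecialLinearGroup (Fin 2) (ZMod 7)) ∧ IsLinearChar φ ∧ φ ≠ 1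

/-- The pairs `H ≅ 3 × Ã₅`, `φ` a faithful irreducible character of `H` of degree two. -/
def PairDoubleA5 {G : Type u} [Group G] (H : Subgroup G) (φ : H → ℂ) : Prop :=
  IsThreeTimesDoubleA5 H ∧ IsFaithfulIrr φ ∧ φ 1 = 2

/-- The set of characters `φ↑G`, where `(H, φ)` runs over the pairs described by `P`. -/
def inducedFrom {G : Type u} [Group G] [Fintype G]
    (P : (H : Subgroup G) → (H → ℂ) → Prop) : Set (G → ℂ) :=
  {χ | ∃ (H : Subgroup G) (φ : H → ℂ), P H φ ∧ χ = ind H φ}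

/-- The faithful irreducible characters of degree `d`. -/
def faithfulOfDegree (G : Type u) [Group G] (d : ℕ) : Set (G → ℂ) :=
  {χ | IsFaithfulIrr χ ∧ χ 1 = d}

/-- The faithful irreducible characters of degree `d` with value `a` on all involutions. -/
def faithfulOfDegreeAndValue (G : Type u) [Group G] (d : ℕ) (a : ℤ) : Set (G → ℂ) :=
  {χ | IsFaithfulIrr χ ∧ χ 1 = d ∧ ∀ t : G, orderOf t = 2 → χ t = a}

/-- `S` consists of the two distinct, complex conjugate functions `χ` and `χ̄`. -/
def IsConjPair {G : Type u} (S : Set (G → ℂ)) (χ : G → ℂ) : Prop :=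
  χ ≠ star χ ∧ S = {χ, star χ}

/-- `S` consists of the four distinct functions `χ`, `ψ` and their complex conjugates, where `χ`
and `ψ` agree on the centre. -/
def IsConjQuadruple {G : Type u} [Group G] (S : Set (G → ℂ)) (χ ψ : G → ℂ) : Prop :=
  [χ, ψ, star χ, star ψ].Nodup ∧ S = {χ, ψ, star χ, star ψ} ∧
    ∀ z ∈ Subgroup.center G, χ z = ψ z

end ImprimitiveCovers

set_option linter.unusedSectionVars false
namespace ImprimitiveCovers

open Finset LinearMap Module

/-! ### Traces of operators of finite order -/

section Trace

variable {V : Type*} [AddCommGroup V] [Module ℂ V] [FiniteDimensional ℂ V]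

/-! Regard `G` as a central extension `π : G → Aₙ` with kernel of order three or six. If two
irreducible characters restrict to multiples of the same linear character of the kernel, their
product χψ̄ is a function on `Aₙ`. Hence the sum of χψ̄ over lifts of the elements of `Aₙ` is |Aₙ|
or 0 (`CentralExt.sum_mul_star`), and the squares of the degrees over one central character add up
to |Aₙ| (`exists_finset_sum_sq`). The faithful linear characters of the kernel form one complex
conjugate pair (`FaithfulOn.sameOn_or`), so it suffices to count over one of them; this produces the
conjugate pairs and quadruples.

The scalar products are evaluated order by order. Above elements of order three everything vanishes:
by transfer the Sylow 3-subgroups of the perfect group `G` are not abelian, so such an element is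
conjugate to a nontrivial central multiple of itself (`CentralExt.exists_conj_mul`). When the kernel
has order three, the values at lifts of elements of order 2 and 4 are integers. The values at orders
5 and 7 lie in ℤ or in quadratic fields and satisfy congruences with the degree. Since the total
norm is only 360 or 2520, these constraints leave very few solutions. They determine the characters
that are needed and bound the degrees of all others.

If χ is induced from φ on `H`, then χ(1) = [G : H]φ(1), the centre lies in `H`, and `H` corresponds
to a proper subgroup of `Aₙ`. Its index is at least n (`le_index_alt`), and several small indices
are impossible because of the number of elements of prime order such a subgroup would have
(`index_ne_alt_seven`, `index_ne_alt_six`). With the degree bounds only a few pairs (index, φ(1))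
survive. The subgroups of these indices are identified as A₅, S₄, A₆, S₅ and L₂(7), and transfer
again splits off the central subgroup of order three where it should
(`CentralExt.exists_hom_zmod_three`). For S₄ and S₅ the linear characters without sign part induce
to characters of too large norm.

Conversely, an induced character of norm less than two is irreducible (`isIrr_of_isChar`). The norm
is bounded by Cauchy–Schwarz in terms of the permutation character on the cosets of `H`
(`CentralExt.osum_norm_ind_le`). Minimality follows by comparing degrees or from the classification
of indices.

For 6·A₆ one needs in addition that involutions of A₆ do not lift to involutions
(`sq_ne_one_of_orderOf_two`), so that the preimage of A₅ is 3 × 2·A₅. For 6·A₇ the degree would be a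
multiple of 6 that is at most 50 and different from 30 and 42, and no possible index is compatible
with this. -/

theorem exists_nat_sum_trace_pow (h : Module.End ℂ V) {n : ℕ} (hn : n ≠ 0) (hh : h ^ n = 1) :
    ∃ m : ℕ, ∑ i ∈ range n, trace ℂ V (h ^ i) = n * m ∧
      (m = finrank ℂ V → h = 1) := by
  -- `P` projects onto the fixed space of `h`; its trace is its rank, and this rank is the number
  -- `m`.
  set P : Module.End ℂ V := (n : ℂ)⁻¹ • ∑ i ∈ range n, h ^ i with hP
  have hn' : (n : ℂ) ≠ 0 := by exact_mod_cast hn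
  have h1 : h * ∑ i ∈ range n, h ^ i = ∑ i ∈ range n, h ^ i := by
    rw [Finset.mul_sum]
    simp_rw [← pow_succ']
    have e1 := Finset.sum_range_succ (fun i => h ^ i) n
    have e2 := Finset.sum_range_succ' (fun i => h ^ i) n
    rw [hh] at e1
    rw [pow_zero] at e2
    exact add_right_cancel (e2.symm.trans e1)
  have hhP : h * P = P := by rw [hP, mul_smul_comm, h1]
  have hiP : ∀ i, h ^ i * P = P := by
    intro i
    induction i with
    | zero => simp
    | succ k ih => rw [pow_succ, mul_assoc, hhP, ih]
  have hPP : IsIdempotentElem P := by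
    change P * P = P
    conv_lhs => rw [hP]
    rw [smul_mul_assoc, Finset.sum_mul, ← hP]
    simp_rw [hiP]
    rw [Finset.sum_const, card_range, ← Nat.cast_smul_eq_nsmul ℂ, smul_smul,
      inv_mul_cancel₀ hn', one_smul]
  have htr := (LinearMap.IsProj.trace ((LinearMap.isProj_range_iff_isIdempotentElem P).2 hPP))
  refine ⟨finrank ℂ (range P), ?_, ?_⟩
  · rw [← htr, hP, map_smul, map_sum, smul_eq_mul, ← mul_assoc, mul_inv_cancel₀ hn', one_mul]
  · intro hm
    have hr : LinearMap.range P = ⊤ := Submodule.eq_top_of_finrank_eq hm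
    have hP1 : P = 1 := by
      ext v
      obtain ⟨w, rfl⟩ : v ∈ LinearMap.range P := hr ▸ Submodule.mem_top
      exact congrArg (fun f : Module.End ℂ V => f w) hPP
    rw [hP1, mul_one] at hhP
    exact hhP

end Trace

/-! ### Irreducible characters -/

section Irr

variable {G : Type u} [Group G]

theorem isIrreducible_of_equiv {V W : Type*} [AddCommGroup V] [Module ℂ V] [AddCommGroup W]
    [Module ℂ W] {ρ : Representation ℂ G V} {σ : Representation ℂ G W} (e : ρ.Equiv σ)
    (h : ρ.IsIrreducible) : σ.IsIrreducible := by
  let f : Subrepresentation ρ ≃o Subrepresentation σ :=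
    { toFun := fun S => ⟨S.toSubmodule.map e.toLinearEquiv.toLinearMap, by
        rintro g _ ⟨v, hv, rfl⟩
        exact ⟨ρ g v, S.apply_mem_toSubmodule g hv, Representation.IntertwiningMap.isIntertwining _ _ e.toIntertwiningMap g v⟩⟩
      invFun := fun S => ⟨S.toSubmodule.map e.symm.toLinearEquiv.toLinearMap, by
        rintro g _ ⟨v, hv, rfl⟩
        exact ⟨σ g v, S.apply_mem_toSubmodule g hv, Representation.IntertwiningMap.isIntertwining _ _ e.symm.toIntertwiningMap g v⟩⟩
      left_inv := fun S => by
        apply Subrepresentation.toSubmodule_injective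
        ext v
        constructor
        · rintro ⟨_, ⟨w, hw, rfl⟩, rfl⟩
          have : e.symm.toLinearEquiv (e.toLinearEquiv w) = w := e.toLinearEquiv.symm_apply_apply w
          change e.symm.toLinearEquiv (e.toLinearEquiv w) ∈ _
          rw [this]; exact hw
        · intro hv
          exact ⟨e.toLinearEquiv v, ⟨v, hv, rfl⟩, e.toLinearEquiv.symm_apply_apply v⟩
      right_inv := fun S => by
        apply Subrepresentation.toSubmodule_injective
        ext v
        constructor
        · rintro ⟨_, ⟨w, hw, rfl⟩, rfl⟩
          have : e.toLinearEquiv (e.symm.toLinearEquiv w) = w := e.toLinearEquiv.apply_symm_apply w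
          change e.toLinearEquiv (e.symm.toLinearEquiv w) ∈ _
          rw [this]; exact hw
        · intro hv
          exact ⟨e.symm.toLinearEquiv v, ⟨v, hv, rfl⟩, e.toLinearEquiv.apply_symm_apply v⟩
      map_rel_iff' := by
        intro S T
        exact Submodule.map_le_map_iff_of_injective e.toLinearEquiv.injective _ _ }
  exact f.isSimpleOrder_iff.1 h

/-- `IsIrr` speaks only of the spaces `Fin d → ℂ`, so other representations are transported along a
basis. -/
theorem isIrr_character {V : Type*} [AddCommGroup V] [Module ℂ V] [FiniteDimensional ℂ V]
    {ρ : Representation ℂ G V} (h : ρ.IsIrreducible) : IsIrr ρ.character := by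
  let b := (finBasis ℂ V).equivFun
  let σ : Representation ℂ G (Fin (finrank ℂ V) → ℂ) :=
    { toFun := fun g => b.conj (ρ g)
      map_one' := by ext; simp
      map_mul' := fun x y => by rw [map_mul]; exact LinearEquiv.conj_comp b (ρ y) (ρ x) }
  let e : ρ.Equiv σ := Representation.Equiv.mk b (fun g => by
    ext v
    simp [σ])
  exact ⟨_, σ, isIrreducible_of_equiv e h, Representation.char_iso e⟩

end Irr
end ImprimitiveCovers

namespace ImprimitiveCovers

open Finset LinearMap Module

/-! ### Eigenvalues of group elements and the kernel of a character -/

section Basic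

variable {G : Type u} [Group G] {χ ψ : G → ℂ}

theorem IsIrr.conj (h : IsIrr χ) (x g : G) : χ (x * g * x⁻¹) = χ g := by
  obtain ⟨d, ρ, -, rfl⟩ := h
  exact ρ.char_conj g x

theorem IsIrr.exists_degree (h : IsIrr χ) : ∃ d : ℕ, 0 < d ∧ χ 1 = d := by
  obtain ⟨d, ρ, hρ, rfl⟩ := h
  refine ⟨d, Nat.pos_of_ne_zero ?_, by simp⟩
  rintro rfl
  have : Subsingleton (Subrepresentation ρ) :=
    Subrepresentation.toSubmodule_injective.subsingleton
  exact not_subsingleton _ this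

theorem IsIrr.one_ne_zero (h : IsIrr χ) : χ 1 ≠ 0 := by
  obtain ⟨d, hd, h1⟩ := h.exists_degree
  rw [h1]
  exact_mod_cast hd.ne'

/-- The multiplicities of the eigenvalues of an element of finite order. -/
theorem IsIrr.exists_nat_sum_pow (h : IsIrr χ) {g : G} {n : ℕ} (hn : n ≠ 0) (hg : g ^ n = 1)
    {z : ℂ} (hz : z ^ n = 1) : ∃ m : ℕ, ∑ i ∈ range n, z ^ i * χ (g ^ i) = n * m := by
  obtain ⟨d, ρ, hρ, rfl⟩ := h
  obtain ⟨m, hm, -⟩ := exists_nat_sum_trace_pow (z • ρ g) hn (by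
    rw [smul_pow, ← map_pow, hg, hz, map_one, one_smul])
  refine ⟨m, hm ▸ sum_congr rfl fun i _ => ?_⟩
  rw [smul_pow, map_smul, smul_eq_mul, ← map_pow]
  rfl

/-- Fourier inversion for the restriction of a character to a cyclic group. -/
theorem IsIrr.exists_eigenvalues (h : IsIrr χ) {g : G} {n : ℕ} (hn : n ≠ 0) (hg : g ^ n = 1)
    {z : ℂ} (hz : IsPrimitiveRoot z n) : ∃ m : ℕ → ℕ, ∀ j : ℕ,
      χ (g ^ j) = ∑ k ∈ range n, (m k : ℂ) * z ^ (j * k) := by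
  have hn' : (n : ℂ) ≠ 0 := by exact_mod_cast hn
  have hz0 : z ≠ 0 := hz.ne_zero hn
  have hk : ∀ k : ℕ, (z⁻¹ ^ k) ^ n = 1 := fun k => by
    rw [← pow_mul, mul_comm, pow_mul, inv_pow, hz.pow_eq_one, inv_one, one_pow]
  choose m hm using fun k => h.exists_nat_sum_pow hn hg (hk k)
  refine ⟨m, fun j => ?_⟩
  -- Orthogonality of the powers of a primitive root of unity; `m k` is the multiplicity of the
  -- eigenvalue `z ^ k`.
  have key : ∀ i < n, ∑ k ∈ range n, (z⁻¹ ^ k) ^ i * z ^ ((j % n) * k) =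
      if i = j % n then (n : ℂ) else 0 := by
    intro i hi
    have hj : j % n < n := Nat.mod_lt _ (Nat.pos_of_ne_zero hn)
    have e : ∀ k, (z⁻¹ ^ k) ^ i * z ^ ((j % n) * k) = (z⁻¹ ^ i * z ^ (j % n)) ^ k := by
      intro k
      rw [mul_pow, ← pow_mul, ← pow_mul, ← pow_mul, mul_comm i k]
    simp_rw [e]
    split_ifs with hij
    · subst hij
      rw [← mul_pow, inv_mul_cancel₀ hz0]
      simp
    · have hne : z⁻¹ ^ i * z ^ (j % n) ≠ 1 := by
        intro h1
        rw [inv_pow, inv_mul_eq_one₀ (pow_ne_zero _ hz0)] at h1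
        exact hij (hz.pow_inj hi hj h1)
      have hone : (z⁻¹ ^ i * z ^ (j % n)) ^ n = 1 := by
        rw [mul_pow, ← pow_mul, ← pow_mul, mul_comm i, mul_comm (j % n), pow_mul, pow_mul,
          inv_pow, hz.pow_eq_one]
        simp
      have := mul_geom_sum (z⁻¹ ^ i * z ^ (j % n)) n
      rw [hone, sub_self] at this
      exact (mul_eq_zero.1 this).resolve_left (sub_ne_zero.2 hne)
  have hjm : ∀ k, z ^ (j * k) = z ^ ((j % n) * k) := fun k => by
    rw [pow_mul, pow_mul, ← pow_mod_orderOf z j, ← hz.eq_orderOf]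
  have hgj : χ (g ^ j) = χ (g ^ (j % n)) := by
    rw [← Nat.div_add_mod j n, pow_add, pow_mul, hg, one_pow, one_mul]
    simp
  apply mul_left_cancel₀ hn'
  rw [hgj, Finset.mul_sum]
  have : ∀ k, (n : ℂ) * ((m k : ℂ) * z ^ (j * k)) =
      ∑ i ∈ range n, χ (g ^ i) * ((z⁻¹ ^ k) ^ i * z ^ ((j % n) * k)) := by
    intro k
    rw [← mul_assoc, ← hm, Finset.sum_mul, hjm]
    exact sum_congr rfl fun i _ => by ring
  simp_rw [this]
  rw [Finset.sum_comm]
  simp_rw [← Finset.mul_sum]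
  rw [Finset.sum_congr rfl fun i hi => by rw [key i (mem_range.1 hi)]]
  rw [Finset.sum_eq_single (j % n)]
  · simp [mul_comm]
  · intro b _ hb; simp [hb]
  · intro hb; exact absurd (mem_range.2 (Nat.mod_lt _ (Nat.pos_of_ne_zero hn))) hb

variable [Finite G]

theorem IsIrr.inv (h : IsIrr χ) (g : G) : χ g⁻¹ = star (χ g) := by
  have hn : orderOf g ≠ 0 := (orderOf_pos g).ne'
  obtain ⟨m, hm⟩ := h.exists_eigenvalues hn (pow_orderOf_eq_one g)
    (Complex.isPrimitiveRoot_exp (orderOf g) hn)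
  set z := Complex.exp (2 * Real.pi * Complex.I / (orderOf g)) with hzdef
  have hz : IsPrimitiveRoot z (orderOf g) := Complex.isPrimitiveRoot_exp (orderOf g) hn
  have hconj : star z = z⁻¹ := (Complex.inv_eq_conj (hz.norm'_eq_one hn)).symm
  have e1 : g⁻¹ = g ^ (orderOf g - 1) := by
    rw [inv_eq_iff_mul_eq_one, ← pow_succ', Nat.sub_add_cancel (orderOf_pos g), pow_orderOf_eq_one]
  have e2 : z ^ (orderOf g - 1) = z⁻¹ := by
    apply eq_inv_of_mul_eq_one_left
    rw [← pow_succ, Nat.sub_add_cancel (orderOf_pos g),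
      hz.pow_eq_one]
  have h1 := hm 1
  rw [pow_one] at h1
  rw [e1, hm, h1, star_sum]
  refine sum_congr rfl fun k _ => ?_
  rw [pow_mul, e2, one_mul, star_mul', star_pow, hconj]
  simp

/-- The value is a sum of χ(1) roots of unity, each of real part at most 1. Equality with χ(1)
forces every eigenvalue that occurs to be 1, and then `g` acts trivially because its fixed space is
everything. -/
theorem IsIrr.mem_ker (h : IsIrr χ) {g : G} (hg : χ g = χ 1) :
    ∀ x, χ (x * g) = χ x := by
  obtain ⟨N, hN0, hN⟩ : ∃ N : ℕ, N ≠ 0 ∧ g ^ N = 1 :=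
    ⟨orderOf g, (orderOf_pos g).ne', pow_orderOf_eq_one g⟩
  have hz : IsPrimitiveRoot _ N := Complex.isPrimitiveRoot_exp N hN0
  obtain ⟨m, hm⟩ := h.exists_eigenvalues hN0 hN hz
  set z := Complex.exp (2 * Real.pi * Complex.I / N)
  have h0 := hm 0
  have h1 := hm 1
  simp only [pow_zero, zero_mul, mul_one, pow_one, one_mul] at h0 h1
  rw [hg, h0] at h1
  have hall : ∀ k ∈ range N, (m k : ℝ) * (1 - (z ^ k).re) = 0 := by
    have hre := congrArg Complex.re h1
    simp only [Complex.re_sum, Complex.natCast_re, Complex.mul_re, Complex.natCast_im, zero_mul,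
      sub_zero] at hre
    rw [← sub_eq_zero, ← Finset.sum_sub_distrib] at hre
    have h2 : ∑ k ∈ range N, (m k : ℝ) * (1 - (z ^ k).re) = 0 := by
      rw [← hre]; exact sum_congr rfl fun k _ => by ring
    refine (Finset.sum_eq_zero_iff_of_nonneg fun k _ => ?_).1 h2
    have : (z ^ k).re ≤ 1 := by
      refine (Complex.re_le_norm _).trans ?_
      rw [norm_pow, hz.norm'_eq_one hN0, one_pow]
    have h3 : (0 : ℝ) ≤ m k := Nat.cast_nonneg _
    exact mul_nonneg h3 (by linarith)
  have hj : ∀ j, χ (g ^ j) = χ 1 := by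
    intro j
    rw [hm j, h0]
    refine sum_congr rfl fun k hk => ?_
    rcases mul_eq_zero.1 (hall k hk) with hk0 | hk0
    · have : m k = 0 := by exact_mod_cast hk0
      simp [this]
    · have hz1 : z ^ k = 1 := by
        have hn1 : ‖z ^ k‖ = 1 := by rw [norm_pow, hz.norm'_eq_one hN0, one_pow]
        have hr : (z ^ k).re = 1 := by linarith
        have := Complex.re_eq_norm.1 (hr.trans hn1.symm)
        apply Complex.ext hr
        simpa using this.2.symm
      rw [mul_comm j k, pow_mul, hz1, one_pow, mul_one]
  obtain ⟨d, ρ, hρ, rfl⟩ := h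
  obtain ⟨M, hM, hM'⟩ := exists_nat_sum_trace_pow (ρ g) hN0 (by rw [← map_pow, hN, map_one])
  have hs : ∑ i ∈ range N, trace ℂ (Fin d → ℂ) (ρ g ^ i) = N * (d : ℂ) := by
    have : ∀ i ∈ range N, trace ℂ (Fin d → ℂ) (ρ g ^ i) = d := fun i _ => by
      have := hj i
      rw [Representation.char_one, Module.finrank_fin_fun] at this
      rw [← map_pow]
      exact this
    rw [Finset.sum_congr rfl this]; simp
  have hg1 : ρ g = 1 := hM' (by
    rw [hs] at hM
    have hn' : (N : ℂ) ≠ 0 := by exact_mod_cast hN0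
    have := mul_left_cancel₀ hn' hM
    rw [Module.finrank_fin_fun]
    exact_mod_cast this.symm)
  intro x
  simp [Representation.character, map_mul, hg1]

end Basic

/-! ### Orthogonality and completeness of the irreducible characters -/

section Finite

variable {G : Type u} [Group G] [Fintype G] {χ ψ : G → ℂ}

/-- The unnormalized Hermitian product of complex functions on a finite group. -/
noncomputable def ip (f h : G → ℂ) : ℂ := ∑ g, f g * star (h g)

theorem ip_self (f : G → ℂ) : ip f f = ((∑ g, ‖f g‖ ^ 2 : ℝ) : ℂ) := by
  rw [ip, Complex.ofReal_sum]
  exact sum_congr rfl fun g _ => by simpa using Complex.mul_conj' (f g)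

theorem ip_sub_left (f f' h : G → ℂ) : ip (f - f') h = ip f h - ip f' h := by
  simp [ip, sub_mul, Finset.sum_sub_distrib]

theorem ip_smul_left (c : ℂ) (f h : G → ℂ) : ip (c • f) h = c * ip f h := by
  simp [ip, mul_assoc, Finset.mul_sum]

theorem star_ip (f h : G → ℂ) : star (ip f h) = ip h f := by
  simp only [ip, star_sum, star_mul', star_star]
  exact sum_congr rfl fun g _ => mul_comm _ _

theorem ip_sub_right (f h h' : G → ℂ) : ip f (h - h') = ip f h - ip f h' := by
  simp [ip, mul_sub, Finset.sum_sub_distrib]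

theorem ip_smul_right (c : ℂ) (f h : G → ℂ) : ip f (c • h) = star c * ip f h := by
  simp only [ip, Pi.smul_apply, smul_eq_mul, star_mul', Finset.mul_sum]
  exact sum_congr rfl fun g _ => by ring

theorem card_ne_zero' : (Fintype.card G : ℂ) ≠ 0 := by
  exact_mod_cast Fintype.card_ne_zero

open Classical in
theorem IsIrr.ip_eq (h : IsIrr χ) (h' : IsIrr ψ) :
    ip χ ψ = if χ = ψ then (Fintype.card G : ℂ) else 0 := by
  obtain ⟨d, ρ, hρ, rfl⟩ := id h
  obtain ⟨e, σ, hσ, rfl⟩ := id h'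
  have hc : (Nat.card G : ℂ) ≠ 0 := by rw [Nat.card_eq_fintype_card]; exact card_ne_zero'
  let _ : Invertible (Nat.card G : ℂ) := invertibleOfNonzero hc
  have key := Representation.char_orthonormal ρ σ
  have hip : ∀ f : G → ℂ, ∑ g, f g * σ.character g⁻¹ = ip f σ.character := fun f =>
    sum_congr rfl fun g _ => by rw [h'.inv]
  rw [hip, inv_mul_eq_iff_eq_mul₀ hc, Nat.card_eq_fintype_card] at key
  by_cases hEq : ρ.character = σ.character
  · rw [if_pos hEq, hEq]
    have key2 := Representation.char_orthonormal σ σ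
    rw [hip, inv_mul_eq_iff_eq_mul₀ hc, Nat.card_eq_fintype_card,
      if_pos ⟨Representation.Equiv.refl σ⟩] at key2
    simpa using key2
  · rw [if_neg hEq, key, if_neg, mul_zero]
    rintro ⟨e⟩
    exact hEq (Representation.char_iso e).symm

theorem IsIrr.ip_self (h : IsIrr χ) : ip χ χ = Fintype.card G := by
  rw [h.ip_eq h, if_pos rfl]

theorem IsIrr.sum_norm_sq (h : IsIrr χ) : ∑ g, ‖χ g‖ ^ 2 = (Fintype.card G : ℝ) := by
  have := h.ip_self
  rw [ImprimitiveCovers.ip_self] at this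
  exact_mod_cast this

theorem IsIrr.ip_of_ne (h : IsIrr χ) (h' : IsIrr ψ) (hne : χ ≠ ψ) : ip χ ψ = 0 := by
  rw [h.ip_eq h', if_neg hne]

/-- A class function whose multiplicities in the irreducible characters are natural numbers. -/
def IsChar (f : G → ℂ) : Prop :=
  (∀ x g, f (x * g * x⁻¹) = f g) ∧
    ∀ ψ : G → ℂ, IsIrr ψ → ∃ m : ℕ, ip f ψ = Fintype.card G * m

theorem isChar_character {V : Type*} [AddCommGroup V] [Module ℂ V] [FiniteDimensional ℂ V]
    (ρ : Representation ℂ G V) : IsChar ρ.character := by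
  refine ⟨fun x g => ρ.char_conj g x, ?_⟩
  rintro _ ⟨d, σ, hσ, rfl⟩
  have hc : (Nat.card G : ℂ) ≠ 0 := by rw [Nat.card_eq_fintype_card]; exact card_ne_zero'
  let _ : Invertible (Nat.card G : ℂ) := invertibleOfNonzero hc
  have key := Representation.card_inv_mul_sum_char_mul_char_eq_finrank σ ρ
  have h' : IsIrr σ.character := ⟨d, σ, hσ, rfl⟩
  refine ⟨finrank ℂ (σ.IntertwiningMap ρ), ?_⟩
  rw [inv_mul_eq_iff_eq_mul₀ hc, Nat.card_eq_fintype_card] at key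
  rw [← key]
  exact sum_congr rfl fun g _ => by rw [h'.inv]

/-- The operator commutes with the group. On an irreducible space it is a scalar by Schur, of trace
`ip f ψ = 0`. Otherwise Maschke splits the space into two smaller invariant parts, and induction on
the dimension applies. -/
theorem sum_smul_eq_zero {f : G → ℂ} (hf : ∀ x g, f (x * g * x⁻¹) = f g)
    (h0 : ∀ ψ, IsIrr ψ → ip f ψ = 0) (n : ℕ) :
    ∀ {V : Type u} [AddCommGroup V] [Module ℂ V] [FiniteDimensional ℂ V]
      (ρ : Representation ℂ G V), finrank ℂ V = n → ∑ g, f g • ρ g⁻¹ = 0 := by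
  induction n using Nat.strong_induction_on with
  | _ n ih =>
  intro V _ _ _ ρ hn
  by_cases hirr : ρ.IsIrreducible
  · let T : Representation.IntertwiningMap ρ ρ := ⟨∑ g, f g • ρ g⁻¹, by
      intro x
      ext v
      simp only [LinearMap.coe_comp, Function.comp_apply, LinearMap.sum_apply,
        LinearMap.smul_apply, map_sum, map_smul]
      rw [← (MulAut.conj x).toEquiv.sum_comp (fun g => f g • (ρ g⁻¹) ((ρ x) v))]
      refine sum_congr rfl fun g _ => ?_
      simp only [MulEquiv.toEquiv_eq_coe, EquivLike.coe_coe, MulAut.conj_apply, hf]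
      rw [← Module.End.mul_apply, ← Module.End.mul_apply, ← map_mul, ← map_mul]
      congr 3
      group⟩
    obtain ⟨c, hc⟩ :=
      (Representation.IsIrreducible.algebraMap_intertwiningMap_bijective_of_isAlgClosed
        (ρ := ρ)).2 T
    have hT : T.toLinearMap = c • (LinearMap.id : V →ₗ[ℂ] V) := by
      rw [← hc]; rfl
    have htr : trace ℂ V T.toLinearMap = 0 := by
      change trace ℂ V (∑ g, f g • ρ g⁻¹) = 0
      rw [map_sum]
      rw [← h0 _ (isIrr_character hirr)]
      refine sum_congr rfl fun g _ => ?_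
      rw [← (isIrr_character hirr).inv, map_smul]
      rfl
    have hne : trace ℂ V (LinearMap.id : V →ₗ[ℂ] V) ≠ 0 := by
      have := (isIrr_character hirr).one_ne_zero
      rwa [Representation.character, map_one] at this
    rw [hT, map_smul, smul_eq_mul] at htr
    have hc0 : c = 0 := (mul_eq_zero.1 htr).resolve_right hne
    change T.toLinearMap = 0
    rw [hT, hc0, zero_smul]
  · by_cases hsub : Subsingleton V
    · ext v; exact Subsingleton.elim _ _
    · rw [not_subsingleton_iff_nontrivial] at hsub
      have hnt : Nontrivial (Subrepresentation ρ) := by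
        refine ⟨⊥, ⊤, fun h => ?_⟩
        obtain ⟨v, hv⟩ := exists_ne (0 : V)
        have : v ∈ (⊥ : Subrepresentation ρ) := h ▸ (trivial : v ∈ (⊤ : Submodule ℂ V))
        exact hv ((Submodule.mem_bot ℂ).1 this)
      obtain ⟨W, hWb, hWt⟩ : ∃ W : Subrepresentation ρ, W ≠ ⊥ ∧ W ≠ ⊤ := by
        by_contra hcon
        push Not at hcon
        exact hirr { eq_bot_or_eq_top := fun W => by
                      by_cases h : W = ⊥
                      · exact Or.inl h
                      · exact Or.inr (hcon W h) }
      have : NeZero (Nat.card G : ℂ) := ⟨by rw [Nat.card_eq_fintype_card]; exact card_ne_zero'⟩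
      obtain ⟨W', hWW⟩ := exists_isCompl W
      have hlt : ∀ U : Subrepresentation ρ, U ≠ ⊤ → ∀ v ∈ U, (∑ g, f g • ρ g⁻¹) v = 0 := by
        intro U hU v hv
        have hlt : finrank ℂ U.toSubmodule < n := by
          rw [← hn]
          refine Submodule.finrank_lt fun h => hU ?_
          exact Subrepresentation.toSubmodule_injective h
        have := ih _ hlt U.toRepresentation rfl
        have h2 := congrArg (fun T : U.toSubmodule →ₗ[ℂ] U.toSubmodule =>
          ((T ⟨v, hv⟩ : U.toSubmodule) : V)) this
        simpa [Subrepresentation.toRepresentation] using h2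
      have hW't : W' ≠ ⊤ := fun h => hWb (by simpa [h] using hWW.inf_eq_bot)
      ext v
      have hv : v ∈ W.toSubmodule ⊔ W'.toSubmodule := by
        have : W ⊔ W' = ⊤ := hWW.sup_eq_top
        rw [← Subrepresentation.toSubmodule_sup, this]
        exact Submodule.mem_top
      obtain ⟨w, hw, w', hw', rfl⟩ := Submodule.mem_sup.1 hv
      rw [map_add, hlt W hWt w hw, hlt W' hW't w' hw']
      simp

/-- In the regular representation the operator attached to `f` sends the basis vector at 1 to the
vector with the values of `f` as coefficients. -/
theorem eq_zero_of_forall_irr {f : G → ℂ} (hf : ∀ x g, f (x * g * x⁻¹) = f g)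
    (h0 : ∀ ψ, IsIrr ψ → ip f ψ = 0) : f = 0 := by
  classical
  have key := sum_smul_eq_zero hf h0 _ (ρ := Representation.leftRegular ℂ G) rfl
  funext x
  have h1 := congrArg (fun a : MonoidAlgebra ℂ G => a.coeff x⁻¹)
    (LinearMap.congr_fun key (MonoidAlgebra.single 1 1))
  simp only [LinearMap.sum_apply, LinearMap.smul_apply, Representation.ofMulAction_single] at h1
  simpa [Finsupp.single_apply] using h1

end Finite
end ImprimitiveCovers

namespace ImprimitiveCovers

open Finset LinearMap Module

/-! ### The norm test for irreducibility, linear characters and central scalars -/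

section Finite

variable {G : Type u} [Group G] [Fintype G] {χ ψ : G → ℂ}

theorem ip_self_re (f : G → ℂ) : (ip f f).re = ∑ g, ‖f g‖ ^ 2 := by
  rw [ip_self, Complex.ofReal_re]

theorem exists_irr_ip_ne_zero {f : G → ℂ} (hf : ∀ x g, f (x * g * x⁻¹) = f g) (h : f ≠ 0) :
    ∃ ψ, IsIrr ψ ∧ ip f ψ ≠ 0 := by
  by_contra! hc
  exact h (eq_zero_of_forall_irr hf hc)

theorem sum_norm_sq_sub (hψ : IsIrr ψ) {f : G → ℂ} {m : ℕ} (hm : ip f ψ = Fintype.card G * m) :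
    ∑ g, ‖(f - (m : ℂ) • ψ) g‖ ^ 2 = ∑ g, ‖f g‖ ^ 2 - Fintype.card G * (m : ℝ) ^ 2 := by
  have h1 : ip ψ f = Fintype.card G * m := by rw [← star_ip, hm]; simp
  have : ip (f - (m : ℂ) • ψ) (f - (m : ℂ) • ψ) = ip f f - Fintype.card G * (m : ℂ) ^ 2 := by
    rw [ip_sub_left, ip_sub_right, ip_sub_right, ip_smul_left, ip_smul_right, ip_smul_left,
      ip_smul_right, hm, h1, hψ.ip_self]
    simp only [star_natCast]
    ring
  rw [← ip_self_re, this, ← ip_self_re, Complex.sub_re]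
  congr 1
  have : ((Fintype.card G : ℂ) * (m : ℂ) ^ 2) = (((Fintype.card G : ℝ) * (m : ℝ) ^ 2 : ℝ) : ℂ) := by
    push_cast; rfl
  rw [this, Complex.ofReal_re]

theorem card_le_of_irr_constituent {f : G → ℂ} (hψ : IsIrr ψ) {m : ℕ}
    (hm : ip f ψ = Fintype.card G * m) :
    Fintype.card G * (m : ℝ) ^ 2 ≤ ∑ g, ‖f g‖ ^ 2 := by
  have := sum_norm_sq_sub hψ hm
  have h2 : 0 ≤ ∑ g, ‖(f - (m : ℂ) • ψ) g‖ ^ 2 := Finset.sum_nonneg fun g _ => by positivity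
  linarith

/-- Norm below two leaves room for one constituent only, with multiplicity one: whatever remains
after subtracting it would have a further constituent contributing at least another |G|. Every
irreducibility proof for induced characters rests on this test. -/
theorem isIrr_of_isChar {f : G → ℂ} (hf : IsChar f) (h0 : f ≠ 0)
    (hlt : ∑ g, ‖f g‖ ^ 2 < 2 * (Fintype.card G : ℝ)) : IsIrr f := by
  have hG : (0 : ℝ) < Fintype.card G := by exact_mod_cast Fintype.card_pos
  obtain ⟨ψ, hψ, hne⟩ := exists_irr_ip_ne_zero hf.1 h0
  obtain ⟨m, hm⟩ := hf.2 ψ hψ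
  have hle := card_le_of_irr_constituent hψ hm
  have hm1 : m = 1 := by
    have hm0 : m ≠ 0 := by rintro rfl; exact hne (by rw [hm]; simp)
    have : (m : ℝ) ^ 2 < 2 := by
      by_contra! hc
      nlinarith
    have h2 : m ^ 2 < 2 := by exact_mod_cast this
    have : m < 2 := by nlinarith
    omega
  subst hm1
  have hsub := sum_norm_sq_sub hψ hm
  by_cases hz : f - ((1 : ℕ) : ℂ) • ψ = 0
  · have : f = ψ := by simpa [sub_eq_zero] using hz
    rw [this]; exact hψ
  · obtain ⟨θ, hθ, hne'⟩ := exists_irr_ip_ne_zero (fun x g => by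
      simp [hf.1 x g, hψ.conj x g]) hz
    obtain ⟨k, hk⟩ := hf.2 θ hθ
    have hθψ : ψ ≠ θ := by
      rintro rfl
      exact hne' (by rw [ip_sub_left, ip_smul_left, hm, hψ.ip_self]; simp)
    have hk' : ip (f - ((1 : ℕ) : ℂ) • ψ) θ = Fintype.card G * k := by
      rw [ip_sub_left, ip_smul_left, hψ.ip_of_ne hθ hθψ, hk]; simp
    have hle' := card_le_of_irr_constituent hθ hk'
    have hk1 : (1 : ℝ) ≤ (k : ℝ) ^ 2 := by
      have : k ≠ 0 := by rintro rfl; exact hne' (by rw [hk']; simp)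
      have : 1 ≤ k ^ 2 := Nat.one_le_pow _ _ (by omega)
      exact_mod_cast this
    rw [hsub] at hle'
    push_cast at hle'
    nlinarith

/-- The conjugate is the character of the dual representation and has the same norm, so the norm
test applies. -/
theorem IsIrr.star (h : IsIrr χ) : IsIrr (star χ) := by
  have hG : (0 : ℝ) < Fintype.card G := by exact_mod_cast Fintype.card_pos
  refine isIrr_of_isChar ?_ ?_ ?_
  · have h' := h
    obtain ⟨d, ρ, -, rfl⟩ := h'
    have : Star.star ρ.character = ρ.dual.character := by
      funext g
      rw [Representation.char_dual, h.inv]; rfl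
    rw [this]
    exact isChar_character _
  · intro h0
    exact h.one_ne_zero (by simpa using congrFun h0 1)
  · simp only [Pi.star_apply, norm_star]
    rw [h.sum_norm_sq]; linarith

theorem isIrr_of_monoidHom (f : G →* ℂ) : IsIrr f := by
  have hG : (0 : ℝ) < Fintype.card G := by exact_mod_cast Fintype.card_pos
  let ρ : Representation ℂ G ℂ :=
    { toFun := fun g => f g • LinearMap.id
      map_one' := by ext; simp
      map_mul' := fun x y => by ext; simp [mul_comm] }
  have hρ : ρ.character = f := by
    funext g
    simp [Representation.character, ρ]
  refine isIrr_of_isChar (hρ ▸ isChar_character ρ) (fun h => ?_) ?_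
  · simpa using congrFun h 1
  · have : ∀ g, ‖f g‖ = 1 := fun g => by
      refine Complex.norm_eq_one_of_pow_eq_one (n := Fintype.card G) ?_ Fintype.card_ne_zero
      rw [← map_pow, pow_card_eq_one, map_one]
    simp only [this]
    simp; linarith

theorem IsIrr.map_mul (h : IsIrr χ) (h1 : χ 1 = 1) (x y : G) : χ (x * y) = χ x * χ y := by
  obtain ⟨d, ρ, -, rfl⟩ := h
  have hd : d = 1 := by
    rw [Representation.char_one, Module.finrank_fin_fun] at h1
    exact_mod_cast h1
  subst hd
  -- On a line every endomorphism is multiplication by its trace.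
  have key : ∀ f : Module.End ℂ (Fin 1 → ℂ), f = trace ℂ _ f • 1 := by
    intro f
    have htr : trace ℂ (Fin 1 → ℂ) f = f (Pi.single 0 1) 0 := by
      rw [LinearMap.trace_eq_matrix_trace ℂ (Pi.basisFun ℂ (Fin 1))]
      simp [Matrix.trace]
    rw [htr]
    refine LinearMap.pi_ext' fun i => LinearMap.ext_ring ?_
    funext j
    fin_cases i; fin_cases j
    simp
  simp only [Representation.character, _root_.map_mul]
  rw [key (ρ x)]
  simp

/-- Schur's lemma gives the scalar. The determinant is a linear character, hence trivial on the
commutator subgroup, while on a scalar it is the d-th power. This is the source of the divisibility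
of degrees of faithful characters. -/
theorem IsIrr.exists_central_scalar (h : IsIrr χ) {z : G} (hz : z ∈ Subgroup.center G) :
    ∃ w : ℂ, (∀ g, χ (z * g) = w * χ g) ∧
      (z ∈ commutator G → ∀ d : ℕ, χ 1 = d → w ^ d = 1) := by
  have hpos := h.exists_degree
  obtain ⟨d, ρ, hρ, rfl⟩ := h
  let T : Representation.IntertwiningMap ρ ρ := ⟨ρ z, fun x => by
    rw [← Module.End.mul_eq_comp, ← Module.End.mul_eq_comp, ← _root_.map_mul, ← _root_.map_mul,
      Subgroup.mem_center_iff.1 hz x]⟩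
  obtain ⟨w, hw⟩ :=
    (Representation.IsIrreducible.algebraMap_intertwiningMap_bijective_of_isAlgClosed
      (ρ := ρ)).2 T
  have hT : ρ z = w • (1 : Module.End ℂ (Fin d → ℂ)) := by
    change T.toLinearMap = _
    rw [← hw]; rfl
  refine ⟨w, fun g => ?_, fun hzc e he => ?_⟩
  · simp [Representation.character, hT]
  · have hed : e = d := by
      rw [Representation.char_one, Module.finrank_fin_fun] at he
      exact_mod_cast he.symm
    subst hed
    let D : G →* ℂ := (LinearMap.det : Module.End ℂ (Fin e → ℂ) →* ℂ).comp ρ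
    have hD : D.toHomUnits.ker = ⊤ ∨ z ∈ D.toHomUnits.ker :=
      Or.inr (Abelianization.commutator_subset_ker _ hzc)
    have : D z = 1 := by
      rcases hD with hD | hD
      · have : z ∈ D.toHomUnits.ker := hD ▸ Subgroup.mem_top z
        exact congrArg Units.val (MonoidHom.mem_ker.1 this)
      · exact congrArg Units.val (MonoidHom.mem_ker.1 hD)
    have h2 : D z = w ^ e := by
      change LinearMap.det (ρ z) = _
      rw [hT, LinearMap.det_smul]; simp
    rw [← h2, this]

end Finite

/-! ### Characters over a fixed central character -/

section Central

variable {G : Type u} [Group G] [Fintype G] {χ ψ : G → ℂ}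

/-- The scalar by which a central element acts in the representation with character `χ`. -/
noncomputable def cc (χ : G → ℂ) (z : G) : ℂ := χ z / χ 1

theorem IsIrr.cc_mul (h : IsIrr χ) {z : G} (hz : z ∈ Subgroup.center G) (g : G) :
    χ (z * g) = cc χ z * χ g := by
  obtain ⟨w, hw, -⟩ := h.exists_central_scalar hz
  have := hw 1
  rw [mul_one] at this
  rw [cc, this, mul_div_assoc, div_self h.one_ne_zero, mul_one, hw]

theorem IsIrr.cc_pow_degree (h : IsIrr χ) {z : G} (hz : z ∈ Subgroup.center G)
    (hc : z ∈ commutator G) {d : ℕ} (hd : χ 1 = d) : cc χ z ^ d = 1 := by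
  obtain ⟨w, hw, hw'⟩ := h.exists_central_scalar hz
  have := hw 1
  rw [mul_one] at this
  rw [cc, this, mul_div_assoc, div_self h.one_ne_zero, mul_one, hw' hc d hd]

theorem IsIrr.cc_map_mul (h : IsIrr χ) {z z' : G} (hz : z ∈ Subgroup.center G) :
    cc χ (z * z') = cc χ z * cc χ z' := by
  rw [cc, h.cc_mul hz, mul_div_assoc]; rfl

theorem IsIrr.cc_one (h : IsIrr χ) : cc χ 1 = 1 := div_self h.one_ne_zero

theorem IsIrr.cc_pow (h : IsIrr χ) {z : G} (hz : z ∈ Subgroup.center G) (n : ℕ) :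
    cc χ (z ^ n) = cc χ z ^ n := by
  induction n with
  | zero => simp [h.cc_one]
  | succ k ih => rw [pow_succ', h.cc_map_mul hz, ih, pow_succ']

theorem IsIrr.norm_cc (h : IsIrr χ) {z : G} (hz : z ∈ Subgroup.center G) : ‖cc χ z‖ = 1 :=
  Complex.norm_eq_one_of_pow_eq_one (n := orderOf z)
    (by rw [← h.cc_pow hz, pow_orderOf_eq_one, h.cc_one]) (orderOf_pos z).ne'

theorem cc_star (χ : G → ℂ) (z : G) : cc (star χ) z = star (cc χ z) := by
  simp [cc]

/-- `χ` and `ψ` restrict to multiples of the same linear character of `N`. -/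
def SameOn (N : Subgroup G) (χ ψ : G → ℂ) : Prop := ∀ z ∈ N, cc χ z = cc ψ z

/-- If the two central characters differ at `z₀`, translating the summation variable by `z₀`
multiplies the sum by a scalar different from 1. -/
theorem ip_ofSubgroup (N : Subgroup G) [Fintype N] (hN : N ≤ Subgroup.center G) (hχ : IsIrr χ) (hψ : IsIrr ψ) :
    (SameOn N χ ψ → ∑ z : N, cc χ z * star (ψ z) = Nat.card N * ψ 1) ∧
      (¬ SameOn N χ ψ → ∑ z : N, cc χ z * star (ψ z) = 0) := by
  have hψ1 : star (ψ 1) = ψ 1 := by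
    obtain ⟨d, -, hd⟩ := hψ.exists_degree
    rw [hd]; simp
  have e : ∀ z : N, ψ z = cc ψ z * ψ 1 := fun z => by
    have := hψ.cc_mul (hN z.2) 1
    rwa [mul_one] at this
  constructor
  · intro hs
    have : ∀ z : N, cc χ z * star (ψ z) = ψ 1 := by
      intro z
      rw [e z, star_mul', hψ1, ← mul_assoc, hs z z.2]
      have := hψ.norm_cc (hN z.2)
      have h2 : cc ψ z * star (cc ψ z) = 1 := by
        have := Complex.mul_conj' (cc ψ z)
        rw [hψ.norm_cc (hN z.2)] at this
        simpa using this
      rw [h2, one_mul]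
    rw [Finset.sum_congr rfl fun z _ => this z]
    simp [Nat.card_eq_fintype_card]
  · intro hs
    simp only [SameOn, not_forall] at hs
    obtain ⟨z₀, hz₀, hne⟩ := hs
    set S := ∑ z : N, cc χ z * star (ψ z) with hS
    have key : S = cc χ z₀ * star (cc ψ z₀) * S := by
      conv_lhs => rw [hS, ← Equiv.sum_comp (Equiv.mulLeft (⟨z₀, hz₀⟩ : N))]
      rw [hS, Finset.mul_sum]
      refine sum_congr rfl fun z _ => ?_
      simp only [Equiv.coe_mulLeft, Subgroup.coe_mul]
      rw [hχ.cc_map_mul (hN hz₀), hψ.cc_mul (hN hz₀), star_mul']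
      ring
    by_contra hS0
    have h1 : cc χ z₀ * star (cc ψ z₀) = 1 := by
      have := mul_right_cancel₀ hS0 ((one_mul S).trans key)
      exact this.symm
    have h2 : cc ψ z₀ * star (cc ψ z₀) = 1 := by
      have := Complex.mul_conj' (cc ψ z₀)
      rw [hψ.norm_cc (hN hz₀)] at this
      simpa using this
    have h3 : star (cc ψ z₀) ≠ 0 := right_ne_zero_of_mul_eq_one h2
    exact hne (mul_right_cancel₀ h3 (h1.trans h2.symm))

/-- Orthogonality makes the irreducible characters linearly independent in a space of finite
dimension. -/
theorem finite_irr : {χ : G → ℂ | IsIrr χ}.Finite := by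
  have hli : LinearIndependent ℂ (fun χ : {χ : G → ℂ // IsIrr χ} => (χ : G → ℂ)) := by
    rw [linearIndependent_iff']
    intro s c hs i hi
    have := congrArg (fun f => ip f (i : G → ℂ)) hs
    have hsum : ∀ t : Finset {χ : G → ℂ // IsIrr χ}, ip (∑ j ∈ t, c j • (j : G → ℂ)) i =
        ∑ j ∈ t, c j * ip (j : G → ℂ) i := by
      intro t
      simp only [ip, Finset.sum_apply, Pi.smul_apply, smul_eq_mul, Finset.sum_mul, Finset.mul_sum]
      rw [Finset.sum_comm]
      simp [mul_assoc]
    simp only [hsum] at this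
    rw [Finset.sum_eq_single i, i.2.ip_self] at this
    · simpa [ip] using this
    · intro j _ hji
      rw [j.2.ip_of_ne i.2 (fun h => hji (Subtype.ext h)), mul_zero]
    · intro h; exact absurd hi h
  exact hli.finite

open Classical in
-- The central character of χ, extended by zero outside `N`, is a class function. Its expansion
-- involves exactly the irreducible characters over the same central character, with coefficients
-- proportional to their degrees; evaluation at 1 gives the formula.
theorem exists_finset_sum_sq (N : Subgroup G) (hN : N ≤ Subgroup.center G) (hχ : IsIrr χ) :
    ∃ S : Finset (G → ℂ), (∀ ψ, ψ ∈ S ↔ IsIrr ψ ∧ SameOn N χ ψ) ∧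
      ∑ ψ ∈ S, ψ 1 ^ 2 * Nat.card N = Fintype.card G := by
  have hG : (Fintype.card G : ℂ) ≠ 0 := card_ne_zero'
  have : Fintype N := Fintype.ofFinite N
  let S := (finite_irr (G := G)).toFinset.filter (fun ψ => SameOn N χ ψ)
  have hS : ∀ ψ, ψ ∈ S ↔ IsIrr ψ ∧ SameOn N χ ψ := by simp [S]
  refine ⟨S, hS, ?_⟩
  let f : G → ℂ := fun g => if g ∈ N then cc χ g else 0
  let F : G → ℂ := f - ∑ ψ ∈ S, ((Nat.card N : ℂ) / Fintype.card G * ψ 1) • ψ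
  have hipf : ∀ ψ, IsIrr ψ → ip f ψ = if SameOn N χ ψ then Nat.card N * ψ 1 else 0 := by
    intro ψ hψ
    have h1 : ip f ψ = ∑ z : N, cc χ z * star (ψ z) := by
      rw [ip]
      have : ∀ g, f g * star (ψ g) = if g ∈ N then cc χ g * star (ψ g) else 0 := by
        intro g; simp only [f]; split_ifs <;> simp
      simp_rw [this]
      rw [← Finset.sum_filter]
      exact Finset.sum_subtype _ (by simp) (fun g => cc χ g * star (ψ g))
    rw [h1]
    split_ifs with h
    · exact (ip_ofSubgroup N hN hχ hψ).1 h
    · exact (ip_ofSubgroup N hN hχ hψ).2 h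
  have hF : F = 0 := by
    refine eq_zero_of_forall_irr ?_ ?_
    · intro x g
      have hf : f (x * g * x⁻¹) = f g := by
        simp only [f]
        have hmem : ∀ y a : G, a ∈ N → y * a * y⁻¹ = a := fun y a ha => by
          rw [Subgroup.mem_center_iff.1 (hN ha) y]; simp
        by_cases hg : g ∈ N
        · rw [hmem x g hg]
        · have : x * g * x⁻¹ ∉ N := by
            intro hc
            have := hmem x⁻¹ _ hc
            apply hg
            rw [← this] at hc
            simpa [mul_assoc] using hc
          rw [if_neg hg, if_neg this]
      simp only [F, Pi.sub_apply, hf, Finset.sum_apply, Pi.smul_apply]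
      congr 1
      refine sum_congr rfl fun ψ hψ => ?_
      rw [((hS ψ).1 hψ).1.conj]
    · intro θ hθ
      have : ip F θ = ip f θ - ∑ ψ ∈ S, ((Nat.card N : ℂ) / Fintype.card G * ψ 1) * ip ψ θ := by
        rw [ip_sub_left]
        congr 1
        simp only [ip, Finset.sum_apply, Pi.smul_apply, smul_eq_mul, Finset.sum_mul,
          Finset.mul_sum]
        rw [Finset.sum_comm]
        simp [mul_assoc]
      rw [this, hipf θ hθ]
      split_ifs with hs
      · rw [Finset.sum_eq_single θ, hθ.ip_self]
        · field_simp; ring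
        · intro ψ hψ hne
          rw [((hS ψ).1 hψ).1.ip_of_ne hθ hne, mul_zero]
        · intro h; exact absurd ((hS θ).2 ⟨hθ, hs⟩) h
      · rw [Finset.sum_eq_zero, sub_zero]
        intro ψ hψ
        rw [((hS ψ).1 hψ).1.ip_of_ne hθ, mul_zero]
        rintro rfl
        exact hs ((hS _).1 hψ).2
  have h1 := congrFun hF 1
  simp only [F, f, Pi.sub_apply, Finset.sum_apply, Pi.smul_apply, smul_eq_mul, N.one_mem, if_true,
    hχ.cc_one, Pi.zero_apply, sub_eq_zero] at h1
  have h2 : (Fintype.card G : ℂ) = Fintype.card G * ∑ x ∈ S, (Nat.card N : ℂ) / Fintype.card G *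
      x 1 * x 1 := by rw [← h1, mul_one]
  rw [h2, Finset.mul_sum]
  refine sum_congr rfl fun ψ _ => ?_
  field_simp

end Central

/-! ### Induction -/

section Induction

variable {G : Type u} [Group G] [Fintype G]

open Classical in
/-- Extension by zero of a function on a subgroup. -/
noncomputable def extz (H : Subgroup G) (φ : H → ℂ) (g : G) : ℂ :=
  if h : g ∈ H then φ ⟨g, h⟩ else 0

theorem extz_mem {H : Subgroup G} {φ : H → ℂ} {g : G} (h : g ∈ H) : extz H φ g = φ ⟨g, h⟩ :=
  dif_pos h

theorem extz_not_mem {H : Subgroup G} {φ : H → ℂ} {g : G} (h : g ∉ H) : extz H φ g = 0 :=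
  dif_neg h

theorem ind_eq (H : Subgroup G) (φ : H → ℂ) (g : G) :
    ind H φ g = (Nat.card H : ℂ)⁻¹ * ∑ x : G, extz H φ (x⁻¹ * g * x) := rfl

theorem natCard_ne_zero (H : Subgroup G) : (Nat.card H : ℂ) ≠ 0 := by
  exact_mod_cast Nat.card_pos.ne'

theorem sum_extz (H : Subgroup G) [Fintype H] (φ : H → ℂ) (f : G → ℂ) :
    ∑ g, extz H φ g * f g = ∑ h : H, φ h * f h := by
  classical
  have : ∀ g, extz H φ g * f g = if g ∈ H then extz H φ g * f g else 0 := by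
    intro g; split_ifs with h
    · rfl
    · rw [extz_not_mem h, zero_mul]
  rw [Finset.sum_congr rfl fun g _ => this g]
  rw [← Finset.sum_filter, Finset.sum_subtype (p := (· ∈ H)) _ (by simp)]
  exact sum_congr rfl fun h _ => by rw [extz_mem h.2]

theorem ind_conj (H : Subgroup G) (φ : H → ℂ) (y g : G) :
    ind H φ (y * g * y⁻¹) = ind H φ g := by
  rw [ind_eq, ind_eq, ← Equiv.sum_comp (Equiv.mulLeft y)]
  congr 1
  refine sum_congr rfl fun x _ => ?_
  congr 1
  simp only [Equiv.coe_mulLeft]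
  group

/-- Frobenius reciprocity for the unnormalized products: every conjugating element contributes the
same sum over `H`. -/
theorem ip_ind (H : Subgroup G) [Fintype H] (φ : H → ℂ) {ψ : G → ℂ}
    (hψ : ∀ x g, ψ (x * g * x⁻¹) = ψ g) :
    ip (ind H φ) ψ = Fintype.card G * ((Nat.card H : ℂ)⁻¹ * ip φ (fun h => ψ h)) := by
  have h1 : ∀ g, ind H φ g * star (ψ g) =
      (Nat.card H : ℂ)⁻¹ * ∑ x : G, extz H φ (x⁻¹ * g * x) * star (ψ (x⁻¹ * g * x)) := by
    intro g
    rw [ind_eq, mul_assoc, Finset.sum_mul]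
    congr 1
    refine sum_congr rfl fun x _ => ?_
    have := hψ x⁻¹ g
    rw [inv_inv] at this
    rw [this]
  rw [ip, Finset.sum_congr rfl fun g _ => h1 g, ← Finset.mul_sum, Finset.sum_comm]
  have h2 : ∀ x : G, ∑ g, extz H φ (x⁻¹ * g * x) * star (ψ (x⁻¹ * g * x)) =
      ip φ (fun h => ψ h) := by
    intro x
    have := (MulAut.conj x⁻¹).toEquiv.sum_comp (fun g => extz H φ g * star (ψ g))
    simp only [MulEquiv.toEquiv_eq_coe, EquivLike.coe_coe, MulAut.conj_apply, inv_inv] at this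
    rw [this, sum_extz H φ (fun g => star (ψ g))]
    rfl
  rw [Finset.sum_congr rfl fun x _ => h2 x]
  simp
  ring

theorem isChar_restrict (H : Subgroup G) [Fintype H] {ψ : G → ℂ} (hψ : IsIrr ψ) :
    IsChar (fun h : H => ψ h) := by
  obtain ⟨d, ρ, -, rfl⟩ := hψ
  exact isChar_character (ρ.comp H.subtype)

theorem isChar_ind (H : Subgroup G) {φ : H → ℂ} (hφ : IsIrr φ) : IsChar (ind H φ) := by
  classical
  have : Fintype H := Fintype.ofFinite H
  refine ⟨ind_conj H φ, fun ψ hψ => ?_⟩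
  obtain ⟨m, hm⟩ := (isChar_restrict H hψ).2 φ hφ
  refine ⟨m, ?_⟩
  rw [ip_ind H φ hψ.conj, ← star_ip, hm, Nat.card_eq_fintype_card]
  have : (Fintype.card H : ℂ) ≠ 0 := card_ne_zero'
  simp only [star_mul', star_natCast]
  field_simp

theorem ind_central (H : Subgroup G) (φ : H → ℂ) {z : G} (hz : z ∈ Subgroup.center G) :
    ind H φ z = H.index * extz H φ z := by
  have h1 : ∀ x : G, x⁻¹ * z * x = z := fun x => by
    rw [mul_assoc, ← Subgroup.mem_center_iff.1 hz x]; simp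
  rw [ind_eq, Finset.sum_congr rfl fun x _ => by rw [h1 x]]
  have := H.card_mul_index
  rw [Finset.sum_const, card_univ, ← Nat.card_eq_fintype_card, ← this]
  have h2 := natCard_ne_zero H
  simp only [nsmul_eq_mul, Nat.cast_mul]
  field_simp

theorem ind_one (H : Subgroup G) (φ : H → ℂ) : ind H φ 1 = H.index * φ 1 := by
  rw [ind_central H φ (Subgroup.one_mem _), extz_mem H.one_mem]; rfl

theorem ind_star (H : Subgroup G) (φ : H → ℂ) : ind H (star φ) = star (ind H φ) := by
  funext g
  simp only [Pi.star_apply, ind_eq, star_mul', star_sum, star_inv₀, star_natCast]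
  congr 1
  refine sum_congr rfl fun x _ => ?_
  by_cases h : x⁻¹ * g * x ∈ H
  · rw [extz_mem h, extz_mem h]; rfl
  · rw [extz_not_mem h, extz_not_mem h]; simp

theorem ind_ne_zero (H : Subgroup G) {φ : H → ℂ} (hφ : IsIrr φ) : ind H φ ≠ 0 := by
  intro h
  have := congrFun h 1
  rw [ind_one, Pi.zero_apply, mul_eq_zero] at this
  rcases this with h | h
  · exact Subgroup.index_ne_zero_of_finite (H := H) (by exact_mod_cast h)
  · exact hφ.one_ne_zero h

/-- An irreducible character has absolute value χ(1) on the centre, whereas an induced character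
vanishes at central elements outside `H`. Block stabilizers therefore automatically contain the
centre. -/
theorem center_le_of_isIrr_ind {H : Subgroup G} {φ : H → ℂ} (h : IsIrr (ind H φ)) :
    Subgroup.center G ≤ H := by
  intro z hz
  by_contra hc
  have h1 := ind_central H φ hz
  rw [extz_not_mem hc, mul_zero] at h1
  have h2 := h.norm_cc hz
  rw [cc, h1, zero_div, norm_zero] at h2
  exact zero_ne_one h2

theorem IsIrr.ind_of_lt {H : Subgroup G} {φ : H → ℂ} (hφ : IsIrr φ)
    (hlt : ∑ g, ‖ind H φ g‖ ^ 2 < 2 * (Fintype.card G : ℝ)) : IsIrr (ind H φ) :=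
  isIrr_of_isChar (isChar_ind H hφ) (ind_ne_zero H hφ) hlt

theorem cc_ind {H : Subgroup G} {φ : H → ℂ} {z : G} (hz : z ∈ Subgroup.center G) (hzH : z ∈ H) :
    cc (ind H φ) z = cc φ ⟨z, hzH⟩ := by
  rw [cc, cc, ind_central H φ hz, ind_one, extz_mem hzH]
  have : (H.index : ℂ) ≠ 0 := by exact_mod_cast Subgroup.index_ne_zero_of_finite
  rw [mul_div_mul_left _ _ this]

end Induction
end ImprimitiveCovers

namespace ImprimitiveCovers

open Finset

/-! ### Sums over the elements of a given order -/

section OrderSum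

variable {A : Type v} [Group A] [Fintype A] {M : Type*} [AddCommMonoid M]

/-- The elements of order `r`. -/
noncomputable def ofOrder (A : Type v) [Group A] [Finite A] (r : ℕ) : Finset A :=
  (Set.toFinite {a : A | orderOf a = r}).toFinset

@[simp] theorem mem_ofOrder {A : Type v} [Group A] [Finite A] {r : ℕ} {a : A} : a ∈ ofOrder A r ↔ orderOf a = r := by
  simp [ofOrder]

/-- The sum of a function over the elements of order `r`. -/
noncomputable def osum (r : ℕ) (f : A → M) : M := ∑ a ∈ ofOrder A r, f a

theorem sum_eq_sum_osum {R : Finset ℕ} (hR : ∀ a : A, orderOf a ∈ R) (f : A → M) :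
    ∑ a, f a = ∑ r ∈ R, osum r f := by
  classical
  rw [← Finset.sum_fiberwise_of_maps_to (fun a _ => hR a)]
  refine sum_congr rfl fun r _ => ?_
  rw [osum]
  refine sum_congr ?_ fun _ _ => rfl
  ext a; simp

theorem osum_one (f : A → M) : osum 1 f = f 1 := by
  have : ofOrder A 1 = {1} := by ext a; simp
  rw [osum, this, sum_singleton]

theorem osum_const {r : ℕ} {f : A → M} {c : M} (h : ∀ a, orderOf a = r → f a = c) :
    osum r f = (ofOrder A r).card • c := by
  rw [osum, Finset.sum_congr rfl fun a ha => h a (mem_ofOrder.1 ha), sum_const]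

theorem osum_conj {r : ℕ} (f : A → M) (x : A) : osum r (fun a => f (x * a * x⁻¹)) = osum r f := by
  refine Finset.sum_nbij' (fun a => x * a * x⁻¹) (fun a => x⁻¹ * a * x) ?_ ?_ ?_ ?_ ?_
  · intro a ha
    rw [mem_ofOrder] at ha ⊢
    have := MulEquiv.orderOf_eq (MulAut.conj x) a
    rw [MulAut.conj_apply] at this
    rw [this, ha]
  · intro a ha
    rw [mem_ofOrder] at ha ⊢
    have := MulEquiv.orderOf_eq (MulAut.conj x⁻¹) a
    rw [MulAut.conj_apply, inv_inv] at this
    rw [this, ha]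
  · intro a _; group
  · intro a _; group
  · intro a _; rfl

end OrderSum

/-! ### Fixed cosets: the permutation character and element counts in subgroups -/

section Fix

variable {A : Type v} [Group A] [Fintype A] (H : Subgroup A)

/-- The number of cosets of `H` that are fixed by `a`. -/
noncomputable def fixc (a : A) : ℕ := Nat.card (MulAction.fixedBy (A ⧸ H) a)

open Classical in
-- The condition says that `a` fixes the coset of `x`, and each coset has |H| representatives.
theorem card_conj_mem (a : A) :
    (univ.filter fun x : A => x⁻¹ * a * x ∈ H).card = Nat.card H * fixc H a := by
  have h1 : Nat.card {x : A // x⁻¹ * a * x ∈ H} = Nat.card (MulAction.fixedBy (A ⧸ H) a × H) := by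
    have hmem : ∀ x : A, x⁻¹ * a * x ∈ H ↔ (x : A ⧸ H) ∈ MulAction.fixedBy (A ⧸ H) a := by
      intro x
      rw [MulAction.mem_fixedBy, MulAction.Quotient.smul_mk, eq_comm, QuotientGroup.eq, smul_eq_mul,
        mul_assoc]
    let e : {x : A // x⁻¹ * a * x ∈ H} ≃
        {p : (A ⧸ H) × H // p.1 ∈ MulAction.fixedBy (A ⧸ H) a} :=
      Equiv.subtypeEquiv Subgroup.groupEquivQuotientProdSubgroup (fun x => by
        rw [hmem]; rfl)
    rw [Nat.card_congr e]
    exact Nat.card_congr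
      { toFun := fun p => (⟨p.1.1, p.2⟩, p.1.2)
        invFun := fun p => ⟨(p.1.1, p.2), p.1.2⟩
        left_inv := fun _ => rfl
        right_inv := fun _ => rfl }
  rw [← Fintype.card_subtype, ← Nat.card_eq_fintype_card, h1, Nat.card_prod, mul_comm, fixc]

theorem fixc_conj (x a : A) : fixc H (x * a * x⁻¹) = fixc H a := by
  refine Nat.card_congr ?_
  refine (Equiv.subtypeEquiv (MulAction.toPerm x⁻¹) fun q => ?_)
  simp only [MulAction.mem_fixedBy, MulAction.toPerm_apply]
  simp only [← mul_smul]
  constructor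
  · intro h
    conv_rhs => rw [← h]
    rw [← mul_smul]; congr 1; group
  · intro h
    have := congrArg (x • ·) h
    simpa [← mul_smul, mul_assoc] using this

/-- `a` and `a ^ j` generate the same cyclic group, so each is a power of the other. -/
theorem fixc_pow {a : A} {j : ℕ} (hj : (orderOf a).Coprime j) : fixc H (a ^ j) = fixc H a := by
  obtain ⟨k, hk⟩ := exists_pow_eq_self_of_coprime hj.symm
  have key : ∀ (b : A) (n : ℕ), MulAction.fixedBy (A ⧸ H) b ⊆ MulAction.fixedBy (A ⧸ H) (b ^ n) := by
    intro b n q hq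
    induction n with
    | zero => simp
    | succ n ih =>
      rw [MulAction.mem_fixedBy] at *
      rw [pow_succ, mul_smul, hq, ih]
  have : MulAction.fixedBy (A ⧸ H) (a ^ j) = MulAction.fixedBy (A ⧸ H) a := by
    apply Set.Subset.antisymm
    · have := key (a ^ j) k
      rwa [hk] at this
    · exact key a j
  rw [fixc, this, fixc]

/-- The orbits of a group of order `p` on the cosets have length 1 or `p`. -/
theorem fixc_modEq {p : ℕ} [Fact p.Prime] {a : A} (ha : orderOf a = p) :
    fixc H a ≡ H.index [MOD p] := by
  have hp : IsPGroup p (Subgroup.zpowers a) := by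
    refine IsPGroup.of_card (n := 1) ?_
    rw [Nat.card_zpowers, ha, pow_one]
  have := hp.card_modEq_card_fixedPoints (A ⧸ H)
  rw [Subgroup.index]
  refine (this.trans ?_).symm
  rw [fixc]
  have : MulAction.fixedPoints (Subgroup.zpowers a) (A ⧸ H) = MulAction.fixedBy (A ⧸ H) a := by
    ext q
    rw [MulAction.mem_fixedPoints, MulAction.mem_fixedBy]
    constructor
    · intro h; exact h ⟨a, Subgroup.mem_zpowers a⟩
    · rintro h ⟨_, k, rfl⟩
      exact MulAction.mem_stabilizer_iff.1
        (Subgroup.zpow_mem (MulAction.stabilizer A q) (MulAction.mem_stabilizer_iff.2 h) k)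
  rw [this]

open Classical in
-- Count the pairs (x, a) with `a` of order `r` and x⁻¹ax in `H` in two ways.
theorem osum_fixc (r : ℕ) :
    osum r (fixc H) = H.index * (ofOrder H r).card := by
  have h1 : Nat.card H * osum r (fixc H) =
      ∑ x : A, (univ.filter fun a : A => orderOf a = r ∧ x⁻¹ * a * x ∈ H).card := by
    rw [osum, Finset.mul_sum]
    simp_rw [← card_conj_mem H, Finset.card_filter]
    rw [Finset.sum_comm]
    refine sum_congr rfl fun x _ => ?_
    rw [show ofOrder A r = univ.filter fun a => orderOf a = r by ext; simp, Finset.sum_filter]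
    refine sum_congr rfl fun a _ => ?_
    split_ifs <;> simp_all
  have h2 : ∀ x : A, (univ.filter fun a : A => orderOf a = r ∧ x⁻¹ * a * x ∈ H).card =
      (ofOrder H r).card := by
    intro x
    symm
    refine Finset.card_bij (fun h _ => x * h * x⁻¹) ?_ ?_ ?_
    · intro h hh
      rw [mem_ofOrder] at hh
      have := MulEquiv.orderOf_eq (MulAut.conj x) (h : A)
      rw [MulAut.conj_apply] at this
      rw [mem_filter, this, Subgroup.orderOf_coe]
      exact ⟨mem_univ _, hh, by simp [mul_assoc]⟩
    · intro h _ h' _ e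
      simpa using e
    · intro a ha
      rw [mem_filter] at ha
      refine ⟨⟨x⁻¹ * a * x, ha.2.2⟩, ?_, by simp [mul_assoc]⟩
      have := MulEquiv.orderOf_eq (MulAut.conj x⁻¹) a
      rw [MulAut.conj_apply, inv_inv] at this
      rw [mem_ofOrder, ← Subgroup.orderOf_coe]
      exact this.trans ha.2.1
  rw [Finset.sum_congr rfl fun x _ => h2 x] at h1
  simp only [sum_const, card_univ, smul_eq_mul] at h1
  rw [← Nat.card_eq_fintype_card, ← H.card_mul_index, mul_assoc] at h1
  exact Nat.eq_of_mul_eq_mul_left Nat.card_pos h1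

/-- Any two elements of order `r` are conjugate up to passing to another generator of the cyclic
group. -/
def RatConj (A : Type v) [Group A] (r : ℕ) : Prop :=
  ∀ a b : A, orderOf a = r → orderOf b = r → ∃ j : ℕ, r.Coprime j ∧ IsConj (a ^ j) b

theorem fixc_eq {r : ℕ} (hr : RatConj A r) {a b : A} (ha : orderOf a = r) (hb : orderOf b = r) :
    fixc H a = fixc H b := by
  obtain ⟨j, hj, hc⟩ := hr a b ha hb
  obtain ⟨x, rfl⟩ := isConj_iff.1 hc
  rw [fixc_conj, fixc_pow H (by rwa [ha])]

/-- On the elements of order `r` the number of fixed cosets is constant. The relation serves twice: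
to exclude indices of subgroups, and to bound norms of induced characters. -/
theorem card_mul_fixc {r : ℕ} (hr : RatConj A r) {a : A} (ha : orderOf a = r) :
    (ofOrder A r).card * fixc H a = H.index * (ofOrder H r).card := by
  rw [← osum_fixc, osum_const (c := fixc H a) fun b hb => fixc_eq H hr hb ha, smul_eq_mul]

end Fix

end ImprimitiveCovers

/-! ### Central extensions, canonical lifts and induction from subgroups containing the kernel -/

namespace ImprimitiveCovers

open Finset

/-- `π` is a central extension: it is onto with central kernel. -/
structure CentralExt {G : Type u} {A : Type v} [Group G] [Group A] (π : G →* A) : Prop where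
  surj : Function.Surjective π
  central : π.ker ≤ Subgroup.center G

theorem pow_card_ker {G : Type u} {A : Type v} [Group G] [Finite G] [Group A] {π : G →* A} {z : G}
    (hz : π z = 1) : z ^ Nat.card π.ker = 1 := by
  have : (⟨z, hz⟩ : π.ker) ^ Nat.card π.ker = 1 := pow_card_eq_one'
  exact congrArg Subtype.val this

namespace CentralExt

section Section

variable {G : Type u} {A : Type v} [Group G] [Finite G] [Group A] {π : G →* A}

theorem natCard_eq (h : CentralExt π) : Nat.card G = Nat.card π.ker * Nat.card A := by
  rw [← π.ker.card_mul_index,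
    Subgroup.index_ker, MonoidHom.range_eq_top.2 h.surj]
  simp

theorem mul_comm_of_ker (h : CentralExt π) {z : G} (hz : π z = 1) (g : G) : g * z = z * g :=
  Subgroup.mem_center_iff.1 (h.central hz) g

theorem exists_ker_mul (_h : CentralExt π) {g g' : G} (hg : π g = π g') :
    ∃ z, π z = 1 ∧ g = z * g' :=
  ⟨g * g'⁻¹, by rw [map_mul, map_inv, hg, mul_inv_cancel], by simp⟩

/-- Raise any lift to an exponent congruent to 1 modulo the order of `a` and to 0 modulo the order
of the kernel: the image does not change and the central part disappears. -/
theorem exists_lift_order (h : CentralExt π) (a : A) :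
    ∃ g, π g = a ∧ ((orderOf a).Coprime (Nat.card π.ker) → orderOf g = orderOf a) := by
  obtain ⟨g, rfl⟩ := h.surj a
  by_cases hco : (orderOf (π g)).Coprime (Nat.card π.ker)
  swap
  · exact ⟨g, rfl, fun hc => absurd hc hco⟩
  obtain ⟨e, he1, he0⟩ := Nat.chineseRemainder hco 1 0
  have hπ : π (g ^ e) = π g := by
    rw [map_pow]
    conv_rhs => rw [← pow_one (π g)]
    exact pow_eq_pow_iff_modEq.2 he1
  refine ⟨g ^ e, hπ, fun _ => Nat.dvd_antisymm (orderOf_dvd_of_pow_eq_one ?_) ?_⟩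
  · obtain ⟨k, rfl⟩ := (Nat.modEq_zero_iff_dvd).1 he0
    rw [← pow_mul, mul_comm, ← mul_assoc, pow_mul, pow_mul, pow_card_ker, one_pow]
    rw [map_pow, pow_orderOf_eq_one]
  · rw [← hπ]; exact orderOf_map_dvd π _

/-- A section of `π` which preserves the orders that are coprime to the order of the kernel. -/
noncomputable def s (h : CentralExt π) (a : A) : G := (h.exists_lift_order a).choose

@[simp] theorem π_s (h : CentralExt π) (a : A) : π (h.s a) = a :=
  (h.exists_lift_order a).choose_spec.1

theorem orderOf_s (h : CentralExt π) {a : A} (ha : (orderOf a).Coprime (Nat.card π.ker)) :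
    orderOf (h.s a) = orderOf a :=
  (h.exists_lift_order a).choose_spec.2 ha

/-- Two lifts differ by a central factor whose order divides both `n` and the order of the kernel.
This uniqueness makes `s` compatible with conjugation and powers on elements of coprime order. -/
theorem eq_of_pow_eq_one (h : CentralExt π) {g g' : G} (hg : π g = π g') {n : ℕ}
    (hn : n.Coprime (Nat.card π.ker)) (h1 : g ^ n = 1) (h2 : g' ^ n = 1) : g = g' := by
  obtain ⟨z, hz, rfl⟩ := h.exists_ker_mul hg
  have hc : Commute z g' := (h.mul_comm_of_ker hz g').symm
  rw [hc.mul_pow, h2, mul_one] at h1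
  have h3 := pow_card_ker hz
  have h4 : orderOf z ∣ 1 := by
    rw [← hn.gcd_eq_one]
    exact Nat.dvd_gcd (orderOf_dvd_of_pow_eq_one h1) (orderOf_dvd_of_pow_eq_one h3)
  rw [orderOf_eq_one_iff.1 (Nat.dvd_one.1 h4), one_mul]

theorem s_conj (h : CentralExt π) {a : A} (ha : (orderOf a).Coprime (Nat.card π.ker)) (x : G) :
    h.s (π x * a * (π x)⁻¹) = x * h.s a * x⁻¹ := by
  have ho : orderOf (π x * a * (π x)⁻¹) = orderOf a := by
    have := MulEquiv.orderOf_eq (MulAut.conj (π x)) a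
    rwa [MulAut.conj_apply] at this
  refine h.eq_of_pow_eq_one (n := orderOf a) (by simp) ha ?_ ?_
  · rw [← ho, ← h.orderOf_s (by rwa [ho]), pow_orderOf_eq_one]
  · rw [conj_pow, ← h.orderOf_s ha, pow_orderOf_eq_one]; simp

theorem s_pow (h : CentralExt π) {a : A} (ha : (orderOf a).Coprime (Nat.card π.ker)) (j : ℕ) :
    h.s (a ^ j) = h.s a ^ j := by
  refine h.eq_of_pow_eq_one (n := orderOf a) (by simp) ha ?_ ?_
  · have hd : orderOf (a ^ j) ∣ orderOf a := orderOf_pow_dvd j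
    refine orderOf_dvd_iff_pow_eq_one.1 ?_
    rw [h.orderOf_s (Nat.Coprime.coprime_dvd_left hd ha)]
    exact hd
  · rw [← pow_mul, mul_comm, pow_mul, ← h.orderOf_s ha, pow_orderOf_eq_one, one_pow]

theorem s_one (h : CentralExt π) : h.s 1 = 1 := by
  have := h.s_pow (a := 1) (by simp) 0
  simpa using this

end Section

variable {G : Type u} {A : Type v} [Group G] [Fintype G] [Group A] [Fintype A] {π : G →* A}

theorem card_eq (h : CentralExt π) : Fintype.card G = Nat.card π.ker * Fintype.card A := by
  rw [← Nat.card_eq_fintype_card, ← Nat.card_eq_fintype_card, h.natCard_eq]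

theorem sum_eq {M : Type*} [NonAssocSemiring M] (h : CentralExt π) {F : G → M}
    (hF : ∀ z g, π z = 1 → F (z * g) = F g) :
    ∑ g, F g = Nat.card π.ker * ∑ a, F (h.s a) := by
  classical
  let e : π.ker × A ≃ G :=
    { toFun := fun p => p.1 * h.s p.2
      invFun := fun g => (⟨g * (h.s (π g))⁻¹, by simp [MonoidHom.mem_ker]⟩, π g)
      left_inv := by
        rintro ⟨⟨z, hz⟩, a⟩
        have hz' : π z = 1 := hz
        ext <;> simp [hz']
      right_inv := by intro g; simp }
  rw [← e.sum_comp, Fintype.sum_prod_type]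
  have : ∀ z : π.ker, ∑ a, F (e (z, a)) = ∑ a, F (h.s a) := fun z =>
    Finset.sum_congr rfl fun a _ => hF _ _ z.2
  rw [Finset.sum_congr rfl fun z _ => this z]
  simp

section Irr

variable {χ ψ : G → ℂ}

theorem norm_ker_mul (h : CentralExt π) (hψ : IsIrr ψ) {z : G} (hz : π z = 1) (g : G) :
    ‖ψ (z * g)‖ = ‖ψ g‖ := by
  rw [hψ.cc_mul (h.central hz), norm_mul, hψ.norm_cc (h.central hz), one_mul]

open Classical in
-- With equal central characters the scalars in χψ̄ cancel, so the product is constant on cosets of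
-- the kernel and orthogonality descends to `A`, whatever lifts are chosen.
theorem sum_mul_star (h : CentralExt π) (hχ : IsIrr χ) (hψ : IsIrr ψ) (hs : SameOn π.ker χ ψ) :
    ∑ a, χ (h.s a) * star (ψ (h.s a)) = if χ = ψ then (Fintype.card A : ℂ) else 0 := by
  have h1 := hχ.ip_eq hψ
  rw [ip, h.sum_eq (F := fun g => χ g * star (ψ g)) fun z g hz => by
    rw [hχ.cc_mul (h.central hz), hψ.cc_mul (h.central hz), hs z hz, star_mul']
    have : cc ψ z * star (cc ψ z) = 1 := by
      have := Complex.mul_conj' (cc ψ z)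
      rw [hψ.norm_cc (h.central hz)] at this
      simpa using this
    linear_combination (χ g * star (ψ g)) * this, h.card_eq] at h1
  have h2 : (Nat.card π.ker : ℂ) ≠ 0 := by exact_mod_cast Nat.card_pos.ne'
  apply mul_left_cancel₀ h2
  rw [h1]
  split_ifs <;> simp

theorem apply_s_eq_of_isConj (h : CentralExt π) (hψ : ∀ x g, ψ (x * g * x⁻¹) = ψ g) {a b : A}
    (ha : (orderOf a).Coprime (Nat.card π.ker)) (hab : IsConj a b) : ψ (h.s a) = ψ (h.s b) := by
  obtain ⟨x, rfl⟩ := isConj_iff.1 hab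
  obtain ⟨g, rfl⟩ := h.surj x
  rw [h.s_conj ha, hψ]

theorem norm_apply_conj (h : CentralExt π) (hψ : IsIrr ψ) {g g' : G} (hg : π g = π g') :
    ‖ψ g‖ = ‖ψ g'‖ := by
  obtain ⟨z, hz, rfl⟩ := h.exists_ker_mul hg
  exact h.norm_ker_mul hψ hz g'

theorem eq_on_of_pow_order (h : CentralExt π) {g : G} {n : ℕ} (hn : n.Coprime (Nat.card π.ker))
    (hg : g ^ n = 1) : g = h.s (π g) := by
  have hd : orderOf (π g) ∣ n := orderOf_dvd_of_pow_eq_one (by rw [← map_pow, hg, map_one])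
  refine h.eq_of_pow_eq_one (n := n) (by simp) hn hg ?_
  refine orderOf_dvd_iff_pow_eq_one.1 ?_
  rwa [h.orderOf_s (Nat.Coprime.coprime_dvd_left hd hn)]

end Irr

/-! ### Induction from a subgroup containing the kernel -/

section Ind

variable {B : Type w} [Group B] [Fintype B] {H : Subgroup G} {σ : H →* B}

/-- `σ` presents the subgroup `H ≥ ker π` as an extension by the same kernel. -/
structure Compat (π : G →* A) (H : Subgroup G) (σ : H →* B) : Prop where
  le : π.ker ≤ H
  surj : Function.Surjective σ
  ker : ∀ x : H, σ x = 1 ↔ π x = 1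

theorem Compat.ext (hσ : Compat π H σ) (h : CentralExt π) : CentralExt σ where
  surj := hσ.surj
  central := fun x hx => by
    rw [Subgroup.mem_center_iff]
    intro g
    exact Subtype.ext (h.mul_comm_of_ker ((hσ.ker x).1 hx) g)

theorem Compat.card_ker (hσ : Compat π H σ) : Nat.card σ.ker = Nat.card π.ker := by
  refine Nat.card_congr
    { toFun := fun x => ⟨x.1, (hσ.ker x.1).1 x.2⟩
      invFun := fun z => ⟨⟨z.1, hσ.le z.2⟩, (hσ.ker _).2 z.2⟩
      left_inv := fun _ => rfl
      right_inv := fun _ => rfl }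

theorem Compat.map_eq_iff (hσ : Compat π H σ) (x y : H) : σ x = σ y ↔ π x = π y := by
  rw [← mul_inv_eq_one, ← map_inv, ← map_mul, hσ.ker, Subgroup.coe_mul, Subgroup.coe_inv, map_mul,
    map_inv, mul_inv_eq_one]

theorem Compat.orderOf_eq (hσ : Compat π H σ) (x : H) : orderOf (σ x) = orderOf (π x) := by
  rw [orderOf_eq_orderOf_iff]
  intro n
  rw [← map_pow, hσ.ker, Subgroup.coe_pow, map_pow]

theorem compat_subgroupMap (π : G →* A) (H : Subgroup G) (hH : π.ker ≤ H) :
    Compat π H (π.subgroupMap H) where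
  le := hH
  surj := π.subgroupMap_surjective H
  ker := fun x => by
    rw [← Subtype.coe_inj]; rfl

theorem Compat.comp (hσ : Compat π H σ) {C : Type*} [Group C] (e : B ≃* C) :
    Compat π H (e.toMonoidHom.comp σ) where
  le := hσ.le
  surj := e.surjective.comp hσ.surj
  ker := fun x => by simp [hσ.ker]

/-- The target of a compatible map is the image of the subgroup. -/
noncomputable def Compat.equiv (hσ : Compat π H σ) : H.map π ≃* B :=
  MulEquiv.symm <| MulEquiv.ofBijective
    ({ toFun := fun b => ⟨π (hσ.surj b).choose, Subgroup.mem_map_of_mem _ (hσ.surj b).choose.2⟩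
       map_one' := Subtype.ext ((hσ.ker _).1 (hσ.surj 1).choose_spec)
       map_mul' := fun b c => Subtype.ext <| by
        rw [Subgroup.coe_mul, ← map_mul, ← Subgroup.coe_mul, ← hσ.map_eq_iff, map_mul,
          (hσ.surj _).choose_spec, (hσ.surj _).choose_spec, (hσ.surj _).choose_spec] } :
      B →* H.map π) (by
    constructor
    · intro b c hbc
      have := (hσ.map_eq_iff _ _).2 (Subtype.ext_iff.1 hbc)
      rwa [(hσ.surj _).choose_spec, (hσ.surj _).choose_spec] at this
    · rintro ⟨_, x, hx, rfl⟩
      refine ⟨σ ⟨x, hx⟩, Subtype.ext ?_⟩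
      exact (hσ.map_eq_iff _ ⟨x, hx⟩).1 (hσ.surj _).choose_spec)

theorem Compat.card_ofOrder (hσ : Compat π H σ) (r : ℕ) :
    (ofOrder (H.map π) r).card = (ofOrder B r).card := by
  refine Finset.card_equiv hσ.equiv.toEquiv fun x => ?_
  simp

theorem mem_of_map_mem (hH : π.ker ≤ H) {g : G} (hg : π g ∈ H.map π) : g ∈ H := by
  obtain ⟨y, hy, hxy⟩ := hg
  have : g * y⁻¹ ∈ H := hH (by rw [MonoidHom.mem_ker, map_mul, map_inv, hxy, mul_inv_cancel])
  simpa using H.mul_mem this hy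

theorem index_map (h : CentralExt π) (hH : π.ker ≤ H) : (H.map π).index = H.index :=
  H.index_map_eq h.surj hH

/-- Transport of a sum over the elements of order `r` of `H / ker π`. -/
theorem Compat.osum_extz {M : Type*} [AddCommMonoid M] (h : CentralExt π) (hσ : Compat π H σ)
    (r : ℕ) (f : A → M) (f' : B → M) (h0 : ∀ a, orderOf a = r → h.s a ∉ H → f a = 0)
    (h1 : ∀ x : H, orderOf (π x) = r → f (π x) = f' (σ x)) : osum r f = osum r f' := by
  classical
  symm
  have hs : ∀ b, σ (hσ.surj b).choose = b := fun b => (hσ.surj b).choose_spec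
  refine Finset.sum_of_injOn (fun b => π (hσ.surj b).choose) ?_ ?_ ?_ ?_
  · intro b _ c _ hbc
    have := (hσ.map_eq_iff _ _).2 hbc
    rwa [hs, hs] at this
  · intro b hb
    simp only [Finset.mem_coe, mem_ofOrder] at hb ⊢
    rw [← hσ.orderOf_eq, hs, hb]
  · intro a ha hna
    rw [mem_ofOrder] at ha
    refine h0 a ha fun hc => hna ?_
    have he : π (hσ.surj (σ ⟨h.s a, hc⟩)).choose = a := by
      rw [(hσ.map_eq_iff _ ⟨h.s a, hc⟩).1 (hs _), π_s]
    refine ⟨σ ⟨h.s a, hc⟩, ?_, he⟩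
    simp only [Finset.mem_coe, mem_ofOrder]
    rw [hσ.orderOf_eq, π_s, ha]
  · intro b hb
    rw [mem_ofOrder] at hb
    have ho : orderOf (π (hσ.surj b).choose) = r := by rw [← hσ.orderOf_eq, hs, hb]
    rw [h1 _ ho, hs]

/-- Canonical lifts are permuted by conjugation, so each conjugating element contributes the same
sum. If the elements of order `r` form one class, this average is the value of the induced
character. -/
theorem osum_ind (h : CentralExt π) (hσ : Compat π H σ) {φ : H → ℂ} {r : ℕ}
    (hr : r.Coprime (Nat.card π.ker)) :
    osum r (fun a => ind H φ (h.s a)) =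
      H.index * osum r (fun b => φ ((hσ.ext h).s b)) := by
  have e1 : osum r (fun a => ind H φ (h.s a)) =
      (Nat.card H : ℂ)⁻¹ * ∑ x : G, osum r (fun a => extz H φ (h.s a)) := by
    simp only [osum, ind_eq]
    rw [← Finset.mul_sum, Finset.sum_comm]
    congr 1
    refine sum_congr rfl fun x _ => ?_
    rw [← osum, ← osum, ← osum_conj (fun a => extz H φ (h.s a)) (π x⁻¹)]
    refine sum_congr rfl fun a ha => ?_
    rw [mem_ofOrder] at ha
    simp only
    rw [h.s_conj (by rwa [ha]), inv_inv]
  rw [e1, sum_const, card_univ, ← Nat.card_eq_fintype_card, ← H.card_mul_index, nsmul_eq_mul,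
    Nat.cast_mul, ← mul_assoc, ← mul_assoc, inv_mul_cancel₀ (natCard_ne_zero H), one_mul]
  congr 1
  refine hσ.osum_extz h r _ _ (fun a _ hn => extz_not_mem hn) fun x hx => ?_
  have hmem : h.s (π x) ∈ H := mem_of_map_mem hσ.le (by simpa using Subgroup.mem_map_of_mem π x.2)
  rw [extz_mem hmem]
  congr 1
  have hco : (orderOf (π x)).Coprime (Nat.card π.ker) := by rwa [hx]
  have hco' : (orderOf (σ x)).Coprime (Nat.card σ.ker) := by rwa [hσ.card_ker, hσ.orderOf_eq]
  refine (hσ.ext h).eq_of_pow_eq_one (n := r) ?_ (by rwa [hσ.card_ker]) ?_ ?_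
  · rw [π_s, hσ.map_eq_iff]; simp
  · refine Subtype.ext ?_
    rw [Subgroup.coe_pow, ← hx, ← h.orderOf_s hco, pow_orderOf_eq_one]; rfl
  · rw [← hx, ← hσ.orderOf_eq, ← (hσ.ext h).orderOf_s hco', pow_orderOf_eq_one]

/-- Cauchy–Schwarz over the conjugating elements with nonzero contribution, whose number is |H|
times the number of fixed cosets. -/
theorem norm_ind_sq_le (hπ : CentralExt π) (hH : π.ker ≤ H) (φ : H → ℂ) (g : G) :
    ‖ind H φ g‖ ^ 2 ≤ fixc (H.map π) (π g) *
      ((Nat.card H : ℝ)⁻¹ * ∑ x : G, ‖extz H φ (x⁻¹ * g * x)‖ ^ 2) := by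
  classical
  have hH0 : (0 : ℝ) < Nat.card H := by exact_mod_cast Nat.card_pos
  set T := univ.filter fun x : G => x⁻¹ * g * x ∈ H with hT
  have hcard : T.card = Nat.card H * fixc H g := card_conj_mem H g
  -- As `H` contains the kernel, fixed cosets may be counted in `G` or in `A`; the two counts of
  -- conjugating elements differ by the order of the kernel.
  have hfix : fixc H g = fixc (H.map π) (π g) := by
    have h1 := card_conj_mem (H.map π) (π g)
    have h2 := hcard
    have h3 : T.card = Nat.card π.ker *
        (univ.filter fun x : A => x⁻¹ * π g * x ∈ H.map π).card := by
      have := hπ.sum_eq (M := ℕ) (F := fun x => if x⁻¹ * g * x ∈ H then 1 else 0) (by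
        intro z x hz
        congr 2
        have := hπ.mul_comm_of_ker hz
        rw [mul_inv_rev, mul_assoc x⁻¹ z⁻¹ g, ← mul_assoc, mul_assoc x⁻¹, mul_assoc x⁻¹,
          mul_assoc z⁻¹ g, this g, inv_mul_cancel_left, mul_assoc] )
      rw [hT, Finset.card_filter, this, Finset.card_filter]
      congr 1
      refine sum_congr rfl fun a _ => ?_
      congr 1
      refine propext ⟨fun hm => ?_, fun hm => ?_⟩
      · have := Subgroup.mem_map_of_mem π hm
        simpa using this
      · exact mem_of_map_mem hH (by simpa using hm)
    have h4 : Nat.card H = Nat.card π.ker * Nat.card (H.map π) := by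
      have e := (compat_subgroupMap π H hH).card_ker
      rw [← e, ← (π.subgroupMap H).ker.card_mul_index, Subgroup.index_ker,
        MonoidHom.range_eq_top.2 (π.subgroupMap_surjective H)]
      simp
    rw [h3, h1, h4] at h2
    have h5 : 0 < Nat.card π.ker * Nat.card (H.map π) := Nat.mul_pos Nat.card_pos Nat.card_pos
    rw [← mul_assoc] at h2
    exact (Nat.eq_of_mul_eq_mul_left h5 h2).symm
  have hsum : ∑ x : G, extz H φ (x⁻¹ * g * x) = ∑ x ∈ T, extz H φ (x⁻¹ * g * x) := by
    rw [hT, Finset.sum_filter]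
    refine sum_congr rfl fun x _ => ?_
    split_ifs with hx
    · rfl
    · exact extz_not_mem hx
  have hcs : ‖∑ x ∈ T, extz H φ (x⁻¹ * g * x)‖ ^ 2 ≤
      T.card * ∑ x ∈ T, ‖extz H φ (x⁻¹ * g * x)‖ ^ 2 := by
    refine (pow_le_pow_left₀ (norm_nonneg _) (norm_sum_le _ _) 2).trans ?_
    exact sq_sum_le_card_mul_sum_sq
  have hle : ∑ x ∈ T, ‖extz H φ (x⁻¹ * g * x)‖ ^ 2 ≤ ∑ x : G, ‖extz H φ (x⁻¹ * g * x)‖ ^ 2 :=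
    Finset.sum_le_univ_sum_of_nonneg fun x => by positivity
  rw [ind_eq, hsum, norm_mul, mul_pow, norm_inv, Complex.norm_natCast, ← hfix]
  rw [hcard, Nat.cast_mul] at hcs
  calc ((Nat.card H : ℝ)⁻¹) ^ 2 * ‖∑ x ∈ T, extz H φ (x⁻¹ * g * x)‖ ^ 2
      ≤ ((Nat.card H : ℝ)⁻¹) ^ 2 * (Nat.card H * fixc H g *
          ∑ x : G, ‖extz H φ (x⁻¹ * g * x)‖ ^ 2) := by
        gcongr
        exact hcs.trans (by gcongr)
    _ = _ := by field_simp

/-- Sum the Cauchy–Schwarz bound over the elements of order `r`; absolute values do not depend on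
the lift, so no coprimality is needed. -/
theorem osum_norm_ind_le (h : CentralExt π) (hσ : Compat π H σ) {φ : H → ℂ} (hφ : IsIrr φ)
    {r F : ℕ} (hF : ∀ a, orderOf a = r → fixc (H.map π) a ≤ F) :
    osum r (fun a => ‖ind H φ (h.s a)‖ ^ 2) ≤
      F * (H.index * osum r (fun b => ‖φ ((hσ.ext h).s b)‖ ^ 2)) := by
  have : Fintype H := Fintype.ofFinite H
  have hH0 : (Nat.card H : ℝ) ≠ 0 := by exact_mod_cast Nat.card_pos.ne'
  have hz : ∀ z g, π z = 1 → ‖extz H φ (z * g)‖ = ‖extz H φ g‖ := by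
    intro z g hz
    have hzH : z ∈ H := hσ.le hz
    by_cases hg : g ∈ H
    · rw [extz_mem hg, extz_mem (H.mul_mem hzH hg)]
      exact (hσ.ext h).norm_ker_mul hφ ((hσ.ker ⟨z, hzH⟩).2 hz) ⟨g, hg⟩
    · rw [extz_not_mem hg, extz_not_mem fun hc => hg ((H.mul_mem_cancel_left hzH).1 hc)]
  have e2 : osum r (fun a => ‖extz H φ (h.s a)‖ ^ 2) =
      osum r (fun b => ‖φ ((hσ.ext h).s b)‖ ^ 2) := by
    refine hσ.osum_extz h r _ _ (fun a _ hn => by rw [extz_not_mem hn]; simp) fun x hx => ?_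
    have hmem : h.s (π x) ∈ H :=
      mem_of_map_mem hσ.le (by simpa using Subgroup.mem_map_of_mem π x.2)
    rw [extz_mem hmem, (hσ.ext h).norm_apply_conj hφ]
    rw [π_s, hσ.map_eq_iff]; simp
  have e1 : osum r (fun a => (Nat.card H : ℝ)⁻¹ *
      ∑ x : G, ‖extz H φ (x⁻¹ * h.s a * x)‖ ^ 2) =
      H.index * osum r (fun b => ‖φ ((hσ.ext h).s b)‖ ^ 2) := by
    rw [← e2]
    simp only [osum]
    rw [← Finset.mul_sum, Finset.sum_comm]
    have : ∀ x : G, ∑ a ∈ ofOrder A r, ‖extz H φ (x⁻¹ * h.s a * x)‖ ^ 2 =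
        osum r (fun a => ‖extz H φ (h.s a)‖ ^ 2) := by
      intro x
      rw [← osum_conj (fun a => ‖extz H φ (h.s a)‖ ^ 2) (π x⁻¹)]
      refine sum_congr rfl fun a _ => ?_
      obtain ⟨z, hz1, hz2⟩ := h.exists_ker_mul
        (g := x⁻¹ * h.s a * x) (g' := h.s (π x⁻¹ * a * (π x⁻¹)⁻¹)) (by simp)
      rw [hz2, hz _ _ hz1]
    rw [Finset.sum_congr rfl fun x _ => this x]
    rw [sum_const, card_univ, ← Nat.card_eq_fintype_card, ← H.card_mul_index, nsmul_eq_mul,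
      Nat.cast_mul, ← mul_assoc, ← mul_assoc, inv_mul_cancel₀ hH0, one_mul]
    rfl
  rw [← e1]
  simp only [osum]
  rw [Finset.mul_sum]
  refine Finset.sum_le_sum fun a ha => ?_
  refine (norm_ind_sq_le h hσ.le φ (h.s a)).trans ?_
  rw [π_s]
  gcongr
  exact hF a (mem_ofOrder.1 ha)

end Ind

end CentralExt
end ImprimitiveCovers

namespace ImprimitiveCovers

open Finset Equiv

/-! ### Conjugacy and orders in small alternating groups -/

abbrev Alt (n : ℕ) := alternatingGroup (Fin n)

/-- The multiset on the right contains each part with the largest multiplicity that a sum of at most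
7 allows. Cycle types then lie in a finite set on which statements can be decided. -/
theorem multiset_le_of_sum_le {s : Multiset ℕ} (h2 : ∀ x ∈ s, 2 ≤ x) (hs : s.sum ≤ 7) :
    s ≤ {2, 2, 2, 3, 3, 4, 5, 6, 7} := by
  rw [Multiset.le_iff_count]
  intro x
  have hx : s.count x * x ≤ 7 := by
    have h1 : Multiset.replicate (s.count x) x ≤ s := Multiset.le_count_iff_replicate_le.1 le_rfl
    obtain ⟨u, hu⟩ := Multiset.le_iff_exists_add.1 h1
    have h3 := congrArg Multiset.sum hu
    rw [Multiset.sum_add, Multiset.sum_replicate, smul_eq_mul] at h3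
    omega
  by_cases hmem : x ∈ s
  · have hx2 := h2 x hmem
    have hpos : 0 < s.count x := Multiset.count_pos.2 hmem
    have hx7 : x ≤ 7 := by nlinarith
    interval_cases x
    · have : s.count 2 ≤ 3 := by omega
      exact this.trans (by decide)
    · have : s.count 3 ≤ 2 := by omega
      exact this.trans (by decide)
    · have : s.count 4 ≤ 1 := by omega
      exact this.trans (by decide)
    · have : s.count 5 ≤ 1 := by omega
      exact this.trans (by decide)
    · have : s.count 6 ≤ 1 := by omega
      exact this.trans (by decide)
    · have : s.count 7 ≤ 1 := by omega
      exact this.trans (by decide)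
  · rw [Multiset.count_eq_zero_of_notMem hmem]; exact Nat.zero_le _

theorem cycleType_mem {n : ℕ} (hn : n ≤ 7) (σ : Perm (Fin n)) :
    σ.cycleType ∈ Multiset.powerset {2, 2, 2, 3, 3, 4, 5, 6, 7} ∧ σ.cycleType.sum ≤ n := by
  have hs : σ.cycleType.sum ≤ n := by
    rw [Perm.sum_cycleType]
    exact (Finset.card_le_univ _).trans (by simp)
  exact ⟨Multiset.mem_powerset.2
    (multiset_le_of_sum_le (fun x hx => Perm.two_le_of_mem_cycleType hx) (hs.trans hn)), hs⟩

theorem even_cycleType {n : ℕ} (σ : Alt n) :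
    Even ((σ : Perm (Fin n)).cycleType.sum + Multiset.card (σ : Perm (Fin n)).cycleType) := by
  have h := Perm.mem_alternatingGroup.1 σ.2
  rw [Perm.sign_of_cycleType] at h
  by_contra hc
  rw [Nat.not_even_iff_odd] at hc
  rw [hc.neg_one_pow] at h
  exact absurd h (by decide)

theorem lcm_cycleType {n : ℕ} (σ : Alt n) :
    (σ : Perm (Fin n)).cycleType.lcm = orderOf σ := by
  rw [Perm.lcm_cycleType, Subgroup.orderOf_coe]

/-- Order three is absent from the list of determined types because {3} and {3, 3} both occur; the
characters considered vanish above such elements, so their classes are never needed. -/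
theorem cycleType_table : ∀ s ∈ Multiset.powerset ({2, 2, 2, 3, 3, 4, 5, 6, 7} : Multiset ℕ),
    Even (s.sum + Multiset.card s) → s.sum ≤ 7 →
      (s.lcm ∈ ({1, 2, 3, 4, 5, 6, 7} : Finset ℕ)) ∧ (s.sum ≤ 6 → s.lcm ≤ 5) ∧
      (s.sum ≤ 5 → s.lcm ≠ 4) ∧
      (s.lcm = 2 → s = {2, 2}) ∧ (s.lcm = 4 → s = {2, 4}) ∧ (s.lcm = 5 → s = {5}) ∧
      (s.lcm = 6 → s = {2, 2, 3}) ∧ (s.lcm = 7 → s = {7}) := by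
  decide +kernel

theorem alt_cycleType {n : ℕ} (hn : n ≤ 7) (σ : Alt n) :
    (orderOf σ ∈ ({1, 2, 3, 4, 5, 6, 7} : Finset ℕ)) ∧ (n ≤ 6 → orderOf σ ≤ 5) ∧
      (n ≤ 5 → orderOf σ ≠ 4) ∧
      (orderOf σ = 2 → (σ : Perm (Fin n)).cycleType = {2, 2}) ∧
      (orderOf σ = 4 → (σ : Perm (Fin n)).cycleType = {2, 4}) ∧
      (orderOf σ = 5 → (σ : Perm (Fin n)).cycleType = {5}) ∧
      (orderOf σ = 6 → (σ : Perm (Fin n)).cycleType = {2, 2, 3}) ∧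
      (orderOf σ = 7 → (σ : Perm (Fin n)).cycleType = {7}) := by
  obtain ⟨h1, h2⟩ := cycleType_mem hn (σ : Perm (Fin n))
  have := cycleType_table _ h1 (even_cycleType σ) (h2.trans hn)
  rw [lcm_cycleType] at this
  exact ⟨this.1, fun h => this.2.1 (h2.trans h), fun h => this.2.2.1 (h2.trans h), this.2.2.2⟩

theorem orderOf_alt_five (a : Alt 5) : orderOf a ∈ ({1, 2, 3, 5} : Finset ℕ) := by
  have h := alt_cycleType (by norm_num) a
  have h1 := h.1
  have h2 := h.2.1 (by norm_num)
  have h3 := h.2.2.1 le_rfl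
  simp only [Finset.mem_insert, Finset.mem_singleton] at h1 ⊢
  omega

theorem orderOf_alt_six (a : Alt 6) : orderOf a ∈ ({1, 2, 3, 4, 5} : Finset ℕ) := by
  have h := alt_cycleType (by norm_num) a
  have h1 := h.1
  have h2 := h.2.1 (by norm_num)
  simp only [Finset.mem_insert, Finset.mem_singleton] at h1 ⊢
  omega

theorem orderOf_alt_seven (a : Alt 7) : orderOf a ∈ ({1, 2, 3, 4, 5, 6, 7} : Finset ℕ) :=
  (alt_cycleType le_rfl a).1

theorem card_ofOrder_alt {n r : ℕ} (m : Multiset ℕ) (hm : m.lcm = r)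
    (h : ∀ σ : Alt n, orderOf σ = r → (σ : Perm (Fin n)).cycleType = m) :
    (ofOrder (Alt n) r).card =
      if (m.sum ≤ n ∧ ∀ a ∈ m, 2 ≤ a) ∧ Even (m.sum + Multiset.card m) then
        n.factorial / ((n - m.sum).factorial *
          (m.prod * (∏ i ∈ m.toFinset, (m.count i).factorial))) else 0 := by
  have := AlternatingGroup.card_of_cycleType (Fin n) m
  rw [Fintype.card_fin] at this
  rw [← this]
  congr 1
  ext σ
  simp only [mem_ofOrder, mem_filter, mem_univ, true_and]
  exact ⟨h σ, fun hs => by rw [← lcm_cycleType, hs, hm]⟩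

theorem card_two_alt_five : (ofOrder (Alt 5) 2).card = 15 := by
  rw [card_ofOrder_alt {2, 2} (by decide) fun σ => (alt_cycleType (by norm_num) σ).2.2.2.1]; decide
theorem card_five_alt_five : (ofOrder (Alt 5) 5).card = 24 := by
  rw [card_ofOrder_alt {5} (by decide) fun σ => (alt_cycleType (by norm_num) σ).2.2.2.2.2.1]; decide
theorem card_two_alt_six : (ofOrder (Alt 6) 2).card = 45 := by
  rw [card_ofOrder_alt {2, 2} (by decide) fun σ => (alt_cycleType (by norm_num) σ).2.2.2.1]; decide
theorem card_four_alt_six : (ofOrder (Alt 6) 4).card = 90 := by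
  rw [card_ofOrder_alt {2, 4} (by decide) fun σ => (alt_cycleType (by norm_num) σ).2.2.2.2.1]; decide
theorem card_five_alt_six : (ofOrder (Alt 6) 5).card = 144 := by
  rw [card_ofOrder_alt {5} (by decide) fun σ => (alt_cycleType (by norm_num) σ).2.2.2.2.2.1]; decide
theorem card_two_alt_seven : (ofOrder (Alt 7) 2).card = 105 := by
  rw [card_ofOrder_alt {2, 2} (by decide) fun σ => (alt_cycleType le_rfl σ).2.2.2.1]; decide
theorem card_four_alt_seven : (ofOrder (Alt 7) 4).card = 630 := by
  rw [card_ofOrder_alt {2, 4} (by decide) fun σ => (alt_cycleType le_rfl σ).2.2.2.2.1]; decide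
theorem card_five_alt_seven : (ofOrder (Alt 7) 5).card = 504 := by
  rw [card_ofOrder_alt {5} (by decide) fun σ => (alt_cycleType le_rfl σ).2.2.2.2.2.1]; decide
theorem card_six_alt_seven : (ofOrder (Alt 7) 6).card = 210 := by
  rw [card_ofOrder_alt {2, 2, 3} (by decide) fun σ => (alt_cycleType le_rfl σ).2.2.2.2.2.2.1]
  decide
theorem card_seven_alt_seven : (ofOrder (Alt 7) 7).card = 720 := by
  rw [card_ofOrder_alt {7} (by decide) fun σ => (alt_cycleType le_rfl σ).2.2.2.2.2.2.2]; decide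

theorem natCard_alt (n : ℕ) (hn : 2 ≤ n) : Nat.card (Alt n) = n.factorial / 2 := by
  have : Nontrivial (Fin n) := Fin.nontrivial_iff_two_le.2 hn
  rw [nat_card_alternatingGroup]; simp

theorem natCard_alt_five : Nat.card (Alt 5) = 60 := by rw [natCard_alt 5 (by norm_num)]; decide
theorem natCard_alt_six : Nat.card (Alt 6) = 360 := by rw [natCard_alt 6 (by norm_num)]; decide
theorem natCard_alt_seven : Nat.card (Alt 7) = 2520 := by rw [natCard_alt 7 (by norm_num)]; decide

section Conj

variable {n : ℕ} {c κ : Perm (Fin n)} {j : ℕ}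

theorem exists_conj_of_cycleType {a : Perm (Fin n)} (ha : a.cycleType = c.cycleType) :
    ∃ θ : Perm (Fin n), a = θ * c * θ⁻¹ := by
  obtain ⟨θ, hθ⟩ := isConj_iff.1 (Perm.isConj_iff_cycleType_eq.2 ha.symm)
  exact ⟨θ, hθ.symm⟩

/-- Elements of the same cycle type are conjugate in the alternating group up to a power `j`, if
an odd permutation conjugates a representative to its `j`-th power. -/
theorem isConj_or_isConj_pow (hκ : Perm.sign κ = -1) (hc : κ * c * κ⁻¹ = c ^ j) (a b : Alt n)
    (ha : (a : Perm (Fin n)).cycleType = c.cycleType)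
    (hb : (b : Perm (Fin n)).cycleType = c.cycleType) : IsConj a b ∨ IsConj (a ^ j) b := by
  obtain ⟨θ, hθ⟩ := exists_conj_of_cycleType ha
  obtain ⟨θ', hθ'⟩ := exists_conj_of_cycleType hb
  rcases Int.units_eq_one_or (Perm.sign (θ' * θ⁻¹)) with hs | hs
  · left
    refine isConj_iff.2 ⟨⟨θ' * θ⁻¹, Perm.mem_alternatingGroup.2 hs⟩, Subtype.ext ?_⟩
    simp only [Subgroup.coe_mul, Subgroup.coe_inv, hθ, hθ']
    group
  · right
    refine isConj_iff.2 ⟨⟨θ' * κ⁻¹ * θ⁻¹, Perm.mem_alternatingGroup.2 ?_⟩, Subtype.ext ?_⟩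
    · rw [Perm.sign_mul, Perm.sign_mul, Perm.sign_inv, mul_right_comm, ← Perm.sign_mul, hs, hκ]
      decide
    · simp only [Subgroup.coe_mul, Subgroup.coe_inv, Subgroup.coe_pow, hθ, hθ', conj_pow, ← hc]
      group

theorem isConj_pow (hκ : Perm.sign κ = 1) (hc : κ * c * κ⁻¹ = c ^ j) (a : Alt n)
    (ha : (a : Perm (Fin n)).cycleType = c.cycleType) : IsConj a (a ^ j) := by
  obtain ⟨θ, hθ⟩ := exists_conj_of_cycleType ha
  refine isConj_iff.2 ⟨⟨θ * κ * θ⁻¹, Perm.mem_alternatingGroup.2 ?_⟩, Subtype.ext ?_⟩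
  · rw [Perm.sign_mul, Perm.sign_mul, Perm.sign_inv, mul_right_comm, Int.units_mul_self, hκ,
      one_mul]
  · simp only [Subgroup.coe_mul, Subgroup.coe_inv, Subgroup.coe_pow, hθ, conj_pow, ← hc]
    group

theorem ratConj_of (hκ : Perm.sign κ = -1) (hc : κ * c * κ⁻¹ = c ^ j) {r : ℕ} (hr : r.Coprime j)
    (h : ∀ a : Alt n, orderOf a = r → (a : Perm (Fin n)).cycleType = c.cycleType) :
    RatConj (Alt n) r := fun a b ha hb =>
  (isConj_or_isConj_pow hκ hc a b (h a ha) (h b hb)).elim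
    (fun hc => ⟨1, Nat.coprime_one_right r, by rwa [pow_one]⟩) fun hc => ⟨j, hr, hc⟩

theorem isConj_of_orderOf (hκ : Perm.sign κ = -1) (hc : κ * c * κ⁻¹ = c ^ 1) {r : ℕ}
    (h : ∀ a : Alt n, orderOf a = r → (a : Perm (Fin n)).cycleType = c.cycleType)
    {a b : Alt n} (ha : orderOf a = r) (hb : orderOf b = r) : IsConj a b :=
  (isConj_or_isConj_pow hκ hc a b (h a ha) (h b hb)).elim id fun hc => by rwa [pow_one] at hc

end Conj

theorem isConj_two_alt_six {a b : Alt 6} (ha : orderOf a = 2) (hb : orderOf b = 2) : IsConj a b :=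
  isConj_of_orderOf (c := c[0, 1] * c[2, 3]) (κ := c[0, 1]) (by decide) (by decide)
    (fun σ h => by rw [(alt_cycleType (by norm_num) σ).2.2.2.1 h]; decide) ha hb

theorem isConj_four_alt_six {a b : Alt 6} (ha : orderOf a = 4) (hb : orderOf b = 4) : IsConj a b :=
  isConj_of_orderOf (c := c[0, 1, 2, 3] * c[4, 5]) (κ := c[4, 5]) (by decide) (by decide)
    (fun σ h => by rw [(alt_cycleType (by norm_num) σ).2.2.2.2.1 h]; decide) ha hb

/-- The 4-cycle is multiplication by 2 on the residues modulo 5, an odd permutation which squares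
the 5-cycle. Below, (1 4)(2 3) is multiplication by −1, which is even. -/
theorem ratConj_five_alt_six : RatConj (Alt 6) 5 :=
  ratConj_of (c := c[0, 1, 2, 3, 4]) (κ := c[1, 2, 4, 3]) (j := 2) (by decide) (by decide)
    (by decide) fun σ h => by rw [(alt_cycleType (by norm_num) σ).2.2.2.2.2.1 h]; decide

theorem isConj_or_five_alt_six {a b : Alt 6} (ha : orderOf a = 5) (hb : orderOf b = 5) :
    IsConj a b ∨ IsConj (a ^ 2) b := by
  have h : ∀ σ : Alt 6, orderOf σ = 5 →
      (σ : Perm (Fin 6)).cycleType = (c[0, 1, 2, 3, 4] : Perm (Fin 6)).cycleType := fun σ h => by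
    rw [(alt_cycleType (by norm_num) σ).2.2.2.2.2.1 h]; decide
  exact isConj_or_isConj_pow (c := c[0, 1, 2, 3, 4]) (κ := c[1, 2, 4, 3]) (by decide) (by decide)
    a b (h a ha) (h b hb)

theorem isConj_inv_five_alt_six {a : Alt 6} (ha : orderOf a = 5) : IsConj a (a ^ 4) :=
  isConj_pow (c := c[0, 1, 2, 3, 4]) (κ := c[1, 4] * c[2, 3]) (by decide) (by decide) a
    (by rw [(alt_cycleType (by norm_num) a).2.2.2.2.2.1 ha]; decide)

theorem isConj_or_five_alt_five {a b : Alt 5} (ha : orderOf a = 5) (hb : orderOf b = 5) :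
    IsConj a b ∨ IsConj (a ^ 2) b := by
  have h : ∀ σ : Alt 5, orderOf σ = 5 →
      (σ : Perm (Fin 5)).cycleType = (c[0, 1, 2, 3, 4] : Perm (Fin 5)).cycleType := fun σ h => by
    rw [(alt_cycleType (by norm_num) σ).2.2.2.2.2.1 h]; decide
  exact isConj_or_isConj_pow (c := c[0, 1, 2, 3, 4]) (κ := c[1, 2, 4, 3]) (by decide) (by decide)
    a b (h a ha) (h b hb)

theorem isConj_inv_five_alt_five {a : Alt 5} (ha : orderOf a = 5) : IsConj a (a ^ 4) :=
  isConj_pow (c := c[0, 1, 2, 3, 4]) (κ := c[1, 4] * c[2, 3]) (by decide) (by decide) a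
    (by rw [(alt_cycleType (by norm_num) a).2.2.2.2.2.1 ha]; decide)

theorem isConj_two_alt_seven {a b : Alt 7} (ha : orderOf a = 2) (hb : orderOf b = 2) :
    IsConj a b :=
  isConj_of_orderOf (c := c[0, 1] * c[2, 3]) (κ := c[0, 1]) (by decide) (by decide)
    (fun σ h => by rw [(alt_cycleType le_rfl σ).2.2.2.1 h]; decide) ha hb

theorem isConj_four_alt_seven {a b : Alt 7} (ha : orderOf a = 4) (hb : orderOf b = 4) :
    IsConj a b :=
  isConj_of_orderOf (c := c[0, 1, 2, 3] * c[4, 5]) (κ := c[4, 5]) (by decide) (by decide)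
    (fun σ h => by rw [(alt_cycleType le_rfl σ).2.2.2.2.1 h]; decide) ha hb

theorem isConj_five_alt_seven {a b : Alt 7} (ha : orderOf a = 5) (hb : orderOf b = 5) :
    IsConj a b :=
  isConj_of_orderOf (c := c[0, 1, 2, 3, 4]) (κ := c[5, 6]) (by decide) (by decide)
    (fun σ h => by rw [(alt_cycleType le_rfl σ).2.2.2.2.2.1 h]; decide) ha hb

theorem isConj_six_alt_seven {a b : Alt 7} (ha : orderOf a = 6) (hb : orderOf b = 6) :
    IsConj a b :=
  isConj_of_orderOf (c := c[0, 1, 2] * c[3, 4] * c[5, 6]) (κ := c[3, 4]) (by decide) (by decide)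
    (fun σ h => by rw [(alt_cycleType le_rfl σ).2.2.2.2.2.2.1 h]; decide) ha hb

/-- Negation modulo 7 is odd and inverts the 7-cycle, while multiplication by 2 is even. So a
7-element is conjugate to its square in `A₇`, and the two classes are exchanged by inversion. -/
theorem ratConj_seven_alt_seven : RatConj (Alt 7) 7 :=
  ratConj_of (c := c[0, 1, 2, 3, 4, 5, 6]) (κ := c[1, 6] * c[2, 5] * c[3, 4]) (j := 6) (by decide)
    (by decide +kernel) (by decide) fun σ h => by
      rw [(alt_cycleType le_rfl σ).2.2.2.2.2.2.2 h]; decide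

theorem isConj_sq_seven_alt_seven {a : Alt 7} (ha : orderOf a = 7) : IsConj a (a ^ 2) :=
  isConj_pow (c := c[0, 1, 2, 3, 4, 5, 6]) (κ := c[1, 2, 4] * c[3, 6, 5]) (by decide)
    (by decide +kernel) a
    (by rw [(alt_cycleType le_rfl a).2.2.2.2.2.2.2 ha]; decide)

theorem ratConj_of_isConj {A : Type*} [Group A] {r : ℕ}
    (h : ∀ {a b : A}, orderOf a = r → orderOf b = r → IsConj a b) : RatConj A r :=
  fun _ _ ha hb => ⟨1, Nat.coprime_one_right r, by rw [pow_one]; exact h ha hb⟩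

end ImprimitiveCovers

namespace ImprimitiveCovers

open Equiv

/-! ### Subgroups of small index in alternating groups -/

theorem isSimpleGroup_alt {n : ℕ} (hn : 5 ≤ n) : IsSimpleGroup (Alt n) :=
  alternatingGroup.isSimpleGroup (by simpa using hn)

theorem center_alt {n : ℕ} (hn : 5 ≤ n) : Subgroup.center (Alt n) = ⊥ :=
  alternatingGroup.center_eq_bot (by rw [Nat.card_fin]; omega)

theorem isPerfect_alt {n : ℕ} (hn : 5 ≤ n) : Group.IsPerfect (Alt n) := by
  have := isSimpleGroup_alt hn
  refine ⟨(Subgroup.Normal.eq_bot_or_eq_top (H := commutator (Alt n)) inferInstance).resolve_left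
    fun h => ?_⟩
  rw [commutator_eq_bot_iff_center_eq_top, center_alt hn] at h
  exact bot_ne_top h

/-- A nontrivial action of a simple group is faithful. -/
theorem normalCore_eq_bot {A : Type*} [Group A] [IsSimpleGroup A] {H : Subgroup A} (hH : H ≠ ⊤) :
    H.normalCore = ⊥ := by
  refine (Subgroup.Normal.eq_bot_or_eq_top (H := H.normalCore) inferInstance).resolve_right
    fun h => hH ?_
  have := H.normalCore_le
  rw [h] at this
  exact top_le_iff.1 this

/-- A proper subgroup has trivial core, so the action on its cosets embeds `A` in a symmetric group.
-/
theorem card_le_factorial_index {A : Type*} [Group A] [Finite A] [IsSimpleGroup A]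
    {H : Subgroup A} (hH : H ≠ ⊤) : Nat.card A ∣ H.index.factorial := by
  have hinj : Function.Injective (MulAction.toPermHom A (A ⧸ H)) := by
    rw [← MonoidHom.ker_eq_bot_iff, ← Subgroup.normalCore_eq_ker, normalCore_eq_bot hH]
  have := Subgroup.card_subgroup_dvd_card (MulAction.toPermHom A (A ⧸ H)).range
  rw [Nat.card_perm, ← Nat.card_congr (MonoidHom.ofInjective hinj).toEquiv] at this
  exact this

/-- A smaller index would embed a group of order n!/2 in a symmetric group of order at most (n −
1)!, which is less than n!/2. -/
theorem le_index_alt {n : ℕ} (hn : 5 ≤ n) {H : Subgroup (Alt n)} (hH : H ≠ ⊤) : n ≤ H.index := by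
  by_contra! hlt
  have := isSimpleGroup_alt hn
  have h1 := Nat.le_of_dvd (Nat.factorial_pos _) (card_le_factorial_index hH)
  rw [natCard_alt n (by omega)] at h1
  have h2 : H.index.factorial ≤ (n - 1).factorial := Nat.factorial_le (by omega)
  have h3 : n.factorial = n * (n - 1).factorial := (Nat.mul_factorial_pred (by omega)).symm
  have h4 := Nat.factorial_pos (n - 1)
  have h5 : 5 * (n - 1).factorial ≤ n * (n - 1).factorial := Nat.mul_le_mul_right _ hn
  omega

/-- `H` acts faithfully on the n − 1 cosets other than its own. Its image has index two in the
symmetric group, hence is the alternating group. Subgroups outside the class of point stabilizers,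
such as the second class of A₅ in A₆, are covered as well. -/
theorem equiv_alt_of_index {n : ℕ} (hn : 5 ≤ n) {H : Subgroup (Alt n)} (hH : H.index = n) :
    Nonempty (H ≃* Alt (n - 1)) := by
  classical
  have := isSimpleGroup_alt hn
  have hne : H ≠ ⊤ := by rintro rfl; rw [Subgroup.index_top] at hH; omega
  let X := {q : Alt n ⧸ H // q ≠ ((1 : Alt n) : Alt n ⧸ H)}
  have hfix : ∀ h ∈ H, h • ((1 : Alt n) : Alt n ⧸ H) = ((1 : Alt n) : Alt n ⧸ H) := by
    intro h hh
    rw [MulAction.Quotient.smul_coe, QuotientGroup.eq]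
    simpa using hh
  let act : MulAction H X :=
    { smul := fun h q => ⟨(h : Alt n) • q.1, fun hc => q.2 (by
        have := congrArg ((h : Alt n)⁻¹ • ·) hc
        simp only [inv_smul_smul] at this
        rw [this, hfix _ (H.inv_mem h.2)])⟩
      one_smul := fun q => Subtype.ext (one_smul _ _)
      mul_smul := fun a b q => Subtype.ext (mul_smul _ _ _) }
  have hX : Nat.card X = n - 1 := by
    have h1 := Set.ncard_compl ({((1 : Alt n) : Alt n ⧸ H)} : Set (Alt n ⧸ H))
    rw [Set.ncard_singleton] at h1
    rw [← hH, Subgroup.index, ← h1]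
    rfl
  have hfin : Finite (Alt n ⧸ H) := inferInstance
  have hXf : Finite X := Subtype.finite
  have e : X ≃ Fin (n - 1) := Finite.equivFinOfCardEq hX
  let f : H →* Perm (Fin (n - 1)) := (e.permCongrHom : Perm X ≃* Perm (Fin (n - 1))).toMonoidHom.comp
    (MulAction.toPermHom H X)
  have hinj : Function.Injective f := by
    refine (MulEquiv.injective (e.permCongrHom : Perm X ≃* Perm (Fin (n - 1)))).comp ?_
    rw [← MonoidHom.ker_eq_bot_iff, eq_bot_iff]
    intro h hh
    rw [MonoidHom.mem_ker] at hh
    have hk : (h : Alt n) ∈ H.normalCore := by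
      rw [Subgroup.normalCore_eq_ker, MonoidHom.mem_ker]
      ext q
      by_cases hq : q = ((1 : Alt n) : Alt n ⧸ H)
      · rw [hq]; exact hfix _ h.2
      · exact congrArg Subtype.val (DFunLike.congr_fun hh ⟨q, hq⟩)
    rw [normalCore_eq_bot hne] at hk
    exact Subtype.ext hk
  have hcard : Nat.card f.range = Nat.card H :=
    (Nat.card_congr (MonoidHom.ofInjective hinj).toEquiv).symm
  have hidx : f.range.index = 2 := by
    have h1 := f.range.card_mul_index
    have h2 := H.card_mul_index
    have h3 : n.factorial = n * (n - 1).factorial := (Nat.mul_factorial_pred (by omega)).symm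
    have h5 : 2 ∣ (n - 1).factorial := Nat.dvd_factorial (by norm_num) (by omega)
    obtain ⟨c, hc⟩ := h5
    rw [hH, natCard_alt n (by omega), h3, hc, show n * (2 * c) = 2 * (c * n) by ring,
      Nat.mul_div_cancel_left _ two_pos] at h2
    have h6 : Nat.card H = c := Nat.eq_of_mul_eq_mul_right (by omega) h2
    rw [hcard, h6, Nat.card_perm, Nat.card_fin, hc, mul_comm 2] at h1
    have hc0 : 0 < c := by
      rw [← h6]; exact Nat.card_pos
    exact Nat.eq_of_mul_eq_mul_left hc0 h1
  exact ⟨(MonoidHom.ofInjective hinj).trans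
    (MulEquiv.subgroupCongr (Equiv.Perm.eq_alternatingGroup_of_index_eq_two hidx))⟩

/-! ### Counting elements of subgroups -/

theorem sum_card_ofOrder_le {B : Type*} [Group B] [Finite B] (R : Finset ℕ) :
    ∑ r ∈ R, (ofOrder B r).card ≤ Nat.card B := by
  classical
  have : Fintype B := Fintype.ofFinite B
  rw [← Finset.card_biUnion, Nat.card_eq_fintype_card]
  · exact Finset.card_le_univ _
  · intro r _ s _ hrs
    rw [Function.onFun, Finset.disjoint_left]
    intro a ha hb
    rw [mem_ofOrder] at ha hb
    exact hrs (ha.symm.trans hb)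

theorem ofOrder_pos {B : Type*} [Group B] [Finite B] {p : ℕ} [Fact p.Prime] (h : p ∣ Nat.card B) :
    0 < (ofOrder B p).card := by
  obtain ⟨x, hx⟩ := exists_prime_orderOf_dvd_card' p h
  exact Finset.card_pos.2 ⟨x, mem_ofOrder.2 hx⟩

theorem ofOrder_eq_zero {B : Type*} [Group B] [Finite B] {r : ℕ} (h : ¬ r ∣ Nat.card B) :
    (ofOrder B r).card = 0 := by
  rw [Finset.card_eq_zero, Finset.eq_empty_iff_forall_notMem]
  intro x hx
  rw [mem_ofOrder] at hx
  exact h (hx ▸ orderOf_dvd_natCard x)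

/-- Elements of order `n` come in batches of generators of cyclic subgroups. -/
theorem totient_dvd_card_ofOrder {B : Type*} [Group B] [Finite B] {n : ℕ} :
    n.totient ∣ (ofOrder B n).card := by
  classical
  have : Fintype B := Fintype.ofFinite B
  rw [Finset.card_eq_sum_card_image (fun a : B => Subgroup.zpowers a)]
  refine Finset.dvd_sum fun K hK => ?_
  obtain ⟨a, ha, rfl⟩ := Finset.mem_image.1 hK
  rw [mem_ofOrder] at ha
  refine dvd_of_eq ?_
  have hcyc : IsCyclic (Subgroup.zpowers a) := inferInstance
  have : Fintype (Subgroup.zpowers a) := Fintype.ofFinite _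
  have h1 := IsCyclic.card_orderOf_eq_totient (α := Subgroup.zpowers a) (d := n)
    (by rw [← Nat.card_eq_fintype_card, Nat.card_zpowers, ha])
  rw [← h1]
  refine Finset.card_bij (fun x _ => (x : B)) ?_ ?_ ?_
  · intro x hx
    simp only [Finset.mem_filter, Finset.mem_univ, true_and] at hx
    rw [Finset.mem_filter, mem_ofOrder, Subgroup.orderOf_coe]
    refine ⟨hx, Subgroup.eq_of_le_of_card_ge ?_ ?_⟩
    · rw [Subgroup.zpowers_le]; exact x.2
    · rw [Nat.card_zpowers, Nat.card_zpowers, ha, Subgroup.orderOf_coe, hx]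
  · intro x _ y _ h; exact Subtype.ext h
  · intro b hb
    rw [Finset.mem_filter, mem_ofOrder] at hb
    refine ⟨⟨b, hb.2 ▸ Subgroup.mem_zpowers b⟩, ?_, rfl⟩
    simp only [Finset.mem_filter, Finset.mem_univ, true_and]
    exact (Subgroup.orderOf_coe _).symm.trans hb.1

/-- The number of fixed cosets of an element of prime order `p`, and how it determines the number
of elements of order `p` in the subgroup. -/
theorem exists_fixc {A : Type*} [Group A] [Fintype A] (H : Subgroup A) {p N : ℕ} [Fact p.Prime]
    (hr : RatConj A p) (hN : (ofOrder A p).card = N) (hN0 : 0 < N) :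
    ∃ f, f ≡ H.index [MOD p] ∧ N * f = H.index * (ofOrder H p).card := by
  subst hN
  obtain ⟨a, ha⟩ := Finset.card_pos.1 hN0
  rw [mem_ofOrder] at ha
  exact ⟨fixc H a, fixc_modEq H ha, card_mul_fixc H hr ha⟩

instance fact_prime_five : Fact (Nat.Prime 5) := ⟨by norm_num⟩
instance fact_prime_seven : Fact (Nat.Prime 7) := ⟨by norm_num⟩

/-- For each index k the numbers of fixed cosets of elements of order 5 and 7 are known modulo 5 and
7, and determine the numbers of such elements in `H`. These must be multiples of 4 and of 6 with sum
at most |H|; no choice satisfies everything. -/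
theorem index_ne_alt_seven (H : Subgroup (Alt 7)) :
    H.index ≠ 8 ∧ H.index ≠ 9 ∧ H.index ≠ 12 ∧ H.index ≠ 18 ∧ H.index ≠ 24 ∧ H.index ≠ 36 := by
  obtain ⟨f5, h5, e5⟩ := exists_fixc H (ratConj_of_isConj isConj_five_alt_seven)
    card_five_alt_seven (by norm_num)
  obtain ⟨f7, h7, e7⟩ := exists_fixc H ratConj_seven_alt_seven card_seven_alt_seven (by norm_num)
  have hc := H.card_mul_index
  rw [natCard_alt_seven] at hc
  have hs := sum_card_ofOrder_le (B := H) {5, 7}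
  rw [Finset.sum_pair (by norm_num)] at hs
  have t5 := totient_dvd_card_ofOrder (B := H) (n := 5)
  have t7 := totient_dvd_card_ofOrder (B := H) (n := 7)
  rw [show Nat.totient 5 = 4 by decide] at t5
  rw [show Nat.totient 7 = 6 by decide] at t7
  rw [Nat.ModEq] at h5 h7
  refine ⟨?_, ?_, ?_, ?_, ?_, ?_⟩ <;> intro hk <;> rw [hk] at h5 e5 h7 e7 hc <;> omega

/-- For index 9 there would be at least 64 elements of order five in a group of order 40. For index
12 there would be 24 of them and at least 15 involutions in a group of order 30. -/
theorem index_ne_alt_six (H : Subgroup (Alt 6)) : H.index ≠ 9 ∧ H.index ≠ 12 := by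
  obtain ⟨f5, h5, e5⟩ := exists_fixc H ratConj_five_alt_six card_five_alt_six (by norm_num)
  obtain ⟨f2, h2, e2⟩ := exists_fixc H (ratConj_of_isConj isConj_two_alt_six)
    card_two_alt_six (by norm_num)
  have hc := H.card_mul_index
  rw [natCard_alt_six] at hc
  have hs := sum_card_ofOrder_le (B := H) {2, 5}
  rw [Finset.sum_pair (by norm_num)] at hs
  rw [Nat.ModEq] at h5 h2
  have hp : 2 ∣ Nat.card H → 0 < (ofOrder H 2).card := fun h => ofOrder_pos h
  refine ⟨?_, ?_⟩ <;> intro hk <;> rw [hk] at h5 e5 h2 e2 hc <;> omega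

end ImprimitiveCovers

namespace ImprimitiveCovers

open Equiv

instance fact_prime_three : Fact (Nat.Prime 3) := ⟨by norm_num⟩

theorem orderOf_mul_eq_six {B : Type*} [Group B] {t x : B} (h : Commute t x) (ht : orderOf t = 2)
    (hx : orderOf x = 3) : orderOf (t * x) = 6 := by
  rw [h.orderOf_mul_eq_mul_orderOf_of_coprime (by rw [ht, hx]; norm_num), ht, hx]

/-- A generator of the normal subgroup of order three has at most two conjugates, so its centralizer
has even order; multiply by a commuting involution. -/
theorem exists_order_six_of_normal {B : Type*} [Group B] [Finite B] (hB : Nat.card B = 24)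
    {P : Subgroup B} [P.Normal] (hP : Nat.card P = 3) : ∃ b : B, orderOf b = 6 := by
  classical
  obtain ⟨x, hx⟩ := exists_prime_orderOf_dvd_card' (G := P) 3 (by rw [hP])
  have hx' : orderOf (x : B) = 3 := by rwa [Subgroup.orderOf_coe]
  have hsub : MulAction.orbit (ConjAct B) (x : B) ⊆ (P : Set B) \ {1} := by
    rintro _ ⟨g, rfl⟩
    refine ⟨?_, ?_⟩
    · simp only [ConjAct.smul_def]
      exact Subgroup.Normal.conj_mem inferInstance _ x.2 _
    · intro h
      rw [Set.mem_singleton_iff] at h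
      have : (x : B) = 1 := by simpa [ConjAct.smul_def] using h
      rw [this, orderOf_one] at hx'
      omega
  have h2 : (MulAction.orbit (ConjAct B) (x : B)).ncard ≤ 2 := by
    refine (Set.ncard_le_ncard hsub).trans ?_
    rw [Set.ncard_sdiff_singleton_of_mem P.one_mem]
    have : (P : Set B).ncard = 3 := hP
    omega
  have h3 := (MulAction.stabilizer (ConjAct B) (x : B)).card_mul_index
  rw [MulAction.index_stabilizer] at h3
  have h4 : Nat.card (ConjAct B) = 24 := hB
  rw [h4] at h3
  have h5 : 2 ∣ Nat.card (MulAction.stabilizer (ConjAct B) (x : B)) := by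
    generalize (MulAction.orbit (ConjAct B) (x : B)).ncard = k at *
    interval_cases k <;> omega
  have : Finite (ConjAct B) := ‹Finite B›
  obtain ⟨t, ht⟩ := exists_prime_orderOf_dvd_card' 2 h5
  refine ⟨ConjAct.ofConjAct (t : ConjAct B) * x, orderOf_mul_eq_six ?_ ?_ hx'⟩
  · have := t.2
    rw [MulAction.mem_stabilizer_iff, ConjAct.smul_def] at this
    exact mul_inv_eq_iff_eq_mul.1 this
  · rw [← Subgroup.orderOf_coe] at ht
    exact ht

/-- A group of order 24 without elements of order six is the symmetric group of degree four. -/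
theorem equiv_perm_four {B : Type*} [Group B] [Finite B] (hB : Nat.card B = 24)
    (h6 : ∀ b : B, orderOf b ≠ 6) : Nonempty (B ≃* Perm (Fin 4)) := by
  classical
  have hP : ∀ P : Sylow 3 B, Nat.card P = 3 := fun P => by
    rw [P.card_eq_multiplicity, hB]
    have : (24 : ℕ).factorization 3 = 1 := by
      rw [show 24 = 3 ^ 1 * 8 by norm_num]
      rw [Nat.factorization_mul (by norm_num) (by norm_num)]
      simp [Nat.factorization_eq_zero_of_not_dvd, Nat.Prime.factorization_self Nat.prime_three]
    rw [this, pow_one]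
  obtain ⟨P⟩ := (inferInstance : Nonempty (Sylow 3 B))
  have hidx : (P : Subgroup B).index = 8 := by
    have := (P : Subgroup B).card_mul_index
    rw [hB, hP] at this
    omega
  have h1 := P.card_dvd_index
  rw [hidx] at h1
  have h2 := card_sylow_modEq_one 3 B
  have h3 : Nat.card (Sylow 3 B) = 4 := by
    have hle := Nat.le_of_dvd (by norm_num) h1
    rw [Nat.ModEq] at h2
    have hne : Nat.card (Sylow 3 B) ≠ 1 := by
      intro h
      have : Subsingleton (Sylow 3 B) := (Nat.card_eq_one_iff_unique.1 h).1
      have : (P : Subgroup B).Normal := Sylow.normal_of_subsingleton P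
      obtain ⟨b, hb⟩ := exists_order_six_of_normal hB (hP P)
      exact h6 b hb
    generalize Nat.card (Sylow 3 B) = k at *
    interval_cases k <;> omega
  let f : B →* Perm (Sylow 3 B) := MulAction.toPermHom B (Sylow 3 B)
  have hn : Nat.card (Subgroup.normalizer (P : Set B)) = 6 := by
    have e := (Subgroup.normalizer (P : Set B)).card_mul_index
    have := P.card_eq_index_normalizer
    rw [← this, h3, hB] at e
    omega
  have hker : ∀ x ∈ f.ker, ∀ Q : Sylow 3 B, x ∈ Subgroup.normalizer (Q : Set B) := by
    intro x hx Q
    rw [← Sylow.smul_eq_iff_mem_normalizer]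
    exact DFunLike.congr_fun (MonoidHom.mem_ker.1 hx) Q
  -- An element of order three in the kernel normalizes every Sylow 3-subgroup, hence lies in and
  -- generates each of them, contradicting that there are four.
  have h3K : ¬ 3 ∣ Nat.card f.ker := by
    intro hd
    obtain ⟨x, hx⟩ := exists_prime_orderOf_dvd_card' 3 hd
    have hx' : orderOf (x : B) = 3 := by rwa [Subgroup.orderOf_coe]
    have hz : IsPGroup 3 (Subgroup.zpowers (x : B)) :=
      IsPGroup.of_card (n := 1) (by rw [Nat.card_zpowers, hx', pow_one])
    have hall : ∀ Q : Sylow 3 B, (Q : Subgroup B) = Subgroup.zpowers (x : B) := by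
      intro Q
      have h := hz.inf_normalizer_sylow Q
      have hle : Subgroup.zpowers (x : B) ≤ Subgroup.normalizer (Q : Set B) := by
        rw [Subgroup.zpowers_le]; exact hker x x.2 Q
      rw [inf_eq_left.2 hle] at h
      have hle2 : Subgroup.zpowers (x : B) ≤ Q := inf_eq_left.1 h.symm
      refine (Subgroup.eq_of_le_of_card_ge hle2 ?_).symm
      rw [Nat.card_zpowers, hx']
      exact (hP Q).le
    have : Subsingleton (Sylow 3 B) := ⟨fun Q R => Sylow.ext ((hall Q).trans (hall R).symm)⟩
    have := Nat.card_eq_one_iff_unique.2 ⟨this, inferInstance⟩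
    omega
  have hK6 : Nat.card f.ker ∣ 6 := by
    rw [← hn]
    exact Subgroup.card_dvd_of_le fun x hx => hker x hx P
  have hK : Nat.card f.ker = 1 := by
    have hle := Nat.le_of_dvd (by norm_num) hK6
    -- A normal subgroup of order two is central, and its involution times an element of order three
    -- has order six.
    have h2K : Nat.card f.ker ≠ 2 := by
      intro h2
      obtain ⟨t, ht⟩ := exists_prime_orderOf_dvd_card' (G := f.ker) 2 (by rw [h2])
      obtain ⟨x, hx⟩ := exists_prime_orderOf_dvd_card' (G := B) 3 (by rw [hB]; norm_num)
      have ht' : orderOf (t : B) = 2 := by rwa [Subgroup.orderOf_coe]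
      have hmem : x * t * x⁻¹ ∈ f.ker := Subgroup.Normal.conj_mem inferInstance _ t.2 _
      have htop : (Subgroup.zpowers t) = ⊤ :=
        Subgroup.eq_top_of_card_eq _ (by rw [Nat.card_zpowers, ht, h2])
      have hin : (⟨_, hmem⟩ : f.ker) ∈ Subgroup.zpowers t := htop ▸ Subgroup.mem_top _
      rw [mem_zpowers_iff_mem_range_orderOf, ht] at hin
      have hcases : (⟨_, hmem⟩ : f.ker) = 1 ∨ (⟨_, hmem⟩ : f.ker) = t := by
        simpa [Finset.range_add_one, or_comm, eq_comm] using hin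
      have hcomm : Commute (t : B) x := by
        rcases hcases with h | h
        · have h' : x * t * x⁻¹ = 1 := congrArg Subtype.val h
          have : (t : B) = 1 := by simpa using h'
          rw [this, orderOf_one] at ht'; omega
        · have h' : x * t * x⁻¹ = t := congrArg Subtype.val h
          exact (mul_inv_eq_iff_eq_mul.1 h').symm
      exact h6 _ (orderOf_mul_eq_six hcomm ht' hx)
    have hpos : 0 < Nat.card f.ker := Nat.card_pos
    generalize Nat.card f.ker = k at *
    interval_cases k <;> omega
  have hinj : Function.Injective f := (MonoidHom.ker_eq_bot_iff f).1 (Subgroup.card_eq_one.1 hK)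
  have hbij : Function.Bijective f := by
    rw [Nat.bijective_iff_injective_and_card]
    refine ⟨hinj, ?_⟩
    rw [hB, Nat.card_perm, h3]; rfl
  exact ⟨(MulEquiv.ofBijective f hbij).trans (Finite.equivFinOfCardEq h3).permCongrHom⟩

theorem equiv_perm_four_of_index {B : Subgroup (Alt 6)} (hB : B.index = 15) :
    Nonempty (B ≃* Perm (Fin 4)) := by
  have h := B.card_mul_index
  rw [hB, natCard_alt_six] at h
  refine equiv_perm_four (by omega) fun b hb => ?_
  have := orderOf_alt_six b
  rw [Subgroup.orderOf_coe, hb] at this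
  revert this; decide

/-- `B` has order 120 and contains a 5-cycle, so it has an orbit of length 5, 6 or 7 whose length
divides 120. Length 6 is impossible, and on an orbit of length 5 the action is faithful, hence onto
the symmetric group. -/
theorem equiv_perm_five_of_index {B : Subgroup (Alt 7)} (hB : B.index = 21) :
    Nonempty (B ≃* Perm (Fin 5)) := by
  classical
  have hc := B.card_mul_index
  rw [hB, natCard_alt_seven] at hc
  have hc : Nat.card B = 120 := by omega
  obtain ⟨c, hc5⟩ := exists_prime_orderOf_dvd_card' (G := B) 5 (by rw [hc]; norm_num)
  have hcy : ((c : Alt 7) : Perm (Fin 7)).cycleType = {5} :=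
    (alt_cycleType le_rfl (c : Alt 7)).2.2.2.2.2.1 (by rw [Subgroup.orderOf_coe, hc5])
  have hcyc : ((c : Alt 7) : Perm (Fin 7)).IsCycle := by
    rw [← Perm.card_cycleType_eq_one, hcy]; rfl
  have hsupp : ((c : Alt 7) : Perm (Fin 7)).support.card = 5 := by
    rw [← Perm.sum_cycleType, hcy]; rfl
  obtain ⟨x, hx⟩ := Finset.card_pos.1 (by rw [hsupp]; norm_num :
    0 < ((c : Alt 7) : Perm (Fin 7)).support.card)
  set S := ((c : Alt 7) : Perm (Fin 7)).support with hS
  let O := MulAction.orbit B x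
  have hSO : (S : Set (Fin 7)) ⊆ O := by
    intro y hy
    obtain ⟨i, hi⟩ := hcyc.exists_zpow_eq (Perm.mem_support.1 hx) (Perm.mem_support.1 hy)
    refine ⟨c ^ i, ?_⟩
    rw [← hi]
    simp [Subgroup.smul_def]
  have hOcard : O.ncard ∣ 120 := by
    rw [← hc, ← MulAction.index_stabilizer]
    exact Subgroup.index_dvd_card _
  have hO5 : 5 ≤ O.ncard := by
    rw [← hsupp, ← Set.ncard_coe_finset]
    exact Set.ncard_le_ncard hSO
  have hO7 : O.ncard + Oᶜ.ncard = 7 := by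
    rw [Set.ncard_add_ncard_compl]; simp
  -- Otherwise `B` fixes the remaining point and has index 3 in a point stabilizer, which is
  -- isomorphic to `A₆`.
  have hO6 : O.ncard ≠ 6 := by
    intro h6
    have h1 : Oᶜ.ncard = 1 := by omega
    obtain ⟨p, hp⟩ := Set.ncard_eq_one.1 h1
    have hfix : ∀ b : B, (b : Alt 7) • p = p := by
      intro b
      have hpO : p ∉ O := by
        have : p ∈ Oᶜ := by rw [hp]; rfl
        exact this
      have : b • p ∈ Oᶜ := by
        intro hc
        apply hpO
        have := MulAction.mem_orbit_of_mem_orbit b⁻¹ hc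
        rwa [inv_smul_smul] at this
      rw [hp] at this
      exact this
    have : MulAction.IsPretransitive (Alt 7) (Fin 7) :=
      alternatingGroup.isPretransitive_of_three_le_card _ (by simp)
    have hidx : (MulAction.stabilizer (Alt 7) p).index = 7 := by
      rw [MulAction.index_stabilizer_of_transitive]; simp
    obtain ⟨e⟩ := equiv_alt_of_index (by norm_num) hidx
    have hle : B ≤ MulAction.stabilizer (Alt 7) p := fun b hb => hfix ⟨b, hb⟩
    have hr : (B.subgroupOf (MulAction.stabilizer (Alt 7) p)).index = 3 := by
      have h1 := Subgroup.relIndex_mul_index hle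
      rw [hidx, hB] at h1
      rw [Subgroup.relIndex] at h1
      omega
    have hr' : ((B.subgroupOf (MulAction.stabilizer (Alt 7) p)).map e.toMonoidHom).index = 3 := by
      rw [← hr]
      exact Subgroup.index_map_equiv _ e
    have := le_index_alt (n := 6) (by norm_num) (H := (B.subgroupOf
      (MulAction.stabilizer (Alt 7) p)).map e.toMonoidHom) (by
        intro h
        rw [h, Subgroup.index_top] at hr'
        omega)
    omega
  have hO : O.ncard = 5 := by
    have : O.ncard ≤ 7 := by omega
    generalize O.ncard = k at *
    interval_cases k <;> omega
  let f : B →* Perm O := MulAction.toPermHom B O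
  -- An element trivial on the orbit moves at most two points; being even, it is not a
  -- transposition.
  have hinj : Function.Injective f := by
    refine (injective_iff_map_eq_one f).2 fun b hb => ?_
    have hfix : ∀ y ∈ O, ((b : Alt 7) : Perm (Fin 7)) y = y := by
      intro y hy
      exact congrArg Subtype.val (DFunLike.congr_fun hb ⟨y, hy⟩)
    have hle : ((b : Alt 7) : Perm (Fin 7)).support.card ≤ 2 := by
      have : (((b : Alt 7) : Perm (Fin 7)).support : Set (Fin 7)) ⊆ Oᶜ := by
        intro y hy hyO
        exact Perm.mem_support.1 hy (hfix y hyO)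
      rw [← Set.ncard_coe_finset]
      refine (Set.ncard_le_ncard this).trans ?_
      omega
    have hsgn := Perm.mem_alternatingGroup.1 (b : Alt 7).2
    have hne : ((b : Alt 7) : Perm (Fin 7)).support.card ≠ 2 := by
      intro h2
      rw [Perm.card_support_eq_two] at h2
      rw [h2.sign_eq] at hsgn
      exact absurd hsgn (by decide)
    have h1 := Perm.card_support_le_one.1 (show ((b : Alt 7) : Perm (Fin 7)).support.card ≤ 1 by
      omega)
    exact Subtype.ext (Subtype.ext h1)
  have hbij : Function.Bijective f := by
    rw [Nat.bijective_iff_injective_and_card]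
    refine ⟨hinj, ?_⟩
    have : Nat.card O = 5 := hO
    rw [hc, Nat.card_perm, this]; rfl
  exact ⟨(MulEquiv.ofBijective f hbij).trans (Finite.equivFinOfCardEq hO).permCongrHom⟩

/-! ### Existence of the subgroups -/

theorem exists_index_alt {n : ℕ} (hn : 3 ≤ n) : ∃ H : Subgroup (Alt n), H.index = n := by
  have : MulAction.IsPretransitive (Alt n) (Fin n) :=
    alternatingGroup.isPretransitive_of_three_le_card _ (by simpa using hn)
  refine ⟨MulAction.stabilizer (Alt n) (⟨0, by omega⟩ : Fin n), ?_⟩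
  rw [MulAction.index_stabilizer_of_transitive]; simp

/-- The nontrivial action of the signs on two points. -/
def signPerm : ℤˣ →* Perm (Fin 2) where
  toFun u := if u = 1 then 1 else swap 0 1
  map_one' := by decide
  map_mul' := by decide

/-- Let odd permutations also interchange two additional points; the resulting permutation is always
even. -/
theorem exists_perm_hom_alt (n : ℕ) : ∃ f : Perm (Fin n) →* Alt (n + 2), Function.Injective f := by
  let g : Perm (Fin n) →* Perm (Fin (n + 2)) :=
    (finSumFinEquiv.permCongrHom : Perm (Fin n ⊕ Fin 2) ≃* Perm (Fin (n + 2))).toMonoidHom.comp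
      ((Perm.sumCongrHom (Fin n) (Fin 2)).comp
        ((MonoidHom.id _).prod (signPerm.comp Perm.sign)))
  have hg : ∀ σ, g σ ∈ alternatingGroup (Fin (n + 2)) := by
    intro σ
    rw [Perm.mem_alternatingGroup]
    change Perm.sign (finSumFinEquiv.permCongr (Perm.sumCongr σ (signPerm (Perm.sign σ)))) = 1
    rw [Perm.sign_permCongr, Perm.sign_sumCongr]
    generalize Perm.sign σ = u
    revert u; decide
  refine ⟨g.codRestrict _ hg, fun σ τ h => ?_⟩
  have h1 : g σ = g τ := congrArg Subtype.val h
  have h2 := (finSumFinEquiv.permCongrHom : Perm (Fin n ⊕ Fin 2) ≃* Perm (Fin (n + 2))).injective h1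
  have h3 := Perm.sumCongrHom_injective h2
  exact congrArg Prod.fst h3

theorem exists_index_fifteen_alt_six : ∃ H : Subgroup (Alt 6), H.index = 15 := by
  obtain ⟨f, hf⟩ := exists_perm_hom_alt 4
  refine ⟨f.range, ?_⟩
  have h := f.range.card_mul_index
  rw [natCard_alt_six, ← Nat.card_congr (MonoidHom.ofInjective hf).toEquiv, Nat.card_perm,
    Nat.card_fin, show Nat.factorial 4 = 24 by decide] at h
  omega

theorem exists_index_twentyone_alt_seven : ∃ H : Subgroup (Alt 7), H.index = 21 := by
  obtain ⟨f, hf⟩ := exists_perm_hom_alt 5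
  refine ⟨f.range, ?_⟩
  have h := f.range.card_mul_index
  rw [natCard_alt_seven, ← Nat.card_congr (MonoidHom.ofInjective hf).toEquiv, Nat.card_perm,
    Nat.card_fin, show Nat.factorial 5 = 120 by decide] at h
  omega

end ImprimitiveCovers

namespace ImprimitiveCovers

open Equiv

/-! ### The linear group of order 168 as a permutation group of degree seven -/

namespace L27

/-- The translation by one of the field with seven elements. -/
def c : Perm (Fin 7) := c[0, 1, 2, 3, 4, 5, 6]

/-- The multiplication by two. -/
def m : Perm (Fin 7) := c[1, 2, 4] * c[3, 6, 5]

/-- An involution which together with `c` generates a linear group. -/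
def w : Perm (Fin 7) := swap 1 2 * swap 3 6

/-- Negation. -/
def κ : Perm (Fin 7) := swap 1 6 * swap 2 5 * swap 3 4

theorem pow_c_zero : ∀ x : Fin 7, (c ^ (x : ℕ)) 0 = x := by decide +kernel

/-- The powers of `c` are transitive, so a permutation commuting with `c` is determined by the image
of one point. -/
theorem eq_of_commute {g : Perm (Fin 7)} (h : Commute g c) (h0 : g 0 = 0) : g = 1 := by
  ext1 x
  have := congrArg (fun p : Perm (Fin 7) => p 0) ((h.pow_right (x : ℕ)).eq)
  simp only [Perm.mul_apply, h0] at this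
  rwa [pow_c_zero] at this

theorem eq_of_conj_eq {g h : Perm (Fin 7)} (hc : g * c * g⁻¹ = h * c * h⁻¹) (h0 : g 0 = h 0) :
    g = h := by
  have : h⁻¹ * g = 1 := by
    refine eq_of_commute ?_ (by
      rw [Perm.mul_apply, h0, Perm.inv_eq_iff_eq])
    have := congrArg (fun x => h⁻¹ * x * g) hc
    simpa [Commute, SemiconjBy, mul_assoc] using this
  rw [← mul_left_cancel_iff (a := h⁻¹), this, inv_mul_cancel]

/-- By Sylow there are 1 or 8 subgroups of order 7, so the normalizer of ⟨c⟩ has order at least 21.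
It therefore contains an element conjugating `c` to `c ^ k` with k ≠ ±1. Corrected by a translation
this is multiplication by k, and some power of it is multiplication by two. -/
theorem m_mem {B : Subgroup (Perm (Fin 7))} (hB : Nat.card B = 168) (hc : c ∈ B) : m ∈ B := by
  classical
  have ho : orderOf (⟨c, hc⟩ : B) = 7 := by
    rw [← Subgroup.orderOf_coe]
    exact orderOf_eq_prime (x := c) (by decide +kernel) (by decide +kernel)
  let P : Sylow 7 B := Sylow.ofCard (Subgroup.zpowers ⟨c, hc⟩) (by
    rw [Nat.card_zpowers, ho, hB]
    have : (168 : ℕ).factorization 7 = 1 := by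
      rw [show 168 = 7 ^ 1 * 24 by norm_num]
      rw [Nat.factorization_mul (by norm_num) (by norm_num)]
      simp [Nat.factorization_eq_zero_of_not_dvd,
        Nat.Prime.factorization_self (by norm_num : Nat.Prime 7)]
    rw [this, pow_one])
  have hP : (P : Subgroup B) = Subgroup.zpowers ⟨c, hc⟩ := rfl
  have h1 := card_sylow_modEq_one 7 B
  have h2 := P.card_dvd_index
  have h3 := (P : Subgroup B).card_mul_index
  rw [hP, Nat.card_zpowers, ho, hB, ← hP] at h3
  have h4 : (P : Subgroup B).index = 24 := by omega
  rw [h4] at h2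
  set T := Subgroup.normalizer (P : Set B) with hT
  have h5 : Nat.card T * Nat.card (Sylow 7 B) = 168 := by
    rw [P.card_eq_index_normalizer, ← hB]
    exact Subgroup.card_mul_index _
  have h6 : 21 ≤ Nat.card T := by
    have := Nat.le_of_dvd (by norm_num) h2
    rw [Nat.ModEq] at h1
    generalize Nat.card (Sylow 7 B) = k at *
    interval_cases k <;> omega
  have hk : ∀ y : T, ∃ k : Fin 7, (y : B) * c * ((y : B) : Perm (Fin 7))⁻¹ = c ^ (k : ℕ) := by
    intro y
    have hy := (Subgroup.mem_normalizer_iff.1 y.2 ⟨c, hc⟩).1 (Subgroup.mem_zpowers _)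
    change _ ∈ Subgroup.zpowers _ at hy
    rw [mem_zpowers_iff_mem_range_orderOf, ho, Finset.mem_image] at hy
    obtain ⟨k, hk, hk'⟩ := hy
    exact ⟨⟨k, Finset.mem_range.1 hk⟩, (congrArg Subtype.val hk').symm⟩
  choose k hk using hk
  -- If only the multipliers 1 and 6 occurred, the multiplier and the image of 0 would leave at most
  -- 14 elements, fewer than 21.
  obtain ⟨y, hy⟩ : ∃ y : T, k y ≠ 1 ∧ k y ≠ 6 := by
    by_contra! hcon
    have hinj : Function.Injective (fun y : T => (decide (k y = 1), ((y : B) : Perm (Fin 7)) 0)) := by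
      intro y y' h
      rw [Prod.mk.injEq, decide_eq_decide] at h
      have hkk : k y = k y' := by
        by_cases h1 : k y = 1
        · rw [h1, h.1.1 h1]
        · rw [hcon y h1, hcon y' fun h' => h1 (h.1.2 h')]
      exact Subtype.ext (Subtype.ext (eq_of_conj_eq (by rw [hk, hk, hkk]) h.2))
    have := Nat.card_le_card_of_injective _ hinj
    rw [Nat.card_prod, Nat.card_fin, Nat.card_eq_fintype_card (α := Bool), Fintype.card_bool] at this
    omega
  have h0 : k y ≠ 0 := by
    intro h
    have := hk y
    rw [h] at this
    have h' : c = 1 := by simpa using this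
    revert h'; decide +kernel
  set g : Perm (Fin 7) := (c ^ ((((y : B) : Perm (Fin 7)) 0 : Fin 7) : ℕ))⁻¹ * (y : B) with hg
  have hgB : g ∈ B := B.mul_mem (B.inv_mem (B.pow_mem hc _)) (y : B).2
  have hgc : g * c * g⁻¹ = c ^ (k y : ℕ) := by
    have h := congrArg (fun x => (c ^ ((((y : B) : Perm (Fin 7)) 0 : Fin 7) : ℕ))⁻¹ * x *
      (c ^ ((((y : B) : Perm (Fin 7)) 0 : Fin 7) : ℕ))) (hk y)
    rw [hg, mul_inv_rev, inv_inv]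
    refine Eq.trans (by simp only [mul_assoc]) (h.trans ?_)
    rw [mul_assoc, ((Commute.refl c).pow_pow _ _).eq, inv_mul_cancel_left]
  have hg0 : g 0 = 0 := by
    rw [hg, Perm.mul_apply, Perm.inv_eq_iff_eq, pow_c_zero]
  have hpow : ∀ e : ℕ, g ^ e * c * (g ^ e)⁻¹ = c ^ ((k y : ℕ) ^ e) := by
    intro e
    induction e with
    | zero => simp
    | succ e ih =>
      rw [pow_succ', mul_inv_rev, show g * g ^ e * c * ((g ^ e)⁻¹ * g⁻¹) =
        g * (g ^ e * c * (g ^ e)⁻¹) * g⁻¹ by simp only [mul_assoc], ih, ← conj_pow, hgc, ← pow_mul,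
        pow_succ']
  have hpow0 : ∀ e : ℕ, (g ^ e) 0 = 0 := by
    intro e
    induction e with
    | zero => rfl
    | succ e ih => rw [pow_succ, Perm.mul_apply, hg0, ih]
  -- Modulo 7 one has 2 = 2¹ = 3² = 4² = 5⁴.
  obtain ⟨e, he⟩ : ∃ e : ℕ, c ^ ((k y : ℕ) ^ e) = m * c * m⁻¹ := by
    obtain ⟨h1, h6⟩ := hy
    generalize k y = k at *
    fin_cases k
    · exact absurd rfl h0
    · exact absurd rfl h1
    · exact ⟨1, by decide +kernel⟩
    · exact ⟨2, by decide +kernel⟩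
    · exact ⟨2, by decide +kernel⟩
    · exact ⟨4, (pow_eq_pow_mod (5 ^ 4) (by decide +kernel : c ^ 7 = 1)).trans (by decide +kernel)⟩
    · exact absurd rfl h6
  have : g ^ e = m := eq_of_conj_eq ((hpow e).trans he) ((hpow0 e).trans (by decide +kernel))
  exact this ▸ B.pow_mem hgB e

/-- The affine maps of the field with seven elements. -/
def affine (i j : Fin 7) (z : Fin 7) : Fin 7 := j * z + i

/-- The product of two disjoint transpositions, the first of which moves `0`. -/
def twoSwaps (b x y z : Fin 7) : Fin 7 :=
  if z = 0 then b else if z = b then 0 else if z = x then y else if z = y then x else z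

/-- The values of `w`. -/
def wFun : Fin 7 → Fin 7 := ![0, 2, 1, 6, 4, 5, 3]

/-- The values of `κ * w * κ`. -/
def wFun' : Fin 7 → Fin 7 := ![0, 4, 2, 3, 1, 6, 5]

/-- For every double transposition moving 0, either an affine map with square multiplier carries it
to `w` or to the image of `w` under negation, or its product with such a map has order five. The
last case cannot happen in a group of order 168. -/
theorem involution_table : ∀ b x y : Fin 7, b ≠ 0 → x ≠ 0 → y ≠ 0 → b ≠ x → b ≠ y → x ≠ y →
    ∃ i j : Fin 7, (j = 1 ∨ j = 2 ∨ j = 4) ∧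
      ((∀ z, affine i j (twoSwaps b x y z) = wFun (affine i j z)) ∨
      (∀ z, affine i j (twoSwaps b x y z) = wFun' (affine i j z)) ∨
      ((∀ z, (fun z => twoSwaps b x y (affine i j z))^[5] z = z) ∧
        twoSwaps b x y (affine i j 0) ≠ 0)) := by
  decide +kernel

theorem exists_affine {B : Subgroup (Perm (Fin 7))} (hc : c ∈ B) (hm : m ∈ B) (i j : Fin 7)
    (hj : j = 1 ∨ j = 2 ∨ j = 4) : ∃ n ∈ B, ∀ z, n z = affine i j z := by
  have hc' : ∀ i z : Fin 7, (c ^ (i : ℕ)) z = z + i := by decide +kernel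
  rcases hj with rfl | rfl | rfl
  · refine ⟨c ^ (i : ℕ), B.pow_mem hc _, fun z => ?_⟩
    rw [hc', affine, one_mul]
  · refine ⟨c ^ (i : ℕ) * m, B.mul_mem (B.pow_mem hc _) hm, fun z => ?_⟩
    rw [Perm.mul_apply, hc', affine]
    revert z; decide +kernel +revert
  · refine ⟨c ^ (i : ℕ) * m ^ 2, B.mul_mem (B.pow_mem hc _) (B.pow_mem hm _), fun z => ?_⟩
    rw [Perm.mul_apply, hc', affine]
    revert z; decide +kernel +revert

/-- An involution of `B` is a double transposition; a translation makes it move 0, and the table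
applies. The two outcomes are exchanged by conjugation with the odd permutation `κ`. -/
theorem w_mem {B : Subgroup (Perm (Fin 7))} (hB : Nat.card B = 168)
    (hev : B ≤ alternatingGroup (Fin 7)) (hc : c ∈ B) (hm : m ∈ B) : w ∈ B ∨ κ * w * κ ∈ B := by
  obtain ⟨t, ht⟩ := exists_prime_orderOf_dvd_card' (G := B) 2 (by rw [hB]; norm_num)
  rw [← Subgroup.orderOf_coe] at ht
  have hty := (alt_cycleType le_rfl ⟨t, hev t.2⟩).2.2.2.1 (by rwa [← Subgroup.orderOf_coe])
  obtain ⟨θ, hθ⟩ := exists_conj_of_cycleType (a := (t : Perm (Fin 7)))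
    (c := c[0, 1] * c[2, 3]) (hty.trans (by decide +kernel))
  set r : Perm (Fin 7) := (c ^ ((θ 0 : Fin 7) : ℕ))⁻¹ with hr
  have hrB : r ∈ B := B.inv_mem (B.pow_mem hc _)
  set t' : Perm (Fin 7) := r * t * r⁻¹ with ht'
  have htB : t' ∈ B := B.mul_mem (B.mul_mem hrB t.2) (B.inv_mem hrB)
  have hsw : t' = swap ((r * θ) 0) ((r * θ) 1) * swap ((r * θ) 2) ((r * θ) 3) := by
    rw [ht', hθ, swap_apply_apply, swap_apply_apply,
      show (c[0, 1] * c[2, 3] : Perm (Fin 7)) = swap 0 1 * swap 2 3 by decide +kernel]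
    group
  have h0 : (r * θ) 0 = 0 := by
    rw [hr, Perm.mul_apply, Perm.inv_eq_iff_eq, pow_c_zero]
  have hne : ∀ {i j : Fin 7}, i ≠ j → (r * θ) i ≠ (r * θ) j := fun h h' =>
    h ((r * θ).injective h')
  obtain ⟨i, j, hj, h⟩ := involution_table ((r * θ) 1) ((r * θ) 2) ((r * θ) 3)
    (h0 ▸ hne (by decide)) (h0 ▸ hne (by decide)) (h0 ▸ hne (by decide))
    (hne (by decide)) (hne (by decide)) (hne (by decide))
  have htz : ∀ z, t' z = twoSwaps ((r * θ) 1) ((r * θ) 2) ((r * θ) 3) z := by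
    intro z
    have h12 := hne (show (1 : Fin 7) ≠ 2 by decide)
    have h13 := hne (show (1 : Fin 7) ≠ 3 by decide)
    have h02 := hne (show (0 : Fin 7) ≠ 2 by decide)
    have h03 := hne (show (0 : Fin 7) ≠ 3 by decide)
    rw [h0] at h02 h03
    rw [hsw, h0]
    simp only [Perm.mul_apply, swap_apply_def, twoSwaps]
    split_ifs <;> simp_all
  obtain ⟨n, hn, hnz⟩ := exists_affine hc hm i j hj
  simp only [← htz, ← hnz] at h
  rcases h with h | h | ⟨h5, hne⟩
  · left
    have : n * t' * n⁻¹ = w := by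
      rw [mul_inv_eq_iff_eq_mul]
      ext1 z
      rw [Perm.mul_apply, h, Perm.mul_apply]
      generalize n z = u
      revert u; decide +kernel
    rw [← this]; exact B.mul_mem (B.mul_mem hn htB) (B.inv_mem hn)
  · right
    have : n * t' * n⁻¹ = κ * w * κ := by
      rw [mul_inv_eq_iff_eq_mul]
      ext1 z
      rw [Perm.mul_apply, h, Perm.mul_apply]
      generalize n z = u
      revert u; decide +kernel
    rw [← this]; exact B.mul_mem (B.mul_mem hn htB) (B.inv_mem hn)
  · exfalso
    have ho : orderOf (t' * n) = 5 := by
      refine orderOf_eq_prime ?_ fun h => ?_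
      · ext1 z
        exact h5 z
      · exact hne (DFunLike.congr_fun h 0)
    have := orderOf_dvd_natCard (⟨_, B.mul_mem htB hn⟩ : B)
    rw [← Subgroup.orderOf_coe, ho, hB] at this
    omega

end L27

end ImprimitiveCovers

namespace ImprimitiveCovers

open Equiv Matrix
open scoped MatrixGroups

namespace L27

/-- The values of `w`, on the field with seven elements. -/
def wZ : ZMod 7 → ZMod 7 := wFun

/-- The exceptional action of `SL(2, 7)` on seven points. -/
def lft (a b c d x : ZMod 7) : ZMod 7 :=
  if c = 0 then a * a * x + a * b
  else a * c ^ 5 + c ^ 5 * c ^ 5 * wZ (x + d * c ^ 5)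

/-- The formula for `lft` is read off from the Bruhat decomposition: upper triangular matrices act
by affine maps, `W` acts as `w`, and `c ^ 5` is the inverse of `c`. This identity and the next
express compatibility with left multiplication by the generators `W` and `U 1`. -/
theorem lft_w : ∀ a b c d x : ZMod 7, a * d - b * c = 1 →
    lft (-c) (-d) a b x = wZ (lft a b c d x) := by
  decide +kernel

theorem lft_u : ∀ a b c d x : ZMod 7, a * d - b * c = 1 →
    lft (a + c) (b + d) c d x = lft a b c d x + 1 := by
  decide +kernel

/-- The action of a matrix. -/
def act (M : SL(2, ZMod 7)) (x : ZMod 7) : ZMod 7 := lft (M 0 0) (M 0 1) (M 1 0) (M 1 1) x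

theorem det_eq (M : SL(2, ZMod 7)) : M 0 0 * M 1 1 - M 0 1 * M 1 0 = 1 := by
  have := M.2
  rwa [Matrix.det_fin_two] at this

def U (x : ZMod 7) : SL(2, ZMod 7) := ⟨!![1, x; 0, 1], by simp⟩
def Lo (x : ZMod 7) : SL(2, ZMod 7) := ⟨!![1, 0; x, 1], by simp⟩
def W : SL(2, ZMod 7) := ⟨!![0, -1; 1, 0], by simp⟩

theorem mul_entry (M N : SL(2, ZMod 7)) (i j : Fin 2) :
    (M * N) i j = M i 0 * N 0 j + M i 1 * N 1 j := by
  rw [← Fin.sum_univ_two fun k => M i k * N k j]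
  rfl

theorem act_one (x : ZMod 7) : act 1 x = x := by
  simp [act, lft]

theorem mem_of_generators {S : Subgroup SL(2, ZMod 7)} (hU1 : U 1 ∈ S) (hW : W ∈ S)
    (M : SL(2, ZMod 7)) : M ∈ S := by
  have hU : ∀ x, U x ∈ S := by
    intro x
    have : U x = U 1 ^ x.val := by
      revert x; decide +kernel
    rw [this]; exact S.pow_mem hU1 _
  have hL : ∀ x : ZMod 7, Lo x ∈ S := by
    intro x
    have : Lo x = W * U (-x) * W ^ 3 := by
      revert x; decide +kernel
    rw [this]; exact S.mul_mem (S.mul_mem hW (hU _)) (S.pow_mem hW _)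
  have hne : ∀ M : SL(2, ZMod 7), M 1 0 ≠ 0 → M ∈ S := by
    intro M hM
    have : M = U ((M 0 0 - 1) * (M 1 0)⁻¹) * Lo (M 1 0) *
        U ((M 1 1 - 1) * (M 1 0)⁻¹) := by
      have hd := det_eq M
      have h1 (x : ZMod 7) : U x 0 0 = 1 ∧ U x 0 1 = x ∧ U x 1 0 = 0 ∧ U x 1 1 = 1 :=
        ⟨rfl, rfl, rfl, rfl⟩
      have h2 (x : ZMod 7) : Lo x 0 0 = 1 ∧ Lo x 0 1 = 0 ∧ Lo x 1 0 = x ∧ Lo x 1 1 = 1 :=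
        ⟨rfl, rfl, rfl, rfl⟩
      refine Subtype.ext (Matrix.ext fun i j => ?_)
      rw [mul_entry, mul_entry, mul_entry]
      obtain rfl | rfl : i = 0 ∨ i = 1 := by omega
      all_goals obtain rfl | rfl : j = 0 ∨ j = 1 := by omega
      all_goals simp only [h1, h2]
      all_goals field_simp
      · ring
      · linear_combination -hd
      · ring
      · ring
    rw [this]
    exact S.mul_mem (S.mul_mem (hU _) (hL _)) (hU _)
  have hall : M ∈ S := by
    by_cases hM : M 1 0 = 0
    · have h1 : (W * M) 1 0 ≠ 0 := by
        have hd := det_eq M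
        rw [hM, mul_zero, sub_zero] at hd
        have : (W * M) 1 0 = M 0 0 := by
          simp only [mul_entry]
          simp [W]
        rw [this]
        intro h0
        rw [h0, zero_mul] at hd
        exact zero_ne_one hd
      have : M = W ^ 3 * (W * M) := by
        rw [← mul_assoc, show W ^ 3 * W = 1 by decide +kernel, one_mul]
      rw [this]
      exact S.mul_mem (S.pow_mem hW _) (hne _ h1)
    · exact hne M hM
  exact hall

/-- The matrices `M` that satisfy the identity for all `N` and `x` form a submonoid, which is a
subgroup by finiteness. It contains both generators, by the two decided identities. -/
theorem act_mul (M N : SL(2, ZMod 7)) (x : ZMod 7) : act (M * N) x = act M (act N x) := by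
  let S : Submonoid SL(2, ZMod 7) :=
    { carrier := {M | ∀ N x, act (M * N) x = act M (act N x)}
      one_mem' := fun N x => by rw [one_mul, act_one]
      mul_mem' := fun {M M'} hM hM' N x => by rw [mul_assoc, hM, hM', ← hM] }
  let S' : Subgroup SL(2, ZMod 7) :=
    { S with
      inv_mem' := fun {M} hM => by
        rw [inv_eq_of_mul_eq_one_left (pow_sub_one_mul (orderOf_pos M).ne' M |>.trans
          (pow_orderOf_eq_one M))]
        exact S.pow_mem hM _ }
  have hU1 : U 1 ∈ S' := by
    intro N x
    have h1 : ∀ y, act (U 1) y = y + 1 := fun y => by simp [act, lft, U]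
    rw [h1, act, act, ← lft_u _ _ _ _ _ (det_eq N)]
    simp only [mul_entry]
    simp [U]
  have hW : W ∈ S' := by
    intro N x
    have h1 : ∀ y, act W y = wZ y := by
      intro y
      simp only [act, W]
      revert y; decide +kernel
    rw [h1, act, act, ← lft_w _ _ _ _ _ (det_eq N)]
    simp only [mul_entry]
    simp [W]
  exact mem_of_generators hU1 hW M N x

instance : MulAction SL(2, ZMod 7) (ZMod 7) where
  smul := act
  one_smul := act_one
  mul_smul := act_mul

/-- The permutation representation of degree seven. -/
def permHom : SL(2, ZMod 7) →* Perm (Fin 7) := MulAction.toPermHom SL(2, ZMod 7) (ZMod 7)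

theorem permHom_apply (M : SL(2, ZMod 7)) (x : ZMod 7) : permHom M x = act M x := rfl

theorem isPerfect_sl : Group.IsPerfect SL(2, ZMod 7) :=
  ⟨SL2.commutator_eq_top (a := (2 : ZMod 7)) (by decide) (by decide)⟩

instance : Fact (Nat.Prime 7) := ⟨by norm_num⟩

/-- A perfect group has no nontrivial homomorphism to the signs. -/
theorem permHom_mem (M : SL(2, ZMod 7)) : permHom M ∈ alternatingGroup (Fin 7) := by
  rw [Perm.mem_alternatingGroup]
  have := isPerfect_sl
  have h := Abelianization.commutator_subset_ker (Perm.sign.comp permHom)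
  rw [Group.IsPerfect.commutator_eq_top, top_le_iff] at h
  have hM : M ∈ (Perm.sign.comp permHom).ker := h ▸ Subgroup.mem_top M
  exact MonoidHom.mem_ker.1 hM

theorem permHom_center {M : SL(2, ZMod 7)} (hM : M ∈ Subgroup.center SL(2, ZMod 7)) :
    permHom M = 1 := by
  obtain ⟨r, hr, hM⟩ := Matrix.SpecialLinearGroup.mem_center_iff.1 hM
  ext1 x
  change act M x = x
  have h (i j) : M i j = Matrix.scalar (Fin 2) r i j := by rw [hM]
  rw [Fintype.card_fin, pow_two] at hr
  simp only [act, lft, h]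
  simp only [Matrix.scalar_apply, Matrix.diagonal_apply, if_true, if_neg zero_ne_one,
    if_neg one_ne_zero, hr, mul_zero]
  exact (add_zero _).trans (one_mul (x : ZMod 7))

/-- The induced representation of the projective group. -/
def pslHom : PSL(2, ZMod 7) →* Alt 7 :=
  QuotientGroup.lift _ (permHom.codRestrict _ permHom_mem) fun _ hM =>
    Subtype.ext (permHom_center hM)

theorem pslHom_mk (M : SL(2, ZMod 7)) : (pslHom (QuotientGroup.mk M) : Perm (Fin 7)) = permHom M :=
  rfl

/-- The translation by one. -/
def cZ : ZMod 7 → ZMod 7 := fun x => c x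

/-- The involution. -/
def wPermZ : ZMod 7 → ZMod 7 := fun x => w x

theorem lft_U : ∀ x : ZMod 7, lft 1 1 0 1 x = cZ x := by decide +kernel

theorem lft_W : ∀ x : ZMod 7, lft 0 (-1) 1 0 x = wPermZ x := by decide +kernel

theorem permHom_U : permHom (U 1) = c := by
  refine Equiv.ext fun x => ?_
  exact (permHom_apply (U 1) x).trans (lft_U x)

theorem permHom_W : permHom W = w := by
  refine Equiv.ext fun x => ?_
  exact (permHom_apply W x).trans (lft_W x)

instance isSimpleGroup_psl : IsSimpleGroup PSL(2, ZMod 7) :=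
  Matrix.ProjectiveSpecialLinearGroup.rank_two_simple (by simp)

theorem pslHom_injective : Function.Injective pslHom := by
  rw [← MonoidHom.ker_eq_bot_iff]
  refine (Subgroup.Normal.eq_bot_or_eq_top (H := pslHom.ker) inferInstance).resolve_right ?_
  intro h
  have h1 : pslHom (QuotientGroup.mk (U 1)) = 1 := MonoidHom.mem_ker.1 (h ▸ Subgroup.mem_top _)
  have h2 := congrArg Subtype.val h1
  rw [pslHom_mk, permHom_U] at h2
  have h3 : c = 1 := h2
  revert h3; decide +kernel

theorem centralExt_mk : CentralExt (QuotientGroup.mk' (Subgroup.center SL(2, ZMod 7))) where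
  surj := QuotientGroup.mk'_surjective _
  central := (QuotientGroup.ker_mk' _).le

/-- The matrices as quadruples of entries. -/
def entries : SL(2, ZMod 7) ≃
    {q : ZMod 7 × ZMod 7 × ZMod 7 × ZMod 7 // q.1 * q.2.2.2 - q.2.1 * q.2.2.1 = 1} where
  toFun M := ⟨(M 0 0, M 0 1, M 1 0, M 1 1), det_eq M⟩
  invFun q := ⟨!![q.1.1, q.1.2.1; q.1.2.2.1, q.1.2.2.2], by rw [Matrix.det_fin_two_of]; exact q.2⟩
  left_inv M := by ext i j; fin_cases i <;> fin_cases j <;> rfl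
  right_inv q := rfl

/-- The action of a quadruple of entries. -/
def qact (q : ZMod 7 × ZMod 7 × ZMod 7 × ZMod 7) (x : ZMod 7) : ZMod 7 :=
  lft q.1 q.2.1 q.2.2.1 q.2.2.2 x

theorem count_one : (Finset.univ.filter fun q : ZMod 7 × ZMod 7 × ZMod 7 × ZMod 7 =>
    q.1 * q.2.2.2 - q.2.1 * q.2.2.1 = 1 ∧ ∀ x, qact q x = x).card = 2 := by
  decide +kernel

theorem count_all : (Finset.univ.filter fun q : ZMod 7 × ZMod 7 × ZMod 7 × ZMod 7 =>
    q.1 * q.2.2.2 - q.2.1 * q.2.2.1 = 1 ∧ True).card = 336 := by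
  decide +kernel

theorem count_two : (Finset.univ.filter fun q : ZMod 7 × ZMod 7 × ZMod 7 × ZMod 7 =>
    q.1 * q.2.2.2 - q.2.1 * q.2.2.1 = 1 ∧ ∀ x, qact q (qact q x) = x).card = 44 := by
  decide +kernel

theorem count_four : (Finset.univ.filter fun q : ZMod 7 × ZMod 7 × ZMod 7 × ZMod 7 =>
    q.1 * q.2.2.2 - q.2.1 * q.2.2.1 = 1 ∧
      ∀ x, qact q (qact q (qact q (qact q x))) = x).card = 128 := by
  decide +kernel

theorem pow_table : ∀ q : ZMod 7 × ZMod 7 × ZMod 7 × ZMod 7,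
    q.1 * q.2.2.2 - q.2.1 * q.2.2.1 = 1 → (∀ x, qact q (qact q (qact q (qact q x))) = x) ∨
      (∀ x, qact q (qact q (qact q x)) = x) ∨
      (∀ x, qact q (qact q (qact q (qact q (qact q (qact q (qact q x)))))) = x) := by
  decide +kernel

end L27

end ImprimitiveCovers

namespace ImprimitiveCovers

open Equiv Matrix
open scoped MatrixGroups

theorem card_pow_eq_one {B : Type*} [Group B] [Finite B] {n : ℕ} (hn : n ≠ 0) :
    Nat.card {a : B // a ^ n = 1} = ∑ d ∈ n.divisors, (ofOrder B d).card := by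
  classical
  have : Fintype B := Fintype.ofFinite B
  rw [← Finset.card_biUnion, Nat.card_eq_fintype_card, Fintype.card_subtype]
  · congr 1
    ext a
    simp [hn, orderOf_dvd_iff_pow_eq_one]
  · intro r _ s _ hrs
    rw [Function.onFun, Finset.disjoint_left]
    intro a ha hb
    rw [mem_ofOrder] at ha hb
    exact hrs (ha.symm.trans hb)

theorem ofOrder_one {B : Type*} [Group B] [Finite B] : (ofOrder B 1).card = 1 := by
  have : ofOrder B 1 = {1} := by ext a; simp
  rw [this, Finset.card_singleton]

namespace L27

theorem card_matrices (p : ZMod 7 × ZMod 7 × ZMod 7 × ZMod 7 → Prop) [DecidablePred p] :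
    Nat.card {M : SL(2, ZMod 7) // p (M 0 0, M 0 1, M 1 0, M 1 1)} =
      (Finset.univ.filter fun q : ZMod 7 × ZMod 7 × ZMod 7 × ZMod 7 =>
        q.1 * q.2.2.2 - q.2.1 * q.2.2.1 = 1 ∧ p q).card := by
  rw [← Fintype.card_subtype, ← Nat.card_eq_fintype_card]
  exact Nat.card_congr ((Equiv.subtypeEquiv entries fun M => Iff.rfl).trans
    (Equiv.subtypeSubtypeEquivSubtypeInter _ p))

/-- Counts in the projective group are reduced to counts of quadruples of matrix entries, which can
be decided. -/
theorem card_preimage (P : PSL(2, ZMod 7) → Prop) :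
    Nat.card {M : SL(2, ZMod 7) // P (QuotientGroup.mk M)} =
      Nat.card (Subgroup.center SL(2, ZMod 7)) * Nat.card {a // P a} := by
  classical
  have : Fintype PSL(2, ZMod 7) := Fintype.ofFinite _
  have h := centralExt_mk.sum_eq (M := ℕ) (F := fun M => if P (QuotientGroup.mk M) then 1 else 0)
    (fun z g hz => by
      have : (QuotientGroup.mk (z * g) : PSL(2, ZMod 7)) = QuotientGroup.mk g := by
        have h1 := map_mul (QuotientGroup.mk' (Subgroup.center SL(2, ZMod 7))) z g
        rw [hz, one_mul] at h1
        exact h1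
      rw [this])
  rw [QuotientGroup.ker_mk'] at h
  have h2 : ∀ a, (QuotientGroup.mk (centralExt_mk.s a) : PSL(2, ZMod 7)) = a :=
    centralExt_mk.π_s
  simp only [h2, ← Finset.card_filter] at h
  rw [Nat.card_eq_fintype_card, Nat.card_eq_fintype_card (α := {a // P a}), Fintype.card_subtype,
    Fintype.card_subtype, h, Nat.cast_id]

theorem mk_pow_eq_one_iff (M : SL(2, ZMod 7)) (n : ℕ) :
    (QuotientGroup.mk M : PSL(2, ZMod 7)) ^ n = 1 ↔ ∀ x : ZMod 7, (permHom M ^ n) x = x := by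
  rw [← pslHom_injective.eq_iff, map_pow, map_one, ← Subtype.coe_inj, Subgroup.coe_pow,
    pslHom_mk, Subgroup.coe_one]
  exact ⟨fun h x => by rw [h]; rfl, fun h => Equiv.ext h⟩

theorem card_center : Nat.card (Subgroup.center SL(2, ZMod 7)) = 2 := by
  refine Eq.trans ?_ ((card_matrices fun q => ∀ x, qact q x = x).trans count_one)
  refine Nat.card_congr (Equiv.subtypeEquivRight fun M => ?_)
  rw [← QuotientGroup.eq_one_iff, ← pow_one (QuotientGroup.mk M : PSL(2, ZMod 7)),
    mk_pow_eq_one_iff, pow_one]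
  rfl

theorem natCard_psl : Nat.card PSL(2, ZMod 7) = 168 := by
  have h := card_preimage fun _ => True
  have h2 := card_matrices fun _ => True
  rw [count_all] at h2
  rw [h2, card_center, Nat.card_congr (Equiv.subtypeUnivEquiv fun _ => trivial)] at h
  omega

theorem card_sq_eq_one : Nat.card {a : PSL(2, ZMod 7) // a ^ 2 = 1} = 22 := by
  have h := card_preimage fun a => a ^ 2 = 1
  simp only [mk_pow_eq_one_iff] at h
  have h2 := (card_matrices fun q => ∀ x, qact q (qact q x) = x).trans count_two
  rw [card_center] at h
  have h3 := h.symm.trans h2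
  omega

theorem card_pow_four_eq_one : Nat.card {a : PSL(2, ZMod 7) // a ^ 4 = 1} = 64 := by
  have h := card_preimage fun a => a ^ 4 = 1
  simp only [mk_pow_eq_one_iff] at h
  have h2 := (card_matrices fun q => ∀ x, qact q (qact q (qact q (qact q x))) = x).trans count_four
  rw [card_center] at h
  have h3 := h.symm.trans h2
  omega

theorem card_two_psl : (ofOrder PSL(2, ZMod 7) 2).card = 21 := by
  have h := card_pow_eq_one (B := PSL(2, ZMod 7)) two_ne_zero
  rw [card_sq_eq_one, show Nat.divisors 2 = {1, 2} by decide, Finset.sum_pair (by norm_num),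
    ofOrder_one] at h
  omega

theorem card_four_psl : (ofOrder PSL(2, ZMod 7) 4).card = 42 := by
  have h := card_pow_eq_one (B := PSL(2, ZMod 7)) four_ne_zero
  rw [card_pow_four_eq_one, show Nat.divisors 4 = {1, 2, 4} by decide,
    Finset.sum_insert (by decide), Finset.sum_pair (by norm_num), ofOrder_one, card_two_psl] at h
  omega

theorem orderOf_psl (a : PSL(2, ZMod 7)) : orderOf a ∣ 4 ∨ orderOf a ∣ 3 ∨ orderOf a ∣ 7 := by
  obtain ⟨M, rfl⟩ := QuotientGroup.mk_surjective a
  simp only [orderOf_dvd_iff_pow_eq_one, mk_pow_eq_one_iff]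
  exact pow_table (M 0 0, M 0 1, M 1 0, M 1 1) (det_eq M)

theorem isPerfect_psl : Group.IsPerfect PSL(2, ZMod 7) := by
  have := isPerfect_sl
  infer_instance

theorem exists_index_fifteen : ∃ H : Subgroup (Alt 7), H.index = 15 := by
  refine ⟨pslHom.range, ?_⟩
  have h := pslHom.range.card_mul_index
  rw [natCard_alt_seven, ← Nat.card_congr (MonoidHom.ofInjective pslHom_injective).toEquiv,
    natCard_psl] at h
  omega

theorem equiv_of_mem {B : Subgroup (Perm (Fin 7))} (hB : Nat.card B = 168) (hc : c ∈ B)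
    (hw : w ∈ B) : Nonempty (B ≃* PSL(2, ZMod 7)) := by
  have hle : permHom.range ≤ B := by
    rintro _ ⟨M, rfl⟩
    have : M ∈ B.comap permHom := by
      have hU : U 1 ∈ B.comap permHom := by
        rw [Subgroup.mem_comap, permHom_U]; exact hc
      have hW : W ∈ B.comap permHom := by
        rw [Subgroup.mem_comap, permHom_W]; exact hw
      exact mem_of_generators hU hW M
    exact this
  let f : PSL(2, ZMod 7) →* Perm (Fin 7) := (alternatingGroup (Fin 7)).subtype.comp pslHom
  have hf : Function.Injective f := Subtype.val_injective.comp pslHom_injective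
  have hfB : f.range ≤ B := by
    rintro _ ⟨a, rfl⟩
    obtain ⟨M, rfl⟩ := QuotientGroup.mk_surjective a
    exact hle ⟨M, rfl⟩
  have heq : f.range = B := by
    refine Subgroup.eq_of_le_of_card_ge hfB ?_
    rw [hB, ← Nat.card_congr (MonoidHom.ofInjective hf).toEquiv, natCard_psl]
  exact ⟨((MonoidHom.ofInjective hf).trans (MulEquiv.subgroupCongr heq)).symm⟩

theorem equiv_conj {X : Type*} [Group X] (B : Subgroup X) (x : X) :
    ∃ B' : Subgroup X, Nonempty (B ≃* B') ∧ ∀ g, g ∈ B' ↔ x⁻¹ * g * x ∈ B := by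
  refine ⟨B.map (MulAut.conj x).toMonoidHom,
    ⟨B.equivMapOfInjective _ (MulAut.conj x).injective⟩, fun g => ?_⟩
  rw [Subgroup.mem_map]
  constructor
  · rintro ⟨b, hb, rfl⟩
    simpa [mul_assoc] using hb
  · intro h
    exact ⟨_, h, by simp [mul_assoc]⟩

/-- After conjugation in the symmetric group, `B` contains `c`, hence `m`, hence `w` or its image
under negation. In the latter case conjugation by `κ` restores `w` and inverts `c`. As `c` and `w`
generate the image of `PSL(2, 7)`, comparing orders finishes. -/
theorem equiv_of_index {B : Subgroup (Alt 7)} (hB : B.index = 15) :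
    Nonempty (B ≃* PSL(2, ZMod 7)) := by
  have h := B.card_mul_index
  rw [hB, natCard_alt_seven] at h
  have hB' : Nat.card B = 168 := by omega
  let B₁ := B.map (alternatingGroup (Fin 7)).subtype
  let e₁ : B ≃* B₁ := B.equivMapOfInjective _ Subtype.val_injective
  have hev : B₁ ≤ alternatingGroup (Fin 7) := by
    rintro _ ⟨b, -, rfl⟩; exact b.2
  obtain ⟨t, ht⟩ := exists_prime_orderOf_dvd_card' (G := B) 7 (by rw [hB']; norm_num)
  have hty := (alt_cycleType le_rfl (t : Alt 7)).2.2.2.2.2.2.2 (by rwa [Subgroup.orderOf_coe])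
  obtain ⟨θ, hθ⟩ := exists_conj_of_cycleType (a := ((t : Alt 7) : Perm (Fin 7)))
    (c := c) (hty.trans (by rw [c]; decide +kernel))
  obtain ⟨B₂, ⟨e₂⟩, h₂⟩ := equiv_conj B₁ θ⁻¹
  rw [inv_inv] at h₂
  have hc : c ∈ B₂ := by
    rw [h₂, ← hθ]
    exact ⟨t, t.2, rfl⟩
  have hcard : Nat.card B₂ = 168 := by rw [← Nat.card_congr (e₁.trans e₂).toEquiv, hB']
  have hev₂ : B₂ ≤ alternatingGroup (Fin 7) := by
    intro g hg
    have := hev ((h₂ g).1 hg)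
    rw [Perm.mem_alternatingGroup] at this ⊢
    rw [Perm.sign_mul, Perm.sign_mul, Perm.sign_inv, mul_right_comm, Int.units_mul_self,
      one_mul] at this
    exact this
  rcases w_mem hcard hev₂ hc (m_mem hcard hc) with hw | hw
  · obtain ⟨e₃⟩ := equiv_of_mem hcard hc hw
    exact ⟨(e₁.trans e₂).trans e₃⟩
  · obtain ⟨B₃, ⟨e₃⟩, h₃⟩ := equiv_conj B₂ κ
    obtain ⟨e₄⟩ := equiv_of_mem (B := B₃) (by rw [← Nat.card_congr e₃.toEquiv, hcard])
      ((h₃ c).2 (by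
        rw [show κ⁻¹ * c * κ = c⁻¹ by decide +kernel]
        exact B₂.inv_mem hc))
      ((h₃ w).2 (by
        rw [show κ⁻¹ * w * κ = κ * w * κ by decide +kernel]
        exact hw))
    exact ⟨((e₁.trans e₂).trans e₃).trans e₄⟩

end L27

end ImprimitiveCovers

namespace ImprimitiveCovers

open Equiv

/-! ### Consequences of the transfer -/

section Transfer

variable {G : Type u} {A : Type v} [Group G] [Finite G] [Group A] {π : G →* A}

/-- The transfer of ϕ sends a central `z` to ϕ(z) to the power of the index, and is trivial because
`G` is perfect. -/
theorem map_eq_one_of_coprime_index [Group.IsPerfect G] {Q : Subgroup G} {M : Type*} [CommGroup M]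
    (ϕ : Q →* M) {z : G} (hz : z ∈ Subgroup.center G) (hzQ : z ∈ Q)
    (hco : (orderOf z).Coprime Q.index) : ϕ ⟨z, hzQ⟩ = 1 := by
  have h1 := MonoidHom.transfer_eq_pow ϕ z fun k g _ => by
    rw [mul_assoc, ← Subgroup.mem_center_iff.1 ((Subgroup.center G).pow_mem hz k) g,
      inv_mul_cancel_left]
  have h2 : ϕ.transfer z = 1 := by
    have h := Abelianization.commutator_subset_ker ϕ.transfer
    rw [Group.IsPerfect.commutator_eq_top] at h
    exact h (Subgroup.mem_top z)
  rw [h1] at h2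
  have h3 : (⟨z ^ Q.index, Q.pow_mem hzQ _⟩ : Q) = ⟨z, hzQ⟩ ^ Q.index := rfl
  have h4 : ϕ ⟨z, hzQ⟩ ^ Q.index = 1 := by
    rw [← map_pow, ← h3]; exact h2
  have h5 : ϕ ⟨z, hzQ⟩ ^ orderOf z = 1 := by
    have : (⟨z, hzQ⟩ : Q) ^ orderOf z = 1 := Subtype.ext (pow_orderOf_eq_one z)
    rw [← map_pow, this, map_one]
  exact orderOf_eq_one_iff.1 (Nat.dvd_one.1 (hco ▸ Nat.dvd_gcd (orderOf_dvd_of_pow_eq_one h5)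
    (orderOf_dvd_of_pow_eq_one h4)))

/-- Apply the preceding fact to the abelianization of `Q`. -/
theorem mem_commutator_of_coprime_index [Group.IsPerfect G] {Q : Subgroup G} {z : G}
    (hz : z ∈ Subgroup.center G) (hzQ : z ∈ Q) (hco : (orderOf z).Coprime Q.index) :
    (⟨z, hzQ⟩ : Q) ∈ commutator Q := by
  have := map_eq_one_of_coprime_index (Abelianization.of (G := Q)) hz hzQ hco
  rwa [← MonoidHom.mem_ker, Abelianization.ker_of] at this

theorem zpowers_le_sylow {p : ℕ} [Fact p.Prime] (P : Sylow p G) {z : G}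
    (hz : z ∈ Subgroup.center G) (ho : orderOf z = p) : z ∈ P := by
  have hz' : IsPGroup p (Subgroup.zpowers z) :=
    IsPGroup.of_card (n := 1) (by rw [Nat.card_zpowers, ho, pow_one])
  have h := hz'.inf_normalizer_sylow P
  have hle : Subgroup.zpowers z ≤ Subgroup.normalizer (P : Set G) := by
    rw [Subgroup.zpowers_le]
    refine Subgroup.mem_normalizer_iff.2 fun g => ?_
    rw [← Subgroup.mem_center_iff.1 hz g, mul_inv_cancel_right]
  rw [inf_eq_left.2 hle] at h
  exact (inf_eq_left.1 h.symm) (Subgroup.mem_zpowers z)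

theorem factorization_three_pow_mul {k j : ℕ} (hj : ¬ 3 ∣ j) :
    (3 ^ k * j).factorization 3 = k := by
  have h0 : j ≠ 0 := by rintro rfl; simp at hj
  rw [Nat.factorization_mul (by positivity) h0, Nat.factorization_pow]
  simp [Nat.factorization_eq_zero_of_not_dvd hj, Nat.Prime.factorization_self Nat.prime_three]

/-- An element lying above an element of order three of a group with Sylow `3`-subgroups of order
nine is conjugate to a nontrivial central multiple of itself. -/
theorem CentralExt.exists_conj_mul [Finite A] [Group.IsPerfect G] (h : CentralExt π) {i j : ℕ}
    (hA : Nat.card A = 9 * j) (hj : ¬ 3 ∣ j) (hK : Nat.card π.ker = 3 * i) (hi : ¬ 3 ∣ i) {g : G}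
    (hg : orderOf (π g) = 3) : ∃ x z, π z = 1 ∧ z ≠ 1 ∧ x * g * x⁻¹ = z * g := by
  classical
  have hG : Nat.card G = 3 ^ 3 * (i * j) := by rw [h.natCard_eq, hA, hK]; ring
  have hij : ¬ 3 ∣ i * j := fun hd => (Nat.prime_three.dvd_mul.1 hd).elim hi hj
  obtain ⟨z₀, hz₀⟩ := exists_prime_orderOf_dvd_card' (G := π.ker) 3 (hK ▸ dvd_mul_right _ _)
  have hz₀' : orderOf (z₀ : G) = 3 := by rwa [Subgroup.orderOf_coe]
  have hz₀c : (z₀ : G) ∈ Subgroup.center G := h.central z₀.2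
  have hco : Nat.Coprime 3 i := (Nat.Prime.coprime_iff_not_dvd Nat.prime_three).2 hi
  -- `g ^ e` is a 3-element with the same image as `g`, so it lies in some Sylow 3-subgroup `P`.
  obtain ⟨e, he1, he0⟩ := Nat.chineseRemainder hco 1 0
  obtain ⟨k, hk⟩ := (Nat.modEq_zero_iff_dvd).1 he0
  have hπe : π (g ^ e) = π g := by
    rw [map_pow]
    conv_rhs => rw [← pow_one (π g)]
    exact pow_eq_pow_iff_modEq.2 (hg ▸ he1)
  have hg9 : (g ^ e) ^ 9 = 1 := by
    have h3 : π (g ^ 3) = 1 := by rw [map_pow, ← hg, pow_orderOf_eq_one]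
    have := pow_card_ker h3
    rw [hK] at this
    rw [hk, ← pow_mul, show i * k * 9 = 3 * (3 * i) * k by ring, pow_mul, pow_mul, this, one_pow]
  have hp : IsPGroup 3 (Subgroup.zpowers (g ^ e)) := by
    intro x
    refine ⟨2, ?_⟩
    obtain ⟨n, hn⟩ := x.2
    refine Subtype.ext ?_
    rw [Subgroup.coe_pow, ← hn, Subgroup.coe_one]
    change ((g ^ e) ^ n) ^ (9 : ℕ) = 1
    rw [← zpow_natCast, ← zpow_mul, mul_comm, zpow_mul, zpow_natCast, hg9, one_zpow]
  obtain ⟨P, hP⟩ := hp.exists_le_sylow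
  have hgP : g ^ e ∈ P := hP (Subgroup.mem_zpowers _)
  have hzP : (z₀ : G) ∈ P := zpowers_le_sylow P hz₀c hz₀'
  have hPcard : Nat.card P = 27 := by
    rw [P.card_eq_multiplicity, hG, factorization_three_pow_mul hij]; norm_num
  have hPidx : (P : Subgroup G).index = i * j := by
    have := (P : Subgroup G).card_mul_index
    rw [hPcard, hG] at this
    omega
  -- If `g ^ e` were central in `P`, the centre of `P` would have order at least 9 and index at most
  -- 3, so `P` would be abelian; transfer to `P` would then kill the central element `z₀`.
  obtain ⟨x, hxP, hx⟩ : ∃ x ∈ P, x * g ^ e ≠ g ^ e * x := by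
    by_contra! hcomm
    let C := Subgroup.center P
    have hgC : (⟨g ^ e, hgP⟩ : P) ∈ C :=
      Subgroup.mem_center_iff.2 fun y => Subtype.ext (hcomm y y.2)
    have hzC : (⟨z₀, hzP⟩ : P) ∈ C := Subgroup.mem_center_iff.2 fun y => Subtype.ext
      (Subgroup.mem_center_iff.1 hz₀c y)
    let f : C →* A := (π.comp (P : Subgroup G).subtype).comp C.subtype
    have h1 : 3 ∣ Nat.card f.ker := by
      have : orderOf (⟨⟨⟨z₀, hzP⟩, hzC⟩, z₀.2⟩ : f.ker) = 3 := by
        rw [← Subgroup.orderOf_coe, ← Subgroup.orderOf_coe, ← Subgroup.orderOf_coe]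
        exact hz₀'
      exact this.symm.dvd.trans (orderOf_dvd_natCard _)
    have h2 : 3 ∣ Nat.card f.range := by
      have : orderOf (⟨π (g ^ e), ⟨⟨_, hgC⟩, rfl⟩⟩ : f.range) = 3 := by
        refine (Subgroup.orderOf_coe _).symm.trans ?_
        change orderOf (π (g ^ e)) = 3
        rw [hπe, hg]
      exact this.symm.dvd.trans (orderOf_dvd_natCard _)
    have h3 : 9 ∣ Nat.card C := by
      rw [← f.ker.card_mul_index, Subgroup.index_ker]
      exact Nat.mul_dvd_mul h1 h2
    have h4 : C.index ∣ 3 := by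
      have := C.card_mul_index
      rw [hPcard] at this
      obtain ⟨m, hm⟩ := h3
      rw [hm] at this
      exact ⟨m, by nlinarith⟩
    have : IsCyclic (P ⧸ C) := isCyclic_of_card_dvd_prime (p := 3) h4
    have hab : IsMulCommutative P := isMulCommutative_of_isCyclic_quotient_center_self P
    let _ : CommGroup P := { (inferInstance : Group P) with mul_comm := hab.is_comm.comm }
    have h5 := map_eq_one_of_coprime_index (MonoidHom.id P) hz₀c hzP (by
      rw [hz₀', hPidx]
      exact (Nat.Prime.coprime_iff_not_dvd Nat.prime_three).2 hij)
    have h6 : (z₀ : G) = 1 := congrArg Subtype.val h5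
    rw [h6, orderOf_one] at hz₀'
    omega
  -- The image of `P` has order 9 and is abelian, so the commutator of `x` with `g ^ e` lies in the
  -- kernel.
  have hmap : Nat.card ((P : Subgroup G).map π) = 3 ^ 2 := by
    have h1 : ((P : Subgroup G).map π).index ∣ i * j := hPidx ▸ Subgroup.index_map_dvd _ h.surj
    have h2 := ((P : Subgroup G).map π).card_mul_index
    have h3 : Nat.card ((P : Subgroup G).map π) ∣ 3 ^ 3 := by
      have := Subgroup.card_map_dvd (P : Subgroup G) π
      rwa [hPcard] at this
    obtain ⟨m, hm, hm'⟩ := (Nat.dvd_prime_pow Nat.prime_three).1 h3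
    rw [hm', hA] at h2
    have h4 : ¬ 3 ∣ ((P : Subgroup G).map π).index := fun hd => hij (hd.trans h1)
    rw [hm']
    interval_cases m <;> omega
  have hcomm : π x * π (g ^ e) = π (g ^ e) * π x := by
    have hab : IsMulCommutative ((P : Subgroup G).map π) :=
      IsPGroup.isMulCommutative_of_card_eq_prime_sq hmap
    exact congrArg Subtype.val (hab.is_comm.comm ⟨π x, x, hxP, rfl⟩ ⟨π (g ^ e), _, hgP, rfl⟩)
  refine ⟨x, x * g ^ e * x⁻¹ * (g ^ e)⁻¹, ?_, ?_, ?_⟩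
  · rw [map_mul, map_mul, map_mul, hcomm, map_inv, map_inv]; group
  · intro hc
    rw [mul_inv_eq_one, mul_inv_eq_iff_eq_mul] at hc
    exact hx hc
  · obtain ⟨y, hy, hgy⟩ := h.exists_ker_mul hπe.symm
    have hyc := h.mul_comm_of_ker hy
    generalize g ^ e = g' at hgy
    rw [hgy, ← hyc g']
    simp only [mul_assoc, inv_mul_cancel_left]
    rw [hyc]

end Transfer

section Split

variable {H : Type u} {B : Type v} [Group H] [Finite H] [Group B] {σ : H →* B}

theorem bijective_prod {H : Type u} {C : Type v} {K : Type w} [Group H] [Finite H] [Group C]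
    [Group K] [Finite C] [Finite K] (W : H →* C) (τ : H →* K)
    (hker : ∀ g, τ g = 1 → W g = 1 → g = 1) (hcard : Nat.card H = Nat.card C * Nat.card K) :
    Function.Bijective (W.prod τ) := by
  refine (Nat.bijective_iff_injective_and_card _).2 ⟨(injective_iff_map_eq_one _).2 fun g hg => ?_,
    by rw [hcard, Nat.card_prod]⟩
  have := Prod.ext_iff.1 hg
  exact hker g this.2 this.1

theorem map_eq_one_of_mem_zpowers {C : Type w} [Group C] {z : H} (hz : (orderOf z).Prime) (W : H →* C)
    (hW : W z ≠ 1) {g : H} (hg : g ∈ Subgroup.zpowers z) (h1 : W g = 1) : g = 1 := by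
  obtain ⟨n, rfl⟩ := hg
  have h2 : orderOf (W z) = orderOf z :=
    ((Nat.dvd_prime hz).1 (orderOf_map_dvd W z)).resolve_left fun h => hW (orderOf_eq_one_iff.1 h)
  change z ^ n = 1
  rw [← orderOf_dvd_iff_zpow_eq_one, ← h2, orderOf_dvd_iff_zpow_eq_one, ← map_zpow]
  exact h1

/-- A Sylow 3-subgroup has order 9, hence is abelian, and the transfer to it does not kill the
central element `z` of order three. Modulo ⟨z⟩ the transfer factors through `B`, where it is trivial
by assumption, so it takes its values in ⟨z⟩. -/
theorem CentralExt.exists_hom_zmod_three [Finite B] (h : CentralExt σ) {i j : ℕ}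
    (hB : Nat.card B = 3 * j) (hj : ¬ 3 ∣ j) (hK : Nat.card σ.ker = 3 * i) (hi : ¬ 3 ∣ i)
    (hom : ∀ (f : B →* Multiplicative (ZMod 3)) b, f b = 1) :
    ∃ (z : H) (W : H →* Multiplicative (ZMod 3)), σ z = 1 ∧ orderOf z = 3 ∧ W z ≠ 1 := by
  classical
  have hH : Nat.card H = 3 ^ 2 * (i * j) := by rw [h.natCard_eq, hB, hK]; ring
  have hij : ¬ 3 ∣ i * j := fun hd => (Nat.prime_three.dvd_mul.1 hd).elim hi hj
  obtain ⟨z₀, hz₀⟩ := exists_prime_orderOf_dvd_card' (G := σ.ker) 3 (hK ▸ dvd_mul_right _ _)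
  obtain ⟨z, hz⟩ := z₀
  rw [← Subgroup.orderOf_coe] at hz₀
  change orderOf z = 3 at hz₀
  have hzc : z ∈ Subgroup.center H := h.central hz
  obtain ⟨P, hzP, hPcard⟩ : ∃ P : Subgroup H, z ∈ P ∧ Nat.card P = 3 ^ 2 := by
    obtain ⟨P⟩ : Nonempty (Sylow 3 H) := inferInstance
    refine ⟨P, zpowers_le_sylow P hzc hz₀, ?_⟩
    rw [P.card_eq_multiplicity, hH, factorization_three_pow_mul hij]
  have hPidx : P.index = i * j := by
    have := P.card_mul_index
    rw [hPcard, hH] at this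
    omega
  have hab : IsMulCommutative P := IsPGroup.isMulCommutative_of_card_eq_prime_sq hPcard
  let _ : CommGroup P := { (inferInstance : Group P) with mul_comm := hab.is_comm.comm }
  let V : H →* P := (MonoidHom.id P).transfer
  let z' : P := ⟨z, hzP⟩
  have hz' : orderOf z' = 3 := (Subgroup.orderOf_coe z').symm.trans hz₀
  have hV : V z = z' ^ (i * j) := by
    have h1 := MonoidHom.transfer_eq_pow (MonoidHom.id P) z fun k g _ => by
      rw [mul_assoc, ← Subgroup.mem_center_iff.1 ((Subgroup.center H).pow_mem hzc k) g,
        inv_mul_cancel_left]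
    refine h1.trans (Subtype.ext ?_)
    rw [Subgroup.coe_pow, ← hPidx]
    rfl
  have hcardQ : Nat.card (P ⧸ Subgroup.zpowers z') = 3 := by
    have := (Subgroup.zpowers z').card_mul_index
    rw [hPcard, Nat.card_zpowers, hz'] at this
    have h2 : (Subgroup.zpowers z').index = 3 := by omega
    exact h2
  have hcardM : Nat.card (Multiplicative (ZMod 3)) = 3 := by
    rw [Nat.card_eq_fintype_card]; rfl
  let e₁ : P ⧸ Subgroup.zpowers z' ≃* Multiplicative (ZMod 3) :=
    mulEquivOfPrimeCardEq hcardQ hcardM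
  let F : H →* Multiplicative (ZMod 3) :=
    e₁.toMonoidHom.comp ((QuotientGroup.mk' (Subgroup.zpowers z')).comp V)
  have hFV : ∀ g, F g = 1 ↔ V g ∈ Subgroup.zpowers z' := fun g =>
    (EmbeddingLike.map_eq_one_iff (f := e₁)).trans (QuotientGroup.eq_one_iff _)
  have hFz : F z = 1 := by
    rw [hFV, hV]
    exact Subgroup.pow_mem _ (Subgroup.mem_zpowers z') _
  -- The kernel of σ modulo ⟨z⟩ has order prime to three, so a map to a group of order three which
  -- kills `z` kills the whole kernel.
  have hFker : σ.ker ≤ F.ker := by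
    intro y hy
    let N : Subgroup σ.ker := Subgroup.zpowers ⟨z, hz⟩
    have hN : N.Normal := ⟨fun n hn g => by
      have : g * n * g⁻¹ = n := by
        rw [mul_inv_eq_iff_eq_mul]
        exact Subtype.ext (h.mul_comm_of_ker n.2 g)
      rwa [this]⟩
    have hNi : N.index = i := by
      have h1 := N.card_mul_index
      rw [hK, Nat.card_zpowers, ← Subgroup.orderOf_coe] at h1
      change orderOf z * _ = _ at h1
      rw [hz₀] at h1
      omega
    obtain ⟨n, hn⟩ := N.pow_index_mem ⟨y, hy⟩
    have h2 : z ^ n = y ^ i := hNi ▸ congrArg Subtype.val hn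
    have h3 : F y ^ i = 1 := by rw [← map_pow, ← h2, map_zpow, hFz, one_zpow]
    have h4 : F y ^ 3 = 1 := by
      have := pow_card_eq_one' (x := F y)
      rwa [hcardM] at this
    exact orderOf_eq_one_iff.1 (Nat.dvd_one.1
      (((Nat.Prime.coprime_iff_not_dvd Nat.prime_three).2 hi).gcd_eq_one ▸
        Nat.dvd_gcd (orderOf_dvd_of_pow_eq_one h4) (orderOf_dvd_of_pow_eq_one h3)))
  have hF : ∀ g, F g = 1 := fun g => by
    have h1 := hom (σ.liftOfSurjective h.surj ⟨F, hFker⟩) (σ g)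
    rwa [MonoidHom.liftOfRightInverse_comp_apply] at h1
  have hcardN : Nat.card (Subgroup.zpowers z') = 3 := by rw [Nat.card_zpowers, hz']
  let e₂ : Subgroup.zpowers z' ≃* Multiplicative (ZMod 3) := mulEquivOfPrimeCardEq hcardN hcardM
  refine ⟨z, e₂.toMonoidHom.comp (V.codRestrict _ fun g => (hFV g).1 (hF g)), hz, hz₀, fun h1 => ?_⟩
  have h2 := congrArg Subtype.val ((EmbeddingLike.map_eq_one_iff (f := e₂)).1 h1)
  change V z = 1 at h2
  rw [hV, ← orderOf_dvd_iff_pow_eq_one, hz'] at h2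
  exact hij h2

/-- A central extension of `B` by a group of order three splits if three divides the order of `B`
exactly once and `B` has no quotient of order three. -/
theorem CentralExt.nonempty_equiv_prod [Finite B] (h : CentralExt σ) {j : ℕ}
    (hB : Nat.card B = 3 * j) (hj : ¬ 3 ∣ j) (hK : Nat.card σ.ker = 3)
    (hom : ∀ (f : B →* Multiplicative (ZMod 3)) b, f b = 1) :
    Nonempty (H ≃* Multiplicative (ZMod 3) × B) := by
  obtain ⟨z, W, hz, hz3, hW⟩ := h.exists_hom_zmod_three (i := 1) hB hj hK (by norm_num) hom
  refine ⟨MulEquiv.ofBijective (W.prod σ) (bijective_prod W σ (fun g hg h1 =>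
    map_eq_one_of_mem_zpowers (by rw [hz3]; exact Nat.prime_three) W hW ?_ h1) ?_)⟩
  · have h2 : (⟨g, hg⟩ : σ.ker) ∈ Subgroup.zpowers (⟨z, hz⟩ : σ.ker) :=
      mem_zpowers_of_prime_card hK fun h0 => by
        have := congrArg Subtype.val h0
        change z = 1 at this
        rw [this, orderOf_one] at hz3
        omega
    obtain ⟨n, hn⟩ := h2
    exact ⟨n, congrArg Subtype.val hn⟩
  · rw [h.natCard_eq, hK, Nat.card_eq_fintype_card (α := Multiplicative (ZMod 3))]; rfl

theorem hom_zmod_three_eq_one [Finite B] [Group.IsPerfect B] (f : B →* Multiplicative (ZMod 3))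
    (b : B) : f b = 1 := by
  have h := Abelianization.commutator_subset_ker f
  rw [Group.IsPerfect.commutator_eq_top] at h
  exact h (Subgroup.mem_top b)

end Split

end ImprimitiveCovers

namespace ImprimitiveCovers

open Equiv
open scoped commutatorElement

theorem hom_perm_zmod_three_eq_one {n : ℕ} (f : Perm (Fin n) →* Multiplicative (ZMod 3))
    (b : Perm (Fin n)) : f b = 1 := by
  induction b using Perm.swap_induction_on with
  | one => exact map_one f
  | swap_mul b x y _ hb =>
    have h2 : f (swap x y) ^ 2 = 1 := by rw [← map_pow, pow_two, swap_mul_self, map_one]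
    have h3 : ∀ c : Multiplicative (ZMod 3), c ^ 2 = 1 → c = 1 := by decide
    rw [map_mul, hb, h3 _ h2, one_mul]

/-! ### Covering groups as central extensions -/

section Covers

variable {G : Type u} [Group G]

theorem isPerfect_of_surjective {K : Type v} [Group K] [Group.IsPerfect G] {f : G →* K}
    (hf : Function.Surjective f) : Group.IsPerfect K := by
  refine ⟨?_⟩
  have := Subgroup.map_commutator (⊤ : Subgroup G) ⊤ f
  rw [Subgroup.map_top_of_surjective f hf, ← commutator_def, ← commutator_def,
    Group.IsPerfect.commutator_eq_top, Subgroup.map_top_of_surjective f hf] at this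
  exact this.symm

theorem CentralExt.ker_eq_center {n : ℕ} (hn : 5 ≤ n) {π : G →* Alt n} (h : CentralExt π) :
    π.ker = Subgroup.center G := by
  refine le_antisymm h.central fun z hz => ?_
  have : π z ∈ Subgroup.center (Alt n) := Subgroup.mem_center_iff.2 fun a => by
    obtain ⟨g, rfl⟩ := h.surj a
    rw [← map_mul, Subgroup.mem_center_iff.1 hz g, map_mul]
  rw [center_alt hn] at this
  exact this

theorem IsCover.exists_centralExt {m n : ℕ} (hn : 5 ≤ n) (h : IsCover m n G) :
    ∃ π : G →* Alt n, CentralExt π ∧ Nat.card π.ker = m := by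
  obtain ⟨-, h2, ⟨e⟩⟩ := h
  have hc : CentralExt (e.toMonoidHom.comp (QuotientGroup.mk' (Subgroup.center G))) :=
    ⟨e.surjective.comp (QuotientGroup.mk'_surjective _), fun z hz =>
      (QuotientGroup.eq_one_iff z).1 ((EmbeddingLike.map_eq_one_iff (f := e)).1 hz)⟩
  exact ⟨_, hc, by rw [hc.ker_eq_center hn, h2]⟩

theorem CentralExt.isCover {n : ℕ} (hn : 5 ≤ n) {π : G →* Alt n} (h : CentralExt π)
    (hG : Group.IsPerfect G) : IsCover (Nat.card π.ker) n G :=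
  ⟨hG, by rw [h.ker_eq_center hn], ⟨(QuotientGroup.quotientMulEquivOfEq
    (h.ker_eq_center hn).symm).trans (QuotientGroup.quotientKerEquivOfSurjective π h.surj)⟩⟩

theorem CentralExt.comp_equiv {A : Type v} [Group A] {π : G →* A} (h : CentralExt π) {K : Type w}
    [Group K] (e : K ≃* G) : CentralExt (π.comp e.toMonoidHom) :=
  ⟨h.surj.comp e.surjective, fun z hz => Subgroup.mem_center_iff.2 fun g => e.injective <| by
    rw [map_mul, map_mul]
    exact Subgroup.mem_center_iff.1 (h.central (show π (e z) = 1 from hz)) (e g)⟩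

theorem IsCover.congr {m n : ℕ} (hn : 5 ≤ n) {K : Type v} [Group K] (h : IsCover m n G)
    (e : K ≃* G) : IsCover m n K := by
  obtain ⟨π, hπ, hm⟩ := h.exists_centralExt hn
  have hG := h.1
  have := (hπ.comp_equiv e).isCover hn (isPerfect_of_surjective (f := e.symm.toMonoidHom) e.symm.surjective)
  have hk : Nat.card (π.comp e.toMonoidHom).ker = m := by
    rw [← hm]
    exact Nat.card_congr
      { toFun := fun z => ⟨e z, z.2⟩
        invFun := fun z => ⟨e.symm z, by
          change π (e (e.symm z)) = 1
          rw [e.apply_symm_apply]; exact z.2⟩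
        left_inv := fun z => Subtype.ext (e.symm_apply_apply _)
        right_inv := fun z => Subtype.ext (e.apply_symm_apply _) }
  rwa [hk] at this

end Covers

/-! ### Involutions of `A₆` in 6·A₆ -/

section Involution

def quad : Alt 6 := ⟨c[0, 1, 2, 3] * c[4, 5], Perm.mem_alternatingGroup.2 (by decide +kernel)⟩

def refl : Alt 6 := ⟨swap 0 2 * swap 4 5, Perm.mem_alternatingGroup.2 (by decide +kernel)⟩

/-- The centralizer of the involution `quad ^ 2` is a dihedral group of order 8; its index 45 is
odd, as transfer requires. -/
theorem mem_centralizer_quad : ∀ a : Alt 6, quad ^ 2 * a = a * quad ^ 2 →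
    ∃ i : Fin 4, ∃ e : Fin 2, a = quad ^ (i : ℕ) * refl ^ (e : ℕ) := by decide +kernel

theorem card_centralizer_quad :
    (Finset.univ.filter fun a : Alt 6 => quad ^ 2 * a = a * quad ^ 2).card = 8 := by decide +kernel

theorem index_centralizer_quad : (Subgroup.centralizer {quad ^ 2}).index = 45 := by
  have h1 := (Subgroup.centralizer {quad ^ 2}).card_mul_index
  have h2 : Nat.card (Subgroup.centralizer {quad ^ 2}) = 8 := by
    rw [← card_centralizer_quad, ← Fintype.card_subtype, ← Nat.card_eq_fintype_card]
    exact Nat.card_congr (Equiv.subtypeEquivRight fun a => by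
      rw [Subgroup.mem_centralizer_singleton_iff, eq_comm])
  rw [h2, natCard_alt_six] at h1
  omega

/-- In a dihedral group, finite or not, the commutator subgroup is generated by the square of the
rotation. -/
theorem exists_commutator_eq_zpow {D : Type*} [Group D] {S X : D} (hS : S * S = 1)
    (hX : S * X * S = X⁻¹) (i j : ℤ) (e f : Fin 2) :
    ∃ k : ℤ, ⁅X ^ i * S ^ (e : ℕ), X ^ j * S ^ (f : ℕ)⁆ = (X ^ 2) ^ k := by
  have hinv : S⁻¹ = S := inv_eq_of_mul_eq_one_right hS
  have key : ∀ m : ℤ, S * X ^ m * S = X ^ (-m) := fun m => by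
    have := conj_zpow (a := S) (b := X) (i := m)
    rw [hinv, hX] at this
    rw [← this, zpow_neg, inv_zpow]
  have h2 : ∀ k : ℤ, (X ^ 2) ^ k = X ^ (2 * k) := fun k => by
    rw [← zpow_natCast, ← zpow_mul]; rfl
  simp only [commutatorElement_def, mul_inv_rev, h2, ← zpow_neg]
  fin_cases e <;> fin_cases f <;> simp only [pow_zero, pow_one, mul_one, one_mul, inv_one, hinv]
  · refine ⟨0, ?_⟩
    simp only [← zpow_add]
    congr 1; ring
  · refine ⟨i, ?_⟩
    rw [show X ^ i * (X ^ j * S) * X ^ (-i) * (S * X ^ (-j))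
      = X ^ i * X ^ j * (S * X ^ (-i) * S) * X ^ (-j) by simp only [mul_assoc], key]
    simp only [← zpow_add]
    congr 1; ring
  · refine ⟨-j, ?_⟩
    rw [show X ^ i * S * X ^ j * (S * X ^ (-i)) * X ^ (-j)
      = X ^ i * (S * X ^ j * S) * X ^ (-i) * X ^ (-j) by simp only [mul_assoc], key]
    simp only [← zpow_add]
    congr 1; ring
  · refine ⟨i - j, ?_⟩
    rw [show X ^ i * S * (X ^ j * S) * (S * X ^ (-i)) * (S * X ^ (-j))
      = X ^ i * (S * X ^ j * S) * (S * X ^ (-i) * S) * X ^ (-j) by simp only [mul_assoc], key, key]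
    simp only [← zpow_add]
    congr 1; ring

/-- The involutions of `A₆` do not lift to involutions of `6·A₆`. -/
theorem sq_ne_one_of_orderOf_two {G : Type u} [Group G] [Finite G] [Group.IsPerfect G]
    {π : G →* Alt 6} (h : CentralExt π) (hK : Nat.card π.ker = 6) {g : G}
    (hg : orderOf (π g) = 2) : g ^ 2 ≠ 1 := by
  intro hg2
  -- All involutions of `A₆` are conjugate, so if one lifts to an involution then all do.
  have hlift : ∀ a : Alt 6, orderOf a = 2 → ∃ S, π S = a ∧ S * S = 1 ∧ IsConj g S := by
    intro a ha
    obtain ⟨b, hb⟩ := isConj_iff.1 (isConj_two_alt_six hg ha)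
    obtain ⟨c, rfl⟩ := h.surj b
    refine ⟨c * g * c⁻¹, by simpa using hb, ?_, isConj_iff.2 ⟨c, rfl⟩⟩
    rw [← pow_two, conj_pow, hg2, mul_one, mul_inv_cancel]
  obtain ⟨S, hS, hS2, -⟩ := hlift refl (orderOf_eq_prime (by decide +kernel) (by decide +kernel))
  obtain ⟨U, hU, hU2, -⟩ := hlift (refl * quad)
    (orderOf_eq_prime (by decide +kernel) (by decide +kernel))
  obtain ⟨X, hX⟩ : ∃ X, X = S * U := ⟨_, rfl⟩
  have hπX : π X = quad := by
    rw [hX, map_mul, hS, hU, ← mul_assoc, show refl * refl = 1 by decide +kernel, one_mul]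
  have hSX : S * X * S = X⁻¹ := by
    rw [hX, mul_inv_rev, inv_eq_of_mul_eq_one_right hS2, inv_eq_of_mul_eq_one_right hU2,
      ← mul_assoc, hS2, one_mul]
  obtain ⟨z₀, hz₀⟩ := exists_prime_orderOf_dvd_card' (G := π.ker) 2 (by rw [hK]; norm_num)
  obtain ⟨z, hz⟩ := z₀
  rw [← Subgroup.orderOf_coe] at hz₀
  change orderOf z = 2 at hz₀
  let Q : Subgroup G := (Subgroup.centralizer {quad ^ 2}).comap π
  have hQi : Q.index = 45 := by
    rw [Subgroup.index_comap_of_surjective _ h.surj, index_centralizer_quad]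
  have hzQ : z ∈ Q := by
    rw [Subgroup.mem_comap, show π z = 1 from hz]
    exact Subgroup.one_mem _
  -- By transfer the central involution `z` is a product of commutators of `Q`. But `Q` is generated
  -- by the kernel and the two lifted involutions, so its commutators are powers of `X ^ 2`.
  have hmem := mem_commutator_of_coprime_index (h.central hz) hzQ (by rw [hz₀, hQi]; norm_num)
  have hform : ∀ q ∈ Q, ∃ y, π y = 1 ∧ ∃ (i : ℤ) (e : Fin 2), q = y * (X ^ i * S ^ (e : ℕ)) := by
    intro q hq
    obtain ⟨i, e, hie⟩ := mem_centralizer_quad (π q)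
      (Subgroup.mem_centralizer_singleton_iff.1 hq).symm
    obtain ⟨y, hy, hqy⟩ := h.exists_ker_mul (g := q) (g' := X ^ (i : ℤ) * S ^ (e : ℕ))
      (by rw [hie, map_mul, map_zpow, map_pow, hπX, hS]; rfl)
    exact ⟨y, hy, i, e, hqy⟩
  have hle : commutator Q ≤ (Subgroup.zpowers (X ^ 2)).comap Q.subtype := by
    rw [commutator_def, Subgroup.commutator_le]
    rintro ⟨p, hp⟩ - ⟨q, hq⟩ -
    obtain ⟨y, hy, i, e, rfl⟩ := hform p hp
    obtain ⟨x, hx, j, f, rfl⟩ := hform q hq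
    obtain ⟨k, hk⟩ := exists_commutator_eq_zpow hS2 hSX i j e f
    refine ⟨k, ?_⟩
    change (X ^ 2) ^ k = ⁅y * (X ^ i * S ^ (e : ℕ)), x * (X ^ j * S ^ (f : ℕ))⁆
    rw [← hk]
    generalize X ^ i * S ^ (e : ℕ) = a
    generalize X ^ j * S ^ (f : ℕ) = b
    have cy := h.mul_comm_of_ker hy
    have cx := h.mul_comm_of_ker hx
    rw [commutatorElement_def, commutatorElement_def]
    rw [show y * a * (x * b) * (y * a)⁻¹ * (x * b)⁻¹
        = y * (a * (x * b) * a⁻¹) * y⁻¹ * (x * b)⁻¹ by simp only [mul_inv_rev, mul_assoc],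
      ← cy, mul_inv_cancel_right, show a * (x * b) * a⁻¹ * (x * b)⁻¹
        = a * (x * (b * a⁻¹ * b⁻¹)) * x⁻¹ by simp only [mul_inv_rev, mul_assoc],
      ← cx, ← mul_assoc, mul_inv_cancel_right]
    simp only [mul_assoc]
  obtain ⟨k, hk⟩ := hle hmem
  change (X ^ 2) ^ k = z at hk
  have h1 : (quad ^ 2) ^ k = 1 := by
    rw [← hπX, ← map_pow, ← map_zpow, hk]; exact hz
  obtain ⟨l, rfl⟩ : (2 : ℤ) ∣ k := by
    have h2 : orderOf (quad ^ 2) = 2 := orderOf_eq_prime (by decide +kernel) (by decide +kernel)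
    have := orderOf_dvd_iff_zpow_eq_one.2 h1
    rwa [h2] at this
  obtain ⟨T, hT, hT2, -⟩ := hlift (quad ^ 2)
    (orderOf_eq_prime (by decide +kernel) (by decide +kernel))
  obtain ⟨y, hy, hXy⟩ := h.exists_ker_mul (g := X ^ 2) (g' := T) (by rw [map_pow, hπX, hT])
  have hy6 := pow_card_ker hy
  rw [hK] at hy6
  -- `X ^ 2` is a central `y` times an involution. Since `z` is an even power of `X ^ 2`, it is a
  -- power of `y ^ 2`, which has odd order.
  have h3 : (X ^ 2) ^ 2 = y ^ 2 := by
    have hc : Commute y T := (h.mul_comm_of_ker hy T).symm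
    rw [hXy, hc.mul_pow, pow_two T, hT2, mul_one]
  have h4 : z ^ 3 = 1 := by
    rw [← hk, zpow_mul, show ((X ^ 2) ^ (2 : ℤ)) = y ^ 2 from (zpow_natCast _ 2).trans h3, ← zpow_natCast, ← zpow_mul,
      mul_comm, zpow_mul, zpow_natCast, ← pow_mul, hy6, one_zpow]
  have := orderOf_dvd_of_pow_eq_one h4
  rw [hz₀] at this
  omega

end Involution

/-! ### Recognition of 3 × 2·A₅ -/

section DoubleCover

/-- `IsThreeTimesDoubleA5` asks for the factor in the lowest universe; a finite group can be moved
there. -/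
theorem exists_equiv_type (K : Type u) [Group K] [Finite K] :
    ∃ (K' : Type) (_ : Group K'), Nonempty (K' ≃* K) :=
  ⟨Shrink.{0} K, inferInstance,
    ⟨{ (equivShrink.{0} K).symm with map_mul' := fun a b => equivShrink_symm_mul a b }⟩⟩

/-- Transfer splits off the subgroup `N` of order three. The quotient by `N` is an extension of A₅
by a group of order two; were it not perfect, its commutator subgroup would be a copy of A₅ and
involutions of A₅ would lift to involutions of `H`. -/
theorem IsThreeTimesDoubleA5.intro {H : Type u} [Group H] [Finite H] {σ : H →* Alt 5}
    (h : CentralExt σ) (hK : Nat.card σ.ker = 6) (h2 : ∀ g, orderOf (σ g) = 2 → g ^ 2 ≠ 1) :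
    IsThreeTimesDoubleA5 H := by
  classical
  have := isPerfect_alt (n := 5) le_rfl
  obtain ⟨z, W, hz, hz3, hW⟩ := h.exists_hom_zmod_three (i := 2) (j := 20)
    (by rw [natCard_alt_five]) (by norm_num) hK (by norm_num) hom_zmod_three_eq_one
  let N := Subgroup.zpowers z
  have hN : N.Normal := ⟨fun n hn g => by
    obtain ⟨k, rfl⟩ := hn
    have : g * z ^ k * g⁻¹ = z ^ k := by
      rw [mul_inv_eq_iff_eq_mul, ← Subgroup.mem_center_iff.1
        ((Subgroup.center H).zpow_mem (h.central hz) k) g]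
    exact ⟨k, this.symm⟩⟩
  have hNle : N ≤ σ.ker := by rw [Subgroup.zpowers_le]; exact hz
  have hcH : Nat.card H = 360 := by rw [h.natCard_eq, hK, natCard_alt_five]
  have hcK : Nat.card (H ⧸ N) = 120 := by
    have := N.card_mul_index
    rw [hcH, Nat.card_zpowers, hz3] at this
    change 3 * Nat.card (H ⧸ N) = _ at this
    omega
  let σ' : H ⧸ N →* Alt 5 := QuotientGroup.lift N σ hNle
  have hσ' : ∀ g : H, σ' (QuotientGroup.mk g) = σ g := fun g => rfl
  have hc : CentralExt σ' := by
    refine ⟨fun a => ?_, fun y hy => Subgroup.mem_center_iff.2 fun g => ?_⟩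
    · obtain ⟨g, rfl⟩ := h.surj a
      exact ⟨QuotientGroup.mk g, rfl⟩
    · obtain ⟨y, rfl⟩ := QuotientGroup.mk_surjective y
      obtain ⟨g, rfl⟩ := QuotientGroup.mk_surjective g
      rw [← QuotientGroup.mk_mul, h.mul_comm_of_ker hy, QuotientGroup.mk_mul]
  have hker : Nat.card σ'.ker = 2 := by
    have := hc.natCard_eq
    rw [hcK, natCard_alt_five] at this
    omega
  have hperf : Group.IsPerfect (H ⧸ N) := by
    refine ⟨?_⟩
    have hmap : (commutator (H ⧸ N)).map σ' = ⊤ := by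
      rw [commutator_def, Subgroup.map_commutator, Subgroup.map_top_of_surjective _ hc.surj,
        ← commutator_def, Group.IsPerfect.commutator_eq_top]
    by_contra hne
    -- The commutator subgroup maps onto `A₅`, so its order is a multiple of 60, and a proper
    -- subgroup of a group of order 120 can only have order 60.
    have h60 : Nat.card (commutator (H ⧸ N)) = 60 := by
      have h1 := Subgroup.card_map_dvd (commutator (H ⧸ N)) σ'
      rw [hmap, Subgroup.card_top, natCard_alt_five] at h1
      obtain ⟨m, hm⟩ := h1
      have h3 := (commutator (H ⧸ N)).card_mul_index
      have h4 : (commutator (H ⧸ N)).index ≠ 1 := fun h => hne (Subgroup.index_eq_one.1 h)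
      rw [hcK, hm, mul_assoc] at h3
      have h5 : m * (commutator (H ⧸ N)).index = 2 := by omega
      have h6 : m = 1 := by
        rcases (Nat.dvd_prime Nat.prime_two).1 (Dvd.intro _ h5) with h | h
        · exact h
        · rw [h] at h5; omega
      rw [hm, h6]
    obtain ⟨a, ha⟩ := exists_prime_orderOf_dvd_card' (G := Alt 5) 2
      (by rw [natCard_alt_five]; norm_num)
    have hbij : Function.Bijective fun d : commutator (H ⧸ N) => σ' d := by
      refine (Nat.bijective_iff_surjective_and_card _).2 ⟨fun b => ?_, by
        rw [h60, natCard_alt_five]⟩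
      obtain ⟨d, hd, hdb⟩ : b ∈ (commutator (H ⧸ N)).map σ' := hmap ▸ Subgroup.mem_top b
      exact ⟨⟨d, hd⟩, hdb⟩
    obtain ⟨d, hd⟩ := hbij.2 a
    have hd2 : d ^ 2 = 1 := hbij.1 (by
      change σ' ((d ^ 2 : commutator (H ⧸ N)) : H ⧸ N) = σ' ((1 : commutator (H ⧸ N)) : H ⧸ N)
      rw [Subgroup.coe_pow, map_pow, Subgroup.coe_one, map_one]
      rw [show σ' d = a from hd, ← ha, pow_orderOf_eq_one])
    obtain ⟨g, hg⟩ := QuotientGroup.mk_surjective (d : H ⧸ N)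
    have hga : σ g = a := by rw [← hσ', hg]; exact hd
    have hgN : g ^ 2 ∈ N := by
      rw [← QuotientGroup.eq_one_iff, QuotientGroup.mk_pow, hg, ← Subgroup.coe_pow, hd2]; rfl
    -- The square of `g` lies in `N`, of order three, so the cube of `g` squares to 1 while still
    -- lying above the involution.
    have hg6 : (g ^ 3) ^ 2 = 1 := by
      obtain ⟨k, hk⟩ := hgN
      have hk' : z ^ k = g ^ 2 := hk
      rw [← pow_mul, mul_comm, pow_mul, ← hk', ← zpow_natCast, ← zpow_mul, mul_comm, zpow_mul,
        zpow_natCast, ← hz3, pow_orderOf_eq_one, one_zpow]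
    refine h2 (g ^ 3) ?_ hg6
    rw [map_pow, hga, pow_succ, ← ha, pow_orderOf_eq_one, one_mul]
  have e₁ : Nonempty (H ≃* Multiplicative (ZMod 3) × (H ⧸ N)) :=
    ⟨MulEquiv.ofBijective (W.prod (QuotientGroup.mk' N)) (bijective_prod W _ (fun g hg h1 =>
      map_eq_one_of_mem_zpowers (by rw [hz3]; exact Nat.prime_three) W hW
        ((QuotientGroup.eq_one_iff g).1 hg) h1)
      (by rw [hcH, hcK, Nat.card_eq_fintype_card (α := Multiplicative (ZMod 3))]; rfl))⟩
  obtain ⟨e₁⟩ := e₁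
  have hcov := hc.isCover le_rfl hperf
  rw [hker] at hcov
  obtain ⟨K, hK', ⟨e₂⟩⟩ := exists_equiv_type (H ⧸ N)
  exact ⟨K, hK', hcov.congr le_rfl e₂,
    ⟨e₁.trans (MulEquiv.prodCongr (MulEquiv.refl _) e₂.symm)⟩⟩

end DoubleCover

end ImprimitiveCovers

namespace ImprimitiveCovers

open Finset CentralExt

/-! ### Scalar products split by the orders of elements of the quotient -/

section Rip

variable {G : Type u} {A : Type v} [Group G] [Fintype G] [Group A] [Fintype A] {π : G →* A}
variable {χ ψ : G → ℂ}

/-- The contribution of the elements above the elements of order `r` to a scalar product. -/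
noncomputable def CentralExt.rip (h : CentralExt π) (r : ℕ) (f g : G → ℂ) : ℝ :=
  osum r (fun a => (f (h.s a) * star (g (h.s a))).re)

theorem mul_star_re_self (z : ℂ) : (z * star z).re = ‖z‖ ^ 2 := by
  rw [← Complex.normSq_eq_norm_sq, Complex.normSq_apply]; simp

theorem CentralExt.rip_self (h : CentralExt π) (r : ℕ) (f : G → ℂ) :
    h.rip r f f = osum r (fun a => ‖f (h.s a)‖ ^ 2) :=
  sum_congr rfl fun _ _ => mul_star_re_self _

theorem CentralExt.rip_self_nonneg (h : CentralExt π) (r : ℕ) (f : G → ℂ) : 0 ≤ h.rip r f f := by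
  rw [h.rip_self]
  exact sum_nonneg fun a _ => by positivity

/-- Inequality of the arithmetic and geometric means, pointwise. It controls the orders at which the
values of the two characters are unknown. -/
theorem CentralExt.neg_le_rip (h : CentralExt π) (r : ℕ) (f g : G → ℂ) :
    -((h.rip r f f + h.rip r g g) / 2) ≤ h.rip r f g := by
  rw [h.rip_self, h.rip_self, rip, osum, osum, osum, ← sum_add_distrib, sum_div, ← sum_neg_distrib]
  refine sum_le_sum fun a _ => ?_
  have h1 : -‖f (h.s a) * star (g (h.s a))‖ ≤ (f (h.s a) * star (g (h.s a))).re :=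
    neg_le_of_abs_le (Complex.abs_re_le_norm _)
  rw [norm_mul, norm_star] at h1
  nlinarith [sq_nonneg (‖f (h.s a)‖ - ‖g (h.s a)‖)]

open Classical in
theorem CentralExt.sum_rip (h : CentralExt π) (hχ : IsIrr χ) (hψ : IsIrr ψ)
    (hs : SameOn π.ker χ ψ) {R : Finset ℕ} (hR : ∀ a : A, orderOf a ∈ R) :
    ∑ r ∈ R, h.rip r χ ψ = if χ = ψ then (Nat.card A : ℝ) else 0 := by
  have h1 := congrArg Complex.re (h.sum_mul_star hχ hψ hs)
  rw [Complex.re_sum] at h1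
  rw [sum_eq_sum_osum hR] at h1
  rw [Nat.card_eq_fintype_card]
  refine h1.trans ?_
  split_ifs <;> simp

theorem CentralExt.rip_one (h : CentralExt π) {d e : ℝ} (hχ : χ 1 = d) (hψ : ψ 1 = e) :
    h.rip 1 χ ψ = d * e := by
  rw [rip, osum_one, h.s_one, hχ, hψ]; simp

theorem CentralExt.rip_const (h : CentralExt π) {r : ℕ} {x y : ℝ}
    (hχ : ∀ a, orderOf a = r → χ (h.s a) = x) (hψ : ∀ a, orderOf a = r → ψ (h.s a) = y) :
    h.rip r χ ψ = (ofOrder A r).card * (x * y) := by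
  rw [rip, osum_const (c := x * y) fun a ha => by rw [hχ a ha, hψ a ha]; simp, nsmul_eq_mul]

theorem CentralExt.rip_eq_zero_of_left (h : CentralExt π) {r : ℕ} (hχ : h.rip r χ χ = 0)
    (ψ : G → ℂ) : h.rip r χ ψ = 0 := by
  rw [rip_self, osum, sum_eq_zero_iff_of_nonneg fun a _ => by positivity] at hχ
  refine sum_eq_zero fun a ha => ?_
  have := hχ a ha
  rw [sq_eq_zero_iff, norm_eq_zero] at this
  rw [this, zero_mul, Complex.zero_re]

theorem CentralExt.rip_comm (h : CentralExt π) (r : ℕ) (f g : G → ℂ) :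
    h.rip r f g = h.rip r g f := by
  refine sum_congr rfl fun a _ => ?_
  simp only [Complex.mul_re, Complex.star_def, Complex.conj_re, Complex.conj_im]
  ring

theorem CentralExt.rip_eq_zero_of_right (h : CentralExt π) {r : ℕ} (hψ : h.rip r ψ ψ = 0)
    (χ : G → ℂ) : h.rip r χ ψ = 0 := by
  rw [rip_comm, h.rip_eq_zero_of_left hψ]

theorem ind_mul {H : Subgroup G} {φ : H → ℂ} (hφ : IsIrr φ) {z : G}
    (hz : z ∈ Subgroup.center G) (hzH : z ∈ H) (g : G) :
    ind H φ (z * g) = cc φ ⟨z, hzH⟩ * ind H φ g := by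
  have : Fintype H := Fintype.ofFinite H
  have hzc : (⟨z, hzH⟩ : H) ∈ Subgroup.center H :=
    Subgroup.mem_center_iff.2 fun x => Subtype.ext (Subgroup.mem_center_iff.1 hz x)
  rw [ind_eq, ind_eq, mul_left_comm]
  congr 1
  rw [Finset.mul_sum]
  refine sum_congr rfl fun x _ => ?_
  have h1 : x⁻¹ * (z * g) * x = z * (x⁻¹ * g * x) := by
    rw [← mul_assoc, Subgroup.mem_center_iff.1 hz]; simp only [mul_assoc]
  rw [h1]
  by_cases hg : x⁻¹ * g * x ∈ H
  · rw [extz_mem hg, extz_mem (H.mul_mem hzH hg)]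
    exact hφ.cc_mul hzc ⟨_, hg⟩
  · rw [extz_not_mem hg, extz_not_mem fun hc => hg ((H.mul_mem_cancel_left hzH).1 hc), mul_zero]

/-- The norm test, with the sum over `G` pushed down to the quotient. -/
theorem CentralExt.isIrr_ind (h : CentralExt π) {H : Subgroup G} (hH : π.ker ≤ H) {φ : H → ℂ}
    (hφ : IsIrr φ) {R : Finset ℕ} (hR : ∀ a : A, orderOf a ∈ R)
    (hlt : ∑ r ∈ R, h.rip r (ind H φ) (ind H φ) < 2 * Nat.card A) : IsIrr (ind H φ) := by
  refine hφ.ind_of_lt ?_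
  have : Fintype H := Fintype.ofFinite H
  rw [h.sum_eq fun z g hz => by
    rw [ind_mul hφ (h.central hz) (hH hz), norm_mul, hφ.norm_cc, one_mul]
    exact Subgroup.mem_center_iff.2 fun x => Subtype.ext
      (Subgroup.mem_center_iff.1 (h.central hz) x),
    h.card_eq, sum_eq_sum_osum hR]
  simp only [rip_self] at hlt
  rw [Nat.card_eq_fintype_card] at hlt
  push_cast
  have h0 : (0 : ℝ) < Nat.card π.ker := by exact_mod_cast Nat.card_pos
  nlinarith

/-- Class functions that are faithful on the centre vanish over the elements of order three. -/
theorem CentralExt.apply_eq_zero (h : CentralExt π) [Group.IsPerfect G] {i j : ℕ}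
    (hA : Nat.card A = 9 * j) (hj : ¬ 3 ∣ j) (hK : Nat.card π.ker = 3 * i) (hi : ¬ 3 ∣ i)
    {f : G → ℂ} (hf : ∀ x g, f (x * g * x⁻¹) = f g)
    (hz : ∀ z, π z = 1 → z ≠ 1 → ∃ c : ℂ, c ≠ 1 ∧ ∀ g, f (z * g) = c * f g) {g : G}
    (hg : orderOf (π g) = 3) : f g = 0 := by
  obtain ⟨x, z, hz1, hz2, hx⟩ := h.exists_conj_mul hA hj hK hi hg
  obtain ⟨c, hc, hc'⟩ := hz z hz1 hz2
  have h1 := hf x g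
  rw [hx, hc'] at h1
  have h2 : (c - 1) * f g = 0 := by linear_combination h1
  exact (mul_eq_zero.1 h2).resolve_left (sub_ne_zero.2 hc)

theorem CentralExt.rip_three (h : CentralExt π) [Group.IsPerfect G] {i j : ℕ}
    (hA : Nat.card A = 9 * j) (hj : ¬ 3 ∣ j) (hK : Nat.card π.ker = 3 * i) (hi : ¬ 3 ∣ i)
    {f : G → ℂ} (hf : ∀ x g, f (x * g * x⁻¹) = f g)
    (hz : ∀ z, π z = 1 → z ≠ 1 → ∃ c : ℂ, c ≠ 1 ∧ ∀ g, f (z * g) = c * f g) :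
    h.rip 3 f f = 0 := by
  rw [rip_self]
  refine sum_eq_zero fun a ha => ?_
  rw [h.apply_eq_zero hA hj hK hi hf hz (by rw [π_s]; exact mem_ofOrder.1 ha)]
  simp

/-- `χ` takes the real value `x` on the canonical lifts of the elements of order `r`. -/
def CentralExt.Val (h : CentralExt π) (r : ℕ) (χ : G → ℂ) (x : ℝ) : Prop :=
  ∀ a, orderOf a = r → χ (h.s a) = x

theorem CentralExt.val_of_isConj (h : CentralExt π) {r : ℕ} (hr : r.Coprime (Nat.card π.ker))
    (hc : ∀ a b : A, orderOf a = r → orderOf b = r → IsConj a b)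
    (hχ : ∀ x g, χ (x * g * x⁻¹) = χ g) {a : A} (ha : orderOf a = r) {x : ℝ}
    (hx : χ (h.s a) = x) : h.Val r χ x := fun b hb => by
  rw [← hx, h.apply_s_eq_of_isConj hχ (by rwa [hb]) (hc b a hb ha)]

/-- When the elements of order `r` form one class, the value is the average of the induced character
over them, which `osum_ind` computes on `H`. -/
theorem CentralExt.val_ind (h : CentralExt π) {B : Type w} [Group B] [Fintype B] {H : Subgroup G}
    {σ : H →* B} (hσ : Compat π H σ) {φ : H → ℂ} {r : ℕ} (hr : r.Coprime (Nat.card π.ker))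
    (hc : ∀ a b : A, orderOf a = r → orderOf b = r → IsConj a b) {N : ℕ}
    (hN : (ofOrder A r).card = N) (hN0 : 0 < N) {S x : ℝ}
    (hS : osum r (fun b => φ ((hσ.ext h).s b)) = S) (hx : N * x = H.index * S) :
    h.Val r (ind H φ) x := by
  have h1 := osum_ind h hσ (φ := φ) hr
  rw [hS] at h1
  intro a ha
  have h2 : osum r (fun a => ind H φ (h.s a)) = (ofOrder A r).card • ind H φ (h.s a) :=
    osum_const fun b hb => h.apply_s_eq_of_isConj (ind_conj H φ) (by rwa [hb]) (hc b a hb ha)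
  rw [h2, hN, nsmul_eq_mul] at h1
  have h3 : ((N * x : ℝ) : ℂ) = ((H.index * S : ℝ) : ℂ) := by rw [hx]
  push_cast at h3
  rw [← h3] at h1
  exact mul_left_cancel₀ (by exact_mod_cast hN0.ne') h1

end Rip

/-! ### Arithmetic of character values at elements of order 2, 4, 5 and 7 -/

section Values

variable {G : Type u} [Group G] [Fintype G] {χ : G → ℂ}

theorem IsIrr.exists_int_of_sq (hχ : IsIrr χ) {d : ℕ} (hd : χ 1 = d) {g : G} (hg : g ^ 2 = 1) :
    ∃ n : ℤ, χ g = n := by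
  obtain ⟨m, hm⟩ := hχ.exists_nat_sum_pow two_ne_zero hg (one_pow 2)
  refine ⟨2 * m - d, ?_⟩
  simp only [sum_range_succ, range_zero, sum_empty, pow_zero, pow_one, one_mul, zero_add] at hm
  rw [hd] at hm
  push_cast at hm ⊢
  linear_combination hm

/-- The eigenvalues `i` and `-i` have equal multiplicity because `g` is conjugate to its inverse;
the value is the multiplicity of 1 minus that of −1. -/
theorem IsIrr.exists_int_of_pow_four (hχ : IsIrr χ) {g : G} (hg : g ^ 4 = 1)
    (hc : IsConj g (g ^ 3)) : ∃ n : ℤ, χ g = n := by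
  obtain ⟨m, hm⟩ := hχ.exists_nat_sum_pow four_ne_zero hg (one_pow 4)
  obtain ⟨m', hm'⟩ := hχ.exists_nat_sum_pow four_ne_zero hg (z := -1) (by norm_num)
  obtain ⟨x, hx⟩ := isConj_iff.1 hc
  have h3 : χ (g ^ 3) = χ g := by rw [← hx, hχ.conj]
  refine ⟨m - m', ?_⟩
  simp only [sum_range_succ, range_zero, sum_empty, pow_zero, pow_one, one_mul, zero_add, one_pow,
    h3] at hm hm'
  push_cast at hm hm' ⊢
  linear_combination (hm - hm') / 4

/-- A square root of five. -/
noncomputable def sqrtFive : ℂ :=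
  let ζ := Complex.exp (2 * Real.pi * Complex.I / (5 : ℕ))
  ζ + ζ ^ 4 - ζ ^ 2 - ζ ^ 3

theorem star_exp (n : ℕ) (hn : n ≠ 0) : star (Complex.exp (2 * Real.pi * Complex.I / n)) =
    Complex.exp (2 * Real.pi * Complex.I / n) ^ (n - 1) := by
  have h1 := (Complex.isPrimitiveRoot_exp n hn).pow_eq_one
  have h2 := Complex.norm_eq_one_of_pow_eq_one h1 hn
  generalize Complex.exp (2 * Real.pi * Complex.I / n) = ζ at *
  have h3 : ζ * star ζ = 1 := by
    have := Complex.mul_conj' ζ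
    rw [h2] at this
    simpa using this
  have h0 : ζ ≠ 0 := fun h => by rw [h, zero_pow hn] at h1; exact zero_ne_one h1
  apply mul_left_cancel₀ h0
  rw [h3, ← pow_succ', Nat.sub_add_cancel (Nat.pos_of_ne_zero hn), h1]

theorem sqrtFive_sq : sqrtFive ^ 2 = 5 := by
  have h := Complex.isPrimitiveRoot_exp 5 (by norm_num)
  have h5 := h.pow_eq_one
  have hs := h.geom_sum_eq_zero (by norm_num)
  rw [sqrtFive]
  generalize Complex.exp (2 * Real.pi * Complex.I / (5 : ℕ)) = ζ at *
  simp only [sum_range_succ, range_zero, sum_empty, pow_zero, pow_one, zero_add] at hs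
  linear_combination (-1 : ℂ) * hs + (ζ ^ 3 - ζ - 2 * ζ ^ 2 + 4) * h5

theorem star_sqrtFive : star sqrtFive = sqrtFive := by
  have h5 := (Complex.isPrimitiveRoot_exp 5 (by norm_num)).pow_eq_one
  have hs := star_exp 5 (by norm_num)
  rw [sqrtFive]
  simp only [star_sub, star_add, star_pow]
  rw [hs]
  generalize Complex.exp (2 * Real.pi * Complex.I / (5 : ℕ)) = ζ at *
  linear_combination (ζ ^ 11 + ζ ^ 6 + ζ - ζ ^ 3 - ζ ^ 7 - ζ ^ 2) * h5

/-- `g` is conjugate to its inverse, so only two multiplicities of nontrivial eigenvalues occur,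
those of ζ and of ζ². Their sum is `t` and their difference is `D`, whence the common parity. -/
theorem IsIrr.exists_five (hχ : IsIrr χ) {d : ℕ} (hd : χ 1 = d) {g : G} (hg : g ^ 5 = 1)
    (hc : IsConj g (g ^ 4)) : ∃ (t : ℕ) (D : ℤ), 2 ∣ D - t ∧
      χ g = ((2 * d - 5 * t : ℤ) + D * sqrtFive) / 2 ∧
      χ (g ^ 2) = ((2 * d - 5 * t : ℤ) - D * sqrtFive) / 2 := by
  have h := Complex.isPrimitiveRoot_exp 5 (by norm_num)
  have h5 := h.pow_eq_one
  have hs := h.geom_sum_eq_zero (by norm_num)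
  have hq := sqrtFive_sq
  rw [sqrtFive] at hq ⊢
  generalize Complex.exp (2 * Real.pi * Complex.I / (5 : ℕ)) = ζ at *
  obtain ⟨m, hm⟩ := hχ.exists_nat_sum_pow (n := 5) (by norm_num) hg h5
  obtain ⟨m', hm'⟩ := hχ.exists_nat_sum_pow (n := 5) (by norm_num) hg (z := ζ ^ 2)
    (by rw [← pow_mul, mul_comm, pow_mul, h5, one_pow])
  obtain ⟨x, hx⟩ := isConj_iff.1 hc
  have e4 : χ (g ^ 4) = χ g := by rw [← hx, hχ.conj]
  have e3 : χ (g ^ 3) = χ (g ^ 2) := by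
    have : g ^ 3 = x * g ^ 2 * x⁻¹ := by
      rw [← conj_pow, hx, ← pow_mul, show 4 * 2 = 5 + 3 by rfl, pow_add, hg, one_mul]
    rw [this, hχ.conj]
  simp only [sum_range_succ, range_zero, sum_empty, pow_zero, pow_one, one_mul, zero_add, e3, e4,
    hd] at hm hm' hs
  push_cast at hm hm' ⊢
  have hsum : χ g + χ (g ^ 2) = 2 * d - 5 * (m + m') := by
    linear_combination (χ g + χ (g ^ 2)) * hs - hm - hm' + (ζ * χ (g ^ 2) + ζ ^ 3 * χ g) * h5
  have hdiff : χ g - χ (g ^ 2) = (m - m') * (ζ + ζ ^ 4 - ζ ^ 2 - ζ ^ 3) := by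
    have h1 : (χ g - χ (g ^ 2)) * (ζ + ζ ^ 4 - ζ ^ 2 - ζ ^ 3) = 5 * (m - m') := by
      linear_combination hm - hm' + (ζ * χ (g ^ 2) + ζ ^ 3 * χ g) * h5
    linear_combination (ζ + ζ ^ 4 - ζ ^ 2 - ζ ^ 3) / 5 * h1 - (χ g - χ (g ^ 2)) / 5 * hq
  refine ⟨m + m', m - m', ⟨-m', by push_cast; ring⟩, ?_, ?_⟩
  · push_cast
    linear_combination (hsum + hdiff) / 2
  · push_cast
    linear_combination (hsum - hdiff) / 2

/-- All nontrivial fifth roots of unity have the same multiplicity `t`. -/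
theorem IsIrr.exists_five_of_isConj_sq (hχ : IsIrr χ) {d : ℕ} (hd : χ 1 = d) {g : G}
    (hg : g ^ 5 = 1) (hc : IsConj g (g ^ 2)) : ∃ t : ℕ, χ g = (d - 5 * t : ℤ) := by
  have h := Complex.isPrimitiveRoot_exp 5 (by norm_num)
  have h5 := h.pow_eq_one
  have hs := h.geom_sum_eq_zero (by norm_num)
  generalize Complex.exp (2 * Real.pi * Complex.I / (5 : ℕ)) = ζ at *
  obtain ⟨m, hm⟩ := hχ.exists_nat_sum_pow (n := 5) (by norm_num) hg h5
  obtain ⟨x, hx⟩ := isConj_iff.1 hc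
  have key : ∀ k, χ (g ^ (2 * k)) = χ (g ^ k) := fun k => by
    rw [pow_mul, ← hx, conj_pow, hχ.conj]
  have e2 : χ (g ^ 2) = χ g := by simpa using key 1
  have e4 : χ (g ^ 4) = χ g := by rw [← e2, ← key 2]
  have e3 : χ (g ^ 3) = χ g := by
    rw [← e4, ← key 4, show 2 * 4 = 5 + 3 by rfl, pow_add, hg, one_mul]
  simp only [sum_range_succ, range_zero, sum_empty, pow_zero, pow_one, one_mul, zero_add, e2, e3,
    e4, hd] at hm hs
  refine ⟨m, ?_⟩
  push_cast at hm ⊢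
  linear_combination χ g * hs - hm

/-- A square root of minus seven. -/
noncomputable def sqrtNegSeven : ℂ :=
  let ζ := Complex.exp (2 * Real.pi * Complex.I / (7 : ℕ))
  ζ + ζ ^ 2 + ζ ^ 4 - ζ ^ 3 - ζ ^ 5 - ζ ^ 6

theorem sqrtNegSeven_sq : sqrtNegSeven ^ 2 = -7 := by
  have h := Complex.isPrimitiveRoot_exp 7 (by norm_num)
  have h7 := h.pow_eq_one
  have hs := h.geom_sum_eq_zero (by norm_num)
  rw [sqrtNegSeven]
  generalize Complex.exp (2 * Real.pi * Complex.I / (7 : ℕ)) = ζ at *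
  simp only [sum_range_succ, range_zero, sum_empty, pow_zero, pow_one, zero_add] at hs
  linear_combination hs + (ζ ^ 5 + 2 * ζ ^ 4 - ζ ^ 3 + ζ - 6) * h7

theorem star_sqrtNegSeven : star sqrtNegSeven = -sqrtNegSeven := by
  have h7 := (Complex.isPrimitiveRoot_exp 7 (by norm_num)).pow_eq_one
  have hs := star_exp 7 (by norm_num)
  rw [sqrtNegSeven]
  simp only [star_sub, star_add, star_pow]
  rw [hs]
  generalize Complex.exp (2 * Real.pi * Complex.I / (7 : ℕ)) = ζ at *
  have e : ∀ k r, (ζ ^ (7 * k + r)) = ζ ^ r := fun k r => by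
    rw [pow_add, pow_mul, h7, one_pow, one_mul]
  simp only [← pow_mul]
  norm_num only
  rw [show ζ ^ 12 = ζ ^ 5 from e 1 5, show ζ ^ 24 = ζ ^ 3 from e 3 3,
    show ζ ^ 18 = ζ ^ 4 from e 2 4, show ζ ^ 30 = ζ ^ 2 from e 4 2,
    show ζ ^ 36 = ζ ^ 1 from e 5 1]
  ring

/-- Conjugacy of `g` and `g ^ 2` leaves two multiplicities, for square and nonsquare exponents. As
before `t` is their sum and `D` their difference; the Gauss sum of the quadratic character supplies
√−7. -/
theorem IsIrr.exists_seven (hχ : IsIrr χ) {d : ℕ} (hd : χ 1 = d) {g : G} (hg : g ^ 7 = 1)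
    (hc : IsConj g (g ^ 2)) : ∃ (t : ℕ) (D : ℤ), 2 ∣ D - t ∧ ∀ j, j.Coprime 7 →
      χ (g ^ j) = ((2 * d - 7 * t : ℤ) + D * sqrtNegSeven) / 2 ∨
      χ (g ^ j) = ((2 * d - 7 * t : ℤ) - D * sqrtNegSeven) / 2 := by
  have h := Complex.isPrimitiveRoot_exp 7 (by norm_num)
  have h7 := h.pow_eq_one
  have hs := h.geom_sum_eq_zero (by norm_num)
  have hq := sqrtNegSeven_sq
  rw [sqrtNegSeven] at hq ⊢
  generalize Complex.exp (2 * Real.pi * Complex.I / (7 : ℕ)) = ζ at *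
  have e : ∀ k r, (ζ ^ (7 * k + r)) = ζ ^ r := fun k r => by
    rw [pow_add, pow_mul, h7, one_pow, one_mul]
  have e' : ∀ k r, (g ^ (7 * k + r)) = g ^ r := fun k r => by
    rw [pow_add, pow_mul, hg, one_pow, one_mul]
  obtain ⟨m, hm⟩ := hχ.exists_nat_sum_pow (n := 7) (by norm_num) hg h7
  obtain ⟨m', hm'⟩ := hχ.exists_nat_sum_pow (n := 7) (by norm_num) hg (z := ζ ^ 3)
    (by rw [← pow_mul, mul_comm, pow_mul, h7, one_pow])
  obtain ⟨x, hx⟩ := isConj_iff.1 hc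
  have key : ∀ k, χ (g ^ (2 * k)) = χ (g ^ k) := fun k => by
    rw [pow_mul, ← hx, conj_pow, hχ.conj]
  have e2 : χ (g ^ 2) = χ g := by simpa using key 1
  have e4 : χ (g ^ 4) = χ g := by rw [← e2, ← key 2]
  have e6 : χ (g ^ 6) = χ (g ^ 3) := key 3
  have e5 : χ (g ^ 5) = χ (g ^ 3) := by
    rw [← e6, ← key 6, show g ^ (2 * 6) = g ^ 5 from e' 1 5]
  simp only [sum_range_succ, range_zero, sum_empty, pow_zero, pow_one, one_mul, zero_add, e2, e4,
    e5, e6, hd, ← pow_mul] at hm hm' hs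
  norm_num only at hm'
  rw [show ζ ^ 9 = ζ ^ 2 from e 1 2, show ζ ^ 12 = ζ ^ 5 from e 1 5, show ζ ^ 15 = ζ ^ 1 from e 2 1,
    show ζ ^ 18 = ζ ^ 4 from e 2 4, pow_one] at hm'
  push_cast at hm hm' ⊢
  have hsum : χ g + χ (g ^ 3) = 2 * d - 7 * (m + m') := by
    linear_combination (χ g + χ (g ^ 3)) * hs - hm - hm'
  have hdiff : χ g - χ (g ^ 3) = (m' - m) * (ζ + ζ ^ 2 + ζ ^ 4 - ζ ^ 3 - ζ ^ 5 - ζ ^ 6) := by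
    have h1 : (χ g - χ (g ^ 3)) * (ζ + ζ ^ 2 + ζ ^ 4 - ζ ^ 3 - ζ ^ 5 - ζ ^ 6) = 7 * (m - m') := by
      linear_combination hm - hm'
    linear_combination -(ζ + ζ ^ 2 + ζ ^ 4 - ζ ^ 3 - ζ ^ 5 - ζ ^ 6) / 7 * h1
      + (χ g - χ (g ^ 3)) / 7 * hq
  refine ⟨m + m', m' - m, ⟨-m, by push_cast; ring⟩, fun j hj => ?_⟩
  have hv : χ (g ^ j) = χ g ∨ χ (g ^ j) = χ (g ^ 3) := by
    rw [← Nat.div_add_mod j 7, e']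
    have h0 : j % 7 ≠ 0 := fun h => by
      have := Nat.Coprime.eq_one_of_dvd hj.symm (Nat.dvd_of_mod_eq_zero h)
      omega
    have hlt := Nat.mod_lt j (y := 7) (by norm_num)
    interval_cases j % 7 <;> simp_all
  rcases hv with hv | hv
  · left
    rw [hv]
    push_cast
    linear_combination (hsum + hdiff) / 2
  · right
    rw [hv]
    push_cast
    linear_combination (hsum - hdiff) / 2

theorem norm_sq_seven (S D : ℤ) (ε : ℂ) (hε : ε = 1 ∨ ε = -1) :
    ‖((S : ℂ) + ε * (D * sqrtNegSeven)) / 2‖ ^ 2 = ((S : ℝ) ^ 2 + 7 * D ^ 2) / 4 := by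
  have h1 := mul_star_re_self (((S : ℂ) + ε * (D * sqrtNegSeven)) / 2)
  rw [← h1]
  have h2 : ((S : ℂ) + ε * (D * sqrtNegSeven)) / 2 * star (((S : ℂ) + ε * (D * sqrtNegSeven)) / 2)
      = ((((S : ℝ) ^ 2 + 7 * D ^ 2) / 4 : ℝ) : ℂ) := by
    have hs := star_sqrtNegSeven
    have hq := sqrtNegSeven_sq
    have hε' : star ε = ε := by rcases hε with rfl | rfl <;> simp
    have hε2 : ε ^ 2 = 1 := by rcases hε with rfl | rfl <;> simp
    have e1 : star (((S : ℂ) + ε * (D * sqrtNegSeven)) / 2) =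
        ((S : ℂ) - ε * (D * sqrtNegSeven)) / 2 := by
      rw [star_div₀, star_add, star_mul', star_mul', hs, hε']
      simp
      ring
    rw [e1]
    push_cast
    linear_combination (-(D : ℂ) ^ 2 * sqrtNegSeven ^ 2 / 4) * hε2 - (D : ℂ) ^ 2 / 4 * hq
  rw [h2, Complex.ofReal_re]

end Values

end ImprimitiveCovers

namespace ImprimitiveCovers

open Finset CentralExt

/-! ### Faithfulness on the kernel and comparison of central characters -/

section Faithful

variable {G : Type u} {A : Type v} [Group G] [Fintype G] [Group A] [Fintype A] {π : G →* A}
variable {χ ψ : G → ℂ}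

/-- The character `χ` is faithful on the kernel of `π`. -/
def FaithfulOn (N : Subgroup G) (χ : G → ℂ) : Prop := ∀ z ∈ N, χ z = χ 1 → z = 1

theorem FaithfulOn.cc_ne_one {N : Subgroup G} (hχ : IsIrr χ) (h : FaithfulOn N χ) {z : G}
    (hz : z ∈ N) (hz1 : z ≠ 1) : cc χ z ≠ 1 := fun hc =>
  hz1 (h z hz (by rwa [cc, div_eq_one_iff_eq hχ.one_ne_zero] at hc))

theorem IsFaithfulIrr.faithfulOn (h : IsFaithfulIrr χ) (N : Subgroup G) : FaithfulOn N χ :=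
  fun z _ hz => h.2 z hz

theorem FaithfulOn.star {N : Subgroup G} (h : FaithfulOn N χ) : FaithfulOn N (star χ) :=
  fun z hz h1 => h z hz (star_injective h1)

theorem IsFaithfulIrr.star (h : IsFaithfulIrr χ) : IsFaithfulIrr (star χ) :=
  ⟨h.1.star, fun g hg => h.2 g (star_injective hg)⟩

theorem FaithfulOn.of_sameOn {N : Subgroup G} (hχ : IsIrr χ) (hψ : IsIrr ψ) (h : FaithfulOn N χ)
    (hs : SameOn N χ ψ) : FaithfulOn N ψ := fun z hz h1 => by
  by_contra hz1
  have h2 := h.cc_ne_one hχ hz hz1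
  rw [hs z hz, cc, h1, div_self hψ.one_ne_zero] at h2
  exact h2 rfl

theorem SameOn.symm {N : Subgroup G} (h : SameOn N χ ψ) : SameOn N ψ χ :=
  fun z hz => (h z hz).symm

theorem SameOn.trans {N : Subgroup G} {θ : G → ℂ} (h : SameOn N χ ψ) (h' : SameOn N ψ θ) :
    SameOn N χ θ := fun z hz => (h z hz).trans (h' z hz)

/-- A character of degree at least two that is faithful on the kernel of an extension of a simple
group is faithful. -/
theorem CentralExt.isFaithfulIrr [IsSimpleGroup A] (h : CentralExt π) (hχ : IsIrr χ)
    (hf : FaithfulOn π.ker χ) (h1 : χ 1 ≠ 1) : IsFaithfulIrr χ := by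
  refine ⟨hχ, ?_⟩
  obtain ⟨d, hd0, hd⟩ := hχ.exists_degree
  let N : Subgroup G :=
    { carrier := {g | χ g = χ 1}
      mul_mem' := fun {a b} ha hb => (hχ.mem_ker hb a).trans ha
      one_mem' := rfl
      inv_mem' := fun {a} ha => by
        change χ a⁻¹ = χ 1
        rw [hχ.inv, show χ a = χ 1 from ha, hd]; simp }
  have hN : N.Normal := ⟨fun n hn g => (hχ.conj g n).trans hn⟩
  have hN' : (N.map π).Normal := hN.map π h.surj
  rcases hN'.eq_bot_or_eq_top with hb | ht
  · intro g hg
    have : π g ∈ N.map π := Subgroup.mem_map_of_mem π hg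
    rw [hb] at this
    exact hf g this hg
  -- If the kernel of χ covers `A`, then |χ| = d everywhere, and the norm gives d = 1.
  · exfalso
    have hnorm : ∀ g, ‖χ g‖ = d := fun g => by
      obtain ⟨n, hn, hng⟩ : π g ∈ N.map π := ht ▸ Subgroup.mem_top _
      rw [h.norm_apply_conj hχ hng.symm, show χ n = χ 1 from hn, hd, Complex.norm_natCast]
    have hs := hχ.sum_norm_sq
    simp only [hnorm, sum_const, card_univ, nsmul_eq_mul] at hs
    have hG : (0 : ℝ) < Fintype.card G := by exact_mod_cast Fintype.card_pos
    have hd2 : (d : ℝ) ^ 2 = 1 := by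
      apply mul_left_cancel₀ hG.ne'
      rw [hs, mul_one]
    have : d = 1 := by
      have h3 : d ^ 2 = 1 := by exact_mod_cast hd2
      exact (Nat.pow_eq_one.1 h3).resolve_right two_ne_zero
    exact h1 (by rw [hd, this, Nat.cast_one])

/-- The scalar by which `z` acts has order exactly `p`, and its d-th power is a determinant equal to
1. -/
theorem FaithfulOn.dvd_degree_of_mem_commutator {N : Subgroup G} (hχ : IsIrr χ)
    (hf : FaithfulOn N χ) {d : ℕ} (hd : χ 1 = d) {p : ℕ} [hp : Fact p.Prime] {z : G} (hz : z ∈ N)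
    (hzc : z ∈ Subgroup.center G) (hzG : z ∈ commutator G) (ho : orderOf z = p) : p ∣ d := by
  have h1 := hχ.cc_pow_degree hzc hzG hd
  have h2 : orderOf (cc χ z) = p := orderOf_eq_prime
    (by rw [← hχ.cc_pow hzc, ← ho, pow_orderOf_eq_one, hχ.cc_one])
    (hf.cc_ne_one hχ hz fun h0 => by
      rw [h0, orderOf_one] at ho
      exact hp.1.one_lt.ne ho)
  rw [← h2]
  exact orderOf_dvd_of_pow_eq_one h1

theorem FaithfulOn.dvd_degree [Group.IsPerfect G] (h : CentralExt π) (hχ : IsIrr χ)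
    (hf : FaithfulOn π.ker χ) {d : ℕ} (hd : χ 1 = d) {p : ℕ} [hp : Fact p.Prime]
    (hpK : p ∣ Nat.card π.ker) : p ∣ d := by
  obtain ⟨⟨z, hz⟩, ho⟩ := exists_prime_orderOf_dvd_card' (G := π.ker) p hpK
  rw [← Subgroup.orderOf_coe] at ho
  exact hf.dvd_degree_of_mem_commutator hχ hd hz (h.central hz)
    (by rw [Group.IsPerfect.commutator_eq_top]; trivial) ho

theorem eq_or_eq_star_of_cube {a b : ℂ} (ha : a ^ 3 = 1) (hb : b ^ 3 = 1) (ha1 : a ≠ 1)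
    (hb1 : b ≠ 1) : a = b ∨ a = star b := by
  have ha2 : a ^ 2 + a + 1 = 0 :=
    (mul_eq_zero.1 (by linear_combination ha : (a - 1) * (a ^ 2 + a + 1) = 0)).resolve_left
      (sub_ne_zero.2 ha1)
  have hb2 : b ^ 2 + b + 1 = 0 :=
    (mul_eq_zero.1 (by linear_combination hb : (b - 1) * (b ^ 2 + b + 1) = 0)).resolve_left
      (sub_ne_zero.2 hb1)
  have hbs : b * star b = 1 := by
    have := Complex.mul_conj' b
    rw [Complex.norm_eq_one_of_pow_eq_one hb three_ne_zero] at this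
    simpa using this
  have hs : star b = b ^ 2 := by
    have : star b = b ^ 3 * star b := by rw [hb, one_mul]
    rw [this]
    linear_combination b ^ 2 * hbs
  rcases mul_eq_zero.1 (by linear_combination ha2 - hb2 : (a - b) * (a + b + 1) = 0) with h | h
  · exact Or.inl (sub_eq_zero.1 h)
  · right
    rw [hs]
    linear_combination h - hb2

/-- If the kernel has order three or six, then its faithful characters are complex conjugate. -/
theorem FaithfulOn.sameOn_or (h : CentralExt π) (hK : Nat.card π.ker = 3 ∨ Nat.card π.ker = 6)
    (hχ : IsIrr χ) (hψ : IsIrr ψ) (hf : FaithfulOn π.ker χ) (hf' : FaithfulOn π.ker ψ) :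
    SameOn π.ker χ ψ ∨ SameOn π.ker χ (Star.star ψ) := by
  classical
  have h3 : 3 ∣ Nat.card π.ker := by rcases hK with h | h <;> rw [h]; norm_num
  obtain ⟨⟨y, hy⟩, ho⟩ := exists_prime_orderOf_dvd_card' (G := π.ker) 3 h3
  rw [← Subgroup.orderOf_coe] at ho
  change orderOf y = 3 at ho
  have hyc := h.central hy
  have hy1 : y ≠ 1 := fun h0 => by rw [h0, orderOf_one] at ho; omega
  have hcube : ∀ θ : G → ℂ, IsIrr θ → cc θ y ^ 3 = 1 := fun θ hθ => by
    rw [← hθ.cc_pow hyc, ← ho, pow_orderOf_eq_one, hθ.cc_one]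
  -- ⟨y⟩ has index 1 or 2 in the kernel, so fourth powers lie in it.
  have hmem : ∀ z, π z = 1 → ∃ k, z ^ 4 = y ^ k := by
    intro z hz
    let N : Subgroup π.ker := Subgroup.zpowers ⟨y, hy⟩
    have hN : N.Normal := ⟨fun n hn g => by
      have : g * n * g⁻¹ = n := by
        rw [mul_inv_eq_iff_eq_mul]
        exact Subtype.ext (h.mul_comm_of_ker n.2 g)
      rwa [this]⟩
    have hNi : N.index ∣ 2 := by
      have h1 := N.card_mul_index
      rw [Nat.card_zpowers, ← Subgroup.orderOf_coe] at h1
      change orderOf y * _ = _ at h1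
      rw [ho] at h1
      rcases hK with h | h <;> rw [h] at h1
      · rw [show N.index = 1 by omega]; norm_num
      · rw [show N.index = 2 by omega]
    obtain ⟨c, hc⟩ := hNi
    have h4 : (⟨z, hz⟩ : π.ker) ^ 4 ∈ N := by
      have := N.pow_mem (N.pow_index_mem ⟨z, hz⟩) (2 * c)
      rwa [← pow_mul, show N.index * (2 * c) = 2 * (N.index * c) by ring, ← hc] at this
    obtain ⟨k, hk⟩ := (isOfFinOrder_of_finite _).mem_powers_iff_mem_zpowers.2 h4
    exact ⟨k, (congrArg Subtype.val hk).symm⟩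
  have hsq : ∀ θ : G → ℂ, IsIrr θ → FaithfulOn π.ker θ → ∀ z, π z = 1 →
      cc θ (z ^ 3) = if z ^ 3 = 1 then 1 else -1 := by
    intro θ hθ hfθ z hz
    split_ifs with h1
    · rw [h1, hθ.cc_one]
    · have h6 : z ^ 6 = 1 := by
        have := pow_card_ker hz
        rcases hK with h | h <;> rw [h] at this
        · exact absurd this h1
        · exact this
      have h2 : cc θ (z ^ 3) ^ 2 = 1 := by
        rw [← hθ.cc_pow ((Subgroup.center G).pow_mem (h.central hz) 3), ← pow_mul, h6, hθ.cc_one]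
      exact (mul_self_eq_one_iff.1 ((pow_two _).symm.trans h2)).resolve_left
        (hfθ.cc_ne_one hθ (π.ker.pow_mem hz 3) h1)
  have key : ∀ θ : G → ℂ, IsIrr θ → FaithfulOn π.ker θ → cc χ y = cc θ y → SameOn π.ker χ θ := by
    intro θ hθ hfθ he z hz
    have h6 : z ^ 6 = 1 := by
      have := pow_card_ker (show π z = 1 from hz)
      rcases hK with h | h <;> rw [h] at this
      · rw [show 6 = 3 * 2 by rfl, pow_mul, this, one_pow]
      · exact this
    -- This separates the 2-part from the 3-part: the cube acts by ±1 and the fourth power by a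
    -- power of the scalar of `y`, so the scalar of `y` determines everything.
    have hz7 : z = z ^ 3 * z ^ 4 := by
      rw [← pow_add, show 3 + 4 = 6 + 1 by rfl, pow_add, h6, one_mul, pow_one]
    obtain ⟨k, hk⟩ := hmem z hz
    have hz3c := (Subgroup.center G).pow_mem (h.central hz) 3
    rw [hz7, hχ.cc_map_mul hz3c, hθ.cc_map_mul hz3c, hsq χ hχ hf z hz, hsq θ hθ hfθ z hz, hk,
      hχ.cc_pow hyc, hθ.cc_pow hyc, he]
  rcases eq_or_eq_star_of_cube (hcube χ hχ) (hcube ψ hψ) (hf.cc_ne_one hχ hy hy1)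
    (hf'.cc_ne_one hψ hy hy1) with he | he
  · exact Or.inl (key ψ hψ hf' he)
  · refine Or.inr (key _ hψ.star hf'.star ?_)
    rw [cc_star, he]

/-- A primitive cube root of unity is not real. -/
theorem CentralExt.not_sameOn_star (h : CentralExt π) (hK : 3 ∣ Nat.card π.ker)
    (hχ : IsIrr χ) (hf : FaithfulOn π.ker χ) : ¬ SameOn π.ker χ (star χ) := by
  intro hs
  obtain ⟨⟨y, hy⟩, ho⟩ := exists_prime_orderOf_dvd_card' (G := π.ker) 3 hK
  rw [← Subgroup.orderOf_coe] at ho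
  change orderOf y = 3 at ho
  have hy1 : y ≠ 1 := fun h0 => by rw [h0, orderOf_one] at ho; omega
  have h1 := hf.cc_ne_one hχ hy hy1
  have h2 := hs y hy
  rw [cc_star] at h2
  have h3 : cc χ y ^ 3 = 1 := by
    rw [← hχ.cc_pow (h.central hy), ← ho, pow_orderOf_eq_one, hχ.cc_one]
  have h4 : cc χ y * star (cc χ y) = 1 := by
    have := Complex.mul_conj' (cc χ y)
    rw [Complex.norm_eq_one_of_pow_eq_one h3 three_ne_zero] at this
    simpa using this
  rw [← h2] at h4
  exact h1 (by linear_combination h3 - cc χ y * h4)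

theorem CentralExt.sum_norm_sq_le (h : CentralExt π) (hχ : IsIrr χ) (T : Finset (G → ℂ))
    (hT : ∀ ψ ∈ T, IsIrr ψ ∧ SameOn π.ker χ ψ) :
    ∑ ψ ∈ T, ‖ψ 1‖ ^ 2 ≤ (Nat.card A : ℝ) := by
  obtain ⟨S, hS, hsum⟩ := exists_finset_sum_sq π.ker h.central hχ
  have hle : T ⊆ S := fun ψ hψ => (hS ψ).2 (hT ψ hψ)
  refine (sum_le_sum_of_subset_of_nonneg hle fun ψ _ _ => by positivity).trans ?_
  have h0 : (Nat.card π.ker : ℝ) ≠ 0 := by exact_mod_cast Nat.card_pos.ne'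
  have h1 : ∑ ψ ∈ S, ‖ψ 1‖ ^ 2 * Nat.card π.ker = Nat.card A * Nat.card π.ker := by
    have h2 := hsum
    rw [h.card_eq, ← Nat.card_eq_fintype_card] at h2
    have h3 : ∀ ψ ∈ S, ψ 1 ^ 2 * (Nat.card π.ker : ℂ) =
        ((‖ψ 1‖ ^ 2 * Nat.card π.ker : ℝ) : ℂ) := fun ψ hψ => by
      obtain ⟨d, -, hd⟩ := ((hS ψ).1 hψ).1.exists_degree
      rw [hd]; simp
    rw [sum_congr rfl h3, ← Complex.ofReal_sum] at h2
    have h4 : ((∑ ψ ∈ S, ‖ψ 1‖ ^ 2 * (Nat.card π.ker : ℝ) : ℝ) : ℂ) =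
        ((Nat.card A * Nat.card π.ker : ℝ) : ℂ) := by rw [h2]; push_cast; ring
    exact_mod_cast h4
  rw [← sum_mul] at h1
  exact (mul_right_cancel₀ h0 h1).le

/-- The kernel has two faithful linear characters, complex conjugate to each other, and `S` has one
member over each. -/
theorem isConjPair_of_unique (h : CentralExt π) (hK : Nat.card π.ker = 3)
    {S : Set (G → ℂ)} (hS : ∀ χ ∈ S, IsFaithfulIrr χ) (hstar : ∀ χ ∈ S, star χ ∈ S)
    (huniq : ∀ χ ∈ S, ∀ ψ ∈ S, SameOn π.ker χ ψ → χ = ψ) {χ : G → ℂ} (hχ : χ ∈ S) :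
    IsConjPair S χ := by
  have hi := (hS χ hχ).1
  have hf := (hS χ hχ).faithfulOn π.ker
  refine ⟨fun he => h.not_sameOn_star (dvd_of_eq hK.symm) hi hf ?_, ?_⟩
  · rw [← he]; exact fun _ _ => rfl
  · ext ψ
    simp only [Set.mem_insert_iff, Set.mem_singleton_iff]
    refine ⟨fun hψ => ?_, ?_⟩
    · rcases FaithfulOn.sameOn_or h (Or.inl hK) (hS ψ hψ).1 hi ((hS ψ hψ).faithfulOn _) hf with hs | hs
      · exact Or.inl (huniq _ hψ _ hχ hs)
      · exact Or.inr (huniq _ hψ _ (hstar χ hχ) hs)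
    · rintro (rfl | rfl)
      · exact hχ
      · exact hstar _ hχ

end Faithful

/-! ### Linear characters of extensions by a group of order three -/

section Linear

variable {G : Type u} {B : Type v} [Group G] [Fintype G] [Group B] [Fintype B]

/-- `φ` is a linear character of `G`, faithful on the kernel of `σ`, whose cube is the sign
character `ε` of the quotient. -/
structure LinOver (σ : G →* B) (φ : G → ℂ) (ε : B →* ℤˣ) : Prop where
  irr : IsIrr φ
  one : φ 1 = 1
  faithful : FaithfulOn σ.ker φ
  cube : ∀ g, φ g ^ 3 = ((ε (σ g) : ℤ) : ℂ)

variable {σ : G →* B} {φ : G → ℂ} {ε : B →* ℤˣ}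

theorem IsLinearChar.exists_hom (h : IsLinearChar φ) : ∃ f : G →* ℂ, φ = f :=
  ⟨{ toFun := φ, map_one' := h.2, map_mul' := h.1.map_mul h.2 }, rfl⟩

theorem LinOver.isLinearChar (h : LinOver σ φ ε) : IsLinearChar φ := ⟨h.irr, h.one⟩

/-- The product of φ with the sign has order dividing three at the lift, and also order dividing
that of `b`, which is prime to three. -/
theorem LinOver.apply_s (h : LinOver σ φ ε) (hσ : CentralExt σ) (hK : Nat.card σ.ker = 3) {b : B}
    (hb : (orderOf b).Coprime 3) : φ (hσ.s b) = ((ε b : ℤ) : ℂ) := by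
  obtain ⟨f, rfl⟩ := h.isLinearChar.exists_hom
  have h3 := h.cube (hσ.s b)
  rw [π_s] at h3
  have hu : ((ε b : ℤ) : ℂ) ^ 2 = 1 := by
    rcases Int.units_eq_one_or (ε b) with he | he <;> simp [he]
  have h1 : (f (hσ.s b) * ((ε b : ℤ) : ℂ)) ^ 3 = 1 := by
    rw [mul_pow, h3]
    linear_combination (((ε b : ℤ) : ℂ) ^ 2 + 1) * hu
  have h2 : (f (hσ.s b) * ((ε b : ℤ) : ℂ)) ^ orderOf b = 1 := by
    have h4 : hσ.s b ^ orderOf b = 1 := by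
      rw [← hσ.orderOf_s (by rwa [hK]), pow_orderOf_eq_one]
    have h5 : ε b ^ orderOf b = 1 := by rw [← map_pow, pow_orderOf_eq_one, map_one]
    rw [mul_pow, ← map_pow, h4, map_one, one_mul]
    have := congrArg (fun x : ℤˣ => ((x : ℤ) : ℂ)) h5
    simpa using this
  have h6 : f (hσ.s b) * ((ε b : ℤ) : ℂ) = 1 := orderOf_eq_one_iff.1 (Nat.dvd_one.1
    (hb.gcd_eq_one ▸ Nat.dvd_gcd (orderOf_dvd_of_pow_eq_one h2) (orderOf_dvd_of_pow_eq_one h1)))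
  linear_combination ((ε b : ℤ) : ℂ) * h6 - f (hσ.s b) * hu

theorem LinOver.star (h : LinOver σ φ ε) : LinOver σ (star φ) ε where
  irr := h.irr.star
  one := by rw [Pi.star_apply, h.one, star_one]
  faithful := h.faithful.star
  cube := fun g => by rw [Pi.star_apply, ← star_pow, h.cube]; simp

theorem LinOver.norm_apply (h : LinOver σ φ ε) (g : G) : ‖φ g‖ = 1 := by
  refine Complex.norm_eq_one_of_pow_eq_one (n := 6) ?_ (by norm_num)
  rw [show 6 = 3 * 2 by rfl, pow_mul, h.cube]
  rcases Int.units_eq_one_or (ε (σ g)) with he | he <;> simp [he]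

/-- Multiply a faithful character of the cyclic quotient of order three provided by transfer with
the inflated sign character. -/
theorem exists_linOver (hσ : CentralExt σ) {j : ℕ} (hB : Nat.card B = 3 * j) (hj : ¬ 3 ∣ j)
    (hK : Nat.card σ.ker = 3) (hom : ∀ (f : B →* Multiplicative (ZMod 3)) b, f b = 1)
    (ε : B →* ℤˣ) : ∃ φ, LinOver σ φ ε := by
  obtain ⟨z, W, hz, hz3, hW⟩ := hσ.exists_hom_zmod_three (i := 1) hB hj hK (by norm_num) hom
  let f : Multiplicative (ZMod 3) →* ℂ := (ZMod.stdAddChar (N := 3)).toMonoidHom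
  have hf : ∀ x, f x = 1 → x = 1 := fun x hx =>
    ZMod.injective_stdAddChar (N := 3) (hx.trans (AddChar.map_zero_eq_one _).symm)
  let e : B →* ℂ := ((Int.castRingHom ℂ : ℤ →* ℂ).comp (Units.coeHom ℤ)).comp ε
  let F : G →* ℂ := (f.comp W) * (e.comp σ)
  have hF : ∀ g, F g = f (W g) * ((ε (σ g) : ℤ) : ℂ) := fun g => rfl
  refine ⟨F, isIrr_of_monoidHom F, map_one F, fun y hy h1 => ?_, fun g => ?_⟩
  · have hy' : σ y = 1 := hy
    rw [map_one, hF, hy', map_one, Units.val_one, Int.cast_one, mul_one] at h1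
    have h2 : (⟨y, hy⟩ : σ.ker) ∈ Subgroup.zpowers (⟨z, hz⟩ : σ.ker) :=
      mem_zpowers_of_prime_card hK fun h0 => by
        have := congrArg Subtype.val h0
        change z = 1 at this
        rw [this, orderOf_one] at hz3
        omega
    obtain ⟨n, hn⟩ := h2
    exact map_eq_one_of_mem_zpowers (by rw [hz3]; exact Nat.prime_three) W hW
      ⟨n, congrArg Subtype.val hn⟩ (hf _ h1)
  · rw [hF, mul_pow, ← map_pow, show W g ^ 3 = 1 by
      have := pow_card_eq_one' (x := W g)
      rwa [Nat.card_eq_fintype_card (α := Multiplicative (ZMod 3))] at this, map_one, one_mul]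
    rcases Int.units_eq_one_or (ε (σ g)) with he | he <;> simp [he]
    norm_num

theorem exists_hom_of_ker_le (hσ : CentralExt σ) (f : G →* ℂ) (hf : ∀ z, σ z = 1 → f z = 1) :
    ∃ μ : B →* ℂ, ∀ g, f g = μ (σ g) := by
  let f' : G →* ℂˣ := f.toHomUnits
  have hle : σ.ker ≤ f'.ker := fun z hz => Units.ext (hf z hz)
  refine ⟨(Units.coeHom ℂ).comp (σ.liftOfSurjective hσ.surj ⟨f', hle⟩), fun g => ?_⟩
  have := MonoidHom.liftOfRightInverse_comp_apply σ _ (Function.rightInverse_surjInv hσ.surj)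
    ⟨f', hle⟩ g
  change _ = ((σ.liftOfSurjective hσ.surj ⟨f', hle⟩ (σ g) : ℂˣ) : ℂ)
  rw [MonoidHom.liftOfSurjective, this]
  rfl

/-- The possible linear characters of `B` are trivial or given by `ε`. -/
def HomSign (B : Type v) [Group B] (ε : B →* ℤˣ) : Prop :=
  ∀ μ : B →* ℂ, (∀ b, μ b = 1) ∨ ∀ b, μ b = ((ε b : ℤ) : ℂ)

/-- The cube of φ is trivial on the kernel, so it is a linear character of `B`, trivial or ε. -/
theorem IsLinearChar.linOver (h : IsLinearChar φ) (hσ : CentralExt σ) (hK : Nat.card σ.ker = 3)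
    (hf : FaithfulOn σ.ker φ) (hε : HomSign B ε) : LinOver σ φ 1 ∨ LinOver σ φ ε := by
  obtain ⟨f, rfl⟩ := h.exists_hom
  obtain ⟨μ, hμ⟩ := exists_hom_of_ker_le hσ (f ^ 3) fun z hz => by
    have := pow_card_ker hz
    rw [hK] at this
    rw [MonoidHom.pow_apply, ← map_pow, this, map_one]
  rcases hε μ with h1 | h1
  · exact Or.inl ⟨h.1, h.2, hf, fun g => by
      have := hμ g
      rw [MonoidHom.pow_apply, h1] at this
      rw [this]; simp⟩
  · exact Or.inr ⟨h.1, h.2, hf, fun g => by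
      have := hμ g
      rwa [MonoidHom.pow_apply, h1] at this⟩

theorem homSign_of_isPerfect [Group.IsPerfect B] : HomSign B 1 := fun μ => Or.inl fun b => by
  have h := Abelianization.commutator_subset_ker μ.toHomUnits
  rw [Group.IsPerfect.commutator_eq_top] at h
  exact congrArg Units.val (h (Subgroup.mem_top b))

theorem homSign_perm {n : ℕ} : HomSign (Equiv.Perm (Fin n)) Equiv.Perm.sign := by
  intro μ
  by_cases hall : ∀ x y : Fin n, x ≠ y → μ (Equiv.swap x y) = 1
  · left
    intro b
    induction b using Equiv.Perm.swap_induction_on with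
    | one => exact map_one μ
    | swap_mul b x y hxy hb => rw [map_mul, hb, hall x y hxy, one_mul]
  · right
    push Not at hall
    obtain ⟨x₀, y₀, h0, h1⟩ := hall
    have hneg : ∀ x y : Fin n, x ≠ y → μ (Equiv.swap x y) = -1 := by
      intro x y hxy
      obtain ⟨c, hc⟩ := isConj_iff.1 (Equiv.Perm.isConj_swap h0 hxy)
      have h2 : μ (Equiv.swap x y) = μ (Equiv.swap x₀ y₀) := by
        rw [← hc, map_mul, map_mul, mul_right_comm, ← map_mul, mul_inv_cancel, map_one, one_mul]
      rw [h2]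
      refine (mul_self_eq_one_iff.1 ?_).resolve_left h1
      rw [← map_mul, Equiv.swap_mul_self, map_one]
    intro b
    induction b using Equiv.Perm.swap_induction_on with
    | one => simp
    | swap_mul b x y hxy hb => rw [map_mul, hb, hneg x y hxy, map_mul, Equiv.Perm.sign_swap hxy]; simp

end Linear

end ImprimitiveCovers

namespace ImprimitiveCovers

open Finset CentralExt

/-! ### Elements of order five -/

section Five

variable {G : Type u} {A : Type v} [Group G] [Fintype G] [Group A] [Fintype A] {π : G →* A}
variable {χ ψ : G → ℂ}

/-- The values of `χ` at the lifts of `a` and `a²`, for `a` of order five. -/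
def CentralExt.FiveVal (h : CentralExt π) (a : A) (χ : G → ℂ) (u D : ℤ) : Prop :=
  χ (h.s a) = (u + D * sqrtFive) / 2 ∧ χ (h.s (a ^ 2)) = (u - D * sqrtFive) / 2

/-- The elements of order five form at most two classes, which are closed under inversion. -/
structure FiveClasses (A : Type v) [Group A] : Prop where
  isConj_or : ∀ a b : A, orderOf a = 5 → orderOf b = 5 → IsConj a b ∨ IsConj (a ^ 2) b
  isConj_inv : ∀ a : A, orderOf a = 5 → IsConj a (a ^ 4)

theorem CentralExt.exists_fiveVal (h : CentralExt π) (hco : Nat.Coprime 5 (Nat.card π.ker))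
    (h5 : FiveClasses A) (hχ : IsIrr χ) {d : ℕ} (hd : χ 1 = d) {a : A} (ha : orderOf a = 5) :
    ∃ (t : ℕ) (D : ℤ), 2 ∣ D - t ∧ h.FiveVal a χ (2 * d - 5 * t) D := by
  have hco' : (orderOf a).Coprime (Nat.card π.ker) := by rwa [ha]
  have hpow : h.s a ^ 5 = 1 := by rw [← ha, ← h.orderOf_s hco', pow_orderOf_eq_one]
  have hc : IsConj (h.s a) (h.s a ^ 4) := by
    obtain ⟨x, hx⟩ := isConj_iff.1 (h5.isConj_inv a ha)
    obtain ⟨g, rfl⟩ := h.surj x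
    refine isConj_iff.2 ⟨g, ?_⟩
    rw [← h.s_conj hco', hx, h.s_pow hco']
  obtain ⟨t, D, hD, h1, h2⟩ := hχ.exists_five hd hpow hc
  exact ⟨t, D, hD, h1, by rw [h.s_pow hco', h2]⟩

/-- Averaging over `b` and its square treats one class and two classes alike: the sum of the
contributions at `b` and `b ^ 2` does not depend on `b`, and in it the terms linear in √5 cancel. -/
theorem CentralExt.rip_five (h : CentralExt π) (hco : Nat.Coprime 5 (Nat.card π.ker))
    (h5 : FiveClasses A) (hχ : ∀ x g, χ (x * g * x⁻¹) = χ g) (hψ : ∀ x g, ψ (x * g * x⁻¹) = ψ g)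
    {a : A} (ha : orderOf a = 5) {u D u' D' : ℤ} (h1 : h.FiveVal a χ u D)
    (h2 : h.FiveVal a ψ u' D') :
    4 * h.rip 5 χ ψ = (ofOrder A 5).card * (u * u' + 5 * D * D') := by
  let f : A → ℝ := fun b => (χ (h.s b) * star (ψ (h.s b))).re
  have hord : ∀ b : A, orderOf b = 5 → ∀ k, k.Coprime 5 → orderOf (b ^ k) = 5 := fun b hb k hk => by
    have hg : Nat.gcd 5 k = 1 := hk.symm
    rw [orderOf_pow, hb, hg, Nat.div_one]
  have hfc : ∀ b c, orderOf b = 5 → IsConj b c → f b = f c := fun b c hb hbc => by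
    simp only [f]
    rw [h.apply_s_eq_of_isConj hχ (by rwa [hb]) hbc, h.apply_s_eq_of_isConj hψ (by rwa [hb]) hbc]
  have hpow : ∀ {b c : A}, IsConj b c → IsConj (b ^ 2) (c ^ 2) := fun {b c} hbc => by
    obtain ⟨x, rfl⟩ := isConj_iff.1 hbc
    exact isConj_iff.2 ⟨x, by rw [conj_pow]⟩
  have hsq : osum 5 (fun b => f (b ^ 2)) = osum 5 f := by
    refine sum_nbij' (fun b => b ^ 2) (fun b => b ^ 3) ?_ ?_ ?_ ?_ ?_
    · intro b hb
      rw [mem_ofOrder] at hb ⊢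
      exact hord b hb 2 (by norm_num)
    · intro b hb
      rw [mem_ofOrder] at hb ⊢
      exact hord b hb 3 (by norm_num)
    · intro b hb
      rw [mem_ofOrder] at hb
      rw [← pow_mul, show 2 * 3 = 5 + 1 by rfl, pow_add, ← hb, pow_orderOf_eq_one, one_mul, pow_one]
    · intro b hb
      rw [mem_ofOrder] at hb
      rw [← pow_mul, show 3 * 2 = 5 + 1 by rfl, pow_add, ← hb, pow_orderOf_eq_one, one_mul, pow_one]
    · intro b _; rfl
  have hconst : ∀ b, orderOf b = 5 → f b + f (b ^ 2) = f a + f (a ^ 2) := by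
    intro b hb
    have ha2 := hord a ha 2 (by norm_num)
    rcases h5.isConj_or a b ha hb with hc | hc
    · rw [hfc a b ha hc, hfc _ _ ha2 (hpow hc)]
    · have e1 := hfc _ _ ha2 hc
      have e2 := hfc _ _ (hord _ ha2 2 (by norm_num)) (hpow hc)
      have e3 := hfc _ _ ha (h5.isConj_inv a ha)
      rw [← pow_mul] at e2
      rw [← e1, ← e2, e3, add_comm]
  have hval : f a + f (a ^ 2) = (u * u' + 5 * D * D') / 2 := by
    have hs := star_sqrtFive
    have hq := sqrtFive_sq
    have e : χ (h.s a) * star (ψ (h.s a)) + χ (h.s (a ^ 2)) * star (ψ (h.s (a ^ 2))) =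
        (((u * u' + 5 * D * D') / 2 : ℝ) : ℂ) := by
      rw [h1.1, h1.2, h2.1, h2.2]
      simp only [star_div₀, star_add, star_sub, star_mul', hs, Complex.star_def, map_intCast,
        Complex.conj_ofNat]
      push_cast
      linear_combination (D * D' : ℂ) / 2 * hq
    have := congrArg Complex.re e
    rwa [Complex.add_re, Complex.ofReal_re] at this
  have htot : osum 5 f + osum 5 f = (ofOrder A 5).card * ((u * u' + 5 * D * D') / 2) := by
    nth_rewrite 2 [← hsq]
    rw [osum, osum, ← sum_add_distrib, ← hval, ← nsmul_eq_mul, ← sum_const]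
    exact sum_congr rfl fun b hb => hconst b (mem_ofOrder.1 hb)
  change 4 * osum 5 f = _
  linarith

end Five

/-! ### Norm bounds and values of induced characters -/

section Linear

variable {G : Type u} {A : Type v} {B : Type w} [Group G] [Fintype G] [Group A] [Fintype A]
  [Group B] [Fintype B] {π : G →* A} {H : Subgroup G} {σ : H →* B} {φ : H → ℂ} {ε : B →* ℤˣ}

/-- The Cauchy–Schwarz bound, with the number of fixed cosets replaced by its expression through
element counts. -/
theorem CentralExt.rip_ind_le (h : CentralExt π) (hσ : Compat π H σ) (hφ : IsIrr φ) {r N n : ℕ}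
    (hr : RatConj A r) (hN : (ofOrder A r).card = N) (hn : (ofOrder B r).card = n) :
    N * h.rip r (ind H φ) (ind H φ) ≤
      H.index * n * (H.index * osum r (fun b => ‖φ ((hσ.ext h).s b)‖ ^ 2)) := by
  rcases Nat.eq_zero_or_pos N with h0 | h0
  · rw [h0, Nat.cast_zero, zero_mul]
    have : 0 ≤ osum r (fun b => ‖φ ((hσ.ext h).s b)‖ ^ 2) := sum_nonneg fun _ _ => by positivity
    positivity
  obtain ⟨a, ha⟩ := card_pos.1 (hN ▸ h0)
  rw [mem_ofOrder] at ha
  have h1 := card_mul_fixc (H.map π) hr ha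
  rw [hN, index_map h hσ.le, Compat.card_ofOrder hσ, hn] at h1
  have h2 := osum_norm_ind_le h hσ hφ (r := r) (F := fixc (H.map π) a)
    fun b hb => (fixc_eq _ hr hb ha).le
  rw [← rip_self] at h2
  have h3 : (N : ℝ) * fixc (H.map π) a = H.index * n := by exact_mod_cast h1
  calc (N : ℝ) * h.rip r (ind H φ) (ind H φ) ≤ N * (fixc (H.map π) a *
        (H.index * osum r (fun b => ‖φ ((hσ.ext h).s b)‖ ^ 2))) := by gcongr
    _ = _ := by rw [← mul_assoc, h3]

theorem LinOver.rip_ind_le (hφ : LinOver σ φ ε) (h : CentralExt π) (hσ : Compat π H σ) {r N n : ℕ}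
    (hr : RatConj A r) (hN : (ofOrder A r).card = N) (hn : (ofOrder B r).card = n) :
    N * h.rip r (ind H φ) (ind H φ) ≤ (H.index * n) ^ 2 := by
  have : Fintype H := Fintype.ofFinite H
  have h1 := h.rip_ind_le hσ hφ.irr hr hN hn
  rw [osum_const (c := (1 : ℝ)) fun b _ => by rw [hφ.norm_apply]; norm_num, hn, nsmul_eq_mul,
    mul_one] at h1
  rwa [pow_two]

theorem LinOver.val_ind (hφ : LinOver σ φ ε) (h : CentralExt π) (hσ : Compat π H σ)
    (hK : Nat.card π.ker = 3) {r : ℕ} (hr : r.Coprime 3)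
    (hc : ∀ a b : A, orderOf a = r → orderOf b = r → IsConj a b) {N : ℕ}
    (hN : (ofOrder A r).card = N) (hN0 : 0 < N) {S : ℤ}
    (hS : osum r (fun b => (ε b : ℤ)) = S) {x : ℝ} (hx : N * x = H.index * S) :
    h.Val r (ind H φ) x := by
  have : Fintype H := Fintype.ofFinite H
  refine h.val_ind hσ (by rwa [hK]) hc hN hN0 (S := S) ?_ hx
  rw [← hS, osum, osum]
  push_cast
  refine sum_congr rfl fun b hb => ?_
  rw [hφ.apply_s (hσ.ext h) ((Compat.card_ker hσ).trans hK) (by rwa [mem_ofOrder.1 hb])]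

theorem CentralExt.rip_of_val (h : CentralExt π) {r N : ℕ} {χ : G → ℂ} {x : ℝ}
    (hx : h.Val r χ x) (hN : (ofOrder A r).card = N) : h.rip r χ χ = N * x ^ 2 := by
  rw [h.rip_const hx hx, hN, pow_two]

theorem FaithfulOn.rip_three [Group.IsPerfect G] (h : CentralExt π) {i j : ℕ}
    (hA : Nat.card A = 9 * j) (hj : ¬ 3 ∣ j) (hK : Nat.card π.ker = 3 * i) (hi : ¬ 3 ∣ i)
    {χ : G → ℂ} (hχ : IsIrr χ) (hf : FaithfulOn π.ker χ) : h.rip 3 χ χ = 0 :=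
  h.rip_three hA hj hK hi hχ.conj fun z hz hz1 =>
    ⟨cc χ z, hf.cc_ne_one hχ hz hz1, hχ.cc_mul (h.central hz)⟩

theorem CentralExt.rip_three_ind [Group.IsPerfect G] (h : CentralExt π) {i j : ℕ}
    (hA : Nat.card A = 9 * j) (hj : ¬ 3 ∣ j) (hK : Nat.card π.ker = 3 * i) (hi : ¬ 3 ∣ i)
    (hσ : Compat π H σ) (hφ : IsIrr φ) (hf : FaithfulOn σ.ker φ) :
    h.rip 3 (ind H φ) (ind H φ) = 0 :=
  h.rip_three hA hj hK hi (ind_conj H φ) fun z hz hz1 => by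
    have : Fintype H := Fintype.ofFinite H
    refine ⟨cc φ ⟨z, hσ.le hz⟩, hf.cc_ne_one hφ ((hσ.ker _).2 hz) fun h0 => hz1 ?_,
      ind_mul hφ (h.central hz) (hσ.le hz)⟩
    exact congrArg Subtype.val h0

theorem faithfulOn_ind (h : CentralExt π) (hσ : Compat π H σ)
    (hf : FaithfulOn σ.ker φ) : FaithfulOn π.ker (ind H φ) := fun z hz h1 => by
  have hk : (H.index : ℂ) ≠ 0 := by exact_mod_cast Subgroup.index_ne_zero_of_finite
  rw [ind_one, ind_central H φ (h.central hz), extz_mem (hσ.le hz)] at h1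
  have := hf ⟨z, hσ.le hz⟩ ((hσ.ker _).2 hz) (mul_left_cancel₀ hk h1)
  exact congrArg Subtype.val this

theorem faithfulOn_of_ind (h : CentralExt π) (hσ : Compat π H σ)
    (hf : FaithfulOn π.ker (ind H φ)) : FaithfulOn σ.ker φ := fun z hz h1 => by
  have hz' : π z = 1 := (hσ.ker z).1 hz
  refine Subtype.ext (hf z hz' ?_)
  rw [ind_one, ind_central H φ (h.central hz'), extz_mem z.2, ← h1]

end Linear

/-! ### Numerical data of the characters of 3·A₆ -/

section Six

variable {G : Type u} [Group G] [Fintype G] {π : G →* Alt 6} {χ ψ : G → ℂ}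

theorem fiveClasses_alt_six : FiveClasses (Alt 6) :=
  ⟨fun _ _ ha hb => isConj_or_five_alt_six ha hb, fun _ ha => isConj_inv_five_alt_six ha⟩

theorem fiveClasses_alt_five : FiveClasses (Alt 5) :=
  ⟨fun _ _ ha hb => isConj_or_five_alt_five ha hb, fun _ ha => isConj_inv_five_alt_five ha⟩

theorem natCard_alt_six' : Nat.card (Alt 6) = 9 * 40 := by rw [natCard_alt_six]

/-- The values of a faithful irreducible character of `3·A₆`, where `a` has order five. -/
structure CentralExt.SixData (h : CentralExt π) (a : Alt 6) (χ : G → ℂ) (d x y u D : ℤ) :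
    Prop where
  irr : IsIrr χ
  one : χ 1 = d
  two : h.Val 2 χ x
  three : h.rip 3 χ χ = 0
  four : h.Val 4 χ y
  five : h.FiveVal a χ u D

theorem exists_five_alt_six : ∃ a : Alt 6, orderOf a = 5 :=
  exists_prime_orderOf_dvd_card' 5 (by rw [natCard_alt_six]; norm_num)

/-- There are 1, 45 and 90 elements of orders 1, 2 and 4, and 36 is a quarter of the 144 elements of
order five; order three contributes nothing. -/
theorem CentralExt.SixData.sum_rip (h : CentralExt π) (hK : Nat.card π.ker = 3) {a : Alt 6}
    (ha : orderOf a = 5) {d x y u D d' x' y' u' D' : ℤ}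
    (hχ : h.SixData a χ d x y u D) (hψ : h.SixData a ψ d' x' y' u' D') :
    h.rip 1 χ ψ + h.rip 2 χ ψ + h.rip 3 χ ψ + h.rip 4 χ ψ + h.rip 5 χ ψ =
      ((d * d' + 45 * (x * x') + 90 * (y * y') + 36 * (u * u' + 5 * D * D') : ℤ) : ℝ) := by
  have h5 := h.rip_five (by rw [hK]; norm_num) fiveClasses_alt_six hχ.irr.conj hψ.irr.conj ha
    hχ.five hψ.five
  rw [card_five_alt_six] at h5
  rw [h.rip_one (d := d) (e := d') (by rw [hχ.one]; simp) (by rw [hψ.one]; simp),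
    h.rip_const hχ.two hψ.two, h.rip_const hχ.four hψ.four, h.rip_eq_zero_of_left hχ.three,
    card_two_alt_six, card_four_alt_six]
  push_cast at h5 ⊢
  linarith

theorem sum_orders_six (f : ℕ → ℝ) :
    ∑ r ∈ ({1, 2, 3, 4, 5} : Finset ℕ), f r = f 1 + f 2 + f 3 + f 4 + f 5 := by
  rw [sum_insert (by decide), sum_insert (by decide), sum_insert (by decide),
    sum_insert (by decide), sum_singleton]
  ring

theorem CentralExt.SixData.norm (h : CentralExt π) (hK : Nat.card π.ker = 3) {a : Alt 6}
    (ha : orderOf a = 5) {d x y u D : ℤ} (hχ : h.SixData a χ d x y u D) :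
    d ^ 2 + 45 * x ^ 2 + 90 * y ^ 2 + 36 * (u ^ 2 + 5 * D ^ 2) = 360 := by
  have h1 := SixData.sum_rip h hK ha hχ hχ
  have h2 := h.sum_rip hχ.irr hχ.irr (fun _ _ => rfl) orderOf_alt_six
  rw [sum_orders_six, if_pos rfl, h1, natCard_alt_six] at h2
  have h3 : (d * d + 45 * (x * x) + 90 * (y * y) + 36 * (u * u + 5 * D * D) : ℤ) = 360 := by
    exact_mod_cast h2
  linarith

theorem CentralExt.SixData.orth (h : CentralExt π) (hK : Nat.card π.ker = 3) {a : Alt 6}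
    (ha : orderOf a = 5) {d x y u D d' x' y' u' D' : ℤ}
    (hχ : h.SixData a χ d x y u D) (hψ : h.SixData a ψ d' x' y' u' D')
    (hs : SameOn π.ker χ ψ) (hne : χ ≠ ψ) :
    d * d' + 45 * (x * x') + 90 * (y * y') + 36 * (u * u' + 5 * D * D') = 0 := by
  have h1 := SixData.sum_rip h hK ha hχ hψ
  have h2 := h.sum_rip hχ.irr hψ.irr hs orderOf_alt_six
  rw [sum_orders_six, if_neg hne, h1] at h2
  exact_mod_cast h2

theorem CentralExt.isConj_pow_three {A : Type v} [Group A] {π : G →* A} (h : CentralExt π) {a : A}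
    (hco : (orderOf a).Coprime (Nat.card π.ker)) {k : ℕ} (hc : IsConj a (a ^ k)) :
    IsConj (h.s a) (h.s a ^ k) := by
  obtain ⟨x, hx⟩ := isConj_iff.1 hc
  obtain ⟨g, rfl⟩ := h.surj x
  exact isConj_iff.2 ⟨g, by rw [← h.s_conj hco, hx, h.s_pow hco]⟩

theorem CentralExt.exists_val_two {A : Type v} [Group A] [Fintype A] {π : G →* A}
    (h : CentralExt π) (hK : Nat.card π.ker = 3)
    (hc : ∀ a b : A, orderOf a = 2 → orderOf b = 2 → IsConj a b) {a : A} (ha : orderOf a = 2)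
    (hχ : IsIrr χ) : ∃ x : ℤ, h.Val 2 χ x := by
  obtain ⟨d, -, hd⟩ := hχ.exists_degree
  obtain ⟨x, hx⟩ := hχ.exists_int_of_sq hd (g := h.s a) (by
    rw [← ha, ← h.orderOf_s (by rw [ha, hK]; norm_num), pow_orderOf_eq_one])
  exact ⟨x, h.val_of_isConj (by rw [hK]; norm_num) hc hχ.conj ha (by rw [hx]; simp)⟩

theorem CentralExt.exists_val_four {A : Type v} [Group A] [Fintype A] {π : G →* A}
    (h : CentralExt π) (hK : Nat.card π.ker = 3)
    (hc : ∀ a b : A, orderOf a = 4 → orderOf b = 4 → IsConj a b) {a : A} (ha : orderOf a = 4)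
    (hχ : IsIrr χ) : ∃ x : ℤ, h.Val 4 χ x := by
  have hco : (orderOf a).Coprime (Nat.card π.ker) := by rw [ha, hK]; norm_num
  have h3 : orderOf (a ^ 3) = 4 := by rw [orderOf_pow, ha]; norm_num
  obtain ⟨x, hx⟩ := hχ.exists_int_of_pow_four (g := h.s a)
    (by rw [← ha, ← h.orderOf_s hco, pow_orderOf_eq_one])
    (h.isConj_pow_three hco (hc _ _ ha h3))
  exact ⟨x, h.val_of_isConj (by rw [hK]; norm_num) hc hχ.conj ha (by rw [hx]; simp)⟩

theorem exists_order_of_card_pos {A : Type v} [Group A] [Fintype A] {r N : ℕ}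
    (hN : (ofOrder A r).card = N) (h0 : 0 < N) : ∃ a : A, orderOf a = r := by
  obtain ⟨a, ha⟩ := card_pos.1 (hN ▸ h0)
  exact ⟨a, mem_ofOrder.1 ha⟩

theorem CentralExt.exists_sixData [Group.IsPerfect G] (h : CentralExt π)
    (hK : Nat.card π.ker = 3) {a : Alt 6} (ha : orderOf a = 5) (hχ : IsIrr χ)
    (hf : FaithfulOn π.ker χ) {d : ℕ} (hd : χ 1 = d) :
    ∃ (x y : ℤ) (t : ℕ) (D : ℤ), 2 ∣ D - t ∧ h.SixData a χ d x y (2 * d - 5 * t) D := by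
  obtain ⟨a₂, ha₂⟩ := exists_order_of_card_pos card_two_alt_six (by norm_num)
  obtain ⟨a₄, ha₄⟩ := exists_order_of_card_pos card_four_alt_six (by norm_num)
  obtain ⟨x, hx⟩ := h.exists_val_two hK (fun _ _ => isConj_two_alt_six) ha₂ hχ
  obtain ⟨y, hy⟩ := h.exists_val_four hK (fun _ _ => isConj_four_alt_six) ha₄ hχ
  obtain ⟨t, D, hD, h5⟩ := h.exists_fiveVal (by rw [hK]; norm_num) fiveClasses_alt_six hχ hd ha
  exact ⟨x, y, t, D, hD, hχ, by simpa using hd, hx,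
    hf.rip_three h (i := 1) natCard_alt_six' (by norm_num) hK (by norm_num) hχ, hy, h5⟩

end Six

end ImprimitiveCovers

namespace ImprimitiveCovers

open Finset CentralExt Equiv

/-! ### Element counts in the small groups -/

section Counts

theorem orderOf_eq_two_iff {B : Type*} [Monoid B] (b : B) : orderOf b = 2 ↔ b ^ 2 = 1 ∧ b ≠ 1 := by
  constructor
  · intro h
    exact ⟨h ▸ pow_orderOf_eq_one b, fun h1 => by rw [h1, orderOf_one] at h; omega⟩
  · rintro ⟨h1, h2⟩; exact orderOf_eq_prime h1 h2

theorem orderOf_eq_five_iff {B : Type*} [Monoid B] (b : B) : orderOf b = 5 ↔ b ^ 5 = 1 ∧ b ≠ 1 := by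
  constructor
  · intro h
    exact ⟨h ▸ pow_orderOf_eq_one b, fun h1 => by rw [h1, orderOf_one] at h; omega⟩
  · rintro ⟨h1, h2⟩; exact orderOf_eq_prime h1 h2

theorem orderOf_eq_four_iff {B : Type*} [Monoid B] (b : B) :
    orderOf b = 4 ↔ b ^ 4 = 1 ∧ b ^ 2 ≠ 1 := by
  constructor
  · intro h
    exact ⟨h ▸ pow_orderOf_eq_one b, fun h1 => by
      have := orderOf_dvd_of_pow_eq_one h1
      rw [h] at this; omega⟩
  · rintro ⟨h1, h2⟩
    exact orderOf_eq_prime_pow (p := 2) (n := 1) h2 h1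

theorem orderOf_eq_six_iff {B : Type*} [Monoid B] (b : B) :
    orderOf b = 6 ↔ b ^ 6 = 1 ∧ b ^ 3 ≠ 1 ∧ b ^ 2 ≠ 1 := by
  constructor
  · intro h
    refine ⟨h ▸ pow_orderOf_eq_one b, fun h1 => ?_, fun h1 => ?_⟩ <;>
    · have := orderOf_dvd_of_pow_eq_one h1
      rw [h] at this; omega
  · rintro ⟨h1, h2, h3⟩
    refine orderOf_eq_of_pow_and_pow_div_prime (by norm_num) h1 fun p hp hd => ?_
    have hp' : p ∈ Nat.primeFactors 6 := Nat.mem_primeFactors.2 ⟨hp, hd, by norm_num⟩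
    rw [show Nat.primeFactors 6 = {2, 3} by decide +kernel] at hp'
    rcases Finset.mem_insert.1 hp' with rfl | hp'
    · exact h2
    · rw [Finset.mem_singleton.1 hp']; exact h3

theorem osum_eq_sum_filter {B M : Type*} [Group B] [Fintype B] [AddCommMonoid M] {r : ℕ}
    (p : B → Prop) [DecidablePred p] (hp : ∀ b, orderOf b = r ↔ p b) (f : B → M) :
    osum r f = ∑ b ∈ univ.filter p, f b :=
  sum_congr (by ext b; simp [hp]) fun _ _ => rfl

theorem osum_two_sign_four : osum 2 (fun b : Perm (Fin 4) => (Perm.sign b : ℤ)) = -3 := by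
  rw [osum_eq_sum_filter _ orderOf_eq_two_iff]; decide +kernel

theorem osum_four_sign_four : osum 4 (fun b : Perm (Fin 4) => (Perm.sign b : ℤ)) = -6 := by
  rw [osum_eq_sum_filter _ orderOf_eq_four_iff]; decide +kernel

theorem osum_two_sign_five : osum 2 (fun b : Perm (Fin 5) => (Perm.sign b : ℤ)) = 5 := by
  rw [osum_eq_sum_filter _ orderOf_eq_two_iff]; decide +kernel

theorem osum_four_sign_five : osum 4 (fun b : Perm (Fin 5) => (Perm.sign b : ℤ)) = -30 := by
  rw [osum_eq_sum_filter _ orderOf_eq_four_iff]; decide +kernel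

theorem osum_five_sign_five : osum 5 (fun b : Perm (Fin 5) => (Perm.sign b : ℤ)) = 24 := by
  rw [osum_eq_sum_filter _ orderOf_eq_five_iff]; decide +kernel

theorem card_two_perm_four : (ofOrder (Perm (Fin 4)) 2).card = 9 := by
  rw [card_eq_sum_ones]
  exact (osum_eq_sum_filter _ orderOf_eq_two_iff _).trans (by decide +kernel)

theorem card_two_perm_five : (ofOrder (Perm (Fin 5)) 2).card = 25 := by
  rw [card_eq_sum_ones]
  exact (osum_eq_sum_filter _ orderOf_eq_two_iff _).trans (by decide +kernel)

theorem card_six_perm_five : (ofOrder (Perm (Fin 5)) 6).card = 20 := by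
  rw [card_eq_sum_ones]
  exact (osum_eq_sum_filter _ orderOf_eq_six_iff _).trans (by decide +kernel)

theorem natCard_perm_four : Nat.card (Perm (Fin 4)) = 24 := by
  rw [Nat.card_perm, Nat.card_fin]; rfl

theorem natCard_perm_five : Nat.card (Perm (Fin 5)) = 120 := by
  rw [Nat.card_perm, Nat.card_fin]; rfl

theorem card_four_alt_five : (ofOrder (Alt 5) 4).card = 0 := by
  rw [card_eq_zero, eq_empty_iff_forall_notMem]
  intro a ha
  have h1 := orderOf_alt_five a
  rw [mem_ofOrder.1 ha] at h1
  revert h1; decide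

theorem osum_one_sign {B : Type*} [Group B] [Fintype B] (r : ℕ) :
    osum r (fun b : B => (((1 : B →* ℤˣ) b : ℤˣ) : ℤ)) = (ofOrder B r).card := by
  simp [osum]

end Counts

/-! ### Linear characters of 3 × B -/

section Pairs

variable {G : Type u} {A : Type v} {B : Type} [Group G] [Fintype G] [Group A] [Fintype A]
  [Group B] [Fintype B] {π : G →* A} {H : Subgroup G} {σ : H →* B} {φ : H → ℂ} {ε : B →* ℤˣ}

theorem exists_compat (h : π.ker ≤ H) (e : H.map π ≃* B) : ∃ σ : H →* B, Compat π H σ := by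
  have : Fintype (H.map π) := Fintype.ofFinite _
  exact ⟨_, (compat_subgroupMap π H h).comp e⟩

/-- A subgroup of prime order is contained in `H` or meets it trivially. -/
theorem ker_le_or_injective {p : ℕ} [Fact p.Prime] (hK : Nat.card π.ker = p) (H : Subgroup G) :
    π.ker ≤ H ∨ Function.Injective (π.subgroupMap H) := by
  by_cases hle : π.ker ≤ H
  · exact Or.inl hle
  right
  refine (injective_iff_map_eq_one _).2 fun x hx => ?_
  by_contra hx1
  refine hle fun z hz => ?_
  have hx' : (x : G) ∈ π.ker := congrArg Subtype.val hx
  have : (⟨z, hz⟩ : π.ker) ∈ Subgroup.zpowers (⟨x, hx'⟩ : π.ker) :=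
    mem_zpowers_of_prime_card hK fun h0 => hx1 (Subtype.ext (show (x : G) = 1 from congrArg Subtype.val h0))
  obtain ⟨n, hn⟩ := this
  have hn' : (x : G) ^ n = z := congrArg Subtype.val hn
  rw [← hn']
  exact H.zpow_mem x.2 n

theorem natCard_map_of_injective (hinj : Function.Injective (π.subgroupMap H)) :
    Nat.card (H.map π) = Nat.card H :=
  (Nat.card_congr (Equiv.ofBijective _ ⟨hinj, π.subgroupMap_surjective H⟩)).symm

theorem natCard_of_isThreeTimes {H : Type u} [Group H] {K : Type} [Group K]
    (h : IsThreeTimes H K) : Nat.card H = 3 * Nat.card K := by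
  obtain ⟨e⟩ := h
  rw [Nat.card_congr e.toEquiv, Nat.card_prod, Nat.card_eq_fintype_card (α := Multiplicative _)]
  rfl

theorem faithfulOn_of_ne_one {H : Type u} [Group H] [Fintype H] {σ : H →* B} {φ : H → ℂ}
    (hK : Nat.card σ.ker = 3)
    (hφ : IsLinearChar φ) (h : ∃ z, σ z = 1 ∧ φ z ≠ 1) : FaithfulOn σ.ker φ := by
  obtain ⟨f, rfl⟩ := hφ.exists_hom
  obtain ⟨z, hz, hz1⟩ := h
  intro y hy hy1
  by_contra hne
  rw [map_one] at hy1
  have : (⟨z, hz⟩ : σ.ker) ∈ Subgroup.zpowers (⟨y, hy⟩ : σ.ker) :=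
    mem_zpowers_of_prime_card hK fun h0 => hne (congrArg Subtype.val h0)
  obtain ⟨n, hn⟩ := (isOfFinOrder_of_finite _).mem_powers_iff_mem_zpowers.2 this
  have hn' : y ^ n = z := congrArg Subtype.val hn
  exact hz1 (by rw [← hn', map_pow, hy1, one_pow])

theorem isThreeTimes_of_compat (h : CentralExt π) (hσ : Compat π H σ) (hK : Nat.card π.ker = 3)
    {j : ℕ} (hB : Nat.card B = 3 * j) (hj : ¬ 3 ∣ j)
    (hom : ∀ (f : B →* Multiplicative (ZMod 3)) b, f b = 1) : IsThreeTimes H B :=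
  have : Fintype H := Fintype.ofFinite H
  (hσ.ext h).nonempty_equiv_prod hB hj ((Compat.card_ker hσ).trans hK) hom

theorem LinOver.ne_one (hσ : Compat π H σ) (hK : Nat.card π.ker = 3) (hφ : LinOver σ φ ε) : φ ≠ 1 := by
  rintro rfl
  have h1 := (Compat.card_ker hσ).trans hK
  have : Nontrivial σ.ker := Finite.one_lt_card_iff_nontrivial.1 (by rw [h1]; norm_num)
  obtain ⟨z, hz⟩ := exists_ne (1 : σ.ker)
  exact hz (Subtype.ext (hφ.faithful z z.2 rfl))

/-- If φ were trivial on the kernel it would be a linear character of the perfect group `B`. -/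
theorem linOver_of_ne_one [Group.IsPerfect B] (h : CentralExt π) (hσ : Compat π H σ) 
    (hK : Nat.card π.ker = 3) (hφ : IsLinearChar φ)
    (h1 : φ ≠ 1) : LinOver σ φ 1 := by
  have : Fintype H := Fintype.ofFinite H
  have hc := (Compat.card_ker hσ).trans hK
  have hf : FaithfulOn σ.ker φ := by
    refine faithfulOn_of_ne_one hc hφ ?_
    by_contra! hcon
    obtain ⟨f, rfl⟩ := hφ.exists_hom
    obtain ⟨μ, hμ⟩ := exists_hom_of_ker_le (hσ.ext h) f hcon
    refine h1 (funext fun g => ?_)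
    rcases homSign_of_isPerfect μ with h2 | h2 <;> rw [hμ, h2] <;> simp
  exact (hφ.linOver (hσ.ext h) hc hf homSign_of_isPerfect).elim id id

/-- If φ is trivial on the kernel, its square is trivial; if it is faithful there without sign part,
its cube is. Order six excludes both. -/
theorem linOver_of_orderOf (h : CentralExt π) (hσ : Compat π H σ) 
    (hε : HomSign B ε) (hK : Nat.card π.ker = 3) (hφ : IsLinearChar φ)
    (h6 : orderOf φ = 6) : LinOver σ φ ε := by
  have : Fintype H := Fintype.ofFinite H
  have hc := (Compat.card_ker hσ).trans hK
  have hf : FaithfulOn σ.ker φ := by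
    refine faithfulOn_of_ne_one hc hφ ?_
    by_contra! hcon
    have hφ' := hφ
    obtain ⟨f, rfl⟩ := hφ'.exists_hom
    obtain ⟨μ, hμ⟩ := exists_hom_of_ker_le (hσ.ext h) f hcon
    have h2 : (f : H → ℂ) ^ 2 = 1 := funext fun g => by
      rw [Pi.pow_apply, Pi.one_apply, hμ]
      rcases hε μ with h2 | h2 <;> rw [h2]
      · norm_num
      · rcases Int.units_eq_one_or (ε (σ g)) with he | he <;> simp [he]
    have := orderOf_dvd_of_pow_eq_one h2
    rw [h6] at this
    omega
  refine (hφ.linOver (hσ.ext h) hc hf hε).elim (fun h3 => ?_) id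
  have h4 : φ ^ 3 = 1 := funext fun g => by
    rw [Pi.pow_apply, h3.cube]; simp
  have := orderOf_dvd_of_pow_eq_one h4
  rw [h6] at this
  omega

theorem LinOver.orderOf_eq (hσ : Compat π H σ) (hε : ∃ b, ε b ≠ 1)
    (hK : Nat.card π.ker = 3) (hφ : LinOver σ φ ε) :
    orderOf φ = 6 := by
  have h1 := (Compat.card_ker hσ).trans hK
  rw [orderOf_eq_six_iff]
  refine ⟨funext fun g => ?_, fun h3 => ?_, fun h2 => ?_⟩
  · rw [Pi.pow_apply, show 6 = 3 * 2 by rfl, pow_mul, hφ.cube]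
    rcases Int.units_eq_one_or (ε (σ g)) with he | he <;> simp [he]
  · obtain ⟨b, hb⟩ := hε
    obtain ⟨g, rfl⟩ := hσ.surj b
    have h4 := hφ.cube g
    rw [← Pi.pow_apply, h3, (Int.units_eq_one_or _).resolve_left hb] at h4
    norm_num at h4
  · have : Nontrivial σ.ker := Finite.one_lt_card_iff_nontrivial.1 (by rw [h1]; norm_num)
    obtain ⟨z, hz⟩ := exists_ne (1 : σ.ker)
    have h3 := hφ.cube z
    have h4 := congrFun h2 z
    rw [Pi.pow_apply, Pi.one_apply] at h4
    rw [show σ z = 1 from z.2, map_one, pow_succ, h4] at h3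
    exact hz (Subtype.ext (hφ.faithful z z.2 (by rw [hφ.one]; simpa using h3)))

end Pairs

end ImprimitiveCovers

namespace ImprimitiveCovers

open Finset CentralExt Equiv

/-! ### The characters of 3·A₆ of degrees 3, 6 and 15 -/

section ThreeAltSix

variable {G : Type u} [Group G] [Fintype G] {π : G →* Alt 6} {χ ψ : G → ℂ} {H : Subgroup G}

theorem CentralExt.natCard_three_alt_six (h : CentralExt π) (hK : Nat.card π.ker = 3) :
    Nat.card G = 1080 := by
  rw [h.natCard_eq, hK, natCard_alt_six]

theorem exists_compat_alt_five (h : CentralExt π) (hH : π.ker ≤ H) (hi : H.index = 6) :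
    ∃ σ : H →* Alt 5, Compat π H σ := by
  obtain ⟨e⟩ := equiv_alt_of_index (n := 6) (by norm_num) (H := H.map π)
    (by rw [index_map h hH, hi])
  exact exists_compat hH e

theorem exists_compat_perm_four (h : CentralExt π) (hH : π.ker ≤ H) (hi : H.index = 15) :
    ∃ σ : H →* Perm (Fin 4), Compat π H σ := by
  obtain ⟨e⟩ := equiv_perm_four_of_index (B := H.map π) (by rw [index_map h hH, hi])
  exact exists_compat hH e

theorem exists_ker_le_index (h : CentralExt π) {k : ℕ} (hk : ∃ B : Subgroup (Alt 6), B.index = k) :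
    ∃ H : Subgroup G, π.ker ≤ H ∧ H.index = k := by
  obtain ⟨B, hB⟩ := hk
  exact ⟨B.comap π, fun z hz => by rw [Subgroup.mem_comap, show π z = 1 from hz]; exact B.one_mem,
    by rw [Subgroup.index_comap_of_surjective _ h.surj, hB]⟩

/-- The contributions of orders 1, 2 and 5 are at most 36, 180 and 144, with sum 360; orders 3 and 4
contribute nothing. -/
theorem LinOver.isIrr_ind_alt_five [Group.IsPerfect G] (h : CentralExt π)
    (hK : Nat.card π.ker = 3) (hi : H.index = 6) {σ : H →* Alt 5} (hσ : Compat π H σ) {φ : H → ℂ}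
    (hφ : LinOver σ φ 1) : IsIrr (ind H φ) := by
  refine h.isIrr_ind hσ.le hφ.irr orderOf_alt_six ?_
  have h1 : h.rip 1 (ind H φ) (ind H φ) = 6 * 6 := h.rip_one
    (by rw [ind_one, hi, hφ.one]; simp) (by rw [ind_one, hi, hφ.one]; simp)
  have h2 := hφ.rip_ind_le h hσ (ratConj_of_isConj isConj_two_alt_six) card_two_alt_six
    card_two_alt_five
  have h3 := h.rip_three_ind (i := 1) natCard_alt_six' (by norm_num) hK (by norm_num) hσ hφ.irr
    hφ.faithful
  have h4 := hφ.rip_ind_le h hσ (ratConj_of_isConj isConj_four_alt_six) card_four_alt_six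
    card_four_alt_five
  have h5 := hφ.rip_ind_le h hσ ratConj_five_alt_six card_five_alt_six card_five_alt_five
  rw [hi] at h2 h4 h5
  rw [sum_orders_six, natCard_alt_six]
  norm_num at h2 h4 h5 ⊢
  linarith

theorem LinOver.vals_perm_four (h : CentralExt π)
    (hK : Nat.card π.ker = 3) (hi : H.index = 15) {σ : H →* Perm (Fin 4)} (hσ : Compat π H σ)
    {φ : H → ℂ} (hφ : LinOver σ φ Perm.sign) :
    h.Val 2 (ind H φ) (-1) ∧ h.Val 4 (ind H φ) (-1) :=
  ⟨hφ.val_ind h hσ hK (by norm_num) (fun _ _ => isConj_two_alt_six) card_two_alt_six (by norm_num)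
    osum_two_sign_four (by rw [hi]; norm_num),
  hφ.val_ind h hσ hK (by norm_num) (fun _ _ => isConj_four_alt_six) card_four_alt_six (by norm_num)
    osum_four_sign_four (by rw [hi]; norm_num)⟩

theorem LinOver.isIrr_ind_perm_four [Group.IsPerfect G] (h : CentralExt π)
    (hK : Nat.card π.ker = 3) (hi : H.index = 15) {σ : H →* Perm (Fin 4)} (hσ : Compat π H σ)
    {φ : H → ℂ} (hφ : LinOver σ φ Perm.sign) : IsIrr (ind H φ) := by
  obtain ⟨v2, v4⟩ := hφ.vals_perm_four h hK hi hσ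
  refine h.isIrr_ind hσ.le hφ.irr orderOf_alt_six ?_
  have h1 : h.rip 1 (ind H φ) (ind H φ) = 15 * 15 := h.rip_one
    (by rw [ind_one, hi, hφ.one]; simp) (by rw [ind_one, hi, hφ.one]; simp)
  have h3 := h.rip_three_ind (i := 1) natCard_alt_six' (by norm_num) hK (by norm_num) hσ hφ.irr
    hφ.faithful
  have h5 := hφ.rip_ind_le h hσ ratConj_five_alt_six card_five_alt_six
    (ofOrder_eq_zero (B := Perm (Fin 4)) (r := 5) (by rw [natCard_perm_four]; norm_num))
  rw [hi] at h5
  rw [sum_orders_six, natCard_alt_six, h.rip_of_val v2 card_two_alt_six,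
    h.rip_of_val v4 card_four_alt_six]
  norm_num at h5 ⊢
  linarith

/-- Without the sign the value on involutions is 3, and already 225 + 45 · 9 exceeds 360. -/
theorem LinOver.not_isIrr_ind_perm_four (h : CentralExt π)
    (hK : Nat.card π.ker = 3) (hi : H.index = 15) {σ : H →* Perm (Fin 4)} (hσ : Compat π H σ)
    {φ : H → ℂ} (hφ : LinOver σ φ 1) : ¬ IsIrr (ind H φ) := by
  intro hirr
  have v2 : h.Val 2 (ind H φ) 3 := hφ.val_ind h hσ hK (by norm_num) (fun _ _ => isConj_two_alt_six)
    card_two_alt_six (by norm_num) ((osum_one_sign 2).trans (by rw [card_two_perm_four]; rfl))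
    (S := 9) (by rw [hi]; norm_num)
  have h1 : h.rip 1 (ind H φ) (ind H φ) = 15 * 15 := h.rip_one
    (by rw [ind_one, hi, hφ.one]; simp) (by rw [ind_one, hi, hφ.one]; simp)
  have hs := h.sum_rip hirr hirr (fun _ _ => rfl) orderOf_alt_six
  rw [sum_orders_six, if_pos rfl, h.rip_of_val v2 card_two_alt_six, h1, natCard_alt_six] at hs
  have n3 := h.rip_self_nonneg 3 (ind H φ)
  have n4 := h.rip_self_nonneg 4 (ind H φ)
  have n5 := h.rip_self_nonneg 5 (ind H φ)
  norm_num at hs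
  linarith

/-- The character `χ` is one of the two characters of degree fifteen of `3·A₆`. -/
structure CentralExt.IsChiFifteen (h : CentralExt π) (χ : G → ℂ) : Prop where
  irr : IsIrr χ
  faithful : FaithfulOn π.ker χ
  one : χ 1 = 15
  two : h.Val 2 χ (-1)
  four : h.Val 4 χ (-1)

theorem LinOver.isChiFifteen [Group.IsPerfect G] (h : CentralExt π)
    (hK : Nat.card π.ker = 3) (hi : H.index = 15) {σ : H →* Perm (Fin 4)} (hσ : Compat π H σ)
    {φ : H → ℂ} (hφ : LinOver σ φ Perm.sign) : h.IsChiFifteen (ind H φ) where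
  irr := hφ.isIrr_ind_perm_four h hK hi hσ
  faithful := faithfulOn_ind h hσ hφ.faithful
  one := by rw [ind_one, hi, hφ.one]; simp
  two := (hφ.vals_perm_four h hK hi hσ).1
  four := (hφ.vals_perm_four h hK hi hσ).2

theorem CentralExt.IsChiFifteen.star {h : CentralExt π} (hχ : h.IsChiFifteen χ) :
    h.IsChiFifteen (star χ) where
  irr := hχ.irr.star
  faithful := hχ.faithful.star
  one := by rw [Pi.star_apply, hχ.one]; simp
  two := fun a ha => by rw [Pi.star_apply, hχ.two a ha]; simp
  four := fun a ha => by rw [Pi.star_apply, hχ.four a ha]; simp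

theorem exists_isChiFifteen [Group.IsPerfect G] (h : CentralExt π) (hK : Nat.card π.ker = 3) :
    ∃ (H : Subgroup G) (φ : H → ℂ) (σ : H →* Perm (Fin 4)), H.index = 15 ∧ Compat π H σ ∧
      LinOver σ φ Perm.sign := by
  obtain ⟨H, hH, hi⟩ := exists_ker_le_index h exists_index_fifteen_alt_six
  obtain ⟨σ, hσ⟩ := exists_compat_perm_four h hH hi
  have : Fintype H := Fintype.ofFinite H
  obtain ⟨φ, hφ⟩ := exists_linOver (hσ.ext h) (j := 8) (by rw [natCard_perm_four]) (by norm_num)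
    ((Compat.card_ker hσ).trans hK) hom_perm_zmod_three_eq_one Perm.sign
  exact ⟨H, φ, σ, hi, hσ, hφ⟩

theorem exists_isChiSix [Group.IsPerfect G] (h : CentralExt π) (hK : Nat.card π.ker = 3) :
    ∃ (H : Subgroup G) (φ : H → ℂ) (σ : H →* Alt 5), H.index = 6 ∧ Compat π H σ ∧
      LinOver σ φ 1 := by
  have := isPerfect_alt (n := 5) le_rfl
  obtain ⟨H, hH, hi⟩ := exists_ker_le_index h (exists_index_alt (n := 6) (by norm_num))
  obtain ⟨σ, hσ⟩ := exists_compat_alt_five h hH hi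
  have : Fintype H := Fintype.ofFinite H
  obtain ⟨φ, hφ⟩ := exists_linOver (hσ.ext h) (j := 20) (by rw [natCard_alt_five]) (by norm_num)
    ((Compat.card_ker hσ).trans hK) hom_zmod_three_eq_one 1
  exact ⟨H, φ, σ, hi, hσ, hφ⟩

theorem CentralExt.Val.unique {A : Type v} [Group A] [Fintype A] {π : G →* A} {h : CentralExt π}
    {r N : ℕ} (hN : (ofOrder A r).card = N) (h0 : 0 < N) {x y : ℝ} (hx : h.Val r χ x)
    (hy : h.Val r χ y) : x = y := by
  obtain ⟨a, ha⟩ := exists_order_of_card_pos hN h0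
  have := (hx a ha).symm.trans (hy a ha)
  exact_mod_cast this

/-- 225 + 45 + 90 exhausts the norm 360, so nothing is left for order five. -/
theorem CentralExt.IsChiFifteen.sixData [Group.IsPerfect G] {h : CentralExt π}
    (hK : Nat.card π.ker = 3) {a : Alt 6} (ha : orderOf a = 5) (hχ : h.IsChiFifteen χ) :
    h.SixData a χ 15 (-1) (-1) 0 0 := by
  obtain ⟨x, y, t, D, -, hd⟩ := h.exists_sixData hK ha hχ.irr hχ.faithful (d := 15)
    (by rw [hχ.one]; simp)
  have hx : x = -1 := by
    have := Val.unique card_two_alt_six (by norm_num) hd.two hχ.two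
    exact_mod_cast this
  have hy : y = -1 := by
    have := Val.unique card_four_alt_six (by norm_num) hd.four hχ.four
    exact_mod_cast this
  have hn := SixData.norm h hK ha hd
  subst hx hy
  generalize hu : (2 * ((15 : ℕ) : ℤ) - 5 * t) = u at hn hd
  have hu0 : u = 0 := by
    have : u ^ 2 ≤ 0 := by push_cast at hn; nlinarith [sq_nonneg D]
    nlinarith [sq_nonneg u, pow_eq_zero_iff (n := 2) (a := u) two_ne_zero]
  have hD0 : D = 0 := by
    have : D ^ 2 ≤ 0 := by push_cast at hn; nlinarith [sq_nonneg u]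
    nlinarith [sq_nonneg D, pow_eq_zero_iff (n := 2) (a := D) two_ne_zero]
  subst hu0 hD0
  exact hd

theorem exists_isChiFifteen_sameOn [Group.IsPerfect G] (h : CentralExt π)
    (hK : Nat.card π.ker = 3) (hχ : IsIrr χ) (hf : FaithfulOn π.ker χ) :
    ∃ θ, h.IsChiFifteen θ ∧ SameOn π.ker χ θ := by
  obtain ⟨H, φ, σ, hi, hσ, hφ⟩ := exists_isChiFifteen h hK
  have hθ := hφ.isChiFifteen h hK hi hσ
  rcases FaithfulOn.sameOn_or h (Or.inl hK) hχ hθ.irr hf hθ.faithful with hs | hs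
  · exact ⟨_, hθ, hs⟩
  · exact ⟨_, hθ.star, hs⟩

/-- Two different characters over the same central character. -/
theorem CentralExt.sq_add_sq_le {A : Type v} [Group A] [Fintype A] {π : G →* A} (h : CentralExt π)
    (hχ : IsIrr χ) (hψ : IsIrr ψ) (hs : SameOn π.ker χ ψ) (hne : χ ≠ ψ) {d e : ℕ} (hd : χ 1 = d)
    (he : ψ 1 = e) : d ^ 2 + e ^ 2 ≤ Nat.card A := by
  classical
  have h1 := h.sum_norm_sq_le hχ {χ, ψ} (by
    intro θ hθ
    rcases mem_insert.1 hθ with rfl | hθ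
    · exact ⟨hχ, fun _ _ => rfl⟩
    · rw [mem_singleton.1 hθ]; exact ⟨hψ, hs⟩)
  rw [sum_pair hne, hd, he, Complex.norm_natCast, Complex.norm_natCast] at h1
  exact_mod_cast h1

/-- Beside a character of degree 15 only 135 remains for the square of another degree, and three
divides the degree. -/
theorem degree_three_alt_six [Group.IsPerfect G] (h : CentralExt π)
    (hK : Nat.card π.ker = 3) (hχ : IsIrr χ) (hf : FaithfulOn π.ker χ) {d : ℕ} (hd : χ 1 = d) :
    d = 3 ∨ d = 6 ∨ d = 9 ∨ d = 15 := by
  obtain ⟨θ, hθ, hs⟩ := exists_isChiFifteen_sameOn h hK hχ hf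
  have h3 : 3 ∣ d := hf.dvd_degree h hχ hd (dvd_of_eq hK.symm)
  by_cases he : χ = θ
  · rw [he, hθ.one] at hd
    have : d = 15 := by exact_mod_cast hd.symm
    omega
  · have h1 := h.sq_add_sq_le hχ hθ.irr hs he hd (e := 15) (by rw [hθ.one]; simp)
    rw [natCard_alt_six] at h1
    have h2 : d ≤ 11 := by
      by_contra hc
      have := Nat.pow_le_pow_left (show 12 ≤ d by omega) 2
      linarith
    have h0 : d ≠ 0 := by
      rintro rfl
      exact hχ.one_ne_zero (by rw [hd]; simp)
    omega

theorem eq_of_degree_fifteen (h : CentralExt π) (hχ : IsIrr χ) (hψ : IsIrr ψ)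
    (hs : SameOn π.ker χ ψ) (h1 : χ 1 = 15) (h2 : ψ 1 = 15) : χ = ψ := by
  by_contra hne
  have := h.sq_add_sq_le hχ hψ hs hne (d := 15) (e := 15) (by rw [h1]; simp) (by rw [h2]; simp)
  rw [natCard_alt_six] at this
  omega

/-- Orthogonality to the character of degree 15 gives x = 2 − 2y. The norm equation then bounds y, u
and D, and u = 12 − 5t together with the parity condition leaves one solution. Degree three is
treated in the same way, with two solutions conjugate over √5. -/
theorem sixData_of_degree_six [Group.IsPerfect G] (h : CentralExt π)
    (hK : Nat.card π.ker = 3) {a : Alt 6} (ha : orderOf a = 5) (hχ : IsIrr χ)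
    (hf : FaithfulOn π.ker χ) (hd : χ 1 = 6) : h.SixData a χ 6 2 0 2 0 := by
  obtain ⟨θ, hθ, hs⟩ := exists_isChiFifteen_sameOn h hK hχ hf
  obtain ⟨x, y, t, D, hD, hdat⟩ := h.exists_sixData hK ha hχ hf (d := 6) (by rw [hd]; simp)
  have hne : χ ≠ θ := fun he => by
    rw [he, hθ.one] at hd
    norm_num at hd
  have hn := SixData.norm h hK ha hdat
  have ho := SixData.orth h hK ha hdat (hθ.sixData hK ha) hs hne
  generalize hu : (2 * ((6 : ℕ) : ℤ) - 5 * t) = u at hn hdat ho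
  push_cast at hn ho hu
  have hx : x = 2 - 2 * y := by linarith
  subst hx
  have hy : -1 ≤ y ∧ y ≤ 1 := ⟨by nlinarith [sq_nonneg u, sq_nonneg D, sq_nonneg (2 - 2 * y)],
    by nlinarith [sq_nonneg u, sq_nonneg D, sq_nonneg (2 - 2 * y)]⟩
  have hu2 : -3 ≤ u ∧ u ≤ 3 := ⟨by nlinarith [sq_nonneg y, sq_nonneg D, sq_nonneg (2 - 2 * y)],
    by nlinarith [sq_nonneg y, sq_nonneg D, sq_nonneg (2 - 2 * y)]⟩
  have hD2 : -1 ≤ D ∧ D ≤ 1 := ⟨by nlinarith [sq_nonneg u, sq_nonneg y, sq_nonneg (2 - 2 * y)],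
    by nlinarith [sq_nonneg u, sq_nonneg y, sq_nonneg (2 - 2 * y)]⟩
  obtain ⟨hy1, hy2⟩ := hy
  obtain ⟨hu1, hu2⟩ := hu2
  obtain ⟨hD1, hD2⟩ := hD2
  have key : y = 0 ∧ u = 2 ∧ D = 0 := by
    interval_cases y <;> interval_cases u <;> interval_cases D <;> omega
  obtain ⟨rfl, rfl, rfl⟩ := key
  simpa using hdat

theorem eq_of_degree_six [Group.IsPerfect G] (h : CentralExt π)
    (hK : Nat.card π.ker = 3) (hχ : IsIrr χ) (hψ : IsIrr ψ) (hf : FaithfulOn π.ker χ)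
    (hs : SameOn π.ker χ ψ) (h1 : χ 1 = 6) (h2 : ψ 1 = 6) : χ = ψ := by
  by_contra hne
  obtain ⟨a, ha⟩ := exists_five_alt_six
  have := SixData.orth h hK ha (sixData_of_degree_six h hK ha hχ hf h1)
    (sixData_of_degree_six h hK ha hψ (hf.of_sameOn hχ hψ hs) h2) hs hne
  norm_num at this

theorem sixData_of_degree_three [Group.IsPerfect G] (h : CentralExt π)
    (hK : Nat.card π.ker = 3) {a : Alt 6} (ha : orderOf a = 5) (hχ : IsIrr χ)
    (hf : FaithfulOn π.ker χ) (hd : χ 1 = 3) :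
    h.SixData a χ 3 (-1) 1 1 1 ∨ h.SixData a χ 3 (-1) 1 1 (-1) := by
  obtain ⟨θ, hθ, hs⟩ := exists_isChiFifteen_sameOn h hK hχ hf
  obtain ⟨x, y, t, D, hD, hdat⟩ := h.exists_sixData hK ha hχ hf (d := 3) (by rw [hd]; simp)
  have hne : χ ≠ θ := fun he => by
    rw [he, hθ.one] at hd
    norm_num at hd
  have hn := SixData.norm h hK ha hdat
  have ho := SixData.orth h hK ha hdat (hθ.sixData hK ha) hs hne
  generalize hu : (2 * ((3 : ℕ) : ℤ) - 5 * t) = u at hn hdat ho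
  push_cast at hn ho hu
  have hx : x = 1 - 2 * y := by linarith
  subst hx
  have hy : -2 ≤ y ∧ y ≤ 2 := ⟨by nlinarith [sq_nonneg u, sq_nonneg D, sq_nonneg (1 - 2 * y)],
    by nlinarith [sq_nonneg u, sq_nonneg D, sq_nonneg (1 - 2 * y)]⟩
  have hu2 : -3 ≤ u ∧ u ≤ 3 := ⟨by nlinarith [sq_nonneg y, sq_nonneg D, sq_nonneg (1 - 2 * y)],
    by nlinarith [sq_nonneg y, sq_nonneg D, sq_nonneg (1 - 2 * y)]⟩
  have hD2 : -1 ≤ D ∧ D ≤ 1 := ⟨by nlinarith [sq_nonneg u, sq_nonneg y, sq_nonneg (1 - 2 * y)],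
    by nlinarith [sq_nonneg u, sq_nonneg y, sq_nonneg (1 - 2 * y)]⟩
  obtain ⟨hy1, hy2⟩ := hy
  obtain ⟨hu1, hu2⟩ := hu2
  obtain ⟨hD1, hD2⟩ := hD2
  have key : y = 1 ∧ u = 1 ∧ (D = 1 ∨ D = -1) := by
    interval_cases y <;> interval_cases u <;> interval_cases D <;> omega
  obtain ⟨rfl, rfl, rfl | rfl⟩ := key
  · left; simpa using hdat
  · right; simpa using hdat

end ThreeAltSix

end ImprimitiveCovers

namespace ImprimitiveCovers

open Finset CentralExt Equiv

/-! ### Counting the characters of each degree over one central character -/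

section Counting

variable {G : Type u} {A : Type v} [Group G] [Fintype G] [Group A] [Fintype A] {π : G →* A}
variable {χ ψ : G → ℂ}

theorem CentralExt.exists_degree_counts (h : CentralExt π) (hχ : IsIrr χ) (R : Finset ℕ)
    (hR : ∀ ψ, IsIrr ψ → SameOn π.ker χ ψ → ∃ d ∈ R, ψ 1 = d) :
    ∃ F : ℕ → Finset (G → ℂ), (∀ d ψ, ψ ∈ F d ↔ IsIrr ψ ∧ SameOn π.ker χ ψ ∧ ψ 1 = d) ∧
      ∑ d ∈ R, d ^ 2 * (F d).card = Nat.card A := by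
  classical
  obtain ⟨S, hS, hsum⟩ := exists_finset_sum_sq π.ker h.central hχ
  have hex : ∀ ψ ∈ S, ∃ d ∈ R, ψ 1 = d := fun ψ hψ => hR ψ ((hS ψ).1 hψ).1 ((hS ψ).1 hψ).2
  let deg : (G → ℂ) → ℕ := fun ψ => if hψ : ψ ∈ S then (hex ψ hψ).choose else 0
  have hdeg : ∀ ψ ∈ S, deg ψ ∈ R ∧ ψ 1 = deg ψ := fun ψ hψ => by
    simp only [deg, dif_pos hψ]
    exact (hex ψ hψ).choose_spec
  refine ⟨fun d => S.filter fun ψ => ψ 1 = d, fun d ψ => by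
    rw [mem_filter, hS, and_assoc], ?_⟩
  have h1 : ∑ ψ ∈ S, deg ψ ^ 2 = Nat.card A := by
    have h0 : (Nat.card π.ker : ℂ) ≠ 0 := by exact_mod_cast Nat.card_pos.ne'
    have h2 : (∑ ψ ∈ S, (deg ψ : ℂ) ^ 2) * Nat.card π.ker = Nat.card A * Nat.card π.ker := by
      rw [sum_mul, ← Nat.cast_mul, mul_comm (Nat.card A), ← h.natCard_eq,
        Nat.card_eq_fintype_card (α := G), ← hsum]
      exact sum_congr rfl fun ψ hψ => by rw [(hdeg ψ hψ).2]
    exact_mod_cast mul_right_cancel₀ h0 h2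
  rw [← h1, ← sum_fiberwise_of_maps_to (fun ψ hψ => (hdeg ψ hψ).1)]
  refine sum_congr rfl fun d _ => ?_
  rw [sum_congr rfl fun ψ hψ => by rw [(mem_filter.1 hψ).2], sum_const, smul_eq_mul, mul_comm]
  congr 2
  ext ψ
  simp only [mem_filter, and_congr_right_iff]
  intro hψ
  rw [(hdeg ψ hψ).2]
  exact Nat.cast_inj

theorem card_le_two_of_dichotomy {T : Finset (G → ℂ)} (P Q : (G → ℂ) → Prop)
    (h : ∀ χ ∈ T, P χ ∨ Q χ) (hP : ∀ χ ∈ T, ∀ ψ ∈ T, P χ → P ψ → χ = ψ)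
    (hQ : ∀ χ ∈ T, ∀ ψ ∈ T, Q χ → Q ψ → χ = ψ) : T.card ≤ 2 := by
  by_contra! hc
  obtain ⟨a, ha, b, hb, c, hc, hab, hac, hbc⟩ := two_lt_card.1 hc
  rcases h a ha with h1 | h1 <;> rcases h b hb with h2 | h2 <;> rcases h c hc with h3 | h3
  all_goals first
    | exact hab (hP _ ha _ hb h1 h2) | exact hac (hP _ ha _ hc h1 h3) | exact hbc (hP _ hb _ hc h2 h3)
    | exact hab (hQ _ ha _ hb h1 h2) | exact hac (hQ _ ha _ hc h1 h3) | exact hbc (hQ _ hb _ hc h2 h3)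

/-- Two members lie over one faithful central character; conjugation gives the two over the other,
and there is no third central character. -/
theorem isConjQuadruple_of {n : ℕ} (hn : 5 ≤ n) {π : G →* Alt n} (h : CentralExt π)
    (hK : Nat.card π.ker = 3 ∨ Nat.card π.ker = 6) {S : Set (G → ℂ)}
    (hS : ∀ χ ∈ S, IsFaithfulIrr χ) (hstar : ∀ χ ∈ S, star χ ∈ S) (hχ : χ ∈ S) (hψ : ψ ∈ S)
    (h1 : χ 1 = ψ 1) (hne : χ ≠ ψ) (hs : SameOn π.ker χ ψ)
    (hall : ∀ θ ∈ S, SameOn π.ker χ θ → θ = χ ∨ θ = ψ) : IsConjQuadruple S χ ψ := by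
  have h3 : 3 ∣ Nat.card π.ker := by rcases hK with h | h <;> rw [h]; norm_num
  have n1 := h.not_sameOn_star h3 (hS χ hχ).1 ((hS χ hχ).faithfulOn _)
  have n2 := h.not_sameOn_star h3 (hS ψ hψ).1 ((hS ψ hψ).faithfulOn _)
  have e1 : χ ≠ star χ := fun he => n1 (by rw [← he]; exact fun _ _ => rfl)
  have e2 : ψ ≠ star ψ := fun he => n2 (by rw [← he]; exact fun _ _ => rfl)
  have e3 : χ ≠ star ψ := fun he => n2 (by rw [← he]; exact hs.symm)
  have e4 : ψ ≠ star χ := fun he => n1 (by rw [← he]; exact hs)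
  have e5 : star χ ≠ star ψ := fun he => hne (star_injective he)
  refine ⟨by simp [hne, e1, e2, e3, e4, e5], ?_, fun z hz => ?_⟩
  · ext θ
    simp only [Set.mem_insert_iff, Set.mem_singleton_iff]
    refine ⟨fun hθ => ?_, ?_⟩
    · rcases FaithfulOn.sameOn_or h hK (hS χ hχ).1 (hS θ hθ).1 ((hS χ hχ).faithfulOn _)
        ((hS θ hθ).faithfulOn _) with hs' | hs'
      · rcases hall θ hθ hs' with rfl | rfl <;> simp
      · rcases hall _ (hstar θ hθ) hs' with he | he <;> rw [← he] <;> simp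
    · rintro (rfl | rfl | rfl | rfl)
      · exact hχ
      · exact hψ
      · exact hstar _ hχ
      · exact hstar _ hψ
  · rw [← h.ker_eq_center hn] at hz
    have := hs z hz
    rwa [cc, cc, h1, div_left_inj' (hS ψ hψ).1.one_ne_zero] at this

end Counting

/-! ### Minimal triples -/

section Triples

variable {G : Type u} [Group G] [Fintype G] {H : Subgroup G} {φ : H → ℂ}

theorem faithfulOfDegree_star {d : ℕ} : ∀ χ ∈ faithfulOfDegree G d, star χ ∈ faithfulOfDegree G d :=
  fun χ hχ => ⟨hχ.1.star, by rw [Pi.star_apply, hχ.2]; simp⟩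

theorem faithfulOfDegreeAndValue_star {d : ℕ} {a : ℤ} : ∀ χ ∈ faithfulOfDegreeAndValue G d a,
    star χ ∈ faithfulOfDegreeAndValue G d a :=
  fun χ hχ => ⟨hχ.1.star, by rw [Pi.star_apply, hχ.2.1]; simp,
    fun t ht => by rw [Pi.star_apply, hχ.2.2 t ht]; simp⟩

/-- An imprimitive character has a proper block stabilizer, which would be properly contained in the
whole group. -/
theorem isMinimalTriple_ne_top {χ : G → ℂ} (h : IsMinimalTriple H φ χ) : H ≠ ⊤ := by
  rintro rfl
  obtain ⟨-, ⟨-, K, hK⟩, -, -, h5⟩ := h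
  exact h5 K (lt_top_iff_ne_top.2 hK.1) hK

theorem isMinimalTriple_intro {n : ℕ} (hn : 5 ≤ n) {π : G →* Alt n} (h : CentralExt π)
    {B : Type v} [Group B] {σ : H →* B} (hσ : Compat π H σ) (hf : FaithfulOn σ.ker φ)
    (hφ : IsIrr φ) (hi : IsFaithfulIrr (ind H φ)) (hH : H ≠ ⊤)
    (hmin : ∀ (K : Subgroup G) (ψ : K → ℂ), K < H → IsIrr ψ → ind H φ ≠ ind K ψ) :
    IsMinimalTriple H φ (ind H φ) := by
  have hc := h.ker_eq_center hn
  refine ⟨hi, ⟨hi.1, H, hH, φ, hφ, rfl⟩, ⟨hc ▸ hσ.le, hφ, fun x hx h1 => ?_⟩, rfl, ?_⟩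
  · rw [← hc] at hx
    exact hf x ((hσ.ker x).2 hx) h1
  · rintro K hK ⟨-, ψ, hψ, he⟩
    exact hmin K ψ hK hψ he

/-- Compare degrees: a proper subgroup of `H` has larger index, and φ has degree one already. This
gives minimality for all linear φ. -/
theorem ind_ne_ind_of_lt (h1 : φ 1 = 1) {K : Subgroup G} {ψ : K → ℂ} (hK : K < H) (hψ : IsIrr ψ) :
    ind H φ ≠ ind K ψ := by
  intro he
  have : Fintype K := Fintype.ofFinite K
  obtain ⟨d, hd0, hd⟩ := hψ.exists_degree
  have h2 := congrFun he 1
  rw [ind_one, ind_one, h1, hd, mul_one] at h2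
  have h3 : H.index = K.index * d := by exact_mod_cast h2
  have h4 := Subgroup.index_strictAnti hK
  have h5 : K.index ≤ K.index * d := Nat.le_mul_of_pos_right _ hd0
  omega

theorem inducedFrom_eq_pair {P : (H : Subgroup G) → (H → ℂ) → Prop} {S : Set (G → ℂ)} {χ : G → ℂ}
    (hS : IsConjPair S χ) (hP : ∀ H φ, P H φ → ind H φ ∈ S) (hstar : ∀ H φ, P H φ → P H (star φ))
    {H : Subgroup G} {φ : H → ℂ} (h : P H φ) (hχ : χ = ind H φ) :
    inducedFrom P = {χ, star χ} := by
  rw [← hS.2]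
  ext θ
  refine ⟨?_, fun hθ => ?_⟩
  · rintro ⟨K, ψ, hψ, rfl⟩
    exact hP K ψ hψ
  · rw [hS.2] at hθ
    rcases hθ with rfl | hθ
    · exact ⟨H, φ, h, hχ⟩
    · rw [Set.mem_singleton_iff] at hθ
      exact ⟨H, star φ, hstar _ _ h, by rw [hθ, ind_star, hχ]⟩

end Triples

/-! ### The classification for 3·A₆ -/

section ThreeAltSix

variable {G : Type u} [Group G] [Fintype G] {π : G →* Alt 6} {χ ψ : G → ℂ} {H : Subgroup G}

theorem exists_quadruple_three_alt_six [Group.IsPerfect G] (h : CentralExt π)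
    (hK : Nat.card π.ker = 3) :
    ∃ χ ψ : G → ℂ, IsConjQuadruple (faithfulOfDegree G 3) χ ψ ∧ SameOn π.ker χ ψ := by
  have := isSimpleGroup_alt (n := 6) (by norm_num)
  obtain ⟨H, φ, σ, hi, hσ, hφ⟩ := exists_isChiFifteen h hK
  have hθ := hφ.isChiFifteen h hK hi hσ
  generalize ind H φ = θ at hθ
  obtain ⟨a, ha⟩ := exists_five_alt_six
  have hfs : ∀ ψ, IsIrr ψ → SameOn π.ker θ ψ → FaithfulOn π.ker ψ := fun ψ hψ hs =>
    hθ.faithful.of_sameOn hθ.irr hψ hs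
  obtain ⟨F, hF, hsum⟩ := h.exists_degree_counts hθ.irr {3, 6, 9, 15} fun ψ hψ hs => by
    obtain ⟨d, -, hd⟩ := hψ.exists_degree
    refine ⟨d, ?_, hd⟩
    have := degree_three_alt_six h hK hψ (hfs ψ hψ hs) hd
    simpa using this
  rw [sum_insert (by decide), sum_insert (by decide), sum_insert (by decide), sum_singleton,
    natCard_alt_six] at hsum
  have c15 : (F 15).card = 1 := by
    have hle : (F 15).card ≤ 1 := card_le_one.2 fun χ hχ ψ hψ => by
      rw [hF] at hχ hψ
      exact eq_of_degree_fifteen h hχ.1 hψ.1 (hχ.2.1.symm.trans hψ.2.1) (by simpa using hχ.2.2)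
        (by simpa using hψ.2.2)
    have hpos : 0 < (F 15).card := card_pos.2 ⟨θ, (hF _ _).2 ⟨hθ.irr, fun _ _ => rfl, by
      rw [hθ.one]; simp⟩⟩
    omega
  have c6 : (F 6).card ≤ 1 := card_le_one.2 fun χ hχ ψ hψ => by
    rw [hF] at hχ hψ
    exact eq_of_degree_six h hK hχ.1 hψ.1 (hfs _ hχ.1 hχ.2.1) (hχ.2.1.symm.trans hψ.2.1)
      (by simpa using hχ.2.2) (by simpa using hψ.2.2)
  have c3 : (F 3).card ≤ 2 := by
    have huniq : ∀ D : ℤ, D ^ 2 = 1 → ∀ χ ∈ F 3, ∀ ψ ∈ F 3, h.SixData a χ 3 (-1) 1 1 D →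
        h.SixData a ψ 3 (-1) 1 1 D → χ = ψ := fun D hD χ hχ ψ hψ h1 h2 => by
      rw [hF] at hχ hψ
      by_contra hne
      have := SixData.orth h hK ha h1 h2 (hχ.2.1.symm.trans hψ.2.1) hne
      nlinarith
    refine card_le_two_of_dichotomy (fun χ => h.SixData a χ 3 (-1) 1 1 1)
      (fun χ => h.SixData a χ 3 (-1) 1 1 (-1)) (fun χ hχ => ?_) (huniq 1 (by norm_num))
      (huniq (-1) (by norm_num))
    rw [hF] at hχ
    exact sixData_of_degree_three h hK ha hχ.1 (hfs _ hχ.1 hχ.2.1) (by simpa using hχ.2.2)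
  -- The degrees satisfy 9a + 36b + 81c + 225 = 360 with a ≤ 2 and b ≤ 1, so a = 2 and b = c = 1.
  have c3' : (F 3).card = 2 := by
    have c9 : (F 9).card ≤ 1 := by omega
    interval_cases (F 9).card <;> interval_cases (F 6).card <;> omega
  obtain ⟨χ, ψ, hne, hF3⟩ := card_eq_two.1 c3'
  have hχ := (hF 3 χ).1 (by rw [hF3]; simp)
  have hψ := (hF 3 ψ).1 (by rw [hF3]; simp)
  have hs := hχ.2.1.symm.trans hψ.2.1
  have hfaith : ∀ θ', IsIrr θ' → SameOn π.ker θ θ' → θ' 1 = (3 : ℕ) → IsFaithfulIrr θ' :=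
    fun θ' h1 h2 h3 => h.isFaithfulIrr h1 (hfs _ h1 h2) (by rw [h3]; norm_num)
  refine ⟨χ, ψ, isConjQuadruple_of (by norm_num) h (Or.inl hK) (fun θ hθ => hθ.1)
    faithfulOfDegree_star ⟨hfaith _ hχ.1 hχ.2.1 hχ.2.2, hχ.2.2⟩
    ⟨hfaith _ hψ.1 hψ.2.1 hψ.2.2, hψ.2.2⟩ (hχ.2.2.trans hψ.2.2.symm) hne hs fun θ' hθ' hs' => ?_, hs⟩
  have : θ' ∈ F 3 := (hF _ _).2 ⟨hθ'.1.1, hχ.2.1.trans hs', hθ'.2⟩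
  rw [hF3] at this
  simpa using this

/-- The product of index and φ(1) is 3, 6, 9 or 15, the index is at least 6, and index 9 does not
occur. -/
theorem index_three_alt_six [Group.IsPerfect G] (h : CentralExt π) (hK : Nat.card π.ker = 3)
    (hH : H ≠ ⊤) {φ : H → ℂ} (hφ : IsIrr φ) (hχ : IsFaithfulIrr (ind H φ)) :
    (H.index = 6 ∨ H.index = 15) ∧ φ 1 = 1 := by
  have : Fintype H := Fintype.ofFinite H
  have hle : π.ker ≤ H := h.central.trans (center_le_of_isIrr_ind hχ.1)
  obtain ⟨e, he0, he⟩ := hφ.exists_degree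
  have hd : ind H φ 1 = (H.index * e : ℕ) := by rw [ind_one, he]; simp
  have h1 := degree_three_alt_six h hK hχ.1 (hχ.faithfulOn _) hd
  have hne : H.map π ≠ ⊤ := fun ht => hH (by
    rw [← Subgroup.index_eq_one, ← index_map h hle, ht, Subgroup.index_top])
  have h2 := le_index_alt (n := 6) (by norm_num) hne
  have h3 := index_ne_alt_six (H.map π)
  rw [index_map h hle] at h2 h3
  have key : (H.index = 6 ∨ H.index = 15) ∧ e = 1 := by
    obtain ⟨h4, h5⟩ := h3
    generalize H.index = k at h1 h2 h4 h5
    have he3 : e ≤ 2 := by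
      by_contra hc
      have : 6 * 3 ≤ k * e := Nat.mul_le_mul h2 (by omega)
      omega
    interval_cases e <;> omega
  exact ⟨key.1, by rw [he, key.2]; simp⟩

/-- If the kernel were not in `H`, then `H` would embed in A₆ as a proper subgroup of index less
than six. -/
theorem ker_le_of_isThreeTimes (h : CentralExt π) (hK : Nat.card π.ker = 3) {B : Type} [Group B]
    {b : ℕ} (hB : Nat.card B = b) (hb : 360 < 6 * (3 * b)) (hb' : b < 120)
    (hH : IsThreeTimes H B) : π.ker ≤ H ∧ H.index * (3 * b) = 1080 := by
  have hc : Nat.card H = 3 * b := by rw [natCard_of_isThreeTimes hH, hB]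
  have hi := H.card_mul_index
  rw [hc, h.natCard_three_alt_six hK, mul_comm] at hi
  refine ⟨(ker_le_or_injective hK H).resolve_right fun hinj => ?_, hi⟩
  have h1 := natCard_map_of_injective hinj
  have h2 := (H.map π).card_mul_index
  rw [h1, hc, natCard_alt_six] at h2
  have hne : H.map π ≠ ⊤ := fun ht => by
    rw [ht, Subgroup.index_top] at h2
    omega
  have h3 := le_index_alt (n := 6) (by norm_num) hne
  nlinarith

theorem pairA5_iff (h : CentralExt π) (hK : Nat.card π.ker = 3) (φ : H → ℂ) :
    PairA5 H φ ↔ H.index = 6 ∧ ∃ σ : H →* Alt 5, Compat π H σ ∧ LinOver σ φ 1 := by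
  have := isPerfect_alt (n := 5) le_rfl
  constructor
  · rintro ⟨h1, h2, h3⟩
    obtain ⟨hle, hi⟩ := ker_le_of_isThreeTimes h hK natCard_alt_five (by norm_num) (by norm_num) h1
    have hi' : H.index = 6 := by omega
    obtain ⟨σ, hσ⟩ := exists_compat_alt_five h hle hi'
    exact ⟨hi', σ, hσ, linOver_of_ne_one h hσ hK h2 h3⟩
  · rintro ⟨-, σ, hσ, hφ⟩
    have : Fintype H := Fintype.ofFinite H
    exact ⟨isThreeTimes_of_compat h hσ hK (j := 20) (by rw [natCard_alt_five]) (by norm_num)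
      hom_zmod_three_eq_one, hφ.isLinearChar, hφ.ne_one hσ hK⟩

theorem exists_sign_ne_one {n : ℕ} (hn : 2 ≤ n) : ∃ b : Perm (Fin n), Perm.sign b ≠ 1 :=
  ⟨swap ⟨0, by omega⟩ ⟨1, by omega⟩, by rw [Perm.sign_swap (by simp)]; decide⟩

theorem pairS4_iff (h : CentralExt π) (hK : Nat.card π.ker = 3) (φ : H → ℂ) :
    PairS4 H φ ↔ H.index = 15 ∧
      ∃ σ : H →* Perm (Fin 4), Compat π H σ ∧ LinOver σ φ Perm.sign := by
  constructor
  · rintro ⟨h1, h2, h3⟩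
    obtain ⟨hle, hi⟩ := ker_le_of_isThreeTimes h hK natCard_perm_four (by norm_num) (by norm_num) h1
    have hi' : H.index = 15 := by omega
    obtain ⟨σ, hσ⟩ := exists_compat_perm_four h hle hi'
    exact ⟨hi', σ, hσ, linOver_of_orderOf h hσ homSign_perm hK h2 h3⟩
  · rintro ⟨-, σ, hσ, hφ⟩
    have : Fintype H := Fintype.ofFinite H
    exact ⟨isThreeTimes_of_compat h hσ hK (j := 8) (by rw [natCard_perm_four]) (by norm_num)
      hom_perm_zmod_three_eq_one, hφ.isLinearChar,
      hφ.orderOf_eq hσ (exists_sign_ne_one (by norm_num)) hK⟩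

theorem three_alt_six (hG : IsCover 3 6 G) : ∃ χ₁₆ χ₁₈ : G → ℂ,
    IsConjPair (faithfulOfDegree G 6) χ₁₆ ∧
    IsConjPair (faithfulOfDegree G 15) χ₁₈ ∧
    (∀ (H : Subgroup G) (φ : H → ℂ) (χ : G → ℂ),
      IsMinimalTriple H φ χ ↔ (PairA5 H φ ∨ PairS4 H φ) ∧ χ = ind H φ) ∧
    inducedFrom (G := G) PairA5 = {χ₁₆, star χ₁₆} ∧
    inducedFrom (G := G) PairS4 = {χ₁₈, star χ₁₈} := by
  have := hG.1
  have := isSimpleGroup_alt (n := 6) (by norm_num)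
  obtain ⟨π, h, hK⟩ := hG.exists_centralExt (by norm_num)
  have memA5 : ∀ (H : Subgroup G) φ, PairA5 H φ → ind H φ ∈ faithfulOfDegree G 6 := by
    intro H φ hp
    obtain ⟨hi, σ, hσ, hφ⟩ := (pairA5_iff h hK φ).1 hp
    have h1 : ind H φ 1 = 6 := by rw [ind_one, hi, hφ.one]; simp
    exact ⟨h.isFaithfulIrr (hφ.isIrr_ind_alt_five h hK hi hσ) (faithfulOn_ind h hσ hφ.faithful)
      (by rw [h1]; norm_num), by rw [h1]; simp⟩
  have memS4 : ∀ (H : Subgroup G) φ, PairS4 H φ → ind H φ ∈ faithfulOfDegree G 15 := by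
    intro H φ hp
    obtain ⟨hi, σ, hσ, hφ⟩ := (pairS4_iff h hK φ).1 hp
    have h1 : ind H φ 1 = 15 := by rw [ind_one, hi, hφ.one]; simp
    exact ⟨h.isFaithfulIrr (hφ.isIrr_ind_perm_four h hK hi hσ) (faithfulOn_ind h hσ hφ.faithful)
      (by rw [h1]; norm_num), by rw [h1]; simp⟩
  obtain ⟨H₁, φ₁, σ₁, hi₁, hσ₁, hφ₁⟩ := exists_isChiSix h hK
  obtain ⟨H₂, φ₂, σ₂, hi₂, hσ₂, hφ₂⟩ := exists_isChiFifteen h hK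
  have p₁ : PairA5 H₁ φ₁ := (pairA5_iff h hK φ₁).2 ⟨hi₁, σ₁, hσ₁, hφ₁⟩
  have p₂ : PairS4 H₂ φ₂ := (pairS4_iff h hK φ₂).2 ⟨hi₂, σ₂, hσ₂, hφ₂⟩
  have c₁ : IsConjPair (faithfulOfDegree G 6) (ind H₁ φ₁) :=
    isConjPair_of_unique h hK (fun χ hχ => hχ.1) faithfulOfDegree_star (fun χ hχ ψ hψ hs =>
      eq_of_degree_six h hK hχ.1.1 hψ.1.1 (hχ.1.faithfulOn _) hs (by simpa using hχ.2)
        (by simpa using hψ.2)) (memA5 _ _ p₁)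
  have c₂ : IsConjPair (faithfulOfDegree G 15) (ind H₂ φ₂) :=
    isConjPair_of_unique h hK (fun χ hχ => hχ.1) faithfulOfDegree_star (fun χ hχ ψ hψ hs =>
      eq_of_degree_fifteen h hχ.1.1 hψ.1.1 hs (by simpa using hχ.2) (by simpa using hψ.2))
      (memS4 _ _ p₂)
  refine ⟨_, _, c₁, c₂, fun H φ χ => ⟨fun ht => ?_, ?_⟩, inducedFrom_eq_pair c₁ memA5 ?_ p₁ rfl,
    inducedFrom_eq_pair c₂ memS4 ?_ p₂ rfl⟩
  · have hH := isMinimalTriple_ne_top ht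
    obtain ⟨h1, -, h3, rfl, -⟩ := ht
    have : Fintype H := Fintype.ofFinite H
    refine ⟨?_, rfl⟩
    obtain ⟨hi, h1'⟩ := index_three_alt_six h hK hH h3.2.1 h1
    have hle : π.ker ≤ H := h.central.trans h3.1
    rcases hi with hi | hi
    · obtain ⟨σ, hσ⟩ := exists_compat_alt_five h hle hi
      have := isPerfect_alt (n := 5) le_rfl
      refine Or.inl ((pairA5_iff h hK φ).2 ⟨hi, σ, hσ, ?_⟩)
      exact (IsLinearChar.linOver ⟨h3.2.1, h1'⟩ (hσ.ext h) ((Compat.card_ker hσ).trans hK)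
        (faithfulOn_of_ind h hσ (h1.faithfulOn _)) homSign_of_isPerfect).elim id id
    · obtain ⟨σ, hσ⟩ := exists_compat_perm_four h hle hi
      refine Or.inr ((pairS4_iff h hK φ).2 ⟨hi, σ, hσ, ?_⟩)
      exact (IsLinearChar.linOver ⟨h3.2.1, h1'⟩ (hσ.ext h) ((Compat.card_ker hσ).trans hK)
        (faithfulOn_of_ind h hσ (h1.faithfulOn _)) homSign_perm).resolve_left
        fun hl => hl.not_isIrr_ind_perm_four h hK hi hσ h1.1
  · rintro ⟨hp | hp, rfl⟩
    · obtain ⟨hi, σ, hσ, hφ⟩ := (pairA5_iff h hK φ).1 hp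
      exact isMinimalTriple_intro (by norm_num) h hσ hφ.faithful hφ.irr (memA5 _ _ hp).1
        (fun ht => by rw [ht, Subgroup.index_top] at hi; omega)
        fun K ψ hlt hψ => ind_ne_ind_of_lt hφ.one hlt hψ
    · obtain ⟨hi, σ, hσ, hφ⟩ := (pairS4_iff h hK φ).1 hp
      exact isMinimalTriple_intro (by norm_num) h hσ hφ.faithful hφ.irr (memS4 _ _ hp).1
        (fun ht => by rw [ht, Subgroup.index_top] at hi; omega)
        fun K ψ hlt hψ => ind_ne_ind_of_lt hφ.one hlt hψ
  · intro H φ hp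
    obtain ⟨hi, σ, hσ, hφ⟩ := (pairA5_iff h hK φ).1 hp
    have : Fintype H := Fintype.ofFinite H
    exact (pairA5_iff h hK _).2 ⟨hi, σ, hσ, hφ.star⟩
  · intro H φ hp
    obtain ⟨hi, σ, hσ, hφ⟩ := (pairS4_iff h hK φ).1 hp
    have : Fintype H := Fintype.ofFinite H
    exact (pairS4_iff h hK _).2 ⟨hi, σ, hσ, hφ.star⟩

end ThreeAltSix

end ImprimitiveCovers

namespace ImprimitiveCovers

open Finset CentralExt Equiv

/-! ### Numerical data of the characters of covers of `A₇` -/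

section Seven

variable {G : Type u} [Group G] [Fintype G] {π : G →* Alt 7} {χ ψ : G → ℂ}

theorem natCard_alt_seven' : Nat.card (Alt 7) = 9 * 280 := by rw [natCard_alt_seven]

theorem sum_orders_seven (f : ℕ → ℝ) : ∑ r ∈ ({1, 2, 3, 4, 5, 6, 7} : Finset ℕ), f r =
    f 1 + f 2 + f 3 + f 4 + f 5 + f 6 + f 7 := by
  rw [sum_insert (by decide), sum_insert (by decide), sum_insert (by decide),
    sum_insert (by decide), sum_insert (by decide), sum_insert (by decide), sum_singleton]
  ring

theorem CentralExt.exists_val_five (h : CentralExt π) (hco : Nat.Coprime 5 (Nat.card π.ker))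
    (hχ : IsIrr χ) {d : ℕ} (hd : χ 1 = d) : ∃ t : ℕ, h.Val 5 χ ((d - 5 * t : ℤ) : ℝ) := by
  obtain ⟨a, ha⟩ := exists_order_of_card_pos card_five_alt_seven (by norm_num)
  have hco' : (orderOf a).Coprime (Nat.card π.ker) := by rwa [ha]
  have h2 : orderOf (a ^ 2) = 5 := by rw [orderOf_pow, ha]; norm_num
  obtain ⟨t, ht⟩ := hχ.exists_five_of_isConj_sq hd (g := h.s a)
    (by rw [← ha, ← h.orderOf_s hco', pow_orderOf_eq_one])
    (h.isConj_pow_three hco' (isConj_five_alt_seven ha h2))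
  exact ⟨t, h.val_of_isConj hco (fun _ _ => isConj_five_alt_seven) hχ.conj ha
    (by rw [ht]; push_cast; rfl)⟩

theorem CentralExt.exists_seven (h : CentralExt π) (hco : Nat.Coprime 7 (Nat.card π.ker))
    (hχ : IsIrr χ) {d : ℕ} (hd : χ 1 = d) : ∃ (t : ℕ) (D : ℤ), 2 ∣ D - t ∧
      h.rip 7 χ χ = 180 * ((2 * d - 7 * t : ℤ) ^ 2 + 7 * D ^ 2) ∧
      (D = 0 → h.Val 7 χ ((2 * d - 7 * t : ℤ) / 2)) := by
  obtain ⟨a, ha⟩ := exists_order_of_card_pos card_seven_alt_seven (by norm_num)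
  have hco' : (orderOf a).Coprime (Nat.card π.ker) := by rwa [ha]
  have hpow : h.s a ^ 7 = 1 := orderOf_dvd_iff_pow_eq_one.1 (by rw [h.orderOf_s hco', ha])
  obtain ⟨t, D, hD, hv⟩ := hχ.exists_seven hd hpow
    (h.isConj_pow_three hco' (isConj_sq_seven_alt_seven ha))
  have hv' : ∀ b, orderOf b = 7 → χ (h.s b) = ((2 * d - 7 * t : ℤ) + D * sqrtNegSeven) / 2 ∨
      χ (h.s b) = ((2 * d - 7 * t : ℤ) - D * sqrtNegSeven) / 2 := fun b hb => by
    obtain ⟨j, hj, hc⟩ := ratConj_seven_alt_seven a b ha hb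
    have ho : orderOf (a ^ j) = 7 := by
      rw [orderOf_pow, ha, Nat.Coprime.gcd_eq_one hj, Nat.div_one]
    rw [← h.apply_s_eq_of_isConj hχ.conj (by rwa [ho]) hc, h.s_pow hco']
    exact hv j hj.symm
  refine ⟨t, D, hD, ?_, fun h0 b hb => ?_⟩
  · rw [h.rip_self, osum_const (c := (((2 * d - 7 * t : ℤ) : ℝ) ^ 2 + 7 * (D : ℝ) ^ 2) / 4),
      card_seven_alt_seven, nsmul_eq_mul]
    · push_cast
      ring
    · intro b hb
      rcases hv' b hb with hb' | hb' <;> rw [hb']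
      · have := norm_sq_seven (2 * d - 7 * t) D 1 (Or.inl rfl)
        rwa [one_mul] at this
      · have := norm_sq_seven (2 * d - 7 * t) D (-1) (Or.inr rfl)
        rwa [neg_one_mul, ← sub_eq_add_neg] at this
  · subst h0
    rcases hv' b hb with hb' | hb' <;> rw [hb'] <;> push_cast <;> ring

theorem CentralExt.rip_le (h : CentralExt π) (hχ : IsIrr χ) {d : ℕ} (hd : χ 1 = d) :
    (d : ℝ) ^ 2 + h.rip 5 χ χ + h.rip 7 χ χ ≤ 2520 := by
  have hs := h.sum_rip hχ hχ (fun _ _ => rfl) orderOf_alt_seven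
  rw [sum_orders_seven, if_pos rfl, natCard_alt_seven,
    h.rip_one (d := d) (e := d) (by rw [hd]; simp) (by rw [hd]; simp)] at hs
  have n2 := h.rip_self_nonneg 2 χ
  have n3 := h.rip_self_nonneg 3 χ
  have n4 := h.rip_self_nonneg 4 χ
  have n6 := h.rip_self_nonneg 6 χ
  push_cast at hs
  linarith

/-- For degree 30 the norm allows only u = 60 − 7s = −3 and D = 0 at order seven, so s = 9, and D
would have the wrong parity. The argument applies to kernels of order three and six. -/
theorem CentralExt.degree_ne_thirty (h : CentralExt π) (hco : Nat.Coprime 7 (Nat.card π.ker))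
    (hχ : IsIrr χ) : χ 1 ≠ (30 : ℕ) := fun hd => by
  obtain ⟨s, D, hD, h7, -⟩ := h.exists_seven hco hχ hd
  have hn := h.rip_le hχ hd
  have h5 := h.rip_self_nonneg 5 χ
  push_cast at hn h7
  have hle : (60 - 7 * (s : ℤ)) ^ 2 + 7 * D ^ 2 ≤ 9 := by
    have : ((60 - 7 * (s : ℝ)) ^ 2 + 7 * (D : ℝ) ^ 2) < 10 := by linarith
    have : ((60 - 7 * (s : ℤ)) ^ 2 + 7 * D ^ 2) < 10 := by exact_mod_cast this
    omega
  have hs : s = 9 := by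
    obtain ⟨h1, h2⟩ := abs_lt.1 (abs_lt_of_sq_lt_sq (a := 60 - 7 * (s : ℤ)) (b := 4)
      (by nlinarith [sq_nonneg D]) (by norm_num))
    omega
  subst hs
  have hD0 : D = 0 := by
    push_cast at hle
    have : D ^ 2 = 0 := by nlinarith [sq_nonneg D]
    exact pow_eq_zero_iff two_ne_zero |>.1 this
  subst hD0
  omega

/-- The values of a faithful irreducible character of `3·A₇`. -/
structure CentralExt.SevenData (h : CentralExt π) (χ : G → ℂ) (d : ℕ) (x y b : ℤ) : Prop where
  irr : IsIrr χ
  one : χ 1 = d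
  two : h.Val 2 χ x
  three : h.rip 3 χ χ = 0
  four : h.Val 4 χ y
  five : h.Val 5 χ b

theorem CentralExt.Val.star {r : ℕ} {h : CentralExt π} {x : ℝ} (hx : h.Val r χ x) :
    h.Val r (star χ) x := fun a ha => by rw [Pi.star_apply, hx a ha]; simp

theorem CentralExt.SevenData.star {h : CentralExt π} {d : ℕ} {x y b : ℤ}
    (hχ : h.SevenData χ d x y b) : h.SevenData (star χ) d x y b where
  irr := hχ.irr.star
  one := by rw [Pi.star_apply, hχ.one]; simp
  two := hχ.two.star
  three := by
    have := hχ.three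
    rw [rip_self] at this ⊢
    simpa using this
  four := hχ.four.star
  five := hχ.five.star

variable {h : CentralExt π} {d d' : ℕ} {x y b x' y' b' : ℤ}

theorem CentralExt.SevenData.sum_rip (hχ : h.SevenData χ d x y b)
    (hψ : h.SevenData ψ d' x' y' b') :
    ∑ r ∈ ({1, 2, 3, 4, 5, 6, 7} : Finset ℕ), h.rip r χ ψ =
      d * d' + 105 * (x * x') + 630 * (y * y') + 504 * (b * b') + h.rip 6 χ ψ + h.rip 7 χ ψ := by
  rw [sum_orders_seven, h.rip_one (d := d) (e := d') (by rw [hχ.one]; simp)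
    (by rw [hψ.one]; simp), h.rip_const hχ.two hψ.two, h.rip_const hχ.four hψ.four,
    h.rip_const hχ.five hψ.five, h.rip_eq_zero_of_left hχ.three,
    card_two_alt_seven, card_four_alt_seven, card_five_alt_seven]
  push_cast
  ring

theorem CentralExt.SevenData.norm (hχ : h.SevenData χ d x y b) :
    (d : ℝ) ^ 2 + 105 * x ^ 2 + 630 * y ^ 2 + 504 * b ^ 2 + h.rip 6 χ χ + h.rip 7 χ χ = 2520 := by
  have h1 := SevenData.sum_rip hχ hχ
  have h2 := h.sum_rip hχ.irr hχ.irr (fun _ _ => rfl) orderOf_alt_seven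
  rw [if_pos rfl, h1, natCard_alt_seven] at h2
  push_cast at h2
  linarith

theorem CentralExt.SevenData.orth (hχ : h.SevenData χ d x y b)
    (hψ : h.SevenData ψ d' x' y' b') (hs : SameOn π.ker χ ψ) (hne : χ ≠ ψ) :
    (d * d' + 105 * (x * x') + 630 * (y * y') + 504 * (b * b') : ℝ) + h.rip 6 χ ψ + h.rip 7 χ ψ
      = 0 := by
  have h1 := SevenData.sum_rip hχ hψ
  have h2 := h.sum_rip hχ.irr hψ.irr hs orderOf_alt_seven
  rwa [if_neg hne, h1] at h2

theorem CentralExt.SevenData.norm_le (hχ : h.SevenData χ d x y b) :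
    (d : ℤ) ^ 2 + 105 * x ^ 2 + 630 * y ^ 2 + 504 * b ^ 2 ≤ 2520 := by
  have h1 := hχ.norm
  have h6 := h.rip_self_nonneg 6 χ
  have h7 := h.rip_self_nonneg 7 χ
  have : ((d : ℝ) ^ 2 + 105 * x ^ 2 + 630 * y ^ 2 + 504 * b ^ 2) ≤ 2520 := by linarith
  exact_mod_cast this

/-- If the characters differ, χ + ψ has norm 2 · 2520. Its contributions at orders 6 and 7 are
nonnegative, so those at the known orders cannot exceed this total. -/
theorem CentralExt.SevenData.eq_of_pos (hχ : h.SevenData χ d x y b)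
    (hψ : h.SevenData ψ d' x' y' b') (hs : SameOn π.ker χ ψ)
    (hpos : 2520 < 2 * (d * d' + 105 * (x * x') + 630 * (y * y') + 504 * (b * b')) +
      ((d : ℤ) ^ 2 + 105 * x ^ 2 + 630 * y ^ 2 + 504 * b ^ 2 +
      (d' ^ 2 + 105 * x' ^ 2 + 630 * y' ^ 2 + 504 * b' ^ 2)) - 2520) : χ = ψ := by
  by_contra hne
  have h1 := hχ.orth hψ hs hne
  have h2 := hχ.norm
  have h3 := hψ.norm
  have h6 := h.neg_le_rip 6 χ ψ
  have h7 := h.neg_le_rip 7 χ ψ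
  have h5 : (2520 : ℝ) < 2 * (d * d' + 105 * (x * x') + 630 * (y * y') + 504 * (b * b')) +
      ((d : ℝ) ^ 2 + 105 * x ^ 2 + 630 * y ^ 2 + 504 * b ^ 2 +
      (d' ^ 2 + 105 * x' ^ 2 + 630 * y' ^ 2 + 504 * b' ^ 2)) - 2520 := by exact_mod_cast hpos
  linarith

theorem CentralExt.exists_sevenData [Group.IsPerfect G] (h : CentralExt π)
    (hK : Nat.card π.ker = 3) (hχ : IsIrr χ) (hf : FaithfulOn π.ker χ) (hd : χ 1 = d) :
    ∃ (x y : ℤ) (t : ℕ), h.SevenData χ d x y (d - 5 * t) := by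
  obtain ⟨a₂, ha₂⟩ := exists_order_of_card_pos card_two_alt_seven (by norm_num)
  obtain ⟨a₄, ha₄⟩ := exists_order_of_card_pos card_four_alt_seven (by norm_num)
  obtain ⟨x, hx⟩ := h.exists_val_two hK (fun _ _ => isConj_two_alt_seven) ha₂ hχ
  obtain ⟨y, hy⟩ := h.exists_val_four hK (fun _ _ => isConj_four_alt_seven) ha₄ hχ
  obtain ⟨t, h5⟩ := h.exists_val_five (by rw [hK]; norm_num) hχ hd
  exact ⟨x, y, t, hχ, hd, hx,
    hf.rip_three h (i := 1) natCard_alt_seven' (by norm_num) hK (by norm_num) hχ, hy, h5⟩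

theorem CentralExt.SevenData.unique_two (hχ : h.SevenData χ d x y b) {c : ℤ}
    (hc : h.Val 2 χ c) : x = c := by
  have := Val.unique card_two_alt_seven (by norm_num) hχ.two hc
  exact_mod_cast this

/-- 225 + 105 · 9 leaves 1350. This forces the multiple of five 15 − 5t to be 0, then s = 4 and D =
0 at order seven, and finally leaves 630 for orders 4 and 6. -/
theorem SevenData.val_seven_of_degree_fifteen (hK : Nat.card π.ker = 3) {t : ℕ}
    (hχ : h.SevenData χ 15 3 y (15 - 5 * t)) : h.Val 7 χ 1 ∧ 15 - 5 * (t : ℤ) = 0 ∧ y ^ 2 ≤ 1 ∧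
      h.rip 6 χ χ = 630 - 630 * y ^ 2 := by
  have hn := hχ.norm_le
  have hb : 15 - 5 * (t : ℤ) = 0 := by
    have : (15 - 5 * (t : ℤ)) ^ 2 ≤ 2 := by push_cast at hn; nlinarith [sq_nonneg y]
    obtain ⟨h1, h2⟩ := abs_lt.1 (abs_lt_of_sq_lt_sq (a := 15 - 5 * (t : ℤ)) (b := 2)
      (by linarith) (by norm_num))
    omega
  obtain ⟨s, D, hD, h7, hv⟩ := h.exists_seven (by rw [hK]; norm_num) hχ.irr hχ.one
  have hn' := hχ.norm
  have h6 := h.rip_self_nonneg 6 χ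
  rw [hb] at hn hn'
  push_cast at hn hn' h7
  have hle : (30 - 7 * (s : ℤ)) ^ 2 + 7 * D ^ 2 ≤ 7 := by
    have : ((30 - 7 * (s : ℝ)) ^ 2 + 7 * (D : ℝ) ^ 2) < 8 := by nlinarith [sq_nonneg (y : ℝ)]
    have : ((30 - 7 * (s : ℤ)) ^ 2 + 7 * D ^ 2) < 8 := by exact_mod_cast this
    omega
  have hs : s = 4 := by
    obtain ⟨h1, h2⟩ := abs_lt.1 (abs_lt_of_sq_lt_sq (a := 30 - 7 * (s : ℤ)) (b := 3)
      (by nlinarith [sq_nonneg D]) (by norm_num))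
    omega
  subst hs
  have hD0 : D = 0 := by
    obtain ⟨h1, h2⟩ := abs_lt.1 (abs_lt_of_sq_lt_sq (a := D) (b := 2)
      (by nlinarith) (by norm_num))
    omega
  subst hD0
  refine ⟨?_, hb, ?_, ?_⟩
  · have := hv rfl
    norm_num at this
    exact this
  · obtain ⟨h1, h2⟩ := abs_lt.1 (abs_lt_of_sq_lt_sq (a := y) (b := 2) (by linarith) (by norm_num))
    have hy : y = -1 ∨ y = 0 ∨ y = 1 := by omega
    rcases hy with rfl | rfl | rfl <;> norm_num
  · norm_num at h7 hn'
    linarith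

/-- ψ exhausts its norm without order six, so orthogonality would read 225 + 945 + 630y + 720 = 0,
giving y = −3. -/
theorem eq_of_degree_fifteen_seven [Group.IsPerfect G] (h : CentralExt π)
    (hK : Nat.card π.ker = 3) (hχ : IsIrr χ) (hf : FaithfulOn π.ker χ) (h1 : χ 1 = 15)
    (h2 : h.Val 2 χ 3) (hψ : h.SevenData ψ 15 3 1 0) (hs : SameOn π.ker χ ψ) : χ = ψ := by
  by_contra hne
  obtain ⟨x, y, t, hd⟩ := h.exists_sevenData hK hχ hf (d := 15) (by rw [h1]; simp)
  obtain rfl : x = 3 := hd.unique_two (by exact_mod_cast h2)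
  obtain ⟨v, hb, hy, -⟩ := SevenData.val_seven_of_degree_fifteen hK hd
  obtain ⟨v', -, -, h6⟩ := SevenData.val_seven_of_degree_fifteen (t := 3) hK (by simpa using hψ)
  have ho := hd.orth hψ hs hne
  rw [h.rip_eq_zero_of_right (by rw [h6]; norm_num), h.rip_const v v', card_seven_alt_seven] at ho
  have hb' : ((((15 : ℕ) : ℤ) - 5 * (t : ℤ) : ℤ) : ℝ) = 0 := by exact_mod_cast hb
  rw [hb'] at ho
  norm_num at ho
  have : y = -3 := by
    have : (y : ℝ) = -3 := by linarith
    exact_mod_cast this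
  subst this
  norm_num at hy

/-- The norm forces the value 1 at order five and |y| ≤ 1; each possible y makes the known part of
the norm of χ + ψ too large. -/
theorem eq_of_degree_twentyone [Group.IsPerfect G] (h : CentralExt π)
    (hK : Nat.card π.ker = 3) (hχ : IsIrr χ) (hf : FaithfulOn π.ker χ) (h1 : χ 1 = 21)
    (h2 : h.Val 2 χ (-3)) (hψ : h.SevenData ψ 21 (-3) 1 1) (hs : SameOn π.ker χ ψ) : χ = ψ := by
  obtain ⟨x, y, t, hd⟩ := h.exists_sevenData hK hχ hf (d := 21) (by rw [h1]; simp)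
  obtain rfl : x = -3 := hd.unique_two (by exact_mod_cast h2)
  have hn := hd.norm_le
  push_cast at hn hd
  have hb : (21 : ℤ) - 5 * t = 1 := by
    obtain ⟨h1, h2⟩ := abs_lt.1 (abs_lt_of_sq_lt_sq (a := 21 - 5 * (t : ℤ)) (b := 2)
      (by nlinarith [sq_nonneg y]) (by norm_num))
    omega
  rw [hb] at hn hd
  obtain ⟨h1, h2⟩ := abs_lt.1 (abs_lt_of_sq_lt_sq (a := y) (b := 2) (by linarith) (by norm_num))
  have hy : y = -1 ∨ y = 0 ∨ y = 1 := by omega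
  rcases hy with rfl | rfl | rfl <;> exact hd.eq_of_pos hψ hs (by norm_num)

/-- The norm of θ is exhausted without orders 6 and 7, so orthogonality to θ determines y = −1;
positivity then gives equality with ψ. -/
theorem eq_of_degree_twentyone' [Group.IsPerfect G] (h : CentralExt π)
    (hK : Nat.card π.ker = 3) (hχ : IsIrr χ) (hf : FaithfulOn π.ker χ) (h1 : χ 1 = 21)
    (h2 : h.Val 2 χ 1) (hψ : h.SevenData ψ 21 1 (-1) 1) {θ : G → ℂ}
    (hθ : h.SevenData θ 21 (-3) 1 1) (hs : SameOn π.ker χ ψ) (hs' : SameOn π.ker χ θ) : χ = ψ := by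
  obtain ⟨x, y, t, hd⟩ := h.exists_sevenData hK hχ hf (d := 21) (by rw [h1]; simp)
  obtain rfl : x = 1 := hd.unique_two (by exact_mod_cast h2)
  have hn := hd.norm_le
  push_cast at hn hd
  have hb : (21 : ℤ) - 5 * t = 1 := by
    obtain ⟨h1, h2⟩ := abs_lt.1 (abs_lt_of_sq_lt_sq (a := 21 - 5 * (t : ℤ)) (b := 3)
      (by nlinarith [sq_nonneg y]) (by norm_num))
    omega
  rw [hb] at hn hd
  have hne : χ ≠ θ := fun he => by
    have := hθ.unique_two (c := 1) (he ▸ hd.two)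
    norm_num at this
  have ho := hd.orth hθ hs' hne
  have hn' := hθ.norm
  have e6 := h.rip_self_nonneg 6 θ
  have e7 := h.rip_self_nonneg 7 θ
  rw [h.rip_eq_zero_of_right (r := 6) (by norm_num at hn'; linarith),
    h.rip_eq_zero_of_right (r := 7) (by norm_num at hn'; linarith)] at ho
  obtain rfl : y = -1 := by
    have : (y : ℝ) = -1 := by norm_num at ho; linarith
    exact_mod_cast this
  exact hd.eq_of_pos hψ hs (by norm_num)

end Seven

end ImprimitiveCovers

namespace ImprimitiveCovers

open Finset CentralExt Equiv

open scoped MatrixGroups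

/-! ### Induced characters, degrees and indices for 3·A₇ -/

section ThreeAltSeven

variable {G : Type u} [Group G] [Fintype G] {π : G →* Alt 7} {χ ψ : G → ℂ} {H : Subgroup G}

theorem CentralExt.natCard_three_alt_seven (h : CentralExt π) (hK : Nat.card π.ker = 3) :
    Nat.card G = 7560 := by
  rw [h.natCard_eq, hK, natCard_alt_seven]

noncomputable instance : Fintype PSL(2, ZMod 7) := Fintype.ofFinite _

theorem card_six_psl : (ofOrder PSL(2, ZMod 7) 6).card = 0 := by
  rw [card_eq_zero, eq_empty_iff_forall_notMem]
  intro a ha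
  have := L27.orderOf_psl a
  rw [mem_ofOrder.1 ha] at this
  omega

theorem exists_compat_psl (h : CentralExt π) (hH : π.ker ≤ H) (hi : H.index = 15) :
    ∃ σ : H →* PSL(2, ZMod 7), Compat π H σ := by
  obtain ⟨e⟩ := L27.equiv_of_index (B := H.map π) (by rw [index_map h hH, hi])
  exact exists_compat hH e

theorem exists_compat_perm_five (h : CentralExt π) (hH : π.ker ≤ H) (hi : H.index = 21) :
    ∃ σ : H →* Perm (Fin 5), Compat π H σ := by
  obtain ⟨e⟩ := equiv_perm_five_of_index (B := H.map π) (by rw [index_map h hH, hi])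
  exact exists_compat hH e

theorem exists_compat_alt_six (h : CentralExt π) (hH : π.ker ≤ H) (hi : H.index = 7) :
    ∃ σ : H →* Alt 6, Compat π H σ := by
  obtain ⟨e⟩ := equiv_alt_of_index (n := 7) (by norm_num) (H := H.map π)
    (by rw [index_map h hH, hi])
  exact exists_compat hH e

theorem exists_ker_le_index_seven (h : CentralExt π) {k : ℕ}
    (hk : ∃ B : Subgroup (Alt 7), B.index = k) :
    ∃ H : Subgroup G, π.ker ≤ H ∧ H.index = k := by
  obtain ⟨B, hB⟩ := hk
  exact ⟨B.comap π, fun z hz => by rw [Subgroup.mem_comap, show π z = 1 from hz]; exact B.one_mem,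
    by rw [Subgroup.index_comap_of_surjective _ h.surj, hB]⟩

/-- An induced character with sufficiently small values is irreducible. -/
theorem sevenData_ind [Group.IsPerfect G] (h : CentralExt π) (hK : Nat.card π.ker = 3)
    {B : Type} [Group B] [Fintype B] {σ : H →* B} (hσ : Compat π H σ) {φ : H → ℂ} (hφ : IsIrr φ)
    (hf : FaithfulOn σ.ker φ) {d : ℕ} {x y b : ℤ} (hd : ind H φ 1 = d)
    (hx : h.Val 2 (ind H φ) x) (hy : h.Val 4 (ind H φ) y) (hb : h.Val 5 (ind H φ) b)
    (hlt : (d : ℝ) ^ 2 + 105 * x ^ 2 + 630 * y ^ 2 + 504 * b ^ 2 +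
      h.rip 6 (ind H φ) (ind H φ) + h.rip 7 (ind H φ) (ind H φ) ≤ 5000) :
    h.SevenData (ind H φ) d x y b := by
  have h3 := h.rip_three_ind (i := 1) natCard_alt_seven' (by norm_num) hK (by norm_num) hσ hφ hf
  refine ⟨h.isIrr_ind hσ.le hφ orderOf_alt_seven ?_, hd, hx, h3, hy, hb⟩
  have h1 : h.rip 1 (ind H φ) (ind H φ) = d * d := h.rip_one (by rw [hd]; simp) (by rw [hd]; simp)
  rw [sum_orders_seven, h1, h3, h.rip_of_val hx card_two_alt_seven,
    h.rip_of_val hy card_four_alt_seven, h.rip_of_val hb card_five_alt_seven, natCard_alt_seven]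
  norm_num
  linarith

theorem LinOver.sevenData_psl [Group.IsPerfect G] (h : CentralExt π)
    (hK : Nat.card π.ker = 3) (hi : H.index = 15) {σ : H →* PSL(2, ZMod 7)} (hσ : Compat π H σ)
    {φ : H → ℂ} (hφ : LinOver σ φ 1) : h.SevenData (ind H φ) 15 3 1 0 := by
  have c5 : (ofOrder PSL(2, ZMod 7) 5).card = 0 :=
    ofOrder_eq_zero (by rw [L27.natCard_psl]; norm_num)
  -- An element of order seven fixes f ≡ 1 (mod 7) of the 15 cosets, and the number of such elements
  -- is 48f ≤ 168, so f = 1.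
  have c7 : (ofOrder PSL(2, ZMod 7) 7).card ≤ 48 := by
    obtain ⟨f, hf, e⟩ := exists_fixc (H.map π) ratConj_seven_alt_seven card_seven_alt_seven
      (by norm_num)
    rw [index_map h hσ.le, Compat.card_ofOrder hσ, hi] at e
    rw [index_map h hσ.le, hi] at hf
    have hle := sum_card_ofOrder_le (B := PSL(2, ZMod 7)) {7}
    rw [sum_singleton, L27.natCard_psl] at hle
    have : f % 7 = 1 := hf
    omega
  have h6 := hφ.rip_ind_le h hσ (ratConj_of_isConj isConj_six_alt_seven) card_six_alt_seven
    card_six_psl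
  have h7 := hφ.rip_ind_le h hσ ratConj_seven_alt_seven card_seven_alt_seven rfl
  have h7' : ((15 : ℕ) * (ofOrder PSL(2, ZMod 7) 7).card : ℝ) ^ 2 ≤ (15 * 48) ^ 2 := by
    have : ((ofOrder PSL(2, ZMod 7) 7).card : ℝ) ≤ 48 := by exact_mod_cast c7
    push_cast
    gcongr
  rw [hi] at h6 h7
  refine sevenData_ind h hK hσ hφ.irr hφ.faithful (by rw [ind_one, hi, hφ.one]; simp)
    (hφ.val_ind h hσ hK (by norm_num) (fun _ _ => isConj_two_alt_seven) card_two_alt_seven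
      (by norm_num) ((osum_one_sign 2).trans (by rw [L27.card_two_psl]; rfl)) (S := 21)
      (by rw [hi]; norm_num))
    (hφ.val_ind h hσ hK (by norm_num) (fun _ _ => isConj_four_alt_seven) card_four_alt_seven
      (by norm_num) ((osum_one_sign 4).trans (by rw [L27.card_four_psl]; rfl)) (S := 42)
      (by rw [hi]; norm_num))
    (hφ.val_ind h hσ hK (by norm_num) (fun _ _ => isConj_five_alt_seven) card_five_alt_seven
      (by norm_num) ((osum_one_sign 5).trans (by rw [c5]; rfl)) (S := 0)
      (by rw [hi]; norm_num)) ?_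
  norm_num at h6 h7 h7' ⊢
  linarith

theorem LinOver.sevenData_perm_five [Group.IsPerfect G] (h : CentralExt π)
    (hK : Nat.card π.ker = 3) (hi : H.index = 21) {σ : H →* Perm (Fin 5)} (hσ : Compat π H σ)
    {φ : H → ℂ} (hφ : LinOver σ φ Perm.sign) : h.SevenData (ind H φ) 21 1 (-1) 1 := by
  have h6 := hφ.rip_ind_le h hσ (ratConj_of_isConj isConj_six_alt_seven) card_six_alt_seven
    card_six_perm_five
  have h7 := hφ.rip_ind_le h hσ ratConj_seven_alt_seven card_seven_alt_seven
    (ofOrder_eq_zero (by rw [natCard_perm_five]; norm_num))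
  rw [hi] at h6 h7
  refine sevenData_ind h hK hσ hφ.irr hφ.faithful (by rw [ind_one, hi, hφ.one]; simp)
    (hφ.val_ind h hσ hK (by norm_num) (fun _ _ => isConj_two_alt_seven) card_two_alt_seven
      (by norm_num) osum_two_sign_five (by rw [hi]; norm_num))
    (hφ.val_ind h hσ hK (by norm_num) (fun _ _ => isConj_four_alt_seven) card_four_alt_seven
      (by norm_num) osum_four_sign_five (by rw [hi]; norm_num))
    (hφ.val_ind h hσ hK (by norm_num) (fun _ _ => isConj_five_alt_seven) card_five_alt_seven
      (by norm_num) osum_five_sign_five (by rw [hi]; norm_num)) ?_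
  norm_num at h6 h7 ⊢
  linarith

/-- Without the sign the value on involutions is 5, and 105 · 25 exceeds 2520. -/
theorem LinOver.not_isIrr_ind_perm_five (h : CentralExt π)
    (hK : Nat.card π.ker = 3) (hi : H.index = 21) {σ : H →* Perm (Fin 5)} (hσ : Compat π H σ)
    {φ : H → ℂ} (hφ : LinOver σ φ 1) : ¬ IsIrr (ind H φ) := by
  intro hirr
  have v2 : h.Val 2 (ind H φ) 5 := hφ.val_ind h hσ hK (by norm_num)
    (fun _ _ => isConj_two_alt_seven) card_two_alt_seven (by norm_num)
    ((osum_one_sign 2).trans (by rw [card_two_perm_five]; rfl)) (S := 25) (by rw [hi]; norm_num)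
  have hs := h.sum_rip hirr hirr (fun _ _ => rfl) orderOf_alt_seven
  rw [sum_orders_seven, if_pos rfl, h.rip_of_val v2 card_two_alt_seven, natCard_alt_seven] at hs
  have n1 := h.rip_self_nonneg 1 (ind H φ)
  have n3 := h.rip_self_nonneg 3 (ind H φ)
  have n4 := h.rip_self_nonneg 4 (ind H φ)
  have n5 := h.rip_self_nonneg 5 (ind H φ)
  have n6 := h.rip_self_nonneg 6 (ind H φ)
  have n7 := h.rip_self_nonneg 7 (ind H φ)
  norm_num at hs
  linarith

/-- The commutator subgroup of `H` covers `B`, and by transfer it contains the kernel because the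
index is prime to its order. -/
theorem Compat.isPerfect {A : Type v} {B : Type w} [Group A] [Group B] {π : G →* A} {σ : H →* B}
    [Group.IsPerfect G] [Group.IsPerfect B] (h : CentralExt π) (hσ : Compat π H σ)
    (hco : (Nat.card π.ker).Coprime H.index) : Group.IsPerfect H := by
  refine ⟨eq_top_iff.2 fun g _ => ?_⟩
  have h1 : (commutator H).map σ = ⊤ := by
    rw [commutator_def, Subgroup.map_commutator, Subgroup.map_top_of_surjective σ hσ.surj,
      ← commutator_def, Group.IsPerfect.commutator_eq_top]
  obtain ⟨c, hc, hcg⟩ : σ g ∈ (commutator H).map σ := h1 ▸ Subgroup.mem_top _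
  have hz : π (g * c⁻¹ : H) = 1 := (hσ.ker _).1 (by rw [map_mul, map_inv, hcg, mul_inv_cancel])
  have h2 := mem_commutator_of_coprime_index (h.central hz) (g * c⁻¹).2 (Q := H)
    (Nat.Coprime.coprime_dvd_left (orderOf_dvd_of_pow_eq_one (pow_card_ker hz)) hco)
  have := (commutator H).mul_mem h2 hc
  rwa [Subtype.coe_eta, inv_mul_cancel_right] at this

/-- Pair χ with the constant function 1 in `rip_five`; the values at order five are real, so nothing
is lost by taking real parts. -/
theorem CentralExt.osum_five {A : Type v} [Group A] [Fintype A] {π : G →* A} (h : CentralExt π)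
    (hco : Nat.Coprime 5 (Nat.card π.ker)) (h5 : FiveClasses A) (hχ : IsIrr χ) {a : A}
    (ha : orderOf a = 5) {u D : ℤ} (hv : h.FiveVal a χ u D) :
    osum 5 (fun b => χ (h.s b)) = (((ofOrder A 5).card * u / 2 : ℝ) : ℂ) := by
  have hone : h.FiveVal a (fun _ => 1) 2 0 := ⟨by simp, by simp⟩
  have h1 := h.rip_five hco h5 hχ.conj (fun _ _ => rfl) ha hv hone
  obtain ⟨d, -, hd⟩ := hχ.exists_degree
  have hreal : ∀ b, orderOf b = 5 → χ (h.s b) = ((χ (h.s b)).re : ℂ) := fun b hb => by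
    obtain ⟨t, E, -, hE, -⟩ := h.exists_fiveVal hco h5 hχ hd hb
    refine (Complex.conj_eq_iff_re.1 ?_).symm
    rw [hE, ← Complex.star_def, star_div₀, star_add, star_mul', star_sqrtFive]
    simp
  rw [osum, sum_congr rfl fun b hb => hreal b (mem_ofOrder.1 hb), ← Complex.ofReal_sum]
  congr 1
  have h2 : h.rip 5 χ (fun _ => 1) = ∑ b ∈ ofOrder A 5, (χ (h.s b)).re :=
    sum_congr rfl fun b _ => by simp
  rw [← h2]
  push_cast at h1
  linarith

/-- The two characters of degree three over one central character differ only in the sign of √5,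
which disappears in the sum over elements of order five. -/
theorem sevenData_of_alt_six [Group.IsPerfect G] (h : CentralExt π)
    (hK : Nat.card π.ker = 3) (hi : H.index = 7) {σ : H →* Alt 6} (hσ : Compat π H σ)
    {φ : H → ℂ} (hφ : IsIrr φ) (hf : FaithfulOn σ.ker φ) (h3 : φ 1 = 3) :
    h.SevenData (ind H φ) 21 (-3) 1 1 := by
  have : Fintype H := Fintype.ofFinite H
  have := isPerfect_alt (n := 6) (by norm_num)
  have := Compat.isPerfect h hσ (by rw [hK, hi]; norm_num)
  have hK' := (Compat.card_ker hσ).trans hK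
  obtain ⟨a, ha⟩ := exists_five_alt_six
  obtain ⟨D, hD⟩ : ∃ D, (hσ.ext h).SixData a φ 3 (-1) 1 1 D :=
    (sixData_of_degree_three (hσ.ext h) hK' ha hφ hf h3).elim (fun h => ⟨_, h⟩) fun h => ⟨_, h⟩
  have c6 : (ofOrder (Alt 6) 6).card = 0 := by
    rw [card_eq_zero, eq_empty_iff_forall_notMem]
    intro a ha
    have h1 := orderOf_alt_six a
    rw [mem_ofOrder.1 ha] at h1
    revert h1; decide
  have h6 := h.rip_ind_le hσ hφ (ratConj_of_isConj isConj_six_alt_seven) card_six_alt_seven c6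
  have h7 := h.rip_ind_le hσ hφ ratConj_seven_alt_seven card_seven_alt_seven
    (ofOrder_eq_zero (B := Alt 6) (r := 7) (by rw [natCard_alt_six]; norm_num))
  refine sevenData_ind h hK hσ hφ hf (by rw [ind_one, hi, h3]; norm_num)
    (h.val_ind hσ (by rw [hK]; norm_num) (fun _ _ => isConj_two_alt_seven) card_two_alt_seven
      (by norm_num) (S := -45) ?_ (by rw [hi]; norm_num))
    (h.val_ind hσ (by rw [hK]; norm_num) (fun _ _ => isConj_four_alt_seven) card_four_alt_seven
      (by norm_num) (S := 90) ?_ (by rw [hi]; norm_num))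
    (h.val_ind hσ (by rw [hK]; norm_num) (fun _ _ => isConj_five_alt_seven) card_five_alt_seven
      (by norm_num) (S := 72) ?_ (by rw [hi]; norm_num)) ?_
  · rw [osum_const (fun b hb => hD.two b hb), card_two_alt_six]
    norm_num
  · rw [osum_const (fun b hb => hD.four b hb), card_four_alt_six]
    norm_num
  · rw [(hσ.ext h).osum_five (by rw [hK']; norm_num) fiveClasses_alt_six hφ ha hD.five,
      card_five_alt_six]
    norm_num
  · norm_num at h6 h7 ⊢
    linarith

theorem exists_linOver_psl [Group.IsPerfect G] (h : CentralExt π) (hK : Nat.card π.ker = 3) :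
    ∃ (H : Subgroup G) (φ : H → ℂ) (σ : H →* PSL(2, ZMod 7)), H.index = 15 ∧ Compat π H σ ∧
      LinOver σ φ 1 := by
  have := L27.isPerfect_psl
  obtain ⟨H, hH, hi⟩ := exists_ker_le_index_seven h L27.exists_index_fifteen
  obtain ⟨σ, hσ⟩ := exists_compat_psl h hH hi
  have : Fintype H := Fintype.ofFinite H
  obtain ⟨φ, hφ⟩ := exists_linOver (hσ.ext h) (j := 56) (by rw [L27.natCard_psl]) (by norm_num)
    ((Compat.card_ker hσ).trans hK) hom_zmod_three_eq_one 1
  exact ⟨H, φ, σ, hi, hσ, hφ⟩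

theorem exists_linOver_perm_five [Group.IsPerfect G] (h : CentralExt π)
    (hK : Nat.card π.ker = 3) :
    ∃ (H : Subgroup G) (φ : H → ℂ) (σ : H →* Perm (Fin 5)), H.index = 21 ∧ Compat π H σ ∧
      LinOver σ φ Perm.sign := by
  obtain ⟨H, hH, hi⟩ := exists_ker_le_index_seven h exists_index_twentyone_alt_seven
  obtain ⟨σ, hσ⟩ := exists_compat_perm_five h hH hi
  have : Fintype H := Fintype.ofFinite H
  obtain ⟨φ, hφ⟩ := exists_linOver (hσ.ext h) (j := 40) (by rw [natCard_perm_five]) (by norm_num)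
    ((Compat.card_ker hσ).trans hK) hom_perm_zmod_three_eq_one Perm.sign
  exact ⟨H, φ, σ, hi, hσ, hφ⟩

theorem exists_degree_three_alt_six [Group.IsPerfect G] (h : CentralExt π)
    (hK : Nat.card π.ker = 3) :
    ∃ (H : Subgroup G) (φ : H → ℂ) (σ : H →* Alt 6), H.index = 7 ∧ Compat π H σ ∧
      IsFaithfulIrr φ ∧ φ 1 = 3 := by
  have := isPerfect_alt (n := 6) (by norm_num)
  obtain ⟨H, hH, hi⟩ := exists_ker_le_index_seven h (exists_index_alt (n := 7) (by norm_num))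
  obtain ⟨σ, hσ⟩ := exists_compat_alt_six h hH hi
  have : Fintype H := Fintype.ofFinite H
  have := Compat.isPerfect h hσ (by rw [hK, hi]; norm_num)
  obtain ⟨φ, _, hφ, -⟩ := exists_quadruple_three_alt_six (hσ.ext h)
    ((Compat.card_ker hσ).trans hK)
  have h1 : φ ∈ faithfulOfDegree H 3 := by rw [hφ.2.1]; simp
  exact ⟨H, φ, σ, hi, hσ, h1.1, by rw [h1.2]; norm_num⟩

/-- Conjugating where necessary puts one character of each of the three known kinds over the central
character of χ. They serve as reference points for degree bounds and uniqueness. -/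
theorem exists_frame [Group.IsPerfect G] (h : CentralExt π) (hK : Nat.card π.ker = 3)
    (hχ : IsIrr χ) (hf : FaithfulOn π.ker χ) : ∃ θ₁ θ₂ θ₃, h.SevenData θ₁ 15 3 1 0 ∧
      h.SevenData θ₂ 21 1 (-1) 1 ∧ h.SevenData θ₃ 21 (-3) 1 1 ∧ SameOn π.ker χ θ₁ ∧
      SameOn π.ker χ θ₂ ∧ SameOn π.ker χ θ₃ := by
  have key : ∀ {θ : G → ℂ} {d x y b}, h.SevenData θ d x y b → FaithfulOn π.ker θ →
      ∃ θ', h.SevenData θ' d x y b ∧ SameOn π.ker χ θ' := fun {θ d x y b} hd hf' =>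
    (FaithfulOn.sameOn_or h (Or.inl hK) hχ hd.irr hf hf').elim (fun hs => ⟨_, hd, hs⟩)
      fun hs => ⟨_, hd.star, hs⟩
  obtain ⟨H₁, φ₁, σ₁, i₁, c₁, l₁⟩ := exists_linOver_psl h hK
  obtain ⟨H₂, φ₂, σ₂, i₂, c₂, l₂⟩ := exists_linOver_perm_five h hK
  obtain ⟨H₃, φ₃, σ₃, i₃, c₃, f₃, d₃⟩ := exists_degree_three_alt_six h hK
  have : Fintype H₃ := Fintype.ofFinite H₃
  obtain ⟨θ₁, a₁, b₁⟩ := key (l₁.sevenData_psl h hK i₁ c₁) (faithfulOn_ind h c₁ l₁.faithful)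
  obtain ⟨θ₂, a₂, b₂⟩ := key (l₂.sevenData_perm_five h hK i₂ c₂) (faithfulOn_ind h c₂ l₂.faithful)
  obtain ⟨θ₃, a₃, b₃⟩ := key (sevenData_of_alt_six h hK i₃ c₃ f₃.1 (f₃.faithfulOn _) d₃)
    (faithfulOn_ind h c₃ (f₃.faithfulOn _))
  exact ⟨θ₁, θ₂, θ₃, a₁, a₂, a₃, b₁, b₂, b₃⟩

/-- Besides the degrees 15, 21 and 21 only 2520 − 225 − 441 − 441 = 1413 < 38² remains for the
square of another degree. -/
theorem degree_three_alt_seven [Group.IsPerfect G] (h : CentralExt π)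
    (hK : Nat.card π.ker = 3) (hχ : IsIrr χ) (hf : FaithfulOn π.ker χ) {d : ℕ} (hd : χ 1 = d) :
    3 ∣ d ∧ d ≤ 37 ∧ d ≠ 30 := by
  classical
  refine ⟨hf.dvd_degree h hχ hd (dvd_of_eq hK.symm), ?_, ?_⟩
  · obtain ⟨θ₁, θ₂, θ₃, h₁, h₂, h₃, s₁, s₂, s₃⟩ := exists_frame h hK hχ hf
    by_contra hlt
    have hne : ∀ {θ e x y b}, h.SevenData θ e x y b → e ≤ 37 → χ ≠ θ := fun {θ e x y b} hθ he he' => by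
      rw [he', hθ.one] at hd
      have : e = d := by exact_mod_cast hd
      omega
    have n1 : θ₁ ≠ θ₂ := fun he => by
      have := h₂.one.symm.trans (he ▸ h₁.one)
      norm_num at this
    have n2 : θ₁ ≠ θ₃ := fun he => by
      have := h₃.one.symm.trans (he ▸ h₁.one)
      norm_num at this
    have n3 : θ₂ ≠ θ₃ := fun he => by
      have := h₃.unique_two (he ▸ h₂.two)
      norm_num at this
    have hs := h.sum_norm_sq_le hχ {χ, θ₁, θ₂, θ₃} (by
      intro θ hθ
      simp only [mem_insert, mem_singleton] at hθ
      rcases hθ with rfl | rfl | rfl | rfl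
      · exact ⟨hχ, fun _ _ => rfl⟩
      · exact ⟨h₁.irr, s₁⟩
      · exact ⟨h₂.irr, s₂⟩
      · exact ⟨h₃.irr, s₃⟩)
    rw [sum_insert (by simp [hne h₁ (by norm_num), hne h₂ (by norm_num), hne h₃ (by norm_num)]),
      sum_insert (by simp [n1, n2]), sum_pair n3, hd, h₁.one, h₂.one, h₃.one, natCard_alt_seven] at hs
    simp only [Complex.norm_natCast] at hs
    have h1 : d ^ 2 + (15 ^ 2 + (21 ^ 2 + 21 ^ 2)) ≤ 2520 := by exact_mod_cast hs
    have := Nat.pow_le_pow_left (show 38 ≤ d by omega) 2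
    omega
  · rintro rfl
    exact h.degree_ne_thirty (by rw [hK]; norm_num) hχ hd

/-- The index divides 2520, is at least 7 and avoids the excluded values; the degree is a multiple
of three, at most 37 and not 30. -/
theorem index_three_alt_seven [Group.IsPerfect G] (h : CentralExt π) (hK : Nat.card π.ker = 3)
    (hH : H ≠ ⊤) {φ : H → ℂ} (hφ : IsIrr φ) (hχ : IsFaithfulIrr (ind H φ)) :
    (H.index = 15 ∧ φ 1 = 1) ∨ (H.index = 21 ∧ φ 1 = 1) ∨ (H.index = 7 ∧ φ 1 = 3) := by
  have : Fintype H := Fintype.ofFinite H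
  have hle : π.ker ≤ H := h.central.trans (center_le_of_isIrr_ind hχ.1)
  obtain ⟨e, he0, he⟩ := hφ.exists_degree
  have hd : ind H φ 1 = (H.index * e : ℕ) := by rw [ind_one, he]; simp
  obtain ⟨h3, h37, h30⟩ := degree_three_alt_seven h hK hχ.1 (hχ.faithfulOn _) hd
  have hne : H.map π ≠ ⊤ := fun ht => hH (by
    rw [← Subgroup.index_eq_one, ← index_map h hle, ht, Subgroup.index_top])
  have h2 := le_index_alt (n := 7) (by norm_num) hne
  have h4 := index_ne_alt_seven (H.map π)
  have h5 := (H.map π).index_dvd_card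
  rw [index_map h hle] at h2 h4 h5
  rw [natCard_alt_seven] at h5
  have key : (H.index = 15 ∧ e = 1) ∨ (H.index = 21 ∧ e = 1) ∨ (H.index = 7 ∧ e = 3) := by
    generalize H.index = k at h2 h3 h37 h30 h4 h5
    have hk : k ≤ 37 := le_trans (Nat.le_mul_of_pos_right _ he0) h37
    have he5 : e ≤ 5 := by
      by_contra hc
      have : 7 * 6 ≤ k * e := Nat.mul_le_mul h2 (by omega)
      omega
    clear hd he hne
    interval_cases e <;> interval_cases k <;> omega
  rcases key with ⟨h1, rfl⟩ | ⟨h1, rfl⟩ | ⟨h1, rfl⟩ <;> simp [h1, he]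

end ThreeAltSeven

end ImprimitiveCovers

namespace ImprimitiveCovers

open Finset CentralExt Equiv

open scoped MatrixGroups

/-! ### Conjugation, induction and values on involutions -/

section Triples

variable {G : Type u} {A : Type v} {B : Type w} [Group G] [Fintype G] [Group A] [Fintype A] [Group B]
  [Fintype B] {π : G →* A} {χ ψ : G → ℂ} {H : Subgroup G} {σ : H →* B}

theorem SameOn.ind (h : CentralExt π) (hσ : Compat π H σ) {φ₁ φ₂ : H → ℂ}
    (hs : SameOn σ.ker φ₁ φ₂) : SameOn π.ker (ind H φ₁) (ind H φ₂) := fun z hz => by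
  rw [cc_ind (h.central hz) (hσ.le hz), cc_ind (h.central hz) (hσ.le hz)]
  exact hs _ ((hσ.ker _).2 hz)

theorem IsConjQuadruple.star {S : Set (G → ℂ)} (hS : IsConjQuadruple S χ ψ) :
    IsConjQuadruple S (star χ) (star ψ) := by
  obtain ⟨h1, h2, h3⟩ := hS
  refine ⟨?_, ?_, fun z hz => by rw [Pi.star_apply, Pi.star_apply, h3 z hz]⟩
  · rw [star_star, star_star]
    exact (List.perm_append_comm (l₁ := [χ, ψ])).nodup_iff.1 h1
  · rw [h2]
    ext θ
    simp only [Set.mem_insert_iff, Set.mem_singleton_iff, star_star]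
    tauto

theorem val_two_iff (h : CentralExt π) (hK : Nat.card π.ker = 3) {a : ℤ} :
    h.Val 2 χ a ↔ ∀ t, orderOf t = 2 → χ t = a := by
  constructor
  · intro hv t ht
    have h2 : t ^ 2 = 1 := by rw [← ht, pow_orderOf_eq_one]
    rw [h.eq_on_of_pow_order (g := t) (n := 2) (by rw [hK]; norm_num) h2, hv]
    · simp
    · refine orderOf_eq_prime (by rw [← map_pow, h2, map_one]) fun h1 => ?_
      have h3 := pow_card_ker h1
      rw [hK, pow_succ, h2, one_mul] at h3
      rw [h3, orderOf_one] at ht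
      omega
  · intro hv b hb
    rw [hv _ (by rw [h.orderOf_s (by rw [hb, hK]; norm_num), hb])]
    simp

end Triples

/-! ### The classification for 3·A₇ -/

section ThreeAltSeven

variable {G : Type u} [Group G] [Fintype G] {π : G →* Alt 7} {χ ψ : G → ℂ} {H : Subgroup G}

theorem index_mul_of_isThreeTimes (h : CentralExt π) (hK : Nat.card π.ker = 3) {B : Type} [Group B]
    {b : ℕ} (hB : Nat.card B = b) (hH : IsThreeTimes H B) :
    H.index * (3 * b) = 7560 ∧
      (π.ker ≤ H ∨ Function.Injective (π.subgroupMap H) ∧ (H.map π).index * (3 * b) = 2520) := by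
  have hc : Nat.card H = 3 * b := by rw [natCard_of_isThreeTimes hH, hB]
  have hi := H.card_mul_index
  rw [hc, h.natCard_three_alt_seven hK, mul_comm] at hi
  refine ⟨hi, (ker_le_or_injective hK H).imp_right fun hinj => ⟨hinj, ?_⟩⟩
  have h2 := (H.map π).card_mul_index
  rwa [natCard_map_of_injective hinj, hc, natCard_alt_seven, mul_comm] at h2

theorem not_isThreeTimes_alt_six {K : Type} [Group K] (h : IsThreeTimes (Alt 6) K) : False := by
  obtain ⟨e⟩ := h
  let z : Multiplicative (ZMod 3) × K := (Multiplicative.ofAdd 1, 1)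
  have hz : e.symm z ∈ Subgroup.center (Alt 6) := Subgroup.mem_center_iff.2 fun a => by
    apply e.injective
    rw [map_mul, map_mul, e.apply_symm_apply]
    exact Prod.ext (mul_comm _ _) ((mul_one _).trans (one_mul _).symm)
  rw [center_alt (by norm_num), Subgroup.mem_bot] at hz
  have h1 : z = 1 := by simpa using hz
  have h2 : (Multiplicative.ofAdd 1 : Multiplicative (ZMod 3)) = 1 := congrArg Prod.fst h1
  revert h2
  decide

theorem pairL27_iff (h : CentralExt π) (hK : Nat.card π.ker = 3) (φ : H → ℂ) :
    PairL27 H φ ↔ H.index = 15 ∧ ∃ σ : H →* PSL(2, ZMod 7), Compat π H σ ∧ LinOver σ φ 1 := by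
  have := L27.isPerfect_psl
  constructor
  · rintro ⟨h1, h2, h3⟩
    obtain ⟨hi, hle⟩ := index_mul_of_isThreeTimes h hK L27.natCard_psl h1
    have hi' : H.index = 15 := by omega
    have hle : π.ker ≤ H := hle.resolve_right fun ⟨_, hm⟩ => by
      have := le_index_alt (n := 7) (by norm_num) (H := H.map π) (fun ht => by
        rw [ht, Subgroup.index_top] at hm; omega)
      omega
    obtain ⟨σ, hσ⟩ := exists_compat_psl h hle hi'
    exact ⟨hi', σ, hσ, linOver_of_ne_one h hσ hK h2 h3⟩
  · rintro ⟨-, σ, hσ, hφ⟩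
    have : Fintype H := Fintype.ofFinite H
    exact ⟨isThreeTimes_of_compat h hσ hK (j := 56) (by rw [L27.natCard_psl]) (by norm_num)
      hom_zmod_three_eq_one, hφ.isLinearChar, hφ.ne_one hσ hK⟩

theorem pairS5_iff (h : CentralExt π) (hK : Nat.card π.ker = 3) (φ : H → ℂ) :
    PairS5 H φ ↔ H.index = 21 ∧
      ∃ σ : H →* Perm (Fin 5), Compat π H σ ∧ LinOver σ φ Perm.sign := by
  constructor
  · rintro ⟨h1, h2, h3⟩
    obtain ⟨hi, hle⟩ := index_mul_of_isThreeTimes h hK natCard_perm_five h1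
    have hi' : H.index = 21 := by omega
    -- Otherwise `H` embeds in A₇ with index 7, so it is isomorphic to A₆, which has trivial centre.
    have hle : π.ker ≤ H := hle.resolve_right fun ⟨hinj, hm⟩ => by
      obtain ⟨e⟩ := equiv_alt_of_index (n := 7) (by norm_num) (H := H.map π) (by omega)
      obtain ⟨f⟩ := h1
      let g : H ≃* H.map π := MulEquiv.ofBijective (π.subgroupMap H)
        ⟨hinj, π.subgroupMap_surjective H⟩
      exact not_isThreeTimes_alt_six ⟨(g.trans e).symm.trans f⟩
    obtain ⟨σ, hσ⟩ := exists_compat_perm_five h hle hi'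
    exact ⟨hi', σ, hσ, linOver_of_orderOf h hσ homSign_perm hK h2 h3⟩
  · rintro ⟨-, σ, hσ, hφ⟩
    have : Fintype H := Fintype.ofFinite H
    exact ⟨isThreeTimes_of_compat h hσ hK (j := 40) (by rw [natCard_perm_five]) (by norm_num)
      hom_perm_zmod_three_eq_one, hφ.isLinearChar,
      hφ.orderOf_eq hσ (exists_sign_ne_one (by norm_num)) hK⟩

theorem index_of_isCover (h : CentralExt π) (hK : Nat.card π.ker = 3) (hH : IsCover 3 6 H) :
    H.index = 7 ∧ ∃ σ : H →* Alt 6, Compat π H σ := by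
  have : Fintype H := Fintype.ofFinite H
  obtain ⟨τ, hτ, hτK⟩ := hH.exists_centralExt (by norm_num)
  have hc : Nat.card H = 1080 := hτ.natCard_three_alt_six hτK
  have hi := H.card_mul_index
  rw [hc, h.natCard_three_alt_seven hK] at hi
  have hi' : H.index = 7 := by omega
  have hle : π.ker ≤ H := (ker_le_or_injective hK H).resolve_right fun hinj => by
    have h2 := (H.map π).card_mul_index
    rw [natCard_map_of_injective hinj, hc, natCard_alt_seven] at h2
    omega
  exact ⟨hi', exists_compat_alt_six h hle hi'⟩

theorem pairA6_iff [Group.IsPerfect G] (h : CentralExt π) (hK : Nat.card π.ker = 3) (φ : H → ℂ) :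
    PairA6 H φ ↔ H.index = 7 ∧
      ∃ σ : H →* Alt 6, Compat π H σ ∧ IsFaithfulIrr φ ∧ φ 1 = 3 := by
  constructor
  · rintro ⟨h1, h2, h3⟩
    obtain ⟨hi, σ, hσ⟩ := index_of_isCover h hK h1
    exact ⟨hi, σ, hσ, h2, h3⟩
  · rintro ⟨hi, σ, hσ, hφ, h3⟩
    have := isPerfect_alt (n := 6) (by norm_num)
    have := (hσ.ext h).isCover (by norm_num) (Compat.isPerfect h hσ (by rw [hK, hi]; norm_num))
    rw [Compat.card_ker hσ, hK] at this
    exact ⟨this, hφ, h3⟩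

/-- A smaller block stabilizer has index 15 or 21 in `G`. The index is a multiple of 7, so it is 21,
and A₆ would have a subgroup of index 3. -/
theorem not_isIrr_below_alt_six [Group.IsPerfect G] (h : CentralExt π) (hK : Nat.card π.ker = 3)
    (hi : H.index = 7) {σ : H →* Alt 6} (hσ : Compat π H σ) {φ : H → ℂ}
    (hχ : IsFaithfulIrr (ind H φ)) {K : Subgroup G} {ψ : K → ℂ} (hK' : K < H) (hψ : IsIrr ψ) :
    ind H φ ≠ ind K ψ := by
  intro he
  rw [he] at hχ
  have hle : π.ker ≤ K := h.central.trans (center_le_of_isIrr_ind hχ.1)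
  have h1 := index_three_alt_seven h hK hK'.ne_top hψ hχ
  have h2 := Subgroup.index_strictAnti hK'
  have h3 := Subgroup.relIndex_mul_index hK'.le
  have h4 : ((K.subgroupOf H).map σ).index = K.relIndex H :=
    (K.subgroupOf H).index_map_eq hσ.surj fun x hx =>
      Subgroup.mem_subgroupOf.2 (hle ((hσ.ker x).1 hx))
  have h5 : K.relIndex H = 3 := by
    rw [hi] at h2 h3
    omega
  have h6 := le_index_alt (n := 6) (by norm_num) (H := (K.subgroupOf H).map σ) fun ht => by
    rw [ht, Subgroup.index_top] at h4
    omega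
  omega

theorem CentralExt.SevenData.mem {h : CentralExt π} (hK : Nat.card π.ker = 3) {d : ℕ} {x y b : ℤ}
    (hχ : h.SevenData χ d x y b) (hf : FaithfulOn π.ker χ) (hd : d ≠ 1) :
    χ ∈ faithfulOfDegreeAndValue G d x := by
  have := isSimpleGroup_alt (n := 7) (by norm_num)
  exact ⟨h.isFaithfulIrr hχ.irr hf (by rw [hχ.one]; exact_mod_cast hd), hχ.one,
    (val_two_iff h hK).1 hχ.two⟩

theorem three_alt_seven (hG : IsCover 3 7 G) : ∃ χ₁₉ χ₂₀ χ₂₁ : G → ℂ,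
    IsConjPair (faithfulOfDegreeAndValue G 15 3) χ₁₉ ∧
    IsConjPair (faithfulOfDegreeAndValue G 21 1) χ₂₀ ∧
    IsConjPair (faithfulOfDegreeAndValue G 21 (-3)) χ₂₁ ∧
    (∀ (H : Subgroup G) (φ : H → ℂ) (χ : G → ℂ),
      IsMinimalTriple H φ χ ↔ (PairA6 H φ ∨ PairS5 H φ ∨ PairL27 H φ) ∧ χ = ind H φ) ∧
    inducedFrom (G := G) PairA6 = {χ₂₁, star χ₂₁} ∧
    (∀ H : Subgroup G, IsCover 3 6 H →
      ∃ χ₁₄ χ₁₅ : H → ℂ,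
        IsConjQuadruple (faithfulOfDegree H 3) χ₁₄ χ₁₅ ∧
        ind H χ₁₄ = χ₂₁ ∧ ind H χ₁₅ = χ₂₁ ∧
        ind H (star χ₁₄) = star χ₂₁ ∧ ind H (star χ₁₅) = star χ₂₁) ∧
    inducedFrom (G := G) PairS5 = {χ₂₀, star χ₂₀} ∧
    inducedFrom (G := G) PairL27 = {χ₁₉, star χ₁₉} := by
  have := hG.1
  have := isPerfect_alt (n := 6) (by norm_num)
  have := isSimpleGroup_alt (n := 6) (by norm_num)
  have := L27.isPerfect_psl
  obtain ⟨π, h, hK⟩ := hG.exists_centralExt (by norm_num)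
  have memL : ∀ (H : Subgroup G) φ, PairL27 H φ → ind H φ ∈ faithfulOfDegreeAndValue G 15 3 := by
    intro H φ hp
    obtain ⟨hi, σ, hσ, hφ⟩ := (pairL27_iff h hK φ).1 hp
    exact (hφ.sevenData_psl h hK hi hσ).mem hK (faithfulOn_ind h hσ hφ.faithful) (by norm_num)
  have memS : ∀ (H : Subgroup G) φ, PairS5 H φ → ind H φ ∈ faithfulOfDegreeAndValue G 21 1 := by
    intro H φ hp
    obtain ⟨hi, σ, hσ, hφ⟩ := (pairS5_iff h hK φ).1 hp
    exact (hφ.sevenData_perm_five h hK hi hσ).mem hK (faithfulOn_ind h hσ hφ.faithful)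
      (by norm_num)
  have memA : ∀ (H : Subgroup G) φ, PairA6 H φ →
      ind H φ ∈ faithfulOfDegreeAndValue G 21 (-3) := by
    intro H φ hp
    obtain ⟨hi, σ, hσ, hφ, h3⟩ := (pairA6_iff h hK φ).1 hp
    have : Fintype H := Fintype.ofFinite H
    exact (sevenData_of_alt_six h hK hi hσ hφ.1 (hφ.faithfulOn _) h3).mem hK
      (faithfulOn_ind h hσ (hφ.faithfulOn _)) (by norm_num)
  obtain ⟨H₁, φ₁, σ₁, i₁, c₁, l₁⟩ := exists_linOver_psl h hK
  obtain ⟨H₂, φ₂, σ₂, i₂, c₂, l₂⟩ := exists_linOver_perm_five h hK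
  obtain ⟨H₃, φ₃, σ₃, i₃, c₃, f₃, d₃⟩ := exists_degree_three_alt_six h hK
  have p₁ : PairL27 H₁ φ₁ := (pairL27_iff h hK φ₁).2 ⟨i₁, σ₁, c₁, l₁⟩
  have p₂ : PairS5 H₂ φ₂ := (pairS5_iff h hK φ₂).2 ⟨i₂, σ₂, c₂, l₂⟩
  have p₃ : PairA6 H₃ φ₃ := (pairA6_iff h hK φ₃).2 ⟨i₃, σ₃, c₃, f₃, d₃⟩
  have uA : ∀ χ ∈ faithfulOfDegreeAndValue G 21 (-3), ∀ ψ ∈ faithfulOfDegreeAndValue G 21 (-3),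
      SameOn π.ker χ ψ → χ = ψ := fun χ hχ ψ hψ hs => by
    obtain ⟨-, -, θ, -, -, hθ, -, -, s⟩ := exists_frame h hK hχ.1.1 (hχ.1.faithfulOn _)
    have key : ∀ ξ ∈ faithfulOfDegreeAndValue G 21 (-3), SameOn π.ker ξ θ → ξ = θ :=
      fun ξ hξ hs => eq_of_degree_twentyone h hK hξ.1.1 (hξ.1.faithfulOn _)
        (by simpa using hξ.2.1) (by simpa using (val_two_iff h hK).2 hξ.2.2) hθ hs
    rw [key χ hχ s, key ψ hψ (hs.symm.trans s)]
  have k₁ : IsConjPair (faithfulOfDegreeAndValue G 15 3) (ind H₁ φ₁) :=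
    isConjPair_of_unique h hK (fun χ hχ => hχ.1) faithfulOfDegreeAndValue_star
      (fun χ hχ ψ hψ hs => by
        obtain ⟨θ, -, -, hθ, -, -, s, -, -⟩ := exists_frame h hK hχ.1.1 (hχ.1.faithfulOn _)
        have key : ∀ ξ ∈ faithfulOfDegreeAndValue G 15 3, SameOn π.ker ξ θ → ξ = θ :=
          fun ξ hξ hs => eq_of_degree_fifteen_seven h hK hξ.1.1 (hξ.1.faithfulOn _)
            (by simpa using hξ.2.1) (by simpa using (val_two_iff h hK).2 hξ.2.2) hθ hs
        rw [key χ hχ s, key ψ hψ (hs.symm.trans s)]) (memL _ _ p₁)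
  have k₂ : IsConjPair (faithfulOfDegreeAndValue G 21 1) (ind H₂ φ₂) :=
    isConjPair_of_unique h hK (fun χ hχ => hχ.1) faithfulOfDegreeAndValue_star
      (fun χ hχ ψ hψ hs => by
        obtain ⟨-, θ, η, -, hθ, hη, -, s, s'⟩ := exists_frame h hK hχ.1.1 (hχ.1.faithfulOn _)
        have key : ∀ ξ ∈ faithfulOfDegreeAndValue G 21 1, SameOn π.ker ξ θ → SameOn π.ker ξ η →
            ξ = θ := fun ξ hξ hs hs' => eq_of_degree_twentyone' h hK hξ.1.1 (hξ.1.faithfulOn _)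
            (by simpa using hξ.2.1) (by simpa using (val_two_iff h hK).2 hξ.2.2) hθ hη hs hs'
        rw [key χ hχ s s', key ψ hψ (hs.symm.trans s) (hs.symm.trans s')]) (memS _ _ p₂)
  have k₃ : IsConjPair (faithfulOfDegreeAndValue G 21 (-3)) (ind H₃ φ₃) :=
    isConjPair_of_unique h hK (fun χ hχ => hχ.1) faithfulOfDegreeAndValue_star uA (memA _ _ p₃)
  refine ⟨_, _, _, k₁, k₂, k₃, fun H φ χ => ⟨fun ht => ?_, ?_⟩,
    inducedFrom_eq_pair k₃ memA ?_ p₃ rfl, fun H hH => ?_,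
    inducedFrom_eq_pair k₂ memS ?_ p₂ rfl, inducedFrom_eq_pair k₁ memL ?_ p₁ rfl⟩
  · have hH := isMinimalTriple_ne_top ht
    obtain ⟨h1, -, h3, rfl, -⟩ := ht
    have : Fintype H := Fintype.ofFinite H
    refine ⟨?_, rfl⟩
    have hle : π.ker ≤ H := h.central.trans h3.1
    rcases index_three_alt_seven h hK hH h3.2.1 h1 with ⟨hi, h1'⟩ | ⟨hi, h1'⟩ | ⟨hi, h1'⟩
    · obtain ⟨σ, hσ⟩ := exists_compat_psl h hle hi
      refine Or.inr (Or.inr ((pairL27_iff h hK φ).2 ⟨hi, σ, hσ, ?_⟩))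
      exact (IsLinearChar.linOver ⟨h3.2.1, h1'⟩ (hσ.ext h) ((Compat.card_ker hσ).trans hK)
        (faithfulOn_of_ind h hσ (h1.faithfulOn _)) homSign_of_isPerfect).elim id id
    · obtain ⟨σ, hσ⟩ := exists_compat_perm_five h hle hi
      refine Or.inr (Or.inl ((pairS5_iff h hK φ).2 ⟨hi, σ, hσ, ?_⟩))
      exact (IsLinearChar.linOver ⟨h3.2.1, h1'⟩ (hσ.ext h) ((Compat.card_ker hσ).trans hK)
        (faithfulOn_of_ind h hσ (h1.faithfulOn _)) homSign_perm).resolve_left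
        fun hl => hl.not_isIrr_ind_perm_five h hK hi hσ h1.1
    · obtain ⟨σ, hσ⟩ := exists_compat_alt_six h hle hi
      exact Or.inl ((pairA6_iff h hK φ).2 ⟨hi, σ, hσ, (hσ.ext h).isFaithfulIrr h3.2.1
        (faithfulOn_of_ind h hσ (h1.faithfulOn _)) (by rw [h1']; norm_num), h1'⟩)
  · rintro ⟨hp | hp | hp, rfl⟩
    · obtain ⟨hi, σ, hσ, hφ, h3⟩ := (pairA6_iff h hK φ).1 hp
      have : Fintype H := Fintype.ofFinite H
      exact isMinimalTriple_intro (by norm_num) h hσ (hφ.faithfulOn _) hφ.1 (memA _ _ hp).1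
        (fun ht => by rw [ht, Subgroup.index_top] at hi; omega)
        fun K ψ hlt hψ => not_isIrr_below_alt_six h hK hi hσ (memA _ _ hp).1 hlt hψ
    · obtain ⟨hi, σ, hσ, hφ⟩ := (pairS5_iff h hK φ).1 hp
      exact isMinimalTriple_intro (by norm_num) h hσ hφ.faithful hφ.irr (memS _ _ hp).1
        (fun ht => by rw [ht, Subgroup.index_top] at hi; omega)
        fun K ψ hlt hψ => ind_ne_ind_of_lt hφ.one hlt hψ
    · obtain ⟨hi, σ, hσ, hφ⟩ := (pairL27_iff h hK φ).1 hp
      exact isMinimalTriple_intro (by norm_num) h hσ hφ.faithful hφ.irr (memL _ _ hp).1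
        (fun ht => by rw [ht, Subgroup.index_top] at hi; omega)
        fun K ψ hlt hψ => ind_ne_ind_of_lt hφ.one hlt hψ
  · rintro H φ ⟨hp1, hp2, hp3⟩
    have : Fintype H := Fintype.ofFinite H
    exact ⟨hp1, hp2.star, by rw [Pi.star_apply, hp3]; simp⟩
  · have : Fintype H := Fintype.ofFinite H
    have := hH.1
    obtain ⟨hi, σ, hσ⟩ := index_of_isCover h hK hH
    obtain ⟨φ, ψ, hq, hs⟩ := exists_quadruple_three_alt_six (hσ.ext h)
      ((Compat.card_ker hσ).trans hK)
    have hφ : φ ∈ faithfulOfDegree H 3 := by rw [hq.2.1]; simp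
    have hψ : ψ ∈ faithfulOfDegree H 3 := by rw [hq.2.1]; simp
    have mφ := memA H φ ⟨hH, hφ.1, by simpa using hφ.2⟩
    have mψ := memA H ψ ⟨hH, hψ.1, by simpa using hψ.2⟩
    -- Both induced characters lie over the same central character and have the same degree and
    -- value on involutions, so uniqueness identifies them.
    have he : ind H ψ = ind H φ := (uA _ mφ _ mψ (hs.ind h hσ)).symm
    have hor := mφ
    rw [k₃.2] at hor
    rcases hor with h1 | h1
    · exact ⟨φ, ψ, hq, h1, he.trans h1, by rw [ind_star, h1], by rw [ind_star, he, h1]⟩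
    · rw [Set.mem_singleton_iff] at h1
      -- If `φ` induces to the conjugate of the chosen character, the names are exchanged by
      -- conjugation.
      exact ⟨star φ, star ψ, hq.star, by rw [ind_star, h1, star_star],
        by rw [ind_star, he, h1, star_star], by rw [star_star, h1], by rw [star_star, he, h1]⟩
  · intro H φ hp
    obtain ⟨hi, σ, hσ, hφ⟩ := (pairS5_iff h hK φ).1 hp
    have : Fintype H := Fintype.ofFinite H
    exact (pairS5_iff h hK _).2 ⟨hi, σ, hσ, hφ.star⟩
  · intro H φ hp
    obtain ⟨hi, σ, hσ, hφ⟩ := (pairL27_iff h hK φ).1 hp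
    have : Fintype H := Fintype.ofFinite H
    exact (pairL27_iff h hK _).2 ⟨hi, σ, hσ, hφ.star⟩

end ThreeAltSeven

end ImprimitiveCovers

namespace ImprimitiveCovers

open Finset CentralExt Equiv

/-! ### The group 6·A₇ -/

section SixAltSeven

variable {G : Type u} [Group G] [Fintype G] {χ : G → ℂ}

/-- An induced degree is a multiple of 6, at most 50, and neither 30 nor 42. Every factorization by
an index of at least 7 dividing 2520 then uses one of the excluded indices. -/
theorem six_alt_seven (hG : IsCover 6 7 G) (hχ : IsFaithfulIrr χ) : ¬ IsImprimitive χ := by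
  rintro ⟨-, H, hH, φ, hφ, rfl⟩
  have := hG.1
  obtain ⟨π, h, hK⟩ := hG.exists_centralExt (by norm_num)
  have : Fintype H := Fintype.ofFinite H
  have hle : π.ker ≤ H := h.central.trans (center_le_of_isIrr_ind hχ.1)
  obtain ⟨e, he0, he⟩ := hφ.exists_degree
  have hd : ind H φ 1 = (H.index * e : ℕ) := by rw [ind_one, he]; simp
  have h2 := (hχ.faithfulOn _).dvd_degree h hχ.1 hd (p := 2) (by rw [hK]; norm_num)
  have h3 := (hχ.faithfulOn _).dvd_degree h hχ.1 hd (p := 3) (by rw [hK]; norm_num)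
  have h30 : H.index * e ≠ 30 := fun h30 =>
    h.degree_ne_thirty (by rw [hK]; norm_num) hχ.1 (hd.trans (by rw [h30]))
  have hn := h.rip_le hχ.1 hd
  have n5 := h.rip_self_nonneg 5 (ind H φ)
  have n7 := h.rip_self_nonneg 7 (ind H φ)
  have h50 : H.index * e ≤ 50 := by
    have : ((H.index * e : ℕ) : ℝ) ^ 2 ≤ 2520 := by linarith
    have : (H.index * e) ^ 2 ≤ 2520 := by exact_mod_cast this
    by_contra hc
    have := Nat.pow_le_pow_left (show 51 ≤ H.index * e by omega) 2
    omega
  -- For degree 42 the value at order five is an integer congruent to 2 modulo 5, so its square is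
  -- at least 4, but the norm leaves less than 2.
  have h42 : H.index * e ≠ 42 := fun h42 => by
    obtain ⟨t, ht⟩ := h.exists_val_five (by rw [hK]; norm_num) hχ.1 hd
    rw [h.rip_of_val ht card_five_alt_seven, h42] at hn
    have h1 : (42 - 5 * (t : ℤ)) ^ 2 < 2 ^ 2 := by
      have : (42 - 5 * (t : ℝ)) ^ 2 < 2 ^ 2 := by push_cast at hn; linarith
      exact_mod_cast this
    obtain ⟨h1, h2⟩ := abs_lt.1 (abs_lt_of_sq_lt_sq h1 (by norm_num))
    omega
  have hne : H.map π ≠ ⊤ := fun ht => hH (by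
    rw [← Subgroup.index_eq_one, ← index_map h hle, ht, Subgroup.index_top])
  have h7 := le_index_alt (n := 7) (by norm_num) hne
  have h4 := index_ne_alt_seven (H.map π)
  have h5 := (H.map π).index_dvd_card
  rw [index_map h hle] at h7 h4 h5
  rw [natCard_alt_seven] at h5
  clear n5 n7 hn
  generalize H.index = k at h2 h3 h7 h30 h42 h50 h4 h5
  have hk : k ≤ 50 := le_trans (Nat.le_mul_of_pos_right _ he0) h50
  have he7 : e ≤ 7 := by
    by_contra hc
    have : 7 * 8 ≤ k * e := Nat.mul_le_mul h7 (by omega)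
    omega
  clear hd he hne
  interval_cases e <;> interval_cases k <;> omega

end SixAltSeven

end ImprimitiveCovers

namespace ImprimitiveCovers

open Finset CentralExt Equiv

/-! ### Faithful characters of a kernel of order six and positivity tests -/

section General

variable {G : Type u} {A : Type v} [Group G] [Fintype G] [Group A] [Fintype A] {π : G →* A}
variable {χ ψ : G → ℂ}

/-- The test function is the expansion of (1 − t)(1 − y) in the group algebra. It is not zero, and
its product with ψ is the conjugate of (1 − cc ψ t)(1 − cc ψ y)ψ(1). -/
theorem exists_irr_cc_ne_one {t y : G} (ht : t ∈ Subgroup.center G) (hy : y ∈ Subgroup.center G)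
    (ht1 : t ≠ 1) (hy1 : y ≠ 1) : ∃ ψ, IsIrr ψ ∧ cc ψ t ≠ 1 ∧ cc ψ y ≠ 1 := by
  classical
  let δ : G → G → ℂ := fun a => Pi.single a 1
  have hδ : ∀ a ∈ Subgroup.center G, ∀ x g, δ a (x * g * x⁻¹) = δ a g := fun a ha x g => by
    have : x * g * x⁻¹ = a ↔ g = a := by
      rw [mul_inv_eq_iff_eq_mul, ← Subgroup.mem_center_iff.1 ha x, mul_right_inj]
    simp only [δ, Pi.single_apply, this]
  have hip : ∀ a ψ, ip (δ a) ψ = star (ψ a) := fun a ψ => by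
    rw [ip, sum_eq_single a]
    · simp [δ]
    · intro b _ hb
      simp [δ, hb]
    · simp
  obtain ⟨ψ, hψ, hne⟩ := exists_irr_ip_ne_zero (f := (δ 1 - δ t) - (δ y - δ (t * y)))
    (fun x g => by
      simp only [Pi.sub_apply, hδ 1 (Subgroup.one_mem _), hδ t ht, hδ y hy,
        hδ _ ((Subgroup.center G).mul_mem ht hy)]) (fun h0 => by
      have h1 := congrFun h0 1
      simp only [δ, Pi.sub_apply, Pi.single_apply, Pi.zero_apply, if_neg ht1.symm,
        if_neg hy1.symm, if_true] at h1
      split_ifs at h1 <;> norm_num at h1)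
  refine ⟨ψ, hψ, ?_⟩
  rw [ip_sub_left, ip_sub_left, ip_sub_left, hip, hip, hip, hip] at hne
  have e : ∀ z ∈ Subgroup.center G, ψ z = cc ψ z * ψ 1 := fun z hz => by
    simpa using hψ.cc_mul hz 1
  have h2 : star (ψ 1) - star (ψ t) - (star (ψ y) - star (ψ (t * y))) =
      star ((1 - cc ψ t) * (1 - cc ψ y) * ψ 1) := by
    rw [hψ.cc_mul ht, e t ht, e y hy, ← star_sub, ← star_sub, ← star_sub]
    congr 1
    ring
  rw [h2, star_ne_zero, mul_ne_zero_iff, mul_ne_zero_iff, sub_ne_zero, sub_ne_zero] at hne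
  exact ⟨hne.1.1.symm, hne.1.2.symm⟩

/-- The kernel is cyclic, generated by an involution times an element of order three; a character
nontrivial on both is faithful on it. -/
theorem CentralExt.exists_faithfulOn (h : CentralExt π) (hK : Nat.card π.ker = 6) :
    ∃ ψ, IsIrr ψ ∧ FaithfulOn π.ker ψ := by
  obtain ⟨t, ht⟩ := exists_prime_orderOf_dvd_card' (G := π.ker) 2 (by rw [hK]; norm_num)
  obtain ⟨y, hy⟩ := exists_prime_orderOf_dvd_card' (G := π.ker) 3 (by rw [hK]; norm_num)
  have htc := h.central t.2
  have hyc := h.central y.2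
  have hne : ∀ {z : π.ker} {p : ℕ}, orderOf z = p → p ≠ 1 → (z : G) ≠ 1 := fun {z p} hz hp h0 => by
    rw [show z = 1 from Subtype.ext h0, orderOf_one] at hz
    exact hp hz.symm
  obtain ⟨ψ, hψ, h1, h2⟩ := exists_irr_cc_ne_one htc hyc (hne ht (by norm_num))
    (hne hy (by norm_num))
  have hpow : ∀ {z : π.ker} {p : ℕ}, orderOf z = p → cc ψ z ^ p = 1 := fun {z p} hz => by
    have hzp : (z : G) ^ p = 1 := by
      rw [← hz, ← Subgroup.coe_pow, pow_orderOf_eq_one, Subgroup.coe_one]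
    rw [← hψ.cc_pow (h.central z.2), hzp, hψ.cc_one]
  have hty : Commute t y := Subtype.ext (Subgroup.mem_center_iff.1 hyc t)
  have ho : orderOf (t * y) = 6 := by
    rw [hty.orderOf_mul_eq_mul_orderOf_of_coprime (by rw [ht, hy]; norm_num), ht, hy]
  have hoc : orderOf (cc ψ t * cc ψ y) = 6 := by
    have e2 : orderOf (cc ψ t) = 2 := orderOf_eq_prime (hpow ht) h1
    have e3 : orderOf (cc ψ y) = 3 := orderOf_eq_prime (hpow hy) h2
    rw [(Commute.all _ _).orderOf_mul_eq_mul_orderOf_of_coprime (by rw [e2, e3]; norm_num), e2, e3]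
  have htop : Subgroup.zpowers (t * y) = ⊤ :=
    Subgroup.eq_top_of_card_eq _ (by rw [Nat.card_zpowers, ho, hK])
  refine ⟨ψ, hψ, fun z hz hz1 => ?_⟩
  obtain ⟨n, hn⟩ := (isOfFinOrder_of_finite (t * y)).mem_powers_iff_mem_zpowers.2
    (htop ▸ Subgroup.mem_top (⟨z, hz⟩ : π.ker))
  have hn' : ((t : G) * y) ^ n = z := congrArg Subtype.val hn
  have hcz : cc ψ z = 1 := by rw [cc, hz1, div_self hψ.one_ne_zero]
  rw [← hn', hψ.cc_pow ((Subgroup.center G).mul_mem htc hyc), hψ.cc_map_mul htc,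
    ← orderOf_dvd_iff_pow_eq_one, hoc, ← ho, orderOf_dvd_iff_pow_eq_one] at hcz
  have : (⟨z, hz⟩ : π.ker) = 1 := hn ▸ hcz
  exact congrArg Subtype.val this

theorem CentralExt.sum_rip_le (h : CentralExt π) (hχ : IsIrr χ) (R : Finset ℕ) :
    ∑ r ∈ R, h.rip r χ χ ≤ Nat.card A := by
  classical
  have h1 := h.sum_rip hχ hχ (fun _ _ => rfl) (R := R ∪ univ.image fun a : A => orderOf a)
    fun a => mem_union_right _ (mem_image_of_mem _ (mem_univ a))
  rw [if_pos rfl] at h1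
  rw [← h1]
  exact sum_le_sum_of_subset_of_nonneg subset_union_left fun r _ _ => h.rip_self_nonneg r χ

/-- Each summand is a contribution to the norm of χ + ψ, hence nonnegative, and that norm is 2|A| if
the characters differ. -/
theorem CentralExt.eq_of_rip_pos (h : CentralExt π) (hχ : IsIrr χ) (hψ : IsIrr ψ)
    (hs : SameOn π.ker χ ψ) (R : Finset ℕ)
    (hpos : 2 * (Nat.card A : ℝ) <
      ∑ r ∈ R, (2 * h.rip r χ ψ + h.rip r χ χ + h.rip r ψ ψ)) : χ = ψ := by
  classical
  by_contra hne
  have hR : ∀ a : A, orderOf a ∈ R ∪ univ.image fun a : A => orderOf a :=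
    fun a => mem_union_right _ (mem_image_of_mem _ (mem_univ a))
  have h1 := h.sum_rip hχ hχ (fun _ _ => rfl) hR
  have h2 := h.sum_rip hψ hψ (fun _ _ => rfl) hR
  have h3 := h.sum_rip hχ hψ hs hR
  rw [if_pos rfl] at h1 h2
  rw [if_neg hne] at h3
  have h4 : ∑ r ∈ R, (2 * h.rip r χ ψ + h.rip r χ χ + h.rip r ψ ψ) ≤
      ∑ r ∈ R ∪ univ.image fun a : A => orderOf a,
        (2 * h.rip r χ ψ + h.rip r χ χ + h.rip r ψ ψ) :=
    sum_le_sum_of_subset_of_nonneg subset_union_left fun r _ _ => by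
      have := h.neg_le_rip r χ ψ
      linarith
  have h6 : ∑ r ∈ R ∪ univ.image fun a : A => orderOf a,
      (2 * h.rip r χ ψ + h.rip r χ χ + h.rip r ψ ψ) = 2 * 0 + Nat.card A + Nat.card A := by
    rw [sum_add_distrib, sum_add_distrib, ← mul_sum, h1, h2, h3]
  linarith

theorem sum_orders_one_five (f : ℕ → ℝ) : ∑ r ∈ ({1, 5} : Finset ℕ), f r = f 1 + f 5 :=
  sum_pair (by norm_num)

variable {d : ℕ} {a : A}

theorem CentralExt.eq_of_fiveVal (h : CentralExt π) (hco : Nat.Coprime 5 (Nat.card π.ker))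
    (h5 : FiveClasses A) (hχ : IsIrr χ) (hψ : IsIrr ψ) (hs : SameOn π.ker χ ψ)
    (ha : orderOf a = 5) (hd : χ 1 = d) (hd' : ψ 1 = d) {u D : ℤ} (h1 : h.FiveVal a χ u D)
    (h2 : h.FiveVal a ψ u D)
    (hlt : (2 * Nat.card A : ℤ) < 4 * d ^ 2 + (ofOrder A 5).card * (u ^ 2 + 5 * D ^ 2)) :
    χ = ψ := by
  refine h.eq_of_rip_pos hχ hψ hs {1, 5} ?_
  have e1 := h.rip_five hco h5 hχ.conj hχ.conj ha h1 h1
  have e2 := h.rip_five hco h5 hψ.conj hψ.conj ha h2 h2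
  have e3 := h.rip_five hco h5 hχ.conj hψ.conj ha h1 h2
  have f1 : χ 1 = ((d : ℝ) : ℂ) := by rw [hd]; simp
  have f2 : ψ 1 = ((d : ℝ) : ℂ) := by rw [hd']; simp
  rw [sum_orders_one_five, h.rip_one f1 f2, h.rip_one f1 f1, h.rip_one f2 f2]
  have hlt' : (2 * Nat.card A : ℝ) <
      4 * d ^ 2 + (ofOrder A 5).card * ((u : ℝ) ^ 2 + 5 * D ^ 2) := by exact_mod_cast hlt
  nlinarith

/-- The norm leaves u² + 5D² < 10. Since u = 2d − 5t is congruent to −1 modulo 5, this means u = −1;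
then t is odd, and so is D. -/
theorem CentralExt.fiveVal_of_lt (h : CentralExt π) (hco : Nat.Coprime 5 (Nat.card π.ker))
    (h5 : FiveClasses A) (hχ : IsIrr χ) (ha : orderOf a = 5) (hd : χ 1 = d) (hd5 : d % 5 = 2)
    (hlt : 4 * Nat.card A < 4 * d ^ 2 + (ofOrder A 5).card * 10) :
    h.FiveVal a χ (-1) 1 ∨ h.FiveVal a χ (-1) (-1) := by
  obtain ⟨t, D, hD, hv⟩ := h.exists_fiveVal hco h5 hχ hd ha
  have h1 := h.sum_rip_le hχ {1, 5}
  have f1 : χ 1 = ((d : ℝ) : ℂ) := by rw [hd]; simp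
  rw [sum_orders_one_five, h.rip_one f1 f1] at h1
  have h2 := h.rip_five hco h5 hχ.conj hχ.conj ha hv hv
  generalize hu : 2 * (d : ℤ) - 5 * t = u at hv h2
  have h3 : u ^ 2 + 5 * D ^ 2 < 10 := by
    have hlt' : (4 * Nat.card A : ℝ) < 4 * d ^ 2 + (ofOrder A 5).card * 10 := by
      exact_mod_cast hlt
    have h4 : ((ofOrder A 5).card : ℝ) * ((u : ℝ) ^ 2 + 5 * D ^ 2) < (ofOrder A 5).card * 10 := by
      nlinarith
    have := lt_of_mul_lt_mul_left h4 (Nat.cast_nonneg _)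
    exact_mod_cast this
  obtain ⟨u1, u2⟩ := abs_lt.1 (abs_lt_of_sq_lt_sq (a := u) (b := 4)
    (by nlinarith [sq_nonneg D]) (by norm_num))
  obtain ⟨D1, D2⟩ := abs_lt.1 (abs_lt_of_sq_lt_sq (a := D) (b := 2)
    (by nlinarith [sq_nonneg u]) (by norm_num))
  obtain rfl : u = -1 := by omega
  have : D = 1 ∨ D = -1 := by omega
  rcases this with rfl | rfl
  · exact Or.inl hv
  · exact Or.inr hv

end General

/-! ### Recovering φ from the induced character at elements with one fixed coset -/

section FixedCoset

variable {G : Type u} {A : Type v} {B : Type w} [Group G] [Fintype G] [Group A] [Fintype A]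
  [Group B] [Fintype B] {π : G →* A} {H : Subgroup G} {σ : H →* B} {φ : H → ℂ}

/-- The only coset fixed by `a` is `C` itself, so only elements of `C` conjugate `a` into `C`. -/
theorem mem_of_fixc_eq_one {C : Subgroup A} {a x : A} (ha : a ∈ C) (hf : fixc C a = 1)
    (hx : x⁻¹ * a * x ∈ C) : x ∈ C := by
  classical
  have h1 := card_conj_mem C a
  rw [hf, mul_one] at h1
  have h2 : (univ.filter fun x : A => x ∈ C) = univ.filter fun x : A => x⁻¹ * a * x ∈ C := by
    refine eq_of_subset_of_card_le (fun y hy => ?_) ?_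
    · rw [mem_filter] at hy ⊢
      exact ⟨hy.1, C.mul_mem (C.mul_mem (C.inv_mem hy.2) ha) hy.2⟩
    · have h3 : (univ.filter fun x : A => x ∈ C).card = Nat.card C := by
        rw [← Fintype.card_subtype, ← Nat.card_eq_fintype_card]
      rw [h3, ← h1]
  have : x ∈ univ.filter fun x : A => x ∈ C := by
    rw [h2, mem_filter]
    exact ⟨mem_univ _, hx⟩
  exact (mem_filter.1 this).2

theorem ind_apply_of_fixc_eq_one (hle : π.ker ≤ H) (hφ : ∀ x g, φ (x * g * x⁻¹) = φ g) {g : G}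
    (hg : g ∈ H) (hf : fixc (H.map π) (π g) = 1) : ind H φ g = φ ⟨g, hg⟩ := by
  classical
  have hmem : ∀ x : G, x⁻¹ * g * x ∈ H ↔ x ∈ H := fun x => by
    refine ⟨fun hx => mem_of_map_mem hle (mem_of_fixc_eq_one (Subgroup.mem_map_of_mem π hg) hf ?_),
      fun hx => H.mul_mem (H.mul_mem (H.inv_mem hx) hg) hx⟩
    have := Subgroup.mem_map_of_mem π hx
    rwa [map_mul, map_mul, map_inv] at this
  have h1 : ∀ x, extz H φ (x⁻¹ * g * x) = if x ∈ H then φ ⟨g, hg⟩ else 0 := fun x => by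
    split_ifs with hx
    · rw [extz_mem ((hmem x).2 hx)]
      have := hφ (⟨x, hx⟩ : H)⁻¹ ⟨g, hg⟩
      rwa [inv_inv] at this
    · exact extz_not_mem fun hc => hx ((hmem x).1 hc)
  rw [ind_eq, sum_congr rfl fun x _ => h1 x, ← sum_filter, sum_const, nsmul_eq_mul,
    ← Fintype.card_subtype, ← Nat.card_eq_fintype_card, ← mul_assoc]
  rw [inv_mul_cancel₀ (natCard_ne_zero H), one_mul]

theorem coe_s (h : CentralExt π) (hσ : Compat π H σ) (x : H)
    (hco : (orderOf (π x)).Coprime (Nat.card π.ker)) :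
    (((hσ.ext h).s (σ x) : H) : G) = h.s (π x) := by
  have hco' : (orderOf (σ x)).Coprime (Nat.card σ.ker) := by
    rwa [Compat.orderOf_eq hσ, Compat.card_ker hσ]
  refine h.eq_of_pow_eq_one (n := orderOf (π x)) ?_ hco ?_ ?_
  · rw [π_s, ← Compat.map_eq_iff hσ, π_s]
  · rw [← Subgroup.coe_pow, ← Compat.orderOf_eq hσ, ← (hσ.ext h).orderOf_s hco',
      pow_orderOf_eq_one, Subgroup.coe_one]
  · rw [← h.orderOf_s hco, pow_orderOf_eq_one]

theorem ind_s_of_fixc_eq_one (h : CentralExt π) (hσ : Compat π H σ)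
    (hφ : ∀ x g, φ (x * g * x⁻¹) = φ g) (x : H) (hco : (orderOf (π x)).Coprime (Nat.card π.ker))
    (hf : fixc (H.map π) (π x) = 1) : ind H φ (h.s (π x)) = φ ((hσ.ext h).s (σ x)) := by
  have h1 := coe_s h hσ x hco
  have hg : h.s (π x) ∈ H := h1 ▸ ((hσ.ext h).s (σ x)).2
  rw [ind_apply_of_fixc_eq_one hσ.le hφ hg (by rwa [π_s])]
  exact congrArg φ (Subtype.ext h1.symm)

theorem fiveVal_ind_iff [Fintype H] (h : CentralExt π) (hσ : Compat π H σ)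
    (hφ : ∀ x g, φ (x * g * x⁻¹) = φ g) {x : H} (hx : orderOf (π x) = 5)
    (hco : Nat.Coprime 5 (Nat.card π.ker)) (hf : fixc (H.map π) (π x) = 1) {u D : ℤ} :
    h.FiveVal (π x) (ind H φ) u D ↔ (hσ.ext h).FiveVal (σ x) φ u D := by
  have h2 : orderOf (π (x ^ 2 : H)) = 5 := by
    rw [Subgroup.coe_pow, map_pow, orderOf_pow, hx]; norm_num
  have hf2 : fixc (H.map π) (π (x ^ 2 : H)) = 1 := by
    rw [Subgroup.coe_pow, map_pow, fixc_pow _ (by rw [hx]; norm_num), hf]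
  have e1 := ind_s_of_fixc_eq_one h hσ hφ x (by rwa [hx]) hf
  have e2 := ind_s_of_fixc_eq_one h hσ hφ (x ^ 2) (by rwa [h2]) hf2
  rw [Subgroup.coe_pow, map_pow, map_pow] at e2
  simp only [CentralExt.FiveVal]
  rw [e1, e2]

end FixedCoset

end ImprimitiveCovers

namespace ImprimitiveCovers

open Finset CentralExt Equiv

/-! ### Characters of 3 × 2·A₅ -/

section DoubleCover

variable {H : Type u} [Group H] {σ : H →* Alt 5} {φ ψ : H → ℂ}

/-- An involution has trivial component in the factor of order three, and the other factor is
perfect. -/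
theorem IsThreeTimesDoubleA5.mem_commutator (hH : IsThreeTimesDoubleA5 H) {z : H}
    (hz : orderOf z = 2) : z ∈ commutator H := by
  obtain ⟨K, _, hK, ⟨e⟩⟩ := hH
  have hK1 := hK.1
  have h2 : e z ^ 2 = 1 := by rw [← map_pow, ← hz, pow_orderOf_eq_one, map_one]
  have h3 : (e z).1 = 1 := by
    have : ∀ c : Multiplicative (ZMod 3), c ^ 2 = 1 → c = 1 := by decide
    exact this _ (congrArg Prod.fst h2)
  let f : K →* H := e.symm.toMonoidHom.comp (MonoidHom.inr _ _)
  have hf : f (e z).2 = z := by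
    refine e.injective ?_
    change e (e.symm (1, (e z).2)) = e z
    rw [e.apply_symm_apply, ← h3]
  have hle : (commutator K).map f ≤ commutator H := by
    rw [commutator_def, Subgroup.map_commutator]
    exact Subgroup.commutator_mono le_top le_top
  refine hf ▸ hle (Subgroup.mem_map_of_mem f ?_)
  rw [Group.IsPerfect.commutator_eq_top]
  trivial

variable [Fintype H]

theorem two_dvd_degree (h : CentralExt σ) (hK : Nat.card σ.ker = 6) (hH : IsThreeTimesDoubleA5 H)
    (hφ : IsIrr φ) (hf : FaithfulOn σ.ker φ) {d : ℕ} (hd : φ 1 = d) : 2 ∣ d := by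
  obtain ⟨⟨z, hz⟩, ho⟩ := exists_prime_orderOf_dvd_card' (G := σ.ker) 2 (by rw [hK]; norm_num)
  rw [← Subgroup.orderOf_coe] at ho
  exact hf.dvd_degree_of_mem_commutator hφ hd hz (h.central hz) (hH.mem_commutator ho) ho

theorem fiveVal_of_degree_two (h : CentralExt σ) (hK : Nat.card σ.ker = 6) {a : Alt 5}
    (ha : orderOf a = 5) (hφ : IsIrr φ) (h2 : φ 1 = (2 : ℕ)) :
    h.FiveVal a φ (-1) 1 ∨ h.FiveVal a φ (-1) (-1) :=
  h.fiveVal_of_lt (by rw [hK]; norm_num) fiveClasses_alt_five hφ ha h2 (by norm_num)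
    (by rw [natCard_alt_five, card_five_alt_five]; norm_num)

theorem eq_of_degree_two (h : CentralExt σ) (hK : Nat.card σ.ker = 6) {a : Alt 5}
    (ha : orderOf a = 5) (hφ : IsIrr φ) (hψ : IsIrr ψ) (hs : SameOn σ.ker φ ψ)
    (h1 : φ 1 = (2 : ℕ)) (h2 : ψ 1 = (2 : ℕ)) {D : ℤ} (hD : D ^ 2 = 1)
    (hv : h.FiveVal a φ (-1) D) (hv' : h.FiveVal a ψ (-1) D) : φ = ψ :=
  h.eq_of_fiveVal (by rw [hK]; norm_num) fiveClasses_alt_five hφ hψ hs ha h1 h2 hv hv'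
    (by rw [natCard_alt_five, card_five_alt_five, hD]; norm_num)

theorem exists_five_alt_five : ∃ a : Alt 5, orderOf a = 5 :=
  exists_prime_orderOf_dvd_card' 5 (by rw [natCard_alt_five]; norm_num)

theorem exists_pair_degree_two (h : CentralExt σ) (hK : Nat.card σ.ker = 6)
    (hH : IsThreeTimesDoubleA5 H) : ∃ φ ψ, IsIrr φ ∧ IsIrr ψ ∧ FaithfulOn σ.ker φ ∧
      FaithfulOn σ.ker ψ ∧ SameOn σ.ker φ ψ ∧ φ 1 = 2 ∧ ψ 1 = 2 ∧ φ ≠ ψ := by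
  obtain ⟨θ, hθ, hf⟩ := h.exists_faithfulOn hK
  obtain ⟨a, ha⟩ := exists_five_alt_five
  obtain ⟨F, hF, hsum⟩ := h.exists_degree_counts hθ {2, 4, 6} fun ψ hψ hs => by
    obtain ⟨d, hd0, hd⟩ := hψ.exists_degree
    refine ⟨d, ?_, hd⟩
    have h2 := two_dvd_degree h hK hH hψ (hf.of_sameOn hθ hψ hs) hd
    have h1 := h.sum_rip_le hψ {1}
    rw [sum_singleton, h.rip_one (d := d) (e := d) (by rw [hd]; simp) (by rw [hd]; simp),
      natCard_alt_five] at h1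
    have h3 : d * d ≤ 60 := by exact_mod_cast h1
    have h4 : d < 8 := by nlinarith
    have : d = 2 ∨ d = 4 ∨ d = 6 := by omega
    simpa using this
  rw [sum_insert (by decide), sum_pair (by decide), natCard_alt_five] at hsum
  have hle : (F 2).card ≤ 2 := by
    refine card_le_two_of_dichotomy (fun χ => h.FiveVal a χ (-1) 1)
      (fun χ => h.FiveVal a χ (-1) (-1)) (fun χ hχ => ?_) (fun χ hχ ψ hψ h1 h2 => ?_)
      (fun χ hχ ψ hψ h1 h2 => ?_)
    · rw [hF] at hχ
      exact fiveVal_of_degree_two h hK ha hχ.1 hχ.2.2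
    all_goals
      rw [hF] at hχ hψ
      exact eq_of_degree_two h hK ha hχ.1 hψ.1 (hχ.2.1.symm.trans hψ.2.1) hχ.2.2 hψ.2.2
        (by norm_num) h1 h2
  -- In 4a + 16b + 36c = 60 with a ≤ 2 the only solution is a = 2, b = c = 1.
  have hcard : (F 2).card = 2 := by
    have h4 : (F 4).card ≤ 3 := by omega
    have h6 : (F 6).card ≤ 1 := by omega
    interval_cases (F 4).card <;> interval_cases (F 6).card <;> omega
  obtain ⟨φ, ψ, hne, hF2⟩ := card_eq_two.1 hcard
  have hφ := (hF 2 φ).1 (by rw [hF2]; simp)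
  have hψ := (hF 2 ψ).1 (by rw [hF2]; simp)
  exact ⟨φ, ψ, hφ.1, hψ.1, hf.of_sameOn hθ hφ.1 hφ.2.1, hf.of_sameOn hθ hψ.1 hψ.2.1,
    hφ.2.1.symm.trans hψ.2.1, by simpa using hφ.2.2, by simpa using hψ.2.2, hne⟩

end DoubleCover

/-! ### The classification for 6·A₆ -/

section SixAltSix

variable {G : Type u} [Group G] [Fintype G] {π : G →* Alt 6} {χ ψ : G → ℂ} {H : Subgroup G}

theorem isThreeTimesDoubleA5_of_compat [Group.IsPerfect G] (h : CentralExt π)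
    (hK : Nat.card π.ker = 6) {σ : H →* Alt 5} (hσ : Compat π H σ) : IsThreeTimesDoubleA5 H := by
  refine IsThreeTimesDoubleA5.intro (hσ.ext h) ((Compat.card_ker hσ).trans hK) fun g hg h2 => ?_
  rw [Compat.orderOf_eq hσ] at hg
  exact sq_ne_one_of_orderOf_two h hK hg (by rw [← Subgroup.coe_pow, h2, Subgroup.coe_one])

/-- On `H` order five contributes 36, which leaves at most 20 for order two. The induced norm is
then at most 144 + 240 + 216 = 600 < 720. -/
theorem isIrr_ind_of_degree_two [Group.IsPerfect G] (h : CentralExt π) (hK : Nat.card π.ker = 6)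
    (hi : H.index = 6) {σ : H →* Alt 5} (hσ : Compat π H σ) {φ : H → ℂ} (hφ : IsIrr φ)
    (hf : FaithfulOn σ.ker φ) (h2 : φ 1 = (2 : ℕ)) : IsIrr (ind H φ) := by
  have : Fintype H := Fintype.ofFinite H
  have hK' := (Compat.card_ker hσ).trans hK
  have hd : ind H φ 1 = ((12 : ℝ) : ℂ) := by rw [ind_one, hi, h2]; norm_num
  have f2 : φ 1 = ((2 : ℝ) : ℂ) := by rw [h2]; simp
  obtain ⟨a, ha⟩ := exists_five_alt_five
  obtain ⟨D, hD, hv⟩ : ∃ D : ℤ, D ^ 2 = 1 ∧ (hσ.ext h).FiveVal a φ (-1) D :=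
    (fiveVal_of_degree_two (hσ.ext h) hK' ha hφ h2).elim (fun h => ⟨1, by norm_num, h⟩)
      fun h => ⟨-1, by norm_num, h⟩
  have e5 : (hσ.ext h).rip 5 φ φ = 36 := by
    have e := (hσ.ext h).rip_five (by rw [hK']; norm_num) fiveClasses_alt_five hφ.conj hφ.conj ha
      hv hv
    have hD' : (D : ℝ) ^ 2 = 1 := by exact_mod_cast hD
    rw [card_five_alt_five] at e
    push_cast at e
    nlinarith
  have e2 : (hσ.ext h).rip 2 φ φ ≤ 20 := by
    have e := (hσ.ext h).sum_rip_le hφ {1, 2, 5}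
    rw [sum_insert (by decide), sum_pair (by decide), e5, (hσ.ext h).rip_one f2 f2,
      natCard_alt_five] at e
    norm_num at e
    linarith
  have r2 := h.rip_ind_le hσ hφ (ratConj_of_isConj isConj_two_alt_six) card_two_alt_six
    card_two_alt_five
  have r4 := h.rip_ind_le hσ hφ (ratConj_of_isConj isConj_four_alt_six) card_four_alt_six
    card_four_alt_five
  have r5 := h.rip_ind_le hσ hφ ratConj_five_alt_six card_five_alt_six card_five_alt_five
  rw [← rip_self, hi] at r2 r4 r5
  rw [e5] at r5
  refine h.isIrr_ind hσ.le hφ orderOf_alt_six ?_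
  rw [sum_orders_six, h.rip_one hd hd, natCard_alt_six,
    h.rip_three_ind (i := 2) natCard_alt_six' (by norm_num) hK (by norm_num) hσ hφ hf]
  norm_num at r2 r4 r5 ⊢
  linarith

theorem fixc_alt_six (h : CentralExt π) (hi : H.index = 6) {σ : H →* Alt 5} (hσ : Compat π H σ)
    {a : Alt 6} (ha : orderOf a = 5) : fixc (H.map π) a = 1 := by
  have h1 := card_mul_fixc (H.map π) ratConj_five_alt_six ha
  rw [card_five_alt_six, index_map h hσ.le, hi, Compat.card_ofOrder hσ, card_five_alt_five] at h1
  omega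

/-- Elements of order five fix exactly one coset, so the induced character has the same values there
as φ, and these values separate the characters of degree two over one central character. -/
theorem ind_injective_of_degree_two (h : CentralExt π) (hK : Nat.card π.ker = 6)
    (hi : H.index = 6) {σ : H →* Alt 5} (hσ : Compat π H σ) {φ ψ : H → ℂ} (hφ : IsIrr φ)
    (hψ : IsIrr ψ) (hs : SameOn σ.ker φ ψ) (h1 : φ 1 = (2 : ℕ)) (h2 : ψ 1 = (2 : ℕ))
    (he : ind H φ = ind H ψ) : φ = ψ := by
  have : Fintype H := Fintype.ofFinite H
  have hK' := (Compat.card_ker hσ).trans hK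
  have hco : Nat.Coprime 5 (Nat.card π.ker) := by rw [hK]; norm_num
  obtain ⟨a, ha⟩ := exists_five_alt_five
  obtain ⟨x, rfl⟩ := hσ.surj a
  have hx : orderOf (π x) = 5 := by rw [← Compat.orderOf_eq hσ, ha]
  have hf := fixc_alt_six h hi hσ hx
  obtain ⟨D, hD, hv⟩ : ∃ D : ℤ, D ^ 2 = 1 ∧ (hσ.ext h).FiveVal (σ x) φ (-1) D :=
    (fiveVal_of_degree_two (hσ.ext h) hK' ha hφ h1).elim (fun h => ⟨1, by norm_num, h⟩)
      fun h => ⟨-1, by norm_num, h⟩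
  have hv' := (fiveVal_ind_iff h hσ hφ.conj hx hco hf).2 hv
  rw [he, fiveVal_ind_iff h hσ hψ.conj hx hco hf] at hv'
  exact eq_of_degree_two (hσ.ext h) hK' ha hφ hψ hs h1 h2 hD hv hv'

theorem exists_compat_six_alt_six (h : CentralExt π) :
    ∃ (H : Subgroup G) (σ : H →* Alt 5), H.index = 6 ∧ Compat π H σ := by
  obtain ⟨H, hH, hi⟩ := exists_ker_le_index h (exists_index_alt (n := 6) (by norm_num))
  obtain ⟨σ, hσ⟩ := exists_compat_alt_five h hH hi
  exact ⟨H, σ, hi, hσ⟩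

theorem exists_degree_twelve [Group.IsPerfect G] (h : CentralExt π) (hK : Nat.card π.ker = 6)
    (hχ : IsIrr χ) (hf : FaithfulOn π.ker χ) : ∃ θ, IsIrr θ ∧ θ 1 = (12 : ℕ) ∧ SameOn π.ker χ θ := by
  obtain ⟨H, σ, hi, hσ⟩ := exists_compat_six_alt_six h
  have : Fintype H := Fintype.ofFinite H
  obtain ⟨φ, -, hφ, -, hf', -, -, h2, -, -⟩ := exists_pair_degree_two (hσ.ext h)
    ((Compat.card_ker hσ).trans hK) (isThreeTimesDoubleA5_of_compat h hK hσ)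
  have hirr := isIrr_ind_of_degree_two h hK hi hσ hφ hf' (by rw [h2]; norm_num)
  have hd : ind H φ 1 = (12 : ℕ) := by rw [ind_one, hi, h2]; norm_num
  rcases FaithfulOn.sameOn_or h (Or.inr hK) hχ hirr hf (faithfulOn_ind h hσ hf') with hs | hs
  · exact ⟨_, hirr, hd, hs⟩
  · exact ⟨_, hirr.star, by rw [Pi.star_apply, hd]; simp, hs⟩

/-- Beside a character of degree 12 only 216 < 15² remains, so the degree is 6 or 12. Index 12 does
not occur, and φ(1) is even because the central involution lies in the commutator subgroup of 3 ×
2·A₅. -/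
theorem index_six_alt_six [Group.IsPerfect G] (h : CentralExt π) (hK : Nat.card π.ker = 6)
    (hH : H ≠ ⊤) {φ : H → ℂ} (hφ : IsIrr φ) (hχ : IsFaithfulIrr (ind H φ)) :
    H.index = 6 ∧ φ 1 = 2 := by
  have : Fintype H := Fintype.ofFinite H
  have hle : π.ker ≤ H := h.central.trans (center_le_of_isIrr_ind hχ.1)
  obtain ⟨e, he0, he⟩ := hφ.exists_degree
  have hd : ind H φ 1 = (H.index * e : ℕ) := by rw [ind_one, he]; simp
  have h2 := (hχ.faithfulOn _).dvd_degree h hχ.1 hd (p := 2) (by rw [hK]; norm_num)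
  have h3 := (hχ.faithfulOn _).dvd_degree h hχ.1 hd (p := 3) (by rw [hK]; norm_num)
  have h14 : H.index * e ≤ 14 := by
    obtain ⟨θ, hθ, hθ1, hs⟩ := exists_degree_twelve h hK hχ.1 (hχ.faithfulOn _)
    by_contra hc
    have hne : ind H φ ≠ θ := fun hc' => by
      rw [hc', hθ1] at hd
      have : 12 = H.index * e := by exact_mod_cast hd
      omega
    have h1 := h.sq_add_sq_le hχ.1 hθ hs hne hd hθ1
    have h5 := Nat.pow_le_pow_left (show 15 ≤ H.index * e by omega) 2
    rw [natCard_alt_six] at h1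
    omega
  have hne : H.map π ≠ ⊤ := fun ht => hH (by
    rw [← Subgroup.index_eq_one, ← index_map h hle, ht, Subgroup.index_top])
  have h6 := le_index_alt (n := 6) (by norm_num) hne
  have h4 := index_ne_alt_six (H.map π)
  rw [index_map h hle] at h6 h4
  have key : H.index = 6 ∧ (e = 1 ∨ e = 2) := by
    generalize H.index = k at h2 h3 h14 h4 h6
    have he2 : e ≤ 2 := by
      by_contra hc
      have : 6 * 3 ≤ k * e := Nat.mul_le_mul h6 (by omega)
      omega
    clear hd he
    interval_cases e <;> omega
  refine ⟨key.1, ?_⟩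
  obtain ⟨σ, hσ⟩ := exists_compat_alt_five h hle key.1
  have he2 := two_dvd_degree (hσ.ext h) ((Compat.card_ker hσ).trans hK)
    (isThreeTimesDoubleA5_of_compat h hK hσ) hφ (faithfulOn_of_ind h hσ (hχ.faithfulOn _)) he
  obtain rfl : e = 2 := by omega
  rw [he]
  norm_num

theorem card_map_mul_card_ker {A : Type v} [Group A] (π : G →* A) (H : Subgroup G) :
    Nat.card (π.comp H.subtype).ker * Nat.card (H.map π) = Nat.card H := by
  rw [← (π.comp H.subtype).ker.card_mul_index, Subgroup.index_ker, MonoidHom.range_comp,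
    Subgroup.range_subtype]

theorem ker_le_of_card_le {A : Type v} [Group A] (π : G →* A) (H : Subgroup G)
    (hle : Nat.card π.ker ≤ Nat.card (π.comp H.subtype).ker) : π.ker ≤ H := by
  let f : (π.comp H.subtype).ker → π.ker := fun x => ⟨x.1, x.2⟩
  have hf : Function.Injective f := fun x y hxy =>
    Subtype.ext (Subtype.ext (congrArg (fun z : π.ker => (z : G)) hxy))
  have hb := hf.bijective_of_nat_card_le hle
  intro z hz
  obtain ⟨x, hx⟩ := hb.2 ⟨z, hz⟩
  have : (x.1 : G) = z := congrArg Subtype.val hx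
  rw [← this]
  exact x.1.2

theorem pairDoubleA5_iff [Group.IsPerfect G] (h : CentralExt π) (hK : Nat.card π.ker = 6)
    (φ : H → ℂ) : PairDoubleA5 H φ ↔ H.index = 6 ∧
      ∃ σ : H →* Alt 5, Compat π H σ ∧ IsIrr φ ∧ FaithfulOn σ.ker φ ∧ φ 1 = 2 := by
  have : Fintype H := Fintype.ofFinite H
  constructor
  · rintro ⟨⟨K, _, hK2, h3⟩, hφ, h2⟩
    have hcK : Nat.card K = 120 := by
      obtain ⟨τ, hτ, hτ2⟩ := hK2.exists_centralExt le_rfl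
      have : Finite K := by
        obtain ⟨e⟩ := h3
        exact Finite.of_injective (fun k => e.symm (1, k)) fun x y hxy =>
          congrArg Prod.snd (e.symm.injective hxy)
      rw [hτ.natCard_eq, hτ2, natCard_alt_five]
    have hc : Nat.card H = 360 := by rw [natCard_of_isThreeTimes h3, hcK]
    have hi := H.card_mul_index
    rw [hc, h.natCard_eq, hK, natCard_alt_six] at hi
    have hi' : H.index = 6 := by omega
    have hmul := card_map_mul_card_ker π H
    rw [hc] at hmul
    -- If `H` mapped onto A₆ it would be isomorphic to A₆, whose centre is trivial.
    have hne : H.map π ≠ ⊤ := fun ht => by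
      rw [ht, Nat.card_congr Subgroup.topEquiv.toEquiv, natCard_alt_six] at hmul
      have h1 : Nat.card (π.comp H.subtype).ker = 1 := by omega
      have hinj : Function.Injective (π.comp H.subtype) :=
        (MonoidHom.ker_eq_bot_iff _).1 (Subgroup.card_eq_one.1 h1)
      have hsurj : Function.Surjective (π.comp H.subtype) := by
        rw [← MonoidHom.range_eq_top, MonoidHom.range_comp, Subgroup.range_subtype, ht]
      obtain ⟨e⟩ := h3
      exact not_isThreeTimes_alt_six ⟨(MulEquiv.ofBijective _ ⟨hinj, hsurj⟩).symm.trans e⟩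
    have h6 := le_index_alt (n := 6) (by norm_num) hne
    have hci := (H.map π).card_mul_index
    rw [natCard_alt_six] at hci
    -- The image has order at most 60, so `H`, of order 360, meets the kernel in at least six
    -- elements.
    have hle : π.ker ≤ H := ker_le_of_card_le π H (by
      rw [hK]
      have : Nat.card (H.map π) ≤ 60 := by nlinarith
      by_contra hc
      have := Nat.mul_le_mul (show Nat.card (π.comp H.subtype).ker ≤ 5 by omega) this
      omega)
    obtain ⟨σ, hσ⟩ := exists_compat_alt_five h hle hi'
    exact ⟨hi', σ, hσ, hφ.1, hφ.faithfulOn _, h2⟩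
  · rintro ⟨hi, σ, hσ, hφ, hf, h2⟩
    have := isSimpleGroup_alt (n := 5) le_rfl
    exact ⟨isThreeTimesDoubleA5_of_compat h hK hσ,
      (hσ.ext h).isFaithfulIrr hφ hf (by rw [h2]; norm_num), h2⟩

theorem six_alt_six (hG : IsCover 6 6 G) : ∃ χ₂₁ χ₂₂ : G → ℂ,
    IsConjQuadruple (faithfulOfDegree G 12) χ₂₁ χ₂₂ ∧
    (∀ (H : Subgroup G) (φ : H → ℂ) (χ : G → ℂ),
      IsMinimalTriple H φ χ ↔ PairDoubleA5 H φ ∧ χ = ind H φ) ∧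
    inducedFrom (G := G) PairDoubleA5 = {χ₂₁, χ₂₂, star χ₂₁, star χ₂₂} := by
  have := hG.1
  have := isSimpleGroup_alt (n := 6) (by norm_num)
  obtain ⟨π, h, hK⟩ := hG.exists_centralExt (by norm_num)
  have hco : Nat.Coprime 5 (Nat.card π.ker) := by rw [hK]; norm_num
  have mem : ∀ (H : Subgroup G) φ, PairDoubleA5 H φ → ind H φ ∈ faithfulOfDegree G 12 := by
    intro H φ hp
    obtain ⟨hi, σ, hσ, hφ, hf, h2⟩ := (pairDoubleA5_iff h hK φ).1 hp
    have h1 : ind H φ 1 = (12 : ℕ) := by rw [ind_one, hi, h2]; norm_num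
    exact ⟨h.isFaithfulIrr (isIrr_ind_of_degree_two h hK hi hσ hφ hf (by rw [h2]; norm_num))
      (faithfulOn_ind h hσ hf) (by rw [h1]; norm_num), h1⟩
  have hstar : ∀ (H : Subgroup G) φ, PairDoubleA5 H φ → PairDoubleA5 H (star φ) := by
    rintro H φ ⟨hp1, hp2, hp3⟩
    have : Fintype H := Fintype.ofFinite H
    exact ⟨hp1, hp2.star, by rw [Pi.star_apply, hp3]; simp⟩
  obtain ⟨H, σ, hi, hσ⟩ := exists_compat_six_alt_six h
  have : Fintype H := Fintype.ofFinite H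
  obtain ⟨φ, ψ, hφ, hψ, fφ, fψ, hs, d1, d2, hne⟩ := exists_pair_degree_two (hσ.ext h)
    ((Compat.card_ker hσ).trans hK) (isThreeTimesDoubleA5_of_compat h hK hσ)
  have pφ : PairDoubleA5 H φ := (pairDoubleA5_iff h hK φ).2 ⟨hi, σ, hσ, hφ, fφ, d1⟩
  have pψ : PairDoubleA5 H ψ := (pairDoubleA5_iff h hK ψ).2 ⟨hi, σ, hσ, hψ, fψ, d2⟩
  have mφ := mem H φ pφ
  have mψ := mem H ψ pψ
  have hne' : ind H φ ≠ ind H ψ := fun he => hne (ind_injective_of_degree_two h hK hi hσ hφ hψ hs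
    (by rw [d1]; norm_num) (by rw [d2]; norm_num) he)
  have hs' := hs.ind h hσ
  have hq : IsConjQuadruple (faithfulOfDegree G 12) (ind H φ) (ind H ψ) := by
    refine isConjQuadruple_of (by norm_num) h (Or.inr hK) (fun χ hχ => hχ.1)
      faithfulOfDegree_star mφ mψ (mφ.2.trans mψ.2.symm) hne' hs' fun θ hθ hsθ => ?_
    obtain ⟨a, ha⟩ := exists_five_alt_six
    -- A character of degree 12 has one of two value patterns at order five, and each pattern occurs
    -- at most once over a central character.
    have dich : ∀ ξ ∈ faithfulOfDegree G 12, h.FiveVal a ξ (-1) 1 ∨ h.FiveVal a ξ (-1) (-1) :=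
      fun ξ hξ => h.fiveVal_of_lt hco fiveClasses_alt_six hξ.1.1 ha hξ.2 (by norm_num)
        (by rw [natCard_alt_six, card_five_alt_six]; norm_num)
    have uniq : ∀ D : ℤ, D ^ 2 = 1 → ∀ ξ ∈ faithfulOfDegree G 12, ∀ η ∈ faithfulOfDegree G 12,
        SameOn π.ker ξ η → h.FiveVal a ξ (-1) D → h.FiveVal a η (-1) D → ξ = η :=
      fun D hD ξ hξ η hη hs v v' => h.eq_of_fiveVal hco fiveClasses_alt_six hξ.1.1 hη.1.1 hs ha
        hξ.2 hη.2 v v' (by rw [natCard_alt_six, card_five_alt_six, hD]; norm_num)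
    have u1 := uniq 1 (by norm_num)
    have u2 := uniq (-1) (by norm_num)
    rcases dich _ hθ with v | v <;> rcases dich _ mφ with v1 | v1 <;>
      rcases dich _ mψ with v2 | v2
    all_goals first
      | exact Or.inl (u1 _ hθ _ mφ hsθ.symm v v1)
      | exact Or.inl (u2 _ hθ _ mφ hsθ.symm v v1)
      | exact Or.inr (u1 _ hθ _ mψ (hsθ.symm.trans hs') v v2)
      | exact Or.inr (u2 _ hθ _ mψ (hsθ.symm.trans hs') v v2)
      | exact absurd (u1 _ mφ _ mψ hs' v1 v2) hne'
      | exact absurd (u2 _ mφ _ mψ hs' v1 v2) hne'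
  refine ⟨_, _, hq, fun H φ χ => ⟨fun ht => ?_, ?_⟩, ?_⟩
  · have hH := isMinimalTriple_ne_top ht
    obtain ⟨h1, -, h3, rfl, -⟩ := ht
    refine ⟨?_, rfl⟩
    have hle : π.ker ≤ H := h.central.trans h3.1
    obtain ⟨hi, h2⟩ := index_six_alt_six h hK hH h3.2.1 h1
    obtain ⟨σ, hσ⟩ := exists_compat_alt_five h hle hi
    exact (pairDoubleA5_iff h hK φ).2 ⟨hi, σ, hσ, h3.2.1,
      faithfulOn_of_ind h hσ (h1.faithfulOn _), h2⟩
  · rintro ⟨hp, rfl⟩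
    obtain ⟨hi, σ, hσ, hφ, hf, -⟩ := (pairDoubleA5_iff h hK φ).1 hp
    refine isMinimalTriple_intro (by norm_num) h hσ hf hφ (mem _ _ hp).1
      (fun ht => by rw [ht, Subgroup.index_top] at hi; omega) fun K ψ hlt hψ he => ?_
    have h1 := (mem _ _ hp).1
    rw [he] at h1
    have h2 := (index_six_alt_six h hK hlt.ne_top hψ h1).1
    have h3 := Subgroup.index_strictAnti hlt
    omega
  · ext θ
    refine ⟨?_, fun hθ => ?_⟩
    · rintro ⟨K, ξ, hp, rfl⟩
      rw [← hq.2.1]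
      exact mem K ξ hp
    · simp only [Set.mem_insert_iff, Set.mem_singleton_iff] at hθ
      rcases hθ with rfl | rfl | rfl | rfl
      · exact ⟨H, φ, pφ, rfl⟩
      · exact ⟨H, ψ, pψ, rfl⟩
      · exact ⟨H, star φ, hstar _ _ pφ, (ind_star H φ).symm⟩
      · exact ⟨H, star ψ, hstar _ _ pψ, (ind_star H ψ).symm⟩

end SixAltSix

end ImprimitiveCovers

open ImprimitiveCovers in
theorem theorem5p7 :
    -- the group `3·A₆`
    (∀ (G : Type u) [Group G] [Fintype G], IsCover 3 6 G →
      ∃ χ₁₆ χ₁₈ : G → ℂ,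
        IsConjPair (faithfulOfDegree G 6) χ₁₆ ∧
        IsConjPair (faithfulOfDegree G 15) χ₁₈ ∧
        (∀ (H : Subgroup G) (φ : H → ℂ) (χ : G → ℂ),
          IsMinimalTriple H φ χ ↔ (PairA5 H φ ∨ PairS4 H φ) ∧ χ = ind H φ) ∧
        inducedFrom (G := G) PairA5 = {χ₁₆, star χ₁₆} ∧
        inducedFrom (G := G) PairS4 = {χ₁₈, star χ₁₈}) ∧
    -- the group `3·A₇`
    (∀ (G : Type u) [Group G] [Fintype G], IsCover 3 7 G →
      ∃ χ₁₉ χ₂₀ χ₂₁ : G → ℂ,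
        IsConjPair (faithfulOfDegreeAndValue G 15 3) χ₁₉ ∧
        IsConjPair (faithfulOfDegreeAndValue G 21 1) χ₂₀ ∧
        IsConjPair (faithfulOfDegreeAndValue G 21 (-3)) χ₂₁ ∧
        (∀ (H : Subgroup G) (φ : H → ℂ) (χ : G → ℂ),
          IsMinimalTriple H φ χ ↔ (PairA6 H φ ∨ PairS5 H φ ∨ PairL27 H φ) ∧ χ = ind H φ) ∧
        inducedFrom (G := G) PairA6 = {χ₂₁, star χ₂₁} ∧
        (∀ H : Subgroup G, IsCover 3 6 H →
          ∃ χ₁₄ χ₁₅ : H → ℂ,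
            IsConjQuadruple (faithfulOfDegree H 3) χ₁₄ χ₁₅ ∧
            ind H χ₁₄ = χ₂₁ ∧ ind H χ₁₅ = χ₂₁ ∧
            ind H (star χ₁₄) = star χ₂₁ ∧ ind H (star χ₁₅) = star χ₂₁) ∧
        inducedFrom (G := G) PairS5 = {χ₂₀, star χ₂₀} ∧
        inducedFrom (G := G) PairL27 = {χ₁₉, star χ₁₉}) ∧
    -- the group `6·A₆`
    (∀ (G : Type u) [Group G] [Fintype G], IsCover 6 6 G →
      ∃ χ₂₁ χ₂₂ : G → ℂ,
        IsConjQuadruple (faithfulOfDegree G 12) χ₂₁ χ₂₂ ∧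
        (∀ (H : Subgroup G) (φ : H → ℂ) (χ : G → ℂ),
          IsMinimalTriple H φ χ ↔ PairDoubleA5 H φ ∧ χ = ind H φ) ∧
        inducedFrom (G := G) PairDoubleA5 = {χ₂₁, χ₂₂, star χ₂₁, star χ₂₂}) ∧
    -- the group `6·A₇`
    (∀ (G : Type u) [Group G] [Fintype G], IsCover 6 7 G →
      ∀ χ : G → ℂ, IsFaithfulIrr χ → ¬ IsImprimitive χ) :=
  ⟨fun _ _ _ hG => three_alt_six hG, fun _ _ _ hG => three_alt_seven hG,
    fun _ _ _ hG => six_alt_six hG, fun _ _ _ hG _ hχ => six_alt_seven hG hχ⟩
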